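/- Let $M$ be Minkowski space with product $x\cdot y=x^0y^0-\vec x\cdot\vec y$, and let $|x|$ be the Euclidean norm of $x$ in a fixed Minkowski basis. For $\kappa\ge 0$ let $\mathcal S_\kappa$ be the space of smooth vector fields $\varphi$ on $M$ with $\sup_x(1+|x|)^{\kappa+|\beta|}|D^\beta\varphi(x)|<\infty$ for every multi-index $\beta$. For $\varepsilon>0$, $\gamma>0$, $\delta\in(0,1)$ put $R_{\gamma,\delta}=\{x:|x^0|\le\gamma+\delta|\vec x|\}$, and let $\mathcal S^3_{3+\varepsilon}(R_{\gamma,\delta})$ be the space of smooth vector fields $J$ supported in $R_{\gamma,\delta}$ with $H_3J=(x\cdot\partial+3)J\in\mathcal S_{3+\varepsilon}$. Such a $J$ has an asymptote $J_{\rm as}(x)=\lim_{R\to\infty}R^3J(Rx)$, $x\neq0$. Let $l$ run over the future-pointing lightlike vectors, $L_{ab}=l_a\partial/\partial l^b-l_b\partial/\partial l^a$, and $\int f(l)\,d^2l=\int_{S^2}f(1,\vec n)\,d\Omega(\vec n)$. Let $\mathcal V_\varepsilon$ be the real vector space of smooth vector functions $V(s,l)$, $s\in\mathbb R$, such that: $V(\mu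 s,\mu l)=\mu^{-1}V(s,l)$ for $\mu>0$; $l\cdot V(s,l)=0$; for every unit timelike future-pointing $t$ and every $k\ge0$, $$|L_{b_1c_1}\cdots L_{b_kc_k}\partial_sV_a(s,l)|\le \frac{C(t,k)}{(t\cdot l)^{2}(1+|s|/t\cdot l)^{1+\varepsilon}};$$ $V(+\infty,l)=-V(-\infty,l)=\tfrac12\Delta V(l)$; and $L_{[ab}\Delta V_{c]}=0$. Put $\mathcal V=\bigcup_{\varepsilon>0}\mathcal V_\varepsilon$ and $$\Phi_V(l)=-\frac1{4\pi}\int\frac{l\cdot\Delta V(l')}{l\cdot l'}\,d^2l'.$$ For a fixed elementary charge $e\neq0$ let $\mathcal V^0_{\rm as}$ be the group of all $V\in\mathcal V$ with $l\wedge V(s,l)=0$ for all $s,l$ and $\Phi_V= 2\pi n/e$ for some $n\in\mathbb Z$; let $L=\mathcal V/\mathcal V^0_{\rm as}$, and let $[V]$ be the class of $V$ in $L$. To a conserved current $J\in\mathcal S^3_{3+\varepsilon}(R_{\gamma,\delta})$ with odd asymptote corresponds the function $V(s,l)$ determined by $$\partial_sV(s,l)=\frac{V_0(s,l)-V_0(0,l)}{s},\qquad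 V_0(s,l)=\int\delta(s-x\cdot l)\,H_3J(x)\,d^4x,\qquad V(+\infty,l)=-V(-\infty,l).$$ **Proposition.** Let $J\in\mathcal S^3_{3+\varepsilon}(R_{\gamma,\delta})$ be a conserved current ($\partial\cdot J=0$) with odd asymptote, $J_{\rm as}(-x)=-J_{\rm as}(x)$, and let $V$ be the corresponding function. Suppose that $L_{[ab}\Delta V_{c]}(l)=0$. Then $V\in\mathcal V_\varepsilon$, and there exists a conserved current $J'\in\mathcal S^3_{3+\varepsilon}(R_{\gamma,\delta})$ whose asymptote has the form $J'_{\rm as}(x)=x\,g(x)$, $x\ne0$, with a scalar function $g$ that is smooth outside the origin, homogeneous of degree $-4$, even, and satisfies $\int g\,d\nu=0$, where $d\nu(z)=2\delta(z^2+1)\,d^4z$ is the invariant measure on the hyperboloid $z^2=-1$, such that the corresponding function $V'$ belongs to $\mathcal V_\varepsilon$ and $$l\wedge(V'-V)(s,l)=0\quad\text{for all }s,l,\qquad \Phi_{V'}(l)=\Phi_V(l)\quad\text{for all }l.$$ In particular $V'-V\in\mathcal V^0_{\rm as}$ and $[V']=[V]$ in $L$. -/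

import Mathlib

open Real Set Filter Topology MeasureTheory
open scoped ContDiff

noncomputable section

namespace AsymptoticQED

/-! ### Minkowski space -/

/-- The Minkowski vector space in a fixed Minkowski basis; the norm is the associated Euclidean
norm `|x|`, and `x a` is the contravariant component `x^a`. -/
abbrev M : Type := EuclideanSpace ℝ (Fin 4)

/-- Three-dimensional Euclidean space. -/
abbrev E3 : Type := EuclideanSpace ℝ (Fin 3)

/-- The vector with time component `t` and space part `y`. -/
def mkVec (t : ℝ) (y : E3) : M := !₂[t, y 0, y 1, y 2]

/-- The space part of a vector. -/
def spatial (x : M) : E3 := !₂[x 1, x 2, x 3]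

/-- The Minkowski product, of signature `(+,-,-,-)`. -/
def mdot (x y : M) : ℝ := x 0 * y 0 - x 1 * y 1 - x 2 * y 2 - x 3 * y 3

/-- The covariant component `x_a`. -/
def lower (x : M) (a : Fin 4) : ℝ := if a = 0 then x a else - x a

/-- The region `|x⁰| ≤ γ + δ |x⃗|`. -/
def region (γ δ : ℝ) : Set M := {x | |x 0| ≤ γ + δ * ‖spatial x‖}

/-- Unit timelike future-pointing vectors, the hyperboloid `H₊`. -/
def IsUnitFuture (t : M) : Prop := mdot t t = 1 ∧ 0 < t 0

/-! ### Test fields -/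

/-- The space `𝒮_κ`: smooth fields with `sup (1+|x|)^(κ+n) |D^β φ(x)| < ∞` for `|β| = n`, all `n`. -/
def IsTestField (κ : ℝ) (φ : M → M) : Prop :=
  ContDiff ℝ ∞ φ ∧
    ∀ n : ℕ, ∃ C : ℝ, ∀ x : M, (1 + ‖x‖) ^ (κ + n) * ‖iteratedFDeriv ℝ n φ x‖ ≤ C

/-- The operator `H_κ = x·∂ + κ`. -/
def dilation (κ : ℝ) (φ : M → M) : M → M := fun x => fderiv ℝ φ x x + κ • φ x

/-- The space `𝒮^κ_{κ+ε}(W)`: smooth fields supported in `W` with `H_κ φ ∈ 𝒮_{κ+ε}`. -/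
def IsHomTestField (κ ε : ℝ) (W : Set M) (φ : M → M) : Prop :=
  ContDiff ℝ ∞ φ ∧ Function.support φ ⊆ W ∧ IsTestField (κ + ε) (dilation κ φ)

/-- `ψ` is the asymptote of `φ` of degree `-κ`: `ψ(x) = lim_{R → ∞} R^κ φ(R x)` for `x ≠ 0`. -/
def HasAsymptote (κ : ℝ) (φ ψ : M → M) : Prop :=
  ∀ x : M, x ≠ 0 → Tendsto (fun R : ℝ => R ^ κ • φ (R • x)) atTop (𝓝 (ψ x))

/-- The continuity equation `∂_a J^a = 0`. -/
def IsConserved (J : M → M) : Prop :=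
  ∀ x : M, ∑ a : Fin 4, fderiv ℝ J x (EuclideanSpace.single a 1) a = 0

/-- The integral `∫ g dν` over the hyperboloid `z² = -1` with `dν(z) = 2 δ(z²+1) d⁴z`, in the
coordinates `z = (τ, √(1+τ²) n)`, `|n| = 1`, in which `dν = √(1+τ²) dτ dΩ(n)`. -/
def hyperboloidIntegral (g : M → ℝ) : ℝ :=
  ∫ τ : ℝ, ∫ n : Metric.sphere (0 : E3) 1,
    g (mkVec τ (√(1 + τ ^ 2) • (n : E3))) * √(1 + τ ^ 2) ∂(volume : Measure E3).toSphere

/-! ### The future lightcone -/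

/-- Future-pointing lightlike vectors. -/
abbrev Cone : Type := {l : M // mdot l l = 0 ∧ 0 < l 0}

theorem mkVec_null (y : E3) (hy : y ≠ 0) :
    mdot (mkVec ‖y‖ y) (mkVec ‖y‖ y) = 0 ∧ 0 < mkVec ‖y‖ y 0 := by
  have h : ‖y‖ * ‖y‖ = y 0 * y 0 + y 1 * y 1 + y 2 * y 2 := by
    have := EuclideanSpace.real_norm_sq_eq y
    rw [Fin.sum_univ_three] at this
    nlinarith
  refine ⟨?_, ?_⟩
  · simp only [mdot, mkVec]
    simp
    linarith
  · simpa [mkVec] using hy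

/-- The vector `(|y|, y)` of the lightcone. -/
def Cone.ofSpace (y : E3) (hy : y ≠ 0) : Cone := ⟨mkVec ‖y‖ y, mkVec_null y hy⟩

/-- The vector `(1, n)` of the lightcone, for a unit vector `n`. -/
def Cone.ofSphere (n : Metric.sphere (0 : E3) 1) : Cone :=
  Cone.ofSpace n (ne_zero_of_mem_unit_sphere n)

/-- The multiple `μ l`, `μ > 0`. -/
def Cone.scale (μ : ℝ) (hμ : 0 < μ) (l : Cone) : Cone :=
  ⟨μ • (l : M), by
    obtain ⟨l, h, h0⟩ := l
    refine ⟨?_, ?_⟩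
    · simp only [mdot] at h ⊢
      simp only [PiLp.smul_apply, smul_eq_mul]
      linear_combination μ ^ 2 * h
    · simpa using mul_pos hμ h0⟩

/-- The integral over null directions, `∫ f(l) d²l = ∫ f(1, n) dΩ(n)`. -/
def coneIntegral (f : Cone → ℝ) : ℝ :=
  ∫ n, f (Cone.ofSphere n) ∂(volume : Measure E3).toSphere

/-- The extension of a function on the cone to `x⃗ ≠ 0` which does not depend on `x⁰`. -/
def coneExtend {F : Type*} [Zero F] (f : Cone → F) (x : M) : F :=
  open Classical in if h : spatial x ≠ 0 then f (Cone.ofSpace (spatial x) h) else 0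

/-- The domain of the extension. -/
def coneDomain : Set M := {x | spatial x ≠ 0}

/-- Smoothness of a function on the cone. -/
def ConeSmooth {F : Type*} [NormedAddCommGroup F] [NormedSpace ℝ F] (f : Cone → F) : Prop :=
  ContDiffOn ℝ ∞ (coneExtend f) coneDomain

/-- The operator `L_{ab} = l_a ∂/∂l^b - l_b ∂/∂l^a`. The direction of differentiation is tangent to
the cone, so it may be applied to any extension of `f` to a neighbourhood of the cone. -/
def coneDeriv (a b : Fin 4) (f : Cone → ℝ) : Cone → ℝ := fun l =>
  fderiv ℝ (coneExtend f) (l : M)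
    (lower l a • EuclideanSpace.single b 1 - lower l b • EuclideanSpace.single a 1)

/-- `L_{b₁c₁} … L_{bₖcₖ} f`. -/
def coneDerivs (I : List (Fin 4 × Fin 4)) (f : Cone → ℝ) : Cone → ℝ :=
  I.foldr (fun p h => coneDeriv p.1 p.2 h) f

/-- The equation `L_{[ab} U_{c]} = 0`. -/
def IsCurlFree (U : Cone → M) : Prop :=
  ∀ (a b c : Fin 4) (l : Cone),
    coneDeriv a b (fun k => lower (U k) c) l + coneDeriv b c (fun k => lower (U k) a) l
      + coneDeriv c a (fun k => lower (U k) b) l = 0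

/-! ### Electromagnetic test functions -/

/-- `∂_s V(s, l)`. -/
def sDeriv (V : ℝ → Cone → M) (s : ℝ) (l : Cone) : M := deriv (fun τ => V τ l) s

/-- The tail `ΔV(l) = 2 V(+∞, l)`. -/
def tail (V : ℝ → Cone → M) (l : Cone) : M := (2 : ℝ) • limUnder atTop (fun s : ℝ => V s l)

/-- `Φ_V(l) = -(1/4π) ∫ (l·ΔV(l')) / (l·l') d²l'`. -/
def phi (V : ℝ → Cone → M) (l : Cone) : ℝ :=
  -(1 / (4 * π)) * coneIntegral (fun k => mdot l (tail V k) / mdot l k)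

/-- Membership of `V` in the space `𝒱_ε`. Smoothness of the tail is a consequence of `smooth`,
`falloff` and `limits`; it is listed so that the derivatives in `closed` are visibly
meaningful. -/
structure IsProfile (ε : ℝ) (V : ℝ → Cone → M) : Prop where
  smooth : ContDiffOn ℝ ∞ (fun p : ℝ × M => coneExtend (V p.1) p.2) (univ ×ˢ coneDomain)
  homog : ∀ (μ : ℝ) (hμ : 0 < μ) (s : ℝ) (l : Cone), V (μ * s) (l.scale μ hμ) = μ⁻¹ • V s l
  orthog : ∀ (s : ℝ) (l : Cone), mdot l (V s l) = 0
  falloff : ∀ t : M, IsUnitFuture t → ∀ k : ℕ, ∃ C : ℝ,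
    ∀ I : List (Fin 4 × Fin 4), I.length = k → ∀ (a : Fin 4) (s : ℝ) (l : Cone),
      |coneDerivs I (fun k => sDeriv V s k a) l|
        ≤ C / (mdot t l ^ 2 * (1 + |s| / mdot t l) ^ (1 + ε))
  limits : ∀ l : Cone, Tendsto (fun s => V s l) atTop (𝓝 ((1 / 2 : ℝ) • tail V l)) ∧
    Tendsto (fun s => V s l) atBot (𝓝 (-((1 / 2 : ℝ) • tail V l)))
  smooth_tail : ConeSmooth (tail V)
  closed : IsCurlFree (tail V)

/-! Facts needed for the vector space and group structures below. -/

theorem isOpen_coneDomain : IsOpen coneDomain := by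
  have h : Continuous spatial := by unfold spatial; fun_prop
  exact isOpen_ne.preimage h

theorem spatial_norm_sq (x : M) : ‖spatial x‖ ^ 2 = x 1 ^ 2 + x 2 ^ 2 + x 3 ^ 2 := by
  rw [EuclideanSpace.real_norm_sq_eq, Fin.sum_univ_three]
  simp [spatial]

theorem Cone.norm_spatial (l : Cone) : ‖spatial l‖ = (l : M) 0 := by
  obtain ⟨l, h, h0⟩ := l
  have := spatial_norm_sq l
  simp only [mdot] at h
  refine (sq_eq_sq₀ (norm_nonneg _) h0.le).1 ?_
  simp only
  linarith

theorem Cone.mem_domain (l : Cone) : (l : M) ∈ coneDomain := by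
  have h : 0 < ‖spatial l‖ := by rw [l.norm_spatial]; exact l.2.2
  exact norm_pos_iff.1 h

theorem Cone.ofSpace_spatial (l : Cone) : Cone.ofSpace (spatial l) l.mem_domain = l := by
  apply Subtype.ext
  have h := l.norm_spatial
  ext i
  simp only [Cone.ofSpace, h]
  fin_cases i <;> simp [mkVec, spatial]

theorem coneExtend_of_mem {F : Type*} [Zero F] (f : Cone → F) {x : M} (hx : spatial x ≠ 0) :
    coneExtend f x = f (Cone.ofSpace (spatial x) hx) := dif_pos hx

theorem coneExtend_coe {F : Type*} [Zero F] (f : Cone → F) (l : Cone) :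
    coneExtend f (l : M) = f l := by
  rw [coneExtend_of_mem f l.mem_domain, l.ofSpace_spatial]

theorem coneExtend_add {F : Type*} [AddZeroClass F] (f g : Cone → F) :
    coneExtend (f + g) = coneExtend f + coneExtend g := by
  funext x
  by_cases h : spatial x = 0 <;> simp [coneExtend, h]

theorem coneExtend_smul {F : Type*} [NormedAddCommGroup F] [NormedSpace ℝ F] (c : ℝ)
    (f : Cone → F) : coneExtend (c • f) = c • coneExtend f := by
  funext x
  by_cases h : spatial x = 0 <;> simp [coneExtend, h]

theorem contDiffOn_norm_spatial : ContDiffOn ℝ ∞ (fun x : M => ‖spatial x‖) coneDomain := by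
  intro x hx
  have h : ContDiff ℝ ∞ spatial := by
    unfold spatial
    rw [contDiff_euclidean]
    intro i
    fin_cases i <;> simp <;> fun_prop
  exact (h.contDiffAt.norm ℝ hx).contDiffWithinAt

theorem contDiffOn_proj :
    ContDiffOn ℝ ∞ (fun x : M => mkVec ‖spatial x‖ (spatial x)) coneDomain := by
  rw [contDiffOn_euclidean]
  intro i
  fin_cases i
  · simpa [mkVec] using contDiffOn_norm_spatial
  all_goals
    simp [mkVec, spatial]
    fun_prop

theorem ConeSmooth.differentiableAt {F : Type*} [NormedAddCommGroup F] [NormedSpace ℝ F]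
    {f : Cone → F} (hf : ConeSmooth f) (l : Cone) :
    DifferentiableAt ℝ (coneExtend f) (l : M) :=
  (hf.contDiffAt (isOpen_coneDomain.mem_nhds l.mem_domain)).differentiableAt (by simp)

theorem ConeSmooth.add {F : Type*} [NormedAddCommGroup F] [NormedSpace ℝ F]
    {f g : Cone → F} (hf : ConeSmooth f) (hg : ConeSmooth g) : ConeSmooth (f + g) := by
  unfold ConeSmooth
  rw [coneExtend_add]
  exact ContDiffOn.add hf hg

theorem ConeSmooth.const_smul {F : Type*} [NormedAddCommGroup F] [NormedSpace ℝ F]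
    {f : Cone → F} (hf : ConeSmooth f) (c : ℝ) : ConeSmooth (c • f) := by
  unfold ConeSmooth
  rw [coneExtend_smul]
  exact ContDiffOn.const_smul c hf

theorem coneDeriv_add {f g : Cone → ℝ} (hf : ConeSmooth f) (hg : ConeSmooth g) (a b : Fin 4) :
    coneDeriv a b (f + g) = coneDeriv a b f + coneDeriv a b g := by
  funext l
  simp only [coneDeriv, coneExtend_add, Pi.add_apply]
  rw [fderiv_add (hf.differentiableAt l) (hg.differentiableAt l)]
  rfl

theorem coneDeriv_smul {f : Cone → ℝ} (hf : ConeSmooth f) (c : ℝ) (a b : Fin 4) :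
    coneDeriv a b (c • f) = c • coneDeriv a b f := by
  funext l
  simp only [coneDeriv, coneExtend_smul, Pi.smul_apply]
  rw [fderiv_const_smul (hf.differentiableAt l)]
  rfl

theorem ConeSmooth.coneDeriv {f : Cone → ℝ} (hf : ConeSmooth f) (a b : Fin 4) :
    ConeSmooth (coneDeriv a b f) := by
  have hmaps : MapsTo (fun x : M => mkVec ‖spatial x‖ (spatial x)) coneDomain coneDomain := by
    intro x hx
    exact (Cone.ofSpace (spatial x) hx).mem_domain
  have hlow : ∀ c : Fin 4, ContDiff ℝ ∞ (fun x : M => lower x c) := by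
    intro c
    unfold lower
    split_ifs <;> fun_prop
  have h1 : ContDiffOn ℝ ∞ (fun x : M => fderiv ℝ (coneExtend f) x
      (lower x a • EuclideanSpace.single b 1 - lower x b • EuclideanSpace.single a 1))
      coneDomain := by
    refine ContDiffOn.clm_apply (hf.fderiv_of_isOpen isOpen_coneDomain (by simp)) ?_
    exact (((hlow a).smul contDiff_const).sub ((hlow b).smul contDiff_const)).contDiffOn
  refine (h1.comp contDiffOn_proj hmaps).congr ?_
  intro x hx
  rw [coneExtend_of_mem _ hx]
  rfl

theorem ConeSmooth.coneDerivs {f : Cone → ℝ} (hf : ConeSmooth f) (I : List (Fin 4 × Fin 4)) :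
    ConeSmooth (coneDerivs I f) := by
  induction I with
  | nil => exact hf
  | cons p I ih => exact ih.coneDeriv p.1 p.2

theorem coneDerivs_add {f g : Cone → ℝ} (hf : ConeSmooth f) (hg : ConeSmooth g)
    (I : List (Fin 4 × Fin 4)) : coneDerivs I (f + g) = coneDerivs I f + coneDerivs I g := by
  induction I with
  | nil => rfl
  | cons p I ih =>
    change coneDeriv p.1 p.2 (coneDerivs I (f + g)) = _
    rw [ih, coneDeriv_add (hf.coneDerivs I) (hg.coneDerivs I)]
    rfl

theorem coneDerivs_smul {f : Cone → ℝ} (hf : ConeSmooth f) (c : ℝ)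
    (I : List (Fin 4 × Fin 4)) : coneDerivs I (c • f) = c • coneDerivs I f := by
  induction I with
  | nil => rfl
  | cons p I ih =>
    change coneDeriv p.1 p.2 (coneDerivs I (c • f)) = _
    rw [ih, coneDeriv_smul (hf.coneDerivs I)]
    rfl

theorem ConeSmooth.apply {U : Cone → M} (hU : ConeSmooth U) (a : Fin 4) :
    ConeSmooth (fun k => U k a) := by
  have h : ContDiffOn ℝ ∞ (fun x => coneExtend U x a) coneDomain := contDiffOn_euclidean.1 hU a
  refine h.congr ?_
  intro x hx
  rw [coneExtend_of_mem _ hx, coneExtend_of_mem _ hx]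

theorem ConeSmooth.lower {U : Cone → M} (hU : ConeSmooth U) (a : Fin 4) :
    ConeSmooth (fun k => lower (U k) a) := by
  unfold AsymptoticQED.lower
  by_cases h : a = 0
  · simpa [h] using hU.apply 0
  · have := (hU.apply a).const_smul (-1)
    simp only [h, if_false]
    convert this using 1
    funext k
    simp

theorem lower_add (x y : M) (a : Fin 4) : lower (x + y) a = lower x a + lower y a := by
  unfold lower
  split_ifs <;> simp
  ring

theorem lower_smul (c : ℝ) (x : M) (a : Fin 4) : lower (c • x) a = c * lower x a := by
  unfold lower
  split_ifs <;> simp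

theorem IsCurlFree.add {U W : Cone → M} (hU : ConeSmooth U) (hW : ConeSmooth W)
    (h : IsCurlFree U) (h' : IsCurlFree W) : IsCurlFree (U + W) := by
  intro a b c l
  have key : ∀ a b c, coneDeriv a b (fun k => lower ((U + W) k) c) l
      = coneDeriv a b (fun k => lower (U k) c) l + coneDeriv a b (fun k => lower (W k) c) l := by
    intro a b c
    have := congrFun (coneDeriv_add (hU.lower c) (hW.lower c) a b) l
    simp only [Pi.add_apply] at this
    rw [← this]
    congr 1
    funext k
    simp [lower_add]
  rw [key, key, key]
  linarith [h a b c l, h' a b c l]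

theorem IsCurlFree.const_smul {U : Cone → M} (hU : ConeSmooth U) (h : IsCurlFree U) (c : ℝ) :
    IsCurlFree (c • U) := by
  intro i j k l
  have key : ∀ a b d, coneDeriv a b (fun k => lower ((c • U) k) d) l
      = c * coneDeriv a b (fun k => lower (U k) d) l := by
    intro a b d
    have := congrFun (coneDeriv_smul (hU.lower d) c a b) l
    simp only [Pi.smul_apply, smul_eq_mul] at this
    rw [← this]
    congr 1
    funext k
    simp [lower_smul]
  rw [key, key, key, ← mul_add, ← mul_add, h i j k l, mul_zero]

theorem mdot_add (x y z : M) : mdot x (y + z) = mdot x y + mdot x z := by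
  simp [mdot]; ring

theorem mdot_smul (c : ℝ) (x y : M) : mdot x (c • y) = c * mdot x y := by
  simp [mdot]; ring

theorem IsUnitFuture.mdot_pos {t : M} (ht : IsUnitFuture t) (l : Cone) : 0 < mdot t l := by
  obtain ⟨h, h0⟩ := ht
  obtain ⟨l, hl, hl0⟩ := l
  simp only [mdot] at h hl ⊢
  by_contra hcon
  push Not at hcon
  have h1 : 0 ≤ t 0 * l 0 := by positivity
  have h2 : (t 0 * l 0) ^ 2 ≤ (t 1 * l 1 + t 2 * l 2 + t 3 * l 3) ^ 2 := by
    apply pow_le_pow_left₀ h1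
    linarith
  have h3 : (t 1 * l 1 + t 2 * l 2 + t 3 * l 3) ^ 2
      ≤ (t 1 ^ 2 + t 2 ^ 2 + t 3 ^ 2) * (l 1 ^ 2 + l 2 ^ 2 + l 3 ^ 2) := by
    nlinarith [sq_nonneg (t 1 * l 2 - t 2 * l 1), sq_nonneg (t 1 * l 3 - t 3 * l 1),
      sq_nonneg (t 2 * l 3 - t 3 * l 2)]
  have h4 : t 1 ^ 2 + t 2 ^ 2 + t 3 ^ 2 = t 0 ^ 2 - 1 := by linarith
  have h5 : l 1 ^ 2 + l 2 ^ 2 + l 3 ^ 2 = l 0 ^ 2 := by linarith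
  rw [h4, h5] at h3
  nlinarith [pow_pos hl0 2]

theorem IsProfile.contDiffAt {ε : ℝ} {V : ℝ → Cone → M} (h : IsProfile ε V) (s : ℝ) {x : M}
    (hx : x ∈ coneDomain) :
    ContDiffAt ℝ ∞ (fun p : ℝ × M => coneExtend (V p.1) p.2) (s, x) :=
  h.smooth.contDiffAt ((isOpen_univ.prod isOpen_coneDomain).mem_nhds ⟨mem_univ _, hx⟩)

theorem IsProfile.hasDerivAt_extend {ε : ℝ} {V : ℝ → Cone → M} (h : IsProfile ε V) (s : ℝ)
    {x : M} (hx : x ∈ coneDomain) :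
    HasDerivAt (fun τ => coneExtend (V τ) x)
      (fderiv ℝ (fun p : ℝ × M => coneExtend (V p.1) p.2) (s, x) (1, 0)) s := by
  have h1 := ((h.contDiffAt s hx).differentiableAt (by simp)).hasFDerivAt
  have h2 : HasDerivAt (fun τ : ℝ => (τ, x)) ((1 : ℝ), (0 : M)) s :=
    (hasDerivAt_id s).prodMk (hasDerivAt_const s x)
  exact h1.comp_hasDerivAt s h2

theorem IsProfile.differentiableAt {ε : ℝ} {V : ℝ → Cone → M} (h : IsProfile ε V) (s : ℝ)
    (l : Cone) : DifferentiableAt ℝ (fun τ => V τ l) s := by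
  have := (h.hasDerivAt_extend s l.mem_domain).differentiableAt
  simpa only [coneExtend_coe] using this

theorem IsProfile.coneSmooth_sDeriv {ε : ℝ} {V : ℝ → Cone → M} (h : IsProfile ε V) (s : ℝ) :
    ConeSmooth (sDeriv V s) := by
  have h1 := h.smooth.fderiv_of_isOpen (m := ∞) (isOpen_univ.prod isOpen_coneDomain) (by simp)
  have h2 : ContDiffOn ℝ ∞ (fun x : M =>
      fderiv ℝ (fun p : ℝ × M => coneExtend (V p.1) p.2) (s, x) (1, 0)) coneDomain := by
    refine ContDiffOn.clm_apply (h1.comp (f := fun x : M => (s, x)) ?_ ?_) contDiffOn_const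
    · fun_prop
    · intro x hx
      exact ⟨mem_univ _, hx⟩
  refine h2.congr ?_
  intro x hx
  have h3 := (h.hasDerivAt_extend s hx).deriv
  rw [coneExtend_of_mem _ hx, ← h3, sDeriv]
  congr 1
  funext τ
  exact (coneExtend_of_mem _ hx).symm

theorem tail_eq_of_tendsto {V : ℝ → Cone → M} {l : Cone} {u : M}
    (h : Tendsto (fun s => V s l) atTop (𝓝 ((1 / 2 : ℝ) • u))) : tail V l = u := by
  rw [tail, h.limUnder_eq, smul_smul]
  norm_num

theorem IsProfile.tail_add {ε ε' : ℝ} {V W : ℝ → Cone → M} (hV : IsProfile ε V)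
    (hW : IsProfile ε' W) : tail (V + W) = tail V + tail W := by
  funext l
  apply tail_eq_of_tendsto
  have := (hV.limits l).1.add (hW.limits l).1
  simpa [smul_add] using this

theorem IsProfile.tail_smul {ε : ℝ} {V : ℝ → Cone → M} (hV : IsProfile ε V) (c : ℝ) :
    tail (c • V) = c • tail V := by
  funext l
  apply tail_eq_of_tendsto
  have := (hV.limits l).1.const_smul c
  simpa [smul_comm c] using this

theorem tail_zero : tail 0 = 0 := by
  funext l
  apply tail_eq_of_tendsto
  simp

theorem coneExtend_zero {F : Type*} [Zero F] : coneExtend (0 : Cone → F) = 0 := by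
  funext x
  by_cases h : spatial x = 0 <;> simp [coneExtend, h]

theorem coneSmooth_zero {F : Type*} [NormedAddCommGroup F] [NormedSpace ℝ F] :
    ConeSmooth (0 : Cone → F) := by
  unfold ConeSmooth
  rw [coneExtend_zero]
  exact contDiffOn_const

theorem IsProfile.add {ε : ℝ} {V W : ℝ → Cone → M} (hV : IsProfile ε V)
    (hW : IsProfile ε W) : IsProfile ε (V + W) where
  smooth := by
    refine (hV.smooth.add hW.smooth).congr ?_
    intro p _
    exact congrFun (coneExtend_add (V p.1) (W p.1)) p.2
  homog μ hμ s l := by simp [hV.homog μ hμ s l, hW.homog μ hμ s l]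
  orthog s l := by
    rw [Pi.add_apply, Pi.add_apply, mdot_add, hV.orthog, hW.orthog, add_zero]
  falloff t ht k := by
    obtain ⟨C, hC⟩ := hV.falloff t ht k
    obtain ⟨D, hD⟩ := hW.falloff t ht k
    refine ⟨C + D, fun I hI a s l => ?_⟩
    have h1 : (fun k => sDeriv (V + W) s k a)
        = (fun k => sDeriv V s k a) + (fun k => sDeriv W s k a) := by
      funext k
      have : sDeriv (V + W) s k = sDeriv V s k + sDeriv W s k :=
        deriv_add (hV.differentiableAt s k) (hW.differentiableAt s k)
      simp [this]
    rw [h1, coneDerivs_add ((hV.coneSmooth_sDeriv s).apply a) ((hW.coneSmooth_sDeriv s).apply a),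
      add_div]
    exact (abs_add_le _ _).trans (add_le_add (hC I hI a s l) (hD I hI a s l))
  limits l := by
    rw [hV.tail_add hW, Pi.add_apply, smul_add, neg_add]
    exact ⟨(hV.limits l).1.add (hW.limits l).1, (hV.limits l).2.add (hW.limits l).2⟩
  smooth_tail := by
    rw [hV.tail_add hW]
    exact hV.smooth_tail.add hW.smooth_tail
  closed := by
    rw [hV.tail_add hW]
    exact hV.closed.add hV.smooth_tail hW.smooth_tail hW.closed

theorem IsProfile.const_smul {ε : ℝ} {V : ℝ → Cone → M} (hV : IsProfile ε V) (c : ℝ) :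
    IsProfile ε (c • V) where
  smooth := by
    refine (hV.smooth.const_smul c).congr ?_
    intro p _
    exact congrFun (coneExtend_smul c (V p.1)) p.2
  homog μ hμ s l := by simp [hV.homog μ hμ s l, smul_comm c]
  orthog s l := by
    rw [Pi.smul_apply, Pi.smul_apply, mdot_smul, hV.orthog, mul_zero]
  falloff t ht k := by
    obtain ⟨C, hC⟩ := hV.falloff t ht k
    refine ⟨|c| * C, fun I hI a s l => ?_⟩
    have h1 : (fun k => sDeriv (c • V) s k a) = c • (fun k => sDeriv V s k a) := by
      funext k
      have : sDeriv (c • V) s k = c • sDeriv V s k := deriv_const_smul c (hV.differentiableAt s k)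
      simp [this]
    rw [h1, coneDerivs_smul ((hV.coneSmooth_sDeriv s).apply a), mul_div_assoc, Pi.smul_apply,
      smul_eq_mul, abs_mul]
    exact mul_le_mul_of_nonneg_left (hC I hI a s l) (abs_nonneg c)
  limits l := by
    rw [hV.tail_smul c, Pi.smul_apply, smul_comm, ← smul_neg]
    exact ⟨(hV.limits l).1.const_smul c, (hV.limits l).2.const_smul c⟩
  smooth_tail := by
    rw [hV.tail_smul c]
    exact hV.smooth_tail.const_smul c
  closed := by
    rw [hV.tail_smul c]
    exact hV.closed.const_smul hV.smooth_tail c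

theorem isProfile_zero (ε : ℝ) : IsProfile ε 0 := by
  have h0 : ∀ a b, coneDeriv a b 0 = 0 := fun a b => by
    have := coneDeriv_smul (f := 0) coneSmooth_zero 0 a b
    simpa using this
  have hI : ∀ I, coneDerivs I 0 = 0 := fun I => by
    have := coneDerivs_smul (f := 0) coneSmooth_zero 0 I
    simpa using this
  refine ⟨?_, ?_, ?_, ?_, ?_, ?_, ?_⟩
  · refine (contDiffOn_const (c := (0 : M))).congr ?_
    intro p _
    exact congrFun coneExtend_zero p.2
  · intros; simp
  · intros; simp [mdot]
  · intro t ht k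
    refine ⟨0, fun I _ a s l => ?_⟩
    have h1 : (fun k => sDeriv 0 s k a) = 0 := by
      funext k
      simp [sDeriv]
    rw [h1, hI]
    simp
  · intro l
    simp [tail_zero]
  · rw [tail_zero]; exact coneSmooth_zero
  · rw [tail_zero]
    intro a b c l
    have h1 : ∀ c, (fun k => lower ((0 : Cone → M) k) c) = (0 : Cone → ℝ) := fun c => by
      funext k
      simp [lower]
    simp only [h1, h0]
    simp

theorem IsProfile.mono {ε ε' : ℝ} (hε : ε' ≤ ε) {V : ℝ → Cone → M} (hV : IsProfile ε V) :
    IsProfile ε' V where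
  smooth := hV.smooth
  homog := hV.homog
  orthog := hV.orthog
  falloff t ht k := by
    obtain ⟨C, hC⟩ := hV.falloff t ht k
    refine ⟨|C|, fun I hI a s l => ?_⟩
    have hpos := ht.mdot_pos l
    have h1 : 1 ≤ 1 + |s| / mdot t l := by
      have : 0 ≤ |s| / mdot t l := by positivity
      linarith
    have h2 : (1 + |s| / mdot t l) ^ (1 + ε') ≤ (1 + |s| / mdot t l) ^ (1 + ε) :=
      Real.rpow_le_rpow_of_exponent_le h1 (by linarith)
    have h3 : 0 < (1 + |s| / mdot t l) ^ (1 + ε') := Real.rpow_pos_of_pos (by linarith) _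
    have h4 : 0 < mdot t l ^ 2 := by positivity
    calc _ ≤ C / (mdot t l ^ 2 * (1 + |s| / mdot t l) ^ (1 + ε)) := hC I hI a s l
      _ ≤ |C| / (mdot t l ^ 2 * (1 + |s| / mdot t l) ^ (1 + ε)) := by
        gcongr
        exact le_abs_self C
      _ ≤ |C| / (mdot t l ^ 2 * (1 + |s| / mdot t l) ^ (1 + ε')) := by
        gcongr
  limits := hV.limits
  smooth_tail := hV.smooth_tail
  closed := hV.closed

/-- The real vector space `𝒱_ε`. -/
def profileSpace (ε : ℝ) : Submodule ℝ (ℝ → Cone → M) where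
  carrier := {V | IsProfile ε V}
  add_mem' h h' := h.add h'
  zero_mem' := isProfile_zero ε
  smul_mem' c _ h := h.const_smul c

/-- The real vector space `𝒱 = ⋃_{ε > 0} 𝒱_ε`. -/
def profiles : Submodule ℝ (ℝ → Cone → M) where
  carrier := {V | ∃ ε : ℝ, 0 < ε ∧ V ∈ profileSpace ε}
  add_mem' := by
    rintro V W ⟨ε, hε, hV⟩ ⟨ε', hε', hW⟩
    exact ⟨min ε ε', lt_min hε hε', IsProfile.add (IsProfile.mono (min_le_left _ _) hV)
      (IsProfile.mono (min_le_right _ _) hW)⟩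
  zero_mem' := ⟨1, one_pos, isProfile_zero 1⟩
  smul_mem' := by
    rintro c V ⟨ε, hε, hV⟩
    exact ⟨ε, hε, IsProfile.const_smul hV c⟩

/-- `l ∧ V(s, l) = 0` for all `s` and `l`. -/
def WedgeZero (V : ℝ → Cone → M) : Prop :=
  ∀ (s : ℝ) (l : Cone) (a b : Fin 4), (l : M) a * V s l b - (l : M) b * V s l a = 0

theorem mdot_tail_of_wedgeZero {V : ℝ → Cone → M} {ε : ℝ} (hV : IsProfile ε V)
    (hw : WedgeZero V) (l : M) (k : Cone) :
    mdot l (tail V k) = mdot l k * (tail V k 0 / (k : M) 0) := by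
  have hk : ∀ a, tail V k a = (k : M) a * (tail V k 0 / (k : M) 0) := by
    intro a
    have h0 := k.2.2
    have hlim := (hV.limits k).1
    have hc : ∀ b, Tendsto (fun s => V s k b) atTop (𝓝 (((1 / 2 : ℝ) • tail V k) b)) := fun b =>
      ((EuclideanSpace.proj (𝕜 := ℝ) b).continuous.tendsto _).comp hlim
    have h1 := ((hc a).const_mul ((k : M) 0)).sub ((hc 0).const_mul ((k : M) a))
    have h2 := tendsto_nhds_unique (h1.congr (fun s => hw s k 0 a)) tendsto_const_nhds
    simp only [PiLp.smul_apply, smul_eq_mul] at h2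
    field_simp
    linarith
  simp only [mdot]
  rw [hk 1, hk 2, hk 3]
  have h0 := k.2.2.ne'
  field_simp

theorem integrable_phi_of_wedgeZero {V : ℝ → Cone → M} {ε : ℝ} (hV : IsProfile ε V)
    (hw : WedgeZero V) (l : Cone) :
    Integrable (fun n => mdot l (tail V (Cone.ofSphere n)) / mdot l (Cone.ofSphere n : M))
      (volume : Measure E3).toSphere := by
  have hs : Continuous (fun n : Metric.sphere (0 : E3) 1 => ((Cone.ofSphere n : Cone) : M)) := by
    have h : (fun n : Metric.sphere (0 : E3) 1 => ((Cone.ofSphere n : Cone) : M))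
        = fun n : Metric.sphere (0 : E3) 1 => mkVec ‖(n : E3)‖ (n : E3) := rfl
    rw [h]
    unfold mkVec
    fun_prop
  have ht : Continuous (fun n : Metric.sphere (0 : E3) 1 => tail V (Cone.ofSphere n)) := by
    have h := hV.smooth_tail.continuousOn.comp_continuous hs (fun n => (Cone.ofSphere n).mem_domain)
    simpa only [Function.comp_def, coneExtend_coe] using h
  have h0 : ∀ n : Metric.sphere (0 : E3) 1, ((Cone.ofSphere n : Cone) : M) 0 = 1 := by
    intro n
    simp [Cone.ofSphere, Cone.ofSpace, mkVec]
  have hα : Continuous (fun n : Metric.sphere (0 : E3) 1 => tail V (Cone.ofSphere n) 0) :=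
    (EuclideanSpace.proj (𝕜 := ℝ) (0 : Fin 4)).continuous.comp ht
  have hint : Integrable (fun n : Metric.sphere (0 : E3) 1 => tail V (Cone.ofSphere n) 0)
      (volume : Measure E3).toSphere :=
    hα.integrable_of_hasCompactSupport (HasCompactSupport.of_compactSpace _)
  have hm : Continuous (fun n : Metric.sphere (0 : E3) 1 => mdot l (Cone.ofSphere n : M)) := by
    unfold mdot
    fun_prop
  refine (hint.indicator ((isOpen_ne (x := (0 : ℝ))).preimage hm).measurableSet).congr ?_
  refine Eventually.of_forall fun n => ?_
  simp only [mdot_tail_of_wedgeZero hV hw, h0, div_one]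
  by_cases h : mdot l (Cone.ofSphere n : M) = 0
  · simp [h, indicator]
  · rw [indicator_of_mem (by exact h), mul_div_cancel_left₀ _ h]

theorem phi_add_of_wedgeZero {V W : ℝ → Cone → M} {ε ε' : ℝ} (hV : IsProfile ε V)
    (hW : IsProfile ε' W) (hv : WedgeZero V) (hw : WedgeZero W) (l : Cone) :
    phi (V + W) l = phi V l + phi W l := by
  simp only [phi, coneIntegral, hV.tail_add hW, Pi.add_apply, mdot_add, add_div]
  rw [integral_add (integrable_phi_of_wedgeZero hV hv l) (integrable_phi_of_wedgeZero hW hw l),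
    mul_add]

theorem phi_neg {V : ℝ → Cone → M} {ε : ℝ} (hV : IsProfile ε V) (l : Cone) :
    phi (-V) l = -phi V l := by
  have h : tail (-V) = (-1 : ℝ) • tail V := by
    rw [← hV.tail_smul]
    simp
  simp only [phi, coneIntegral, h, Pi.smul_apply, mdot_smul]
  simp only [neg_one_mul, neg_div, integral_neg, mul_neg]

/-- The subgroup `𝒱⁰_as` of those `V ∈ 𝒱` for which `l ∧ V(s, l) = 0` and `Φ_V = n (2π/e)` with
some integer `n`; here `e` is the elementary charge. -/
def gaugeGroup (e : ℝ) : AddSubgroup profiles where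
  carrier := {V | WedgeZero V.1 ∧ ∃ n : ℤ, ∀ l, phi V.1 l = n * (2 * π / e)}
  add_mem' := by
    rintro ⟨V, ε, hε, hV⟩ ⟨W, ε', hε', hW⟩ ⟨hv, n, hn⟩ ⟨hw, m, hm⟩
    refine ⟨fun s l a b => ?_, n + m, fun l => ?_⟩
    · have h1 := hv s l a b
      have h2 := hw s l a b
      change (l : M) a * V s l b - (l : M) b * V s l a = 0 at h1
      change (l : M) a * W s l b - (l : M) b * W s l a = 0 at h2
      change (l : M) a * (V s l b + W s l b) - (l : M) b * (V s l a + W s l a) = 0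
      linarith
    · have h := phi_add_of_wedgeZero hV hW hv hw l
      change phi (V + W) l = _
      rw [h, hn l, hm l]
      push_cast
      ring
  zero_mem' := by
    refine ⟨fun s l a b => by simp, 0, fun l => ?_⟩
    simp [phi, tail_zero, coneIntegral, mdot]
  neg_mem' := by
    rintro ⟨V, ε, hε, hV⟩ ⟨hv, n, hn⟩
    refine ⟨fun s l a b => ?_, -n, fun l => ?_⟩
    · have h1 := hv s l a b
      change (l : M) a * V s l b - (l : M) b * V s l a = 0 at h1
      change (l : M) a * -(V s l b) - (l : M) b * -(V s l a) = 0
      linarith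
    · have h := phi_neg hV l
      change phi (-V) l = _
      rw [h, hn l]
      push_cast
      ring

/-- The quotient group `L = 𝒱 / 𝒱⁰_as`. -/
abbrev classGroup (e : ℝ) : Type := profiles ⧸ gaugeGroup e

/-- The class `[V] ∈ L`. -/
def profileClass (e : ℝ) (V : profiles) : classGroup e := QuotientAddGroup.mk V

theorem profileSpace_le {ε : ℝ} (hε : 0 < ε) : profileSpace ε ≤ profiles :=
  fun _ hV => ⟨ε, hε, hV⟩

/-! ### From currents to test functions -/

/-- The integral `∫ δ(s - x·l) f(x) d⁴x` over the null hyperplane `x·l = s`, with the delta function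
resolved in `x⁰`: on the hyperplane `x⁰ = (s + l⃗·y)/l⁰`, `y = x⃗`, and the Jacobian is `1/l⁰`. -/
def nullPlaneIntegral (f : M → M) (s : ℝ) (l : Cone) : M :=
  ((l : M) 0)⁻¹ • ∫ y : E3, f (mkVec ((s + inner ℝ (spatial l) y) / (l : M) 0) y)

/-- `V₀(s, l) = ∫ δ(s - x·l) [H₃ J](x) d⁴x`. -/
def currentV0 (J : M → M) (s : ℝ) (l : Cone) : M := nullPlaneIntegral (dilation 3 J) s l

/-- The function `V(s, l)` corresponding to `J`: its `s`-derivative is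
`(V₀(s, l) - V₀(0, l)) / s`, and `V(+∞, l) = -V(-∞, l)`, that is
`V(s, l) = ½ ∫ sgn(s - τ) ∂_τ V(τ, l) dτ`. -/
def currentProfile (J : M → M) (s : ℝ) (l : Cone) : M :=
  (1 / 2 : ℝ) • ∫ τ : ℝ, Real.sign (s - τ) • τ⁻¹ • (currentV0 J τ l - currentV0 J 0 l)

end AsymptoticQED

end

open Real Set Filter Topology MeasureTheory
open scoped ContDiff

noncomputable section

namespace AsymptoticQED

/-! ### Calculus tools -/

/-- Smoothness of all members of a family of functions whose derivatives are combinations, with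
smooth coefficients, of members of the family. -/
theorem contDiffOn_of_closed {E : Type*} [NormedAddCommGroup E] [NormedSpace ℝ E] {U : Set E}
    (hU : IsOpen U) (P : (E → ℝ) → Prop)
    (h : ∀ f, P f → ∃ (m : ℕ) (c : Fin m → E → (E →L[ℝ] ℝ)) (g : Fin m → E → ℝ),
      (∀ i, ContDiffOn ℝ ∞ (c i) U) ∧ (∀ i, P (g i)) ∧
      ∀ x ∈ U, HasFDerivAt f (∑ i, g i x • c i x) x) {f : E → ℝ} (hf : P f) :
    ContDiffOn ℝ ∞ f U := by
  rw [contDiffOn_infty]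
  intro n
  induction n generalizing f with
  | zero =>
    obtain ⟨m, c, g, -, -, hd⟩ := h f hf
    exact contDiffOn_zero.2 fun x hx => (hd x hx).continuousAt.continuousWithinAt
  | succ n ih =>
    obtain ⟨m, c, g, hc, hg, hd⟩ := h f hf
    push_cast
    rw [contDiffOn_succ_iff_fderiv_of_isOpen hU]
    refine ⟨fun x hx => (hd x hx).differentiableAt.differentiableWithinAt, by simp, ?_⟩
    have : ContDiffOn ℝ n (fun x => ∑ i, g i x • c i x) U :=
      ContDiffOn.sum fun i _ => (ih (hg i)).smul ((hc i).of_le (by exact_mod_cast le_top))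
    exact this.congr fun x hx => (hd x hx).fderiv

/-- Smoothness of an integral over `[0,1]` depending smoothly on parameters. -/
theorem contDiffOn_integral_unit {E : Type} [NormedAddCommGroup E] [NormedSpace ℝ E]
    [FiniteDimensional ℝ E] {V : Set E} (hV : IsOpen V) (n : ℕ) :
    ∀ {F : Type} [NormedAddCommGroup F] [NormedSpace ℝ F] [CompleteSpace F] {G : ℝ × E → F},
      ContDiffOn ℝ ∞ G (univ ×ˢ V) →
      ContDiffOn ℝ n (fun p => ∫ u in (0 : ℝ)..1, G (u, p)) V := by
  have key : ∀ {F : Type} [NormedAddCommGroup F] [NormedSpace ℝ F] [CompleteSpace F]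
      {G : ℝ × E → F}, ContDiffOn ℝ ∞ G (univ ×ˢ V) → ∀ p ∈ V,
      HasFDerivAt (fun p => ∫ u in (0 : ℝ)..1, G (u, p))
        (∫ u in (0 : ℝ)..1, (fderiv ℝ G (u, p)).comp (ContinuousLinearMap.inr ℝ ℝ E)) p := by
    intro F _ _ _ G hG p hp
    have hO : IsOpen ((univ : Set ℝ) ×ˢ V) := isOpen_univ.prod hV
    have hG' : ContinuousOn (fun q : ℝ × E =>
        (fderiv ℝ G q).comp (ContinuousLinearMap.inr ℝ ℝ E)) (univ ×ˢ V) :=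
      (hG.continuousOn_fderiv_of_isOpen hO (by simp)).clm_comp continuousOn_const
    obtain ⟨r, hr, hrV⟩ := Metric.nhds_basis_closedBall.mem_iff.1 (hV.mem_nhds hp)
    have hK : IsCompact (Icc (0 : ℝ) 1 ×ˢ Metric.closedBall p r) :=
      isCompact_Icc.prod (isCompact_closedBall p r)
    obtain ⟨C, hC⟩ := hK.exists_bound_of_continuousOn
      (hG'.mono (prod_mono (subset_univ _) hrV))
    have hcont : ∀ q ∈ V, Continuous fun u : ℝ => G (u, q) := fun q hq =>
      hG.continuousOn.comp_continuous (by fun_prop) fun u => ⟨mem_univ _, hq⟩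
    have hcont' : Continuous fun u : ℝ =>
        (fderiv ℝ G (u, p)).comp (ContinuousLinearMap.inr ℝ ℝ E) :=
      hG'.comp_continuous (f := fun u : ℝ => (u, p)) (by fun_prop) fun u => ⟨mem_univ _, hp⟩
    refine intervalIntegral.hasFDerivAt_integral_of_dominated_of_fderiv_le (𝕜 := ℝ)
      (F := fun p u => G (u, p))
      (F' := fun p u => (fderiv ℝ G (u, p)).comp (ContinuousLinearMap.inr ℝ ℝ E))
      (bound := fun _ => C)
      (Metric.closedBall_mem_nhds p hr) ?_ ?_ ?_ ?_ ?_ ?_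
    · filter_upwards [hV.mem_nhds hp] with q hq
      exact (hcont q hq).aestronglyMeasurable
    · exact (hcont p hp).intervalIntegrable _ _
    · exact hcont'.aestronglyMeasurable
    · refine Eventually.of_forall fun u hu q hq => hC (u, q) ⟨?_, hq⟩
      rw [uIoc_of_le zero_le_one] at hu
      exact ⟨hu.1.le, hu.2⟩
    · exact intervalIntegrable_const
    · refine Eventually.of_forall fun u _ q hq => ?_
      have h1 := ((hG.contDiffAt (hO.mem_nhds (x := (u, q)) ⟨mem_univ _, hrV hq⟩)).differentiableAt
        (by simp)).hasFDerivAt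
      exact h1.comp q (hasFDerivAt_prodMk_right u q)
  induction n with
  | zero =>
    intro F _ _ _ G hG
    exact contDiffOn_zero.2 fun p hp => (key hG p hp).continuousAt.continuousWithinAt
  | succ n ih =>
    intro F _ _ _ G hG
    push_cast
    rw [contDiffOn_succ_iff_fderiv_of_isOpen hV]
    refine ⟨fun x hx => (key hG x hx).differentiableAt.differentiableWithinAt, by simp, ?_⟩
    have h1 : ContDiffOn ℝ ∞ (fun q : ℝ × E =>
        (fderiv ℝ G q).comp (ContinuousLinearMap.inr ℝ ℝ E)) (univ ×ˢ V) :=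
      (hG.fderiv_of_isOpen (isOpen_univ.prod hV) (by simp)).clm_comp contDiffOn_const
    exact (ih h1).congr fun x hx => (key hG x hx).fderiv

/-- The integral over `E3` of a partial derivative of a function which vanishes at infinity. -/
theorem integral_partial_eq_zero (i : Fin 3) {G G' : E3 → ℝ}
    (hG : ∀ y, y ≠ 0 → HasDerivAt (fun t : ℝ => G (y + t • EuclideanSpace.single i 1)) (G' y) 0)
    (hint : Integrable G') (h0 : Tendsto G (cocompact E3) (𝓝 0)) : ∫ y, G' y = 0 := by
  have e1 := (EuclideanSpace.volume_preserving_symm_measurableEquiv_toLp (Fin 3)).symm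
  have e2 := (volume_preserving_piFinSuccAbove (fun _ : Fin 3 => ℝ) i).symm
  let e : ℝ × (Fin 2 → ℝ) → E3 := fun p => WithLp.toLp 2 (i.insertNth p.1 p.2)
  have he : MeasurePreserving e := e1.comp e2
  have hemb : MeasurableEmbedding e :=
    ((MeasurableEquiv.toLp 2 (Fin 3 → ℝ)).measurableEmbedding).comp
      ((MeasurableEquiv.piFinSuccAbove (fun _ : Fin 3 => ℝ) i).symm.measurableEmbedding)
  have hint' : Integrable (fun p => G' (e p)) := (he.integrable_comp_emb hemb).2 hint
  rw [← he.integral_comp hemb]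
  change ∫ p : ℝ × (Fin 2 → ℝ), G' (e p) ∂(volume.prod volume) = 0
  rw [integral_prod_symm _ hint']
  have hq : ∀ᵐ q : Fin 2 → ℝ, q ≠ 0 := by
    simp [ae_iff]
  refine integral_eq_zero_of_ae ?_
  filter_upwards [hq, hint'.prod_left_ae] with q hq hiq
  have hne : ∀ t, e (t, q) ≠ 0 := by
    intro t h
    apply hq
    funext k
    have := congrArg (fun y : E3 => y (i.succAbove k)) h
    simpa [e] using this
  have hline : ∀ t s : ℝ, e (t, q) + s • EuclideanSpace.single i 1 = e (t + s, q) := by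
    intro t s
    ext k
    refine Fin.succAboveCases i ?_ (fun k => ?_) k
    · simp [e]
    · simp [e, Fin.succAbove_ne]
  have hd : ∀ t, HasDerivAt (fun t => G (e (t, q))) (G' (e (t, q))) t := by
    intro t
    have h1 := hG _ (hne t)
    simp only [hline] at h1
    have h2 := HasDerivAt.comp_sub_const t t (by simpa using h1)
    simpa using h2
  have hnorm : ∀ t, |t| ≤ ‖e (t, q)‖ := by
    intro t
    have := PiLp.norm_apply_le (e (t, q)) i
    simpa [e] using this
  have hco : ∀ l : Filter ℝ, Tendsto (fun t : ℝ => |t|) l atTop →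
      Tendsto (fun t => G (e (t, q))) l (𝓝 0) := by
    intro l hl
    refine h0.comp ?_
    rw [← Metric.cobounded_eq_cocompact, ← tendsto_norm_atTop_iff_cobounded]
    exact tendsto_atTop_mono hnorm hl
  have := integral_of_hasDerivAt_of_tendsto hd hiq (hco _ tendsto_abs_atBot_atTop)
    (hco _ tendsto_abs_atTop_atTop)
  simpa using this

/-! ### Integration over the unit sphere -/

/-- The unit sphere of `E3`. -/
abbrev S2 : Type := Metric.sphere (0 : E3) 1

/-- The surface measure of the unit sphere. -/
abbrev sphereMeasure : Measure S2 := (volume : Measure E3).toSphere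

theorem S2.norm (n : S2) : ‖(n : E3)‖ = 1 := by simp

theorem S2.ne_zero (n : S2) : (n : E3) ≠ 0 := ne_zero_of_mem_unit_sphere n

theorem integrable_sphere_of_continuous {f : S2 → ℝ} (hf : Continuous f) :
    Integrable f sphereMeasure :=
  hf.integrable_of_hasCompactSupport (HasCompactSupport.of_compactSpace _)

theorem integrable_homeomorphUnitSphereProd {f : E3 → ℝ} (hf : Integrable f) :
    Integrable (fun p : S2 × Ioi (0 : ℝ) => f ((p.2 : ℝ) • (p.1 : E3)))
      (sphereMeasure.prod (Measure.volumeIoiPow 2)) := by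
  have h1 := (volume : Measure E3).measurePreserving_homeomorphUnitSphereProd
  have h2 : Integrable (fun x : ({0}ᶜ : Set E3) => f x)
      ((volume : Measure E3).comap Subtype.val) := by
    rw [← Function.comp_def f, ← integrableOn_iff_comap_subtypeVal (by measurability)]
    exact hf.integrableOn
  have h3 := (h1.symm (homeomorphUnitSphereProd E3).toMeasurableEquiv).integrable_comp_emb
    (MeasurableEquiv.measurableEmbedding _) |>.2 h2
  simpa [Function.comp_def] using h3

theorem integrable_polar {f : E3 → ℝ} (hf : Integrable f) :
    Integrable (fun p : S2 × ℝ => p.2 ^ 2 * f (p.2 • (p.1 : E3)))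
      (sphereMeasure.prod (volume.restrict (Ioi 0))) := by
  have h4 := integrable_homeomorphUnitSphereProd hf
  have h6 : MeasurePreserving (Subtype.val : Ioi (0 : ℝ) → ℝ) (volume.comap Subtype.val)
      (volume.restrict (Ioi 0)) :=
    ⟨measurable_subtype_coe, map_comap_subtype_coe measurableSet_Ioi _⟩
  have := h6.sigmaFinite
  rw [Measure.volumeIoiPow, prod_withDensity_right (by fun_prop),
    integrable_withDensity_iff_integrable_smul' (by fun_prop) (by simp)] at h4
  have h5 : MeasurePreserving (Prod.map id Subtype.val : S2 × Ioi (0 : ℝ) → S2 × ℝ)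
      (sphereMeasure.prod (volume.comap Subtype.val))
      (sphereMeasure.prod (volume.restrict (Ioi 0))) :=
    (MeasurePreserving.id _).prod h6
  refine (h5.integrable_comp_emb
    (MeasurableEmbedding.id.prodMap (MeasurableEmbedding.subtype_coe measurableSet_Ioi))).1 ?_
  refine h4.congr (Eventually.of_forall fun p => ?_)
  have : (0 : ℝ) ≤ p.2 := le_of_lt p.2.2
  simp [ENNReal.toReal_ofReal (pow_nonneg this 2)]

theorem integral_polar {f : E3 → ℝ} (hf : Integrable f) :
    ∫ y, f y = ∫ n : S2, (∫ r in Ioi (0 : ℝ), r ^ 2 * f (r • (n : E3))) ∂sphereMeasure := by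
  have h1 := (volume : Measure E3).measurePreserving_homeomorphUnitSphereProd
  have h4 := integrable_homeomorphUnitSphereProd hf
  have h6 := (h1.symm (homeomorphUnitSphereProd E3).toMeasurableEquiv).integral_comp
    (MeasurableEquiv.measurableEmbedding _) (fun x : ({0}ᶜ : Set E3) => f x)
  have h7 : ∫ x : ({0}ᶜ : Set E3), f x ∂((volume : Measure E3).comap Subtype.val)
      = ∫ y, f y := by
    rw [integral_subtype_comap (measurableSet_singleton _).compl f, restrict_compl_singleton]
  rw [← h7, ← h6]
  have h8 : ∀ n : S2, ∫ r in Ioi (0 : ℝ), r ^ 2 * f (r • (n : E3))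
      = ∫ r : Ioi (0 : ℝ), f ((r : ℝ) • (n : E3)) ∂Measure.volumeIoiPow 2 := by
    intro n
    simp only [Measure.volumeIoiPow, ENNReal.ofReal]
    rw [integral_withDensity_eq_integral_smul
        ((measurable_subtype_coe.pow_const _).real_toNNReal),
      integral_subtype_comap measurableSet_Ioi
        fun a : ℝ => Real.toNNReal (a ^ 2) • f (a • (n : E3))]
    refine setIntegral_congr_fun measurableSet_Ioi fun r hr => ?_
    simp only [NNReal.smul_def, Real.coe_toNNReal _ (pow_nonneg (le_of_lt hr) 2), smul_eq_mul]
  simp only [h8]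
  rw [← integral_prod _ h4]
  simp

/-- The divergence theorem on the sphere, for functions homogeneous of degree `-1`. -/
theorem integral_sphere_fderiv {h : E3 → ℝ} (hd : ContDiffOn ℝ 1 h {0}ᶜ)
    (hh : ∀ (r : ℝ) (y : E3), 0 < r → y ≠ 0 → h (r • y) = r⁻¹ * h y) (v : E3) :
    ∫ n : S2, fderiv ℝ h n v ∂sphereMeasure
      = ∫ n : S2, inner ℝ (n : E3) v * h n ∂sphereMeasure := by
  let ρ : ContDiffBump (2 : ℝ) := ⟨1 / 2, 1, by norm_num, by norm_num⟩
  have hO : IsOpen ({0}ᶜ : Set E3) := isOpen_compl_singleton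
  have hρs : ∀ r : ℝ, r ∈ tsupport ρ → 1 ≤ r ∧ r ≤ 3 := by
    intro r hr
    rw [ρ.tsupport_eq, Metric.mem_closedBall, Real.dist_eq, abs_le] at hr
    simp only [ρ] at hr
    constructor <;> linarith [hr.1, hr.2]
  have hρd : Differentiable ℝ ρ := (ρ.contDiff (n := 1)).differentiable (by simp)
  have hρ0 : ∀ r : ℝ, r < 1 → ρ r = 0 ∧ deriv ρ r = 0 := by
    intro r hr
    have h1 : r ∉ tsupport ρ := fun h' => by linarith [(hρs r h').1]
    exact ⟨image_eq_zero_of_notMem_tsupport h1,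
      image_eq_zero_of_notMem_tsupport fun h' => h1 (tsupport_deriv_subset h')⟩
  have hdiff : ∀ y : E3, y ≠ 0 → HasFDerivAt h (fderiv ℝ h y) y := fun y hy =>
    ((hd.contDiffAt (hO.mem_nhds hy)).differentiableAt (by simp)).hasFDerivAt
  let H : E3 → ℝ := fun y => h y * ρ ‖y‖
  have hHc : ContDiff ℝ 1 H := by
    rw [contDiff_iff_contDiffAt]
    intro y
    by_cases hy : y = 0
    · have : H =ᶠ[𝓝 y] fun _ => 0 := by
        filter_upwards [Metric.ball_mem_nhds y one_pos] with z hz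
        have hz' : ‖z‖ < 1 := by simpa [hy] using hz
        simp [H, (hρ0 _ hz').1]
      exact contDiffAt_const.congr_of_eventuallyEq this
    · exact (hd.contDiffAt (hO.mem_nhds hy)).mul (ρ.contDiffAt.comp y (contDiffAt_norm ℝ hy))
  have hHs : HasCompactSupport H := by
    refine HasCompactSupport.intro (isCompact_closedBall 0 3) fun y hy => ?_
    have h1 : ‖y‖ ∉ tsupport ρ := fun h' => hy (by simpa using (hρs _ h').2)
    simp [H, image_eq_zero_of_notMem_tsupport h1]
  have hHf : Continuous fun y => fderiv ℝ H y v :=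
    (hHc.continuous_fderiv (by simp)).clm_apply continuous_const
  have hint : Integrable fun y => fderiv ℝ H y v :=
    hHf.integrable_of_hasCompactSupport (hHs.fderiv_apply (𝕜 := ℝ) v)
  have h0 : ∫ y, fderiv ℝ H y v = 0 := by
    have := integral_mul_fderiv_eq_neg_fderiv_mul_of_integrable (μ := (volume : Measure E3))
      (f := fun _ => (1 : ℝ)) (g := H) (v := v) (by simp) (by simpa using hint)
      (by simpa using hHc.continuous.integrable_of_hasCompactSupport hHs)
      (by simp) (fun x _ => hHc.differentiable (by simp) x)
    simpa using this
  have hder : ∀ (n : S2) (r : ℝ), 0 < r → r ^ 2 * fderiv ℝ H (r • (n : E3)) v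
      = fderiv ℝ h n v * ρ r + inner ℝ (n : E3) v * h n * (r * deriv ρ r) := by
    intro n r hr
    have hne : r • (n : E3) ≠ 0 := smul_ne_zero hr.ne' n.ne_zero
    have e1 : fderiv ℝ h (r • (n : E3)) v = (r ^ 2)⁻¹ * fderiv ℝ h n v := by
      have g1 : (fun y => h (r • y)) =ᶠ[𝓝 (n : E3)] fun y => r⁻¹ * h y := by
        filter_upwards [hO.mem_nhds n.ne_zero] with y hy using hh r y hr hy
      have g2 : HasFDerivAt (fun y => h (r • y)) ((fderiv ℝ h (r • (n : E3))).comp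
          (r • ContinuousLinearMap.id ℝ E3)) n :=
        (hdiff _ hne).comp (n : E3) ((hasFDerivAt_id (n : E3)).const_smul r)
      have g3 : HasFDerivAt (fun y => r⁻¹ * h y) (r⁻¹ • fderiv ℝ h n) n :=
        (hdiff n n.ne_zero).const_mul r⁻¹
      have := congrArg (fun L : E3 →L[ℝ] ℝ => L v) ((g3.congr_of_eventuallyEq g1).unique g2)
      simp at this
      field_simp
      field_simp at this
      linarith
    have e2 : HasFDerivAt (fun y : E3 => ρ ‖y‖)
        (deriv ρ ‖r • (n : E3)‖ • fderiv ℝ (fun y : E3 => ‖y‖) (r • (n : E3))) (r • (n : E3)) :=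
      (hρd _).hasDerivAt.comp_hasFDerivAt _
        ((contDiffAt_norm ℝ hne).differentiableAt (n := 1) (by simp)).hasFDerivAt
    have e3 : fderiv ℝ (fun y : E3 => ‖y‖) (r • (n : E3)) v = inner ℝ (n : E3) v := by
      have g1 : HasFDerivAt (fun y : E3 => ‖y‖ ^ 2) (2 • innerSL ℝ (r • (n : E3))) (r • (n : E3)) :=
        (hasStrictFDerivAt_norm_sq _).hasFDerivAt
      have g2 := (((contDiffAt_norm ℝ hne).differentiableAt (n := 1) (by simp)).hasFDerivAt).pow 2
      have := congrArg (fun L : E3 →L[ℝ] ℝ => L v) (g1.unique g2)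
      simp [norm_smul, abs_of_pos hr] at this
      change fderiv ℝ Norm.norm (r • (n : E3)) v = _
      have hr' := hr.ne'
      field_simp at this
      linarith
    have e4 : HasFDerivAt H _ (r • (n : E3)) := (hdiff _ hne).mul e2
    rw [e4.fderiv]
    simp only [_root_.add_apply, _root_.smul_apply, smul_eq_mul, e1, e3,
      hh r n hr n.ne_zero, norm_smul, S2.norm, Real.norm_eq_abs, abs_of_pos hr, mul_one]
    field_simp
    ring
  have hρi : Integrable ρ := ρ.integrable
  have hρ' : Integrable (fun r : ℝ => r * deriv ρ r) := by
    have hc : Continuous fun r : ℝ => r * deriv ρ r :=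
      continuous_id.mul ((ρ.contDiff (n := 1)).continuous_deriv (by simp))
    exact hc.integrable_of_hasCompactSupport (ρ.hasCompactSupport.deriv.mul_left)
  have hIoi : ∀ F : ℝ → ℝ, (∀ r, r < 1 → F r = 0) → ∫ r in Ioi (0 : ℝ), F r = ∫ r, F r := by
    intro F hF
    refine setIntegral_eq_integral_of_forall_compl_eq_zero fun r hr => hF r ?_
    simp only [mem_Ioi, not_lt] at hr
    linarith
  have hparts : ∫ r : ℝ, r * deriv ρ r = -∫ r : ℝ, ρ r := by
    have := integral_mul_deriv_eq_deriv_mul_of_integrable (u := fun r : ℝ => r) (v := ρ)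
      (u' := fun _ => 1) (v' := deriv ρ) (fun x _ => hasDerivAt_id x)
      (fun x _ => (hρd x).hasDerivAt) hρ' (hρi.congr (by simp [Pi.mul_def])) ?_
    · simpa using this
    · exact (continuous_id.mul ρ.continuous).integrable_of_hasCompactSupport
        (ρ.hasCompactSupport.mul_left)
  have hcont1 : Continuous fun n : S2 => fderiv ℝ h n v := by
    have := (hd.continuousOn_fderiv_of_isOpen hO (by simp)).comp_continuous
      (continuous_subtype_val (p := fun y => y ∈ Metric.sphere (0 : E3) 1)) fun n => S2.ne_zero n
    exact this.clm_apply continuous_const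
  have hcont2 : Continuous fun n : S2 => inner ℝ (n : E3) v * h n := by
    have := hd.continuousOn.comp_continuous
      (continuous_subtype_val (p := fun y => y ∈ Metric.sphere (0 : E3) 1)) fun n => S2.ne_zero n
    exact (by fun_prop : Continuous fun n : S2 => inner ℝ (n : E3) v).mul this
  rw [integral_polar hint] at h0
  have h1 : ∀ n : S2, ∫ r in Ioi (0 : ℝ), r ^ 2 * fderiv ℝ H (r • (n : E3)) v
      = (fderiv ℝ h n v - inner ℝ (n : E3) v * h n) * ∫ r : ℝ, ρ r := by
    intro n
    rw [setIntegral_congr_fun measurableSet_Ioi fun r hr => hder n r hr,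
      hIoi _ fun r hr => by simp [hρ0 r hr], integral_add (hρi.const_mul _) (hρ'.const_mul _),
      integral_const_mul, integral_const_mul, hparts]
    ring
  simp only [h1] at h0
  rw [integral_mul_const, mul_eq_zero, or_iff_left ρ.integral_pos.ne',
    integral_sub (integrable_sphere_of_continuous hcont1)
      (integrable_sphere_of_continuous hcont2)] at h0
  linarith

/-- The area of the unit sphere. -/
def sphereArea : ℝ := sphereMeasure.real univ

theorem sphereArea_pos : 0 < sphereArea := by
  rw [sphereArea, measureReal_def]
  exact ENNReal.toReal_pos (by simp [Real.pi_pos]) (measure_ne_top _ _)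

theorem continuous_sphere_inner (v : E3) : Continuous fun n : S2 => inner ℝ (n : E3) v := by
  fun_prop

theorem integral_sphere_inner_pow_succ (v : S2) (p : ℕ) :
    p * ∫ n : S2, inner ℝ (n : E3) v ^ (p - 1) ∂sphereMeasure
      = (p + 2) * ∫ n : S2, inner ℝ (n : E3) v ^ (p + 1) ∂sphereMeasure := by
  let h : E3 → ℝ := fun y => inner ℝ y (v : E3) ^ p * (‖y‖⁻¹) ^ (p + 1)
  have hd : ContDiffOn ℝ 1 h {0}ᶜ := by
    intro y hy
    have h1 : ContDiffAt ℝ 1 (fun y : E3 => ‖y‖) y := contDiffAt_norm ℝ hy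
    have h2 : ContDiffAt ℝ 1 (fun y : E3 => inner ℝ y (v : E3)) y :=
      contDiffAt_id.inner ℝ contDiffAt_const
    exact ((h2.pow p).mul ((h1.inv (norm_ne_zero_iff.2 hy)).pow (p + 1))).contDiffWithinAt
  have hh : ∀ (r : ℝ) (y : E3), 0 < r → y ≠ 0 → h (r • y) = r⁻¹ * h y := by
    intro r y hr hy
    simp only [h, inner_smul_left, norm_smul, Real.norm_eq_abs, abs_of_pos hr, mul_inv]
    have h1 := norm_ne_zero_iff.2 hy
    rw [mul_pow, mul_pow, pow_succ r⁻¹, inv_pow r, conj_trivial]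
    field_simp
  have key := integral_sphere_fderiv hd hh v
  have h1 : ∀ n : S2, fderiv ℝ h n v = p * inner ℝ (n : E3) v ^ (p - 1)
      - (p + 1) * inner ℝ (n : E3) v ^ (p + 1) := by
    intro n
    have a1 : HasFDerivAt (fun y : E3 => inner ℝ y (v : E3)) (innerSL ℝ (v : E3)) (n : E3) := by
      have := (innerSL ℝ (v : E3)).hasFDerivAt (x := (n : E3))
      refine this.congr_of_eventuallyEq (Eventually.of_forall fun y => ?_)
      simp [real_inner_comm]
    have a2 : HasFDerivAt (fun y : E3 => ‖y‖) (fderiv ℝ (fun y : E3 => ‖y‖) n) (n : E3) :=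
      ((contDiffAt_norm ℝ n.ne_zero).differentiableAt (n := 1) (by simp)).hasFDerivAt
    have a3 : fderiv ℝ (fun y : E3 => ‖y‖) n v = inner ℝ (n : E3) v := by
      have g1 : HasFDerivAt (fun y : E3 => ‖y‖ ^ 2) (2 • innerSL ℝ (n : E3)) (n : E3) :=
        (hasStrictFDerivAt_norm_sq _).hasFDerivAt
      have g2 := a2.pow 2
      have := congrArg (fun L : E3 →L[ℝ] ℝ => L v) (g1.unique g2)
      simp at this
      exact this.symm
    have a4 := (a1.pow p).mul (((hasDerivAt_inv (by simp)).comp_hasFDerivAt (n : E3) a2).pow (p + 1))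
    have a5 : fderiv ℝ h n = _ := HasFDerivAt.fderiv a4
    rw [a5]
    simp [a3]
    ring
  have hi : ∀ q : ℕ, Integrable (fun n : S2 => inner ℝ (n : E3) v ^ q) sphereMeasure := fun q =>
    integrable_sphere_of_continuous ((continuous_sphere_inner v).pow q)
  simp only [h1] at key
  rw [integral_sub ((hi _).const_mul _) ((hi _).const_mul _), integral_const_mul,
    integral_const_mul] at key
  have h2 : ∀ n : S2, inner ℝ (n : E3) v * h n = inner ℝ (n : E3) v ^ (p + 1) := by
    intro n
    simp [h]
    ring
  simp only [h2] at key
  linarith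

theorem integral_sphere_inner_pow (v : S2) (p : ℕ) :
    ∫ n : S2, inner ℝ (n : E3) v ^ p ∂sphereMeasure
      = sphereArea / 2 * ∫ u in (-1 : ℝ)..1, u ^ p := by
  induction p using Nat.twoStepInduction with
  | zero => simp [sphereArea]; ring
  | one =>
    have := integral_sphere_inner_pow_succ v 0
    simp at this
    simp [this]
  | more p ih _ =>
    have := integral_sphere_inner_pow_succ v (p + 1)
    simp only [Nat.add_sub_cancel, ih, integral_pow] at this
    rw [integral_pow]
    push_cast at this ⊢
    have h1 : (p : ℝ) + 1 + 2 ≠ 0 := by positivity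
    have h2 : (p : ℝ) + 1 ≠ 0 := by positivity
    have h3 : (p : ℝ) + 2 + 1 ≠ 0 := by positivity
    field_simp at this ⊢
    rw [show (p : ℝ) + 2 + 1 = p + 1 + 2 by ring]
    linear_combination (-1) * this

/-- Archimedes' theorem: the projection of the sphere to an axis is uniformly distributed. -/
theorem integral_sphere_inner (v : S2) {k : ℝ → ℝ} (hk : Continuous k) :
    ∫ n : S2, k (inner ℝ (n : E3) v) ∂sphereMeasure
      = sphereArea / 2 * ∫ u in (-1 : ℝ)..1, k u := by
  have hi : ∀ i : ℕ, Integrable (fun n : S2 => inner ℝ (n : E3) (v : E3) ^ i) sphereMeasure :=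
    fun i => integrable_sphere_of_continuous ((continuous_sphere_inner v).pow i)
  have hpoly : ∀ p : Polynomial ℝ, ∫ n : S2, p.eval (inner ℝ (n : E3) (v : E3)) ∂sphereMeasure
      = sphereArea / 2 * ∫ u in (-1 : ℝ)..1, p.eval u := by
    intro p
    simp only [Polynomial.eval_eq_sum_range]
    rw [integral_finsetSum _ fun i _ => (hi i).const_mul _,
      intervalIntegral.integral_finsetSum fun i _ => (by fun_prop : Continuous fun u : ℝ =>
        p.coeff i * u ^ i).intervalIntegrable _ _, Finset.mul_sum]
    refine Finset.sum_congr rfl fun i _ => ?_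
    rw [integral_const_mul, integral_sphere_inner_pow, intervalIntegral.integral_const_mul]
    ring
  have hA := sphereArea_pos
  have hmem : ∀ n : S2, inner ℝ (n : E3) (v : E3) ∈ Icc (-1 : ℝ) 1 := fun n => by
    have := abs_real_inner_le_norm (n : E3) v
    simp only [S2.norm, mul_one] at this
    exact abs_le.1 this
  refine eq_of_forall_dist_le fun ε hε => ?_
  rw [Real.dist_eq]
  obtain ⟨p, hp⟩ := exists_polynomial_near_of_continuousOn (-1) 1 k hk.continuousOn
    (ε / (2 * sphereArea)) (by positivity)
  have e1 : |∫ n : S2, (k (inner ℝ (n : E3) v) - p.eval (inner ℝ (n : E3) (v : E3)))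
      ∂sphereMeasure| ≤ ε / (2 * sphereArea) * sphereArea := by
    have := norm_integral_le_of_norm_le_const (μ := sphereMeasure) (C := ε / (2 * sphereArea))
      (f := fun n : S2 => k (inner ℝ (n : E3) v) - p.eval (inner ℝ (n : E3) (v : E3)))
      (Eventually.of_forall fun n => by
        rw [Real.norm_eq_abs, abs_sub_comm]
        exact (hp _ (hmem n)).le)
    simpa [sphereArea] using this
  have e2 : |∫ u in (-1 : ℝ)..1, (k u - p.eval u)| ≤ ε / (2 * sphereArea) * 2 := by
    have := intervalIntegral.norm_integral_le_of_norm_le_const (a := -1) (b := 1)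
      (C := ε / (2 * sphereArea)) (f := fun u : ℝ => k u - p.eval u) (fun u hu => by
        rw [uIoc_of_le (by norm_num)] at hu
        rw [Real.norm_eq_abs, abs_sub_comm]
        exact (hp _ ⟨hu.1.le, hu.2⟩).le)
    refine this.trans (le_of_eq ?_)
    norm_num
  have hi1 : Integrable (fun n : S2 => k (inner ℝ (n : E3) v)) sphereMeasure :=
    integrable_sphere_of_continuous (hk.comp (continuous_sphere_inner v))
  have hi2 : Integrable (fun n : S2 => p.eval (inner ℝ (n : E3) (v : E3))) sphereMeasure :=
    integrable_sphere_of_continuous (p.continuous.comp (continuous_sphere_inner v))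
  rw [integral_sub hi1 hi2, hpoly] at e1
  rw [intervalIntegral.integral_sub (hk.intervalIntegrable _ _)
    (p.continuous.intervalIntegrable _ _)] at e2
  have e3 : ε / (2 * sphereArea) * sphereArea = ε / 2 := by field_simp
  have e4 : sphereArea / 2 * (ε / (2 * sphereArea) * 2) = ε / 2 := by field_simp
  have e5 := mul_le_mul_of_nonneg_left e2 (by positivity : 0 ≤ sphereArea / 2)
  rw [← abs_of_pos (half_pos hA), ← abs_mul, abs_of_pos (half_pos hA), e4, mul_sub] at e5
  rw [e3] at e1
  have e6 : ε / 2 + ε / 2 = ε := add_halves ε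
  rw [abs_le] at e1 e5 ⊢
  constructor <;> linarith [e1.1, e1.2, e5.1, e5.2]

theorem integral_sphere_deriv_inner {y : E3} (hy : y ≠ 0) {k k' : ℝ → ℝ}
    (hk : ∀ u, HasDerivAt k (k' u) u) (hk' : Continuous k') :
    ∫ n : S2, k' (inner ℝ (n : E3) y) ∂sphereMeasure
      = sphereArea / 2 * ‖y‖⁻¹ * (k ‖y‖ - k (-‖y‖)) := by
  have hy' : ‖y‖ ≠ 0 := norm_ne_zero_iff.2 hy
  let v : S2 := ⟨‖y‖⁻¹ • y, by simp [norm_smul, hy']⟩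
  have h1 : ∀ n : S2, inner ℝ (n : E3) y = ‖y‖ * inner ℝ (n : E3) (v : E3) := by
    intro n
    simp only [v, inner_smul_right]
    field_simp
  simp only [h1]
  rw [integral_sphere_inner v (k := fun u => k' (‖y‖ * u)) (by fun_prop)]
  have h2 : ∫ u in (-1 : ℝ)..1, k' (‖y‖ * u) = ‖y‖⁻¹ * (k ‖y‖ - k (-‖y‖)) := by
    rw [intervalIntegral.integral_comp_mul_left k' hy',
      intervalIntegral.integral_eq_sub_of_hasDerivAt (fun u _ => hk u)
        (hk'.intervalIntegrable _ _)]
    simp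
  rw [h2]
  ring

theorem sphere_inner_ne {v : E3} (hv : v ≠ 0) (s : ℝ) :
    ∀ᵐ n : S2 ∂sphereMeasure, inner ℝ (n : E3) v ≠ s := by
  let k : ℕ → ℝ → ℝ := fun m u => (1 + m * (u - s) ^ 2)⁻¹
  have hpos : ∀ (m : ℕ) (u : ℝ), 0 < 1 + (m : ℝ) * (u - s) ^ 2 := fun m u => by positivity
  have hkc : ∀ m, Continuous (k m) := fun m =>
    Continuous.inv₀ (by fun_prop) fun u => (hpos m u).ne'
  have hk1 : ∀ m u, ‖k m u‖ ≤ 1 := fun m u => by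
    simp only [k]
    rw [Real.norm_eq_abs, abs_of_pos (inv_pos.2 (hpos m u))]
    refine inv_le_one_of_one_le₀ ?_
    have : 0 ≤ (m : ℝ) * (u - s) ^ 2 := by positivity
    linarith
  have hlim : ∀ u, u ≠ s → Tendsto (fun m => k m u) atTop (𝓝 0) := by
    intro u hu
    have h1 : 0 < (u - s) ^ 2 := by
      exact (sq_pos_of_ne_zero (sub_ne_zero.2 hu))
    exact tendsto_inv_atTop_zero.comp (tendsto_atTop_add_const_left _ _
      (tendsto_natCast_atTop_atTop.atTop_mul_const h1))
  have hv' : ‖v‖ ≠ 0 := norm_ne_zero_iff.2 hv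
  let w : S2 := ⟨‖v‖⁻¹ • v, by simp [norm_smul, hv']⟩
  have hw : ∀ n : S2, inner ℝ (n : E3) v = ‖v‖ * inner ℝ (n : E3) (w : E3) := by
    intro n
    simp only [w, inner_smul_right]
    field_simp
  have h1 : Tendsto (fun m => ∫ n : S2, k m (inner ℝ (n : E3) v) ∂sphereMeasure) atTop (𝓝 0) := by
    simp only [hw]
    have h2 : ∀ m, ∫ n : S2, k m (‖v‖ * inner ℝ (n : E3) (w : E3)) ∂sphereMeasure
        = sphereArea / 2 * ∫ u in (-1 : ℝ)..1, k m (‖v‖ * u) := fun m =>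
      integral_sphere_inner w (k := fun u => k m (‖v‖ * u)) ((hkc m).comp (by fun_prop))
    simp only [h2]
    have h3 : Tendsto (fun m => ∫ u in (-1 : ℝ)..1, k m (‖v‖ * u)) atTop
        (𝓝 (∫ u in (-1 : ℝ)..1, (0 : ℝ))) := by
      refine intervalIntegral.tendsto_integral_filter_of_dominated_convergence (fun _ => 1)
        (Eventually.of_forall fun m => ((hkc m).comp (by fun_prop)).aestronglyMeasurable)
        (Eventually.of_forall fun m => Eventually.of_forall fun u _ => hk1 m _)
        intervalIntegrable_const ?_
      have : ∀ᵐ u : ℝ, u ≠ s / ‖v‖ := by simp [ae_iff]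
      filter_upwards [this] with u hu _
      refine hlim _ fun h => hu ?_
      rw [← h]
      field_simp
    simpa using h3.const_mul (sphereArea / 2)
  have hms : MeasurableSet {n : S2 | inner ℝ (n : E3) v = s} :=
    (isClosed_eq (continuous_sphere_inner v) continuous_const).measurableSet
  have h4 : ∀ m, sphereMeasure.real {n : S2 | inner ℝ (n : E3) v = s}
      ≤ ∫ n : S2, k m (inner ℝ (n : E3) v) ∂sphereMeasure := by
    intro m
    rw [← integral_indicator_one hms]
    refine integral_mono ((integrable_const (1 : ℝ)).indicator hms)
      (integrable_sphere_of_continuous ((hkc m).comp (continuous_sphere_inner v))) fun n => ?_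
    simp only [indicator, Pi.one_apply, mem_ofPred_eq]
    split_ifs with h
    · simp [k, h]
    · exact (inv_pos.2 (hpos m _)).le
  have h5 := ge_of_tendsto' h1 h4
  have h6 := le_antisymm h5 measureReal_nonneg
  rw [measureReal_eq_zero_iff] at h6
  simpa [ae_iff] using h6

/-! ### Partial derivatives and decaying functions -/

/-- The partial derivative `∂_a f`. -/
def pd (a : Fin 4) (f : M → ℝ) : M → ℝ := fun x => fderiv ℝ f x (EuclideanSpace.single a 1)

/-- Iterated partial derivatives. -/
def pds : List (Fin 4) → (M → ℝ) → M → ℝ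
  | [], f => f
  | a :: L, f => pds L (pd a f)

/-- The Euler operator `x·∂ + κ`. -/
def eul (κ : ℝ) (f : M → ℝ) : M → ℝ := fun x => fderiv ℝ f x x + κ * f x

/-- The generator of boosts `x^i ∂_0 + x^0 ∂_i`. -/
def boost (i : Fin 3) (f : M → ℝ) : M → ℝ := fun x => x i.succ * pd 0 f x + x 0 * pd i.succ f x

theorem contDiff_pd {f : M → ℝ} (hf : ContDiff ℝ ∞ f) (a : Fin 4) : ContDiff ℝ ∞ (pd a f) :=
  (hf.fderiv_right (m := ∞) (by simp)).clm_apply contDiff_const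

theorem contDiff_pds {f : M → ℝ} (hf : ContDiff ℝ ∞ f) (L : List (Fin 4)) :
    ContDiff ℝ ∞ (pds L f) := by
  induction L generalizing f with
  | nil => exact hf
  | cons a L ih => exact ih (contDiff_pd hf a)

theorem contDiff_coord (a : Fin 4) : ContDiff ℝ ∞ (fun x : M => x a) := by fun_prop

theorem contDiff_boost {f : M → ℝ} (hf : ContDiff ℝ ∞ f) (i : Fin 3) :
    ContDiff ℝ ∞ (boost i f) :=
  ((contDiff_coord _).mul (contDiff_pd hf _)).add ((contDiff_coord _).mul (contDiff_pd hf _))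

theorem contDiff_eul {f : M → ℝ} (hf : ContDiff ℝ ∞ f) (κ : ℝ) : ContDiff ℝ ∞ (eul κ f) :=
  ((hf.fderiv_right (m := ∞) (by simp)).clm_apply contDiff_id).add (contDiff_const.mul hf)

theorem smooth_diffAt {f : M → ℝ} (hf : ContDiff ℝ ∞ f) (x : M) : DifferentiableAt ℝ f x :=
  (hf.differentiable (by simp)) x

theorem M.sum_single (v : M) : v = ∑ a, v a • EuclideanSpace.single a (1 : ℝ) := by
  ext b
  simp [Pi.single_apply]

theorem fderiv_eq_sum_pd (f : M → ℝ) (x v : M) : fderiv ℝ f x v = ∑ a, v a * pd a f x := by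
  conv_lhs => rw [M.sum_single v]
  simp [pd]

theorem pd_add {f g : M → ℝ} (hf : ContDiff ℝ ∞ f) (hg : ContDiff ℝ ∞ g) (a : Fin 4) :
    pd a (fun x => f x + g x) = fun x => pd a f x + pd a g x := by
  funext x
  simp [pd, fderiv_fun_add (smooth_diffAt hf x) (smooth_diffAt hg x)]

theorem pd_sub {f g : M → ℝ} (hf : ContDiff ℝ ∞ f) (hg : ContDiff ℝ ∞ g) (a : Fin 4) :
    pd a (fun x => f x - g x) = fun x => pd a f x - pd a g x := by
  funext x
  simp [pd, fderiv_fun_sub (smooth_diffAt hf x) (smooth_diffAt hg x)]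

theorem pd_const_mul {f : M → ℝ} (hf : ContDiff ℝ ∞ f) (c : ℝ) (a : Fin 4) :
    pd a (fun x => c * f x) = fun x => c * pd a f x := by
  funext x
  simp [pd, fderiv_const_mul (smooth_diffAt hf x)]

theorem pd_mul {f g : M → ℝ} (hf : ContDiff ℝ ∞ f) (hg : ContDiff ℝ ∞ g) (a : Fin 4) :
    pd a (fun x => f x * g x) = fun x => f x * pd a g x + pd a f x * g x := by
  funext x
  simp [pd, fderiv_fun_mul (smooth_diffAt hf x) (smooth_diffAt hg x)]
  ring

theorem pd_coord (a b : Fin 4) : pd a (fun x : M => x b) = fun _ => if a = b then 1 else 0 := by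
  funext x
  have : HasFDerivAt (fun x : M => x b) (EuclideanSpace.proj (𝕜 := ℝ) b) x :=
    (EuclideanSpace.proj (𝕜 := ℝ) b).hasFDerivAt
  simp [pd, this.fderiv, eq_comm]

theorem pd_coord_mul {f : M → ℝ} (hf : ContDiff ℝ ∞ f) (a b : Fin 4) :
    pd a (fun x => x b * f x) = fun x => x b * pd a f x + (if a = b then 1 else 0) * f x := by
  rw [pd_mul (contDiff_coord b) hf, pd_coord]

theorem pd_comm {f : M → ℝ} (hf : ContDiff ℝ ∞ f) (a b : Fin 4) :
    pd a (pd b f) = pd b (pd a f) := by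
  funext x
  have h1 : ∀ c, HasFDerivAt (pd c f)
      ((fderiv ℝ (fderiv ℝ f) x).flip (EuclideanSpace.single c 1)) x := by
    intro c
    have h := ((hf.fderiv_right (m := ∞) (by simp)).differentiable (by simp) x).hasFDerivAt
    have := h.clm_apply (hasFDerivAt_const (EuclideanSpace.single c (1 : ℝ) : M) x)
    simp only [ContinuousLinearMap.comp_zero, zero_add] at this
    exact this
  have h2 : IsSymmSndFDerivAt ℝ f x := (contDiff_infty.1 hf 2).contDiffAt.isSymmSndFDerivAt
    (by simp)
  rw [pd, pd, (h1 a).fderiv, (h1 b).fderiv]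
  exact h2 _ _

theorem eul_eq (κ : ℝ) (f : M → ℝ) (x : M) :
    eul κ f x = ∑ a, x a * pd a f x + κ * f x := by
  rw [eul, fderiv_eq_sum_pd]

theorem pd_eul {f : M → ℝ} (hf : ContDiff ℝ ∞ f) (κ : ℝ) (a : Fin 4) :
    pd a (eul κ f) = eul (κ + 1) (pd a f) := by
  have h0 : eul κ f = fun x => x 0 * pd 0 f x + (x 1 * pd 1 f x + (x 2 * pd 2 f x +
      (x 3 * pd 3 f x + κ * f x))) := by
    funext x
    rw [eul_eq, Fin.sum_univ_four]
    ring
  have hs : ∀ b, ContDiff ℝ ∞ (fun x : M => x b * pd b f x) := fun b =>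
    (contDiff_coord b).mul (contDiff_pd hf b)
  have hk : ContDiff ℝ ∞ fun x => κ * f x := contDiff_const.mul hf
  rw [h0, pd_add (hs 0) ((hs 1).add ((hs 2).add ((hs 3).add hk))),
    pd_add (hs 1) ((hs 2).add ((hs 3).add hk)), pd_add (hs 2) ((hs 3).add hk), pd_add (hs 3) hk,
    pd_const_mul hf]
  simp only [pd_coord_mul (contDiff_pd hf _)]
  funext x
  rw [eul_eq, Fin.sum_univ_four, pd_comm hf a 0, pd_comm hf a 1, pd_comm hf a 2, pd_comm hf a 3]
  fin_cases a <;> simp <;> ring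

theorem boost_eul {f : M → ℝ} (hf : ContDiff ℝ ∞ f) (κ : ℝ) (i : Fin 3) :
    boost i (eul κ f) = eul κ (boost i f) := by
  funext x
  have hs : ∀ b c, ContDiff ℝ ∞ (fun x : M => x b * pd c f x) := fun b c =>
    (contDiff_coord b).mul (contDiff_pd hf c)
  have h1 : ∀ c, pd c (boost i f) = fun x => (x i.succ * pd c (pd 0 f) x +
      (if c = i.succ then 1 else 0) * pd 0 f x) + (x 0 * pd c (pd i.succ f) x +
      (if c = 0 then 1 else 0) * pd i.succ f x) := by
    intro c
    unfold boost
    rw [pd_add (hs _ _) (hs _ _), pd_coord_mul (contDiff_pd hf _), pd_coord_mul (contDiff_pd hf _)]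
  rw [boost, pd_eul hf, pd_eul hf, eul_eq, eul_eq, eul_eq]
  simp only [h1, Fin.sum_univ_four, boost]
  fin_cases i <;> simp <;> ring

theorem pds_add {f g : M → ℝ} (hf : ContDiff ℝ ∞ f) (hg : ContDiff ℝ ∞ g) (L : List (Fin 4)) :
    pds L (fun x => f x + g x) = fun x => pds L f x + pds L g x := by
  induction L generalizing f g with
  | nil => rfl
  | cons a L ih =>
    simp only [pds, pd_add hf hg]
    exact ih (contDiff_pd hf a) (contDiff_pd hg a)

theorem pds_const_mul {f : M → ℝ} (hf : ContDiff ℝ ∞ f) (c : ℝ) (L : List (Fin 4)) :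
    pds L (fun x => c * f x) = fun x => c * pds L f x := by
  induction L generalizing f with
  | nil => rfl
  | cons a L ih =>
    simp only [pds, pd_const_mul hf]
    exact ih (contDiff_pd hf a)

/-- Smooth functions with `|D^β f(x)| ≤ C (1+|x|)^{-κ-|β|}`. -/
structure Decays (κ : ℝ) (f : M → ℝ) : Prop where
  smooth : ContDiff ℝ ∞ f
  bound : ∀ L : List (Fin 4), ∃ C : ℝ, 0 ≤ C ∧
    ∀ x, |pds L f x| ≤ C * (1 + ‖x‖) ^ (-(κ + L.length))

theorem neg_add_length_cons (κ : ℝ) (a : Fin 4) (L : List (Fin 4)) :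
    -(κ + (a :: L).length) = -(κ + 1 + L.length) := by
  simp only [List.length_cons]
  push_cast
  ring

theorem one_le_one_add_norm {E : Type*} [NormedAddCommGroup E] (x : E) : 1 ≤ 1 + ‖x‖ := by
  linarith [norm_nonneg x]

namespace Decays

variable {κ : ℝ} {f g : M → ℝ}

theorem bound_zero (hf : Decays κ f) : ∃ C : ℝ, 0 ≤ C ∧ ∀ x, |f x| ≤ C * (1 + ‖x‖) ^ (-κ) := by
  obtain ⟨C, h0, h⟩ := hf.bound []
  exact ⟨C, h0, by simpa [pds] using h⟩

protected theorem pd (hf : Decays κ f) (a : Fin 4) : Decays (κ + 1) (pd a f) := by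
  refine ⟨contDiff_pd hf.smooth a, fun L => ?_⟩
  obtain ⟨C, h0, h⟩ := hf.bound (a :: L)
  refine ⟨C, h0, fun x => ?_⟩
  rw [← neg_add_length_cons κ a L]
  exact h x

theorem mono {κ' : ℝ} (hf : Decays κ f) (h : κ' ≤ κ) : Decays κ' f := by
  refine ⟨hf.smooth, fun L => ?_⟩
  obtain ⟨C, h0, hC⟩ := hf.bound L
  refine ⟨C, h0, fun x => (hC x).trans (mul_le_mul_of_nonneg_left ?_ h0)⟩
  exact Real.rpow_le_rpow_of_exponent_le (one_le_one_add_norm x) (by linarith)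

theorem add (hf : Decays κ f) (hg : Decays κ g) : Decays κ (fun x => f x + g x) := by
  refine ⟨hf.smooth.add hg.smooth, fun L => ?_⟩
  obtain ⟨C, h0, hC⟩ := hf.bound L
  obtain ⟨D, h1, hD⟩ := hg.bound L
  refine ⟨C + D, by positivity, fun x => ?_⟩
  rw [pds_add hf.smooth hg.smooth, add_mul]
  exact (abs_add_le _ _).trans (add_le_add (hC x) (hD x))

theorem const_mul (hf : Decays κ f) (c : ℝ) : Decays κ (fun x => c * f x) := by
  refine ⟨contDiff_const.mul hf.smooth, fun L => ?_⟩
  obtain ⟨C, h0, hC⟩ := hf.bound L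
  refine ⟨|c| * C, by positivity, fun x => ?_⟩
  rw [pds_const_mul hf.smooth, abs_mul, mul_assoc]
  exact mul_le_mul_of_nonneg_left (hC x) (abs_nonneg c)

theorem sub (hf : Decays κ f) (hg : Decays κ g) : Decays κ (fun x => f x - g x) := by
  simpa [sub_eq_add_neg] using hf.add (hg.const_mul (-1))

theorem coord_mul (hf : Decays (κ + 1) f) (b : Fin 4) : Decays κ (fun x => x b * f x) := by
  refine ⟨(contDiff_coord b).mul hf.smooth, fun L => ?_⟩
  induction L generalizing κ f with
  | nil =>
    obtain ⟨C, h0, hC⟩ := hf.bound_zero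
    refine ⟨C, h0, fun x => ?_⟩
    have h1 : |x b| ≤ 1 + ‖x‖ := by
      have := PiLp.norm_apply_le x b
      rw [Real.norm_eq_abs] at this
      linarith
    have hp : 0 < 1 + ‖x‖ := by linarith [one_le_one_add_norm x]
    simp only [pds, List.length_nil, Nat.cast_zero, add_zero, abs_mul]
    calc |x b| * |f x| ≤ (1 + ‖x‖) * (C * (1 + ‖x‖) ^ (-(κ + 1))) :=
          mul_le_mul h1 (hC x) (abs_nonneg _) hp.le
      _ = C * (1 + ‖x‖) ^ (-κ) := by
          rw [show -κ = -(κ + 1) + 1 by ring, Real.rpow_add_one hp.ne']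
          ring
  | cons a L ih =>
    obtain ⟨C, h0, hC⟩ := ih (hf.pd a)
    obtain ⟨D, h1, hD⟩ := hf.bound L
    refine ⟨C + D, by positivity, fun x => ?_⟩
    have hs := (contDiff_coord b).mul (contDiff_pd hf.smooth a)
    rw [neg_add_length_cons κ a L]
    simp only [pds, pd_coord_mul hf.smooth]
    rw [pds_add hs (contDiff_const.mul hf.smooth), pds_const_mul hf.smooth, add_mul]
    refine (abs_add_le _ _).trans (add_le_add ?_ ?_)
    · exact hC x
    · rw [abs_mul]
      have h2 : |(if a = b then (1 : ℝ) else 0)| ≤ 1 := by split_ifs <;> simp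
      refine (mul_le_of_le_one_left (abs_nonneg _) h2).trans (hD x)

protected theorem boost (hf : Decays κ f) (i : Fin 3) : Decays κ (boost i f) :=
  ((hf.pd 0).coord_mul i.succ).add ((hf.pd i.succ).coord_mul 0)

theorem of_hasCompactSupport (hs : ContDiff ℝ ∞ f) (hc : HasCompactSupport f) : Decays κ f := by
  refine ⟨hs, fun L => ?_⟩
  have hL : HasCompactSupport (pds L f) := by
    induction L generalizing f with
    | nil => exact hc
    | cons a L ih => exact ih (contDiff_pd hs a) (hc.fderiv_apply (𝕜 := ℝ) _)
  have hp : ∀ x : M, 0 < 1 + ‖x‖ := fun x => by linarith [one_le_one_add_norm x]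
  have hcont : Continuous fun x : M => pds L f x * (1 + ‖x‖) ^ (κ + L.length) :=
    (contDiff_pds hs L).continuous.mul ((by fun_prop : Continuous fun x : M => 1 + ‖x‖).rpow_const
      fun x => Or.inl (hp x).ne')
  obtain ⟨C, hC⟩ := hcont.bounded_above_of_compact_support hL.mul_right
  refine ⟨max C 0, le_max_right _ _, fun x => ?_⟩
  have h1 := (hC x).trans (le_max_left C 0)
  rw [Real.norm_eq_abs, abs_mul, abs_of_pos (Real.rpow_pos_of_pos (hp x) _)] at h1
  rw [Real.rpow_neg (hp x).le]
  exact (le_mul_inv_iff₀ (Real.rpow_pos_of_pos (hp x) _)).2 h1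

end Decays

theorem norm_iteratedFDeriv_pds_le {f : M → ℝ} (hf : ContDiff ℝ ∞ f) (L : List (Fin 4)) (m : ℕ)
    (x : M) : ‖iteratedFDeriv ℝ m (pds L f) x‖ ≤ ‖iteratedFDeriv ℝ (m + L.length) f x‖ := by
  induction L generalizing f with
  | nil => exact le_rfl
  | cons a L ih =>
    refine (ih (contDiff_pd hf a)).trans ?_
    let e : (M →L[ℝ] ℝ) →L[ℝ] ℝ :=
      ContinuousLinearMap.apply ℝ ℝ (EuclideanSpace.single a (1 : ℝ) : M)
    have he : ‖e‖ ≤ 1 := by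
      refine ContinuousLinearMap.opNorm_le_bound _ zero_le_one fun φ => ?_
      have := φ.le_opNorm (EuclideanSpace.single a (1 : ℝ) : M)
      simpa [e] using this
    have h1 := e.norm_iteratedFDeriv_comp_left (x := x) (N := ∞)
      (hf.fderiv_right (m := ∞) (by simp)).contDiffAt (n := m + L.length) (by exact_mod_cast le_top)
    rw [norm_iteratedFDeriv_fderiv] at h1
    exact h1.trans (mul_le_of_le_one_left (norm_nonneg _) he)

theorem contDiff_component {φ : M → M} (h : ContDiff ℝ ∞ φ) (a : Fin 4) :
    ContDiff ℝ ∞ fun x => φ x a := contDiff_euclidean.1 h a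

theorem IsTestField.decays {κ : ℝ} {φ : M → M} (h : IsTestField κ φ) (a : Fin 4) :
    Decays κ fun x => φ x a := by
  refine ⟨contDiff_component h.1 a, fun L => ?_⟩
  obtain ⟨C, hC⟩ := h.2 L.length
  refine ⟨max C 0, le_max_right _ _, fun x => ?_⟩
  have hp : 0 < 1 + ‖x‖ := by linarith [one_le_one_add_norm x]
  have h1 := norm_iteratedFDeriv_pds_le (contDiff_component h.1 a) L 0 x
  have he : ‖(EuclideanSpace.proj a : M →L[ℝ] ℝ)‖ ≤ 1 := by
    refine ContinuousLinearMap.opNorm_le_bound _ zero_le_one fun v => ?_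
    simpa using PiLp.norm_apply_le v a
  have h2 := (EuclideanSpace.proj a : M →L[ℝ] ℝ).norm_iteratedFDeriv_comp_left (x := x) (N := ∞)
    h.1.contDiffAt (n := L.length) (by exact_mod_cast le_top)
  have h3 := h2.trans (mul_le_of_le_one_left (norm_nonneg _) he)
  rw [norm_iteratedFDeriv_zero, zero_add, Real.norm_eq_abs] at h1
  rw [Real.rpow_neg hp.le]
  refine (le_mul_inv_iff₀ (Real.rpow_pos_of_pos hp _)).2 ?_
  calc _ ≤ ‖iteratedFDeriv ℝ L.length φ x‖ * (1 + ‖x‖) ^ (κ + L.length) :=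
        mul_le_mul_of_nonneg_right (h1.trans h3) (Real.rpow_pos_of_pos hp _).le
    _ ≤ C := by rw [mul_comm]; exact hC x
    _ ≤ max C 0 := le_max_left _ _

theorem dilation_component {φ : M → M} (h : ContDiff ℝ ∞ φ) (κ : ℝ) (a : Fin 4) (x : M) :
    dilation κ φ x a = eul κ (fun x => φ x a) x := by
  have h1 : HasFDerivAt (fun x => φ x a) ((EuclideanSpace.proj a : M →L[ℝ] ℝ).comp (fderiv ℝ φ x))
      x := (EuclideanSpace.proj a : M →L[ℝ] ℝ).hasFDerivAt.comp x
        ((h.differentiable (by simp)) x).hasFDerivAt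
  simp [dilation, eul, h1.fderiv]

theorem IsHomTestField.decays_eul {κ ε : ℝ} {W : Set M} {φ : M → M}
    (h : IsHomTestField κ ε W φ) (a : Fin 4) : Decays (κ + ε) (eul κ fun x => φ x a) := by
  have := h.2.2.decays a
  simpa only [dilation_component h.1] using this

theorem abs_rescale_sub_le {κ ε : ℝ} (hκ : 0 ≤ κ) (hε : 0 < ε) {f : M → ℝ} (hf : ContDiff ℝ ∞ f)
    (h : Decays (κ + ε) (eul κ f)) : ∃ C, 0 ≤ C ∧ ∀ x : M, x ≠ 0 → ∀ r R : ℝ, 0 < r → r ≤ R →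
      |R ^ κ * f (R • x) - r ^ κ * f (r • x)| ≤ C * ‖x‖ ^ (-(κ + ε)) * r ^ (-ε) := by
  obtain ⟨C, h0, hC⟩ := h.bound_zero
  refine ⟨C / ε, by positivity, fun x hx r R hr hrR => ?_⟩
  have hx' : 0 < ‖x‖ := norm_pos_iff.2 hx
  set B := C / ε * ‖x‖ ^ (-(κ + ε)) with hB
  have hB0 : 0 ≤ B := by positivity
  have hd : ∀ t : ℝ, 0 < t → HasDerivAt (fun t : ℝ => t ^ κ * f (t • x))
      (t ^ (κ - 1) * eul κ f (t • x)) t := by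
    intro t ht
    have h1 : HasDerivAt (fun t : ℝ => f (t • x)) (fderiv ℝ f (t • x) x) t := by
      have h0 := (smooth_diffAt hf (t • x)).hasFDerivAt.comp_hasDerivAt t
        ((hasDerivAt_id t).smul_const x)
      exact h0.congr_deriv (by simp)
    have h2 := (Real.hasDerivAt_rpow_const (p := κ) (Or.inl ht.ne')).mul h1
    refine h2.congr_deriv ?_
    rw [eul, map_smul, Real.rpow_sub_one ht.ne', smul_eq_mul]
    field_simp
    ring
  have hb : ∀ t : ℝ, 0 < t → HasDerivAt (fun t : ℝ => B * t ^ (-ε)) (-(B * ε * t ^ (-ε - 1))) t := by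
    intro t ht
    have := (Real.hasDerivAt_rpow_const (p := -ε) (Or.inl ht.ne')).const_mul B
    exact this.congr_deriv (by ring)
  have hle : ∀ t : ℝ, 0 < t → |t ^ (κ - 1) * eul κ f (t • x)| ≤ B * ε * t ^ (-ε - 1) := by
    intro t ht
    rw [abs_mul, abs_of_pos (Real.rpow_pos_of_pos ht _)]
    have h1 : (1 + ‖t • x‖) ^ (-(κ + ε)) ≤ (t * ‖x‖) ^ (-(κ + ε)) := by
      refine Real.rpow_le_rpow_of_nonpos (by positivity) ?_ (by linarith)
      rw [norm_smul, Real.norm_eq_abs, abs_of_pos ht]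
      linarith
    calc t ^ (κ - 1) * |eul κ f (t • x)|
        ≤ t ^ (κ - 1) * (C * (t * ‖x‖) ^ (-(κ + ε))) := by
          gcongr
          exact (hC _).trans (mul_le_mul_of_nonneg_left h1 h0)
      _ = B * ε * t ^ (-ε - 1) := by
          rw [Real.mul_rpow ht.le hx'.le, hB, show -ε - 1 = (κ - 1) + (-(κ + ε)) by ring,
            Real.rpow_add ht]
          field_simp
  have hmono : ∀ σ : ℝ, |σ| ≤ 1 → AntitoneOn
      (fun t : ℝ => σ * (t ^ κ * f (t • x)) + B * t ^ (-ε)) (Ioi 0) := by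
    intro σ hσ
    refine antitoneOn_of_deriv_nonpos (convex_Ioi 0) ?_ ?_ ?_
    · exact fun t ht => (((hd t ht).const_mul σ).add (hb t ht)).continuousAt.continuousWithinAt
    · rw [interior_Ioi]
      exact fun t ht => (((hd t ht).const_mul σ).add
        (hb t ht)).differentiableAt.differentiableWithinAt
    · rw [interior_Ioi]
      intro t ht
      have e : deriv (fun t : ℝ => σ * (t ^ κ * f (t • x)) + B * t ^ (-ε)) t = _ :=
        (((hd t ht).const_mul σ).add (hb t ht)).deriv
      rw [e]
      have h2 : σ * (t ^ (κ - 1) * eul κ f (t • x)) ≤ B * ε * t ^ (-ε - 1) := by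
        refine (le_abs_self _).trans ?_
        rw [abs_mul]
        exact (mul_le_of_le_one_left (abs_nonneg _) hσ).trans (hle t ht)
      linarith
  have hR : 0 < R := hr.trans_le hrR
  have h1 := hmono 1 (by simp) hr hR hrR
  have h2 := hmono (-1) (by simp) hr hR hrR
  have h3 : 0 ≤ B * R ^ (-ε) := by positivity
  simp only at h1 h2
  rw [abs_le]
  constructor <;> linarith

/-- A smooth function which is asymptotically homogeneous of degree `-κ` belongs to `𝒮_κ`. -/
theorem Decays.of_eul {κ ε : ℝ} (hκ : 0 ≤ κ) (hε : 0 < ε) {f : M → ℝ} (hf : ContDiff ℝ ∞ f)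
    (h : Decays (κ + ε) (eul κ f)) : Decays κ f := by
  have key : ∀ (κ : ℝ) (f : M → ℝ), 0 ≤ κ → ContDiff ℝ ∞ f →
      Decays (κ + ε) (eul κ f) →
      ∃ C : ℝ, 0 ≤ C ∧ ∀ x, |f x| ≤ C * (1 + ‖x‖) ^ (-κ) := by
    intro κ f hκ hf h
    obtain ⟨C, h0, hC⟩ := abs_rescale_sub_le hκ hε hf h
    obtain ⟨D, hD⟩ := (isCompact_closedBall (0 : M) 1).exists_bound_of_continuousOn
      hf.continuous.continuousOn
    have hD0 : 0 ≤ D := (norm_nonneg _).trans (hD 0 (by simp))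
    refine ⟨(D + C) * 2 ^ κ, by positivity, fun x => ?_⟩
    have hp : 0 < 1 + ‖x‖ := by linarith [one_le_one_add_norm x]
    rw [Real.rpow_neg hp.le, le_mul_inv_iff₀ (by positivity)]
    by_cases hx : ‖x‖ ≤ 1
    · have h1 := hD x (by simpa using hx)
      rw [Real.norm_eq_abs] at h1
      have h2 : (1 + ‖x‖) ^ κ ≤ 2 ^ κ := Real.rpow_le_rpow hp.le (by linarith) hκ
      exact mul_le_mul (by linarith) h2 (by positivity) (by positivity)
    · push Not at hx
      have hx0 : 0 < ‖x‖ := by linarith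
      have hne : x ≠ 0 := norm_pos_iff.1 hx0
      let u : M := ‖x‖⁻¹ • x
      have hu : ‖u‖ = 1 := by simp [u, norm_smul, hx0.ne']
      have h1 := hC u (by rw [← norm_pos_iff, hu]; exact one_pos) 1 ‖x‖ one_pos hx.le
      have h2 : ‖x‖ • u = x := by simp [u, smul_smul, hx0.ne']
      have h3 := hD u (by simp [hu])
      rw [Real.norm_eq_abs] at h3
      simp only [h2, hu, Real.one_rpow, one_mul, mul_one, one_smul] at h1
      have h4 : ‖x‖ ^ κ * |f x| ≤ D + C := by
        have h5 : ‖x‖ ^ κ * |f x| = |‖x‖ ^ κ * f x| := by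
          rw [abs_mul, abs_of_pos (Real.rpow_pos_of_pos hx0 _)]
        rw [h5]
        have h7 := abs_sub_abs_le_abs_sub (‖x‖ ^ κ * f x) (f u)
        linarith
      have h6 : (1 + ‖x‖) ^ κ ≤ 2 ^ κ * ‖x‖ ^ κ := by
        rw [← Real.mul_rpow (by norm_num) hx0.le]
        exact Real.rpow_le_rpow hp.le (by linarith) hκ
      calc |f x| * (1 + ‖x‖) ^ κ ≤ |f x| * (2 ^ κ * ‖x‖ ^ κ) := by gcongr
        _ = (‖x‖ ^ κ * |f x|) * 2 ^ κ := by ring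
        _ ≤ (D + C) * 2 ^ κ := by gcongr
  have all : ∀ (L : List (Fin 4)) (κ : ℝ) (f : M → ℝ), 0 ≤ κ → ContDiff ℝ ∞ f →
      Decays (κ + ε) (eul κ f) →
      ∃ C : ℝ, 0 ≤ C ∧ ∀ x, |pds L f x| ≤ C * (1 + ‖x‖) ^ (-(κ + L.length)) := by
    intro L
    induction L with
    | nil =>
      intro κ f hκ hf h
      simpa [pds] using key κ f hκ hf h
    | cons a L ih =>
      intro κ f hκ hf h
      have h1 : Decays (κ + 1 + ε) (eul (κ + 1) (pd a f)) := by
        rw [← pd_eul hf]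
        exact (by ring : κ + ε + 1 = κ + 1 + ε) ▸ h.pd a
      obtain ⟨C, h0, hC⟩ := ih (κ + 1) (pd a f) (by linarith) (contDiff_pd hf a) h1
      refine ⟨C, h0, fun x => ?_⟩
      rw [neg_add_length_cons κ a L]
      exact hC x
  exact ⟨hf, fun L => all L κ f hκ hf h⟩

/-! ### Integrals over null hyperplanes -/

@[simp] theorem mkVec_zero (t : ℝ) (y : E3) : mkVec t y 0 = t := by simp [mkVec]

@[simp] theorem mkVec_succ (t : ℝ) (y : E3) (i : Fin 3) : mkVec t y i.succ = y i := by
  fin_cases i <;> simp [mkVec]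

@[simp] theorem spatial_apply (x : M) (i : Fin 3) : spatial x i = x i.succ := by
  fin_cases i <;> simp [spatial]

@[simp] theorem spatial_mkVec (t : ℝ) (y : E3) : spatial (mkVec t y) = y := by
  ext i
  simp

@[simp] theorem mkVec_spatial (x : M) : mkVec (x 0) (spatial x) = x := by
  ext a
  refine Fin.cases ?_ (fun i => ?_) a <;> simp

/-- `(t, y) ↦ mkVec t y` as a continuous linear map. -/
def mkVecL : ℝ × E3 →L[ℝ] M := LinearMap.toContinuousLinearMap
  { toFun := fun p => mkVec p.1 p.2
    map_add' := fun p q => by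
      ext a
      refine Fin.cases ?_ (fun i => ?_) a <;> simp
    map_smul' := fun c p => by
      ext a
      refine Fin.cases ?_ (fun i => ?_) a <;> simp }

@[simp] theorem mkVecL_apply (p : ℝ × E3) : mkVecL p = mkVec p.1 p.2 := rfl

/-- `x ↦ spatial x` as a continuous linear map. -/
def spatialL : M →L[ℝ] E3 := LinearMap.toContinuousLinearMap
  { toFun := spatial
    map_add' := fun p q => by ext i; simp
    map_smul' := fun c p => by ext i; simp }

@[simp] theorem spatialL_apply (x : M) : spatialL x = spatial x := rfl

theorem continuous_mkVec : Continuous fun p : ℝ × E3 => mkVec p.1 p.2 := mkVecL.continuous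

theorem norm_mkVec_sq (t : ℝ) (y : E3) : ‖mkVec t y‖ ^ 2 = t ^ 2 + ‖y‖ ^ 2 := by
  rw [EuclideanSpace.real_norm_sq_eq, EuclideanSpace.real_norm_sq_eq, Fin.sum_univ_succ]
  simp

theorem norm_le_norm_mkVec (t : ℝ) (y : E3) : ‖y‖ ≤ ‖mkVec t y‖ := by
  refine (sq_le_sq₀ (norm_nonneg _) (norm_nonneg _)).1 ?_
  rw [norm_mkVec_sq]
  nlinarith

theorem abs_le_norm_mkVec (t : ℝ) (y : E3) : |t| ≤ ‖mkVec t y‖ := by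
  refine (sq_le_sq₀ (abs_nonneg _) (norm_nonneg _)).1 ?_
  rw [norm_mkVec_sq, sq_abs]
  nlinarith [sq_nonneg ‖y‖]

theorem norm_mkVec_le (t : ℝ) (y : E3) : ‖mkVec t y‖ ≤ |t| + ‖y‖ := by
  refine (sq_le_sq₀ (norm_nonneg _) (by positivity)).1 ?_
  rw [norm_mkVec_sq]
  nlinarith [sq_abs t, abs_nonneg t, norm_nonneg y, mul_nonneg (abs_nonneg t) (norm_nonneg y)]

theorem hasFDerivAt_pd {f : M → ℝ} (hf : ContDiff ℝ ∞ f) {E : Type*} [NormedAddCommGroup E]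
    [NormedSpace ℝ E] {g : E → M} {g' : E →L[ℝ] M} {p : E} (hg : HasFDerivAt g g' p) :
    HasFDerivAt (fun q => f (g q)) ((fderiv ℝ f (g p)).comp g') p :=
  (smooth_diffAt hf (g p)).hasFDerivAt.comp p hg

theorem fderiv_mkVec (f : M → ℝ) (x : M) (t : ℝ) (y : E3) :
    fderiv ℝ f x (mkVec t y) = t * pd 0 f x + ∑ i : Fin 3, y i * pd i.succ f x := by
  rw [fderiv_eq_sum_pd, Fin.sum_univ_succ]
  simp

/-- The point of the hyperplane `x·l = s`, `l = (|x|, x)`, with space part `y`. -/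
def planePt (s : ℝ) (x y : E3) : M := mkVec ((s + inner ℝ x y) / ‖x‖) y

/-- The integral of a scalar function over the null hyperplane `x·l = s`, `l = (|x|, x)`. -/
def nullInt (f : M → ℝ) (s : ℝ) (x : E3) : ℝ := ‖x‖⁻¹ * ∫ y : E3, f (planePt s x y)

theorem norm_le_planePt (s : ℝ) (x y : E3) : ‖y‖ ≤ ‖planePt s x y‖ := norm_le_norm_mkVec _ _

theorem continuous_planePt (s : ℝ) (x : E3) : Continuous fun y => planePt s x y :=
  continuous_mkVec.comp (f := fun y => ((s + inner ℝ x y) / ‖x‖, y)) (by fun_prop)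

theorem rpow_neg_le_of_le {κ a b : ℝ} (hκ : 0 ≤ κ) (ha : 0 < a) (hab : a ≤ b) :
    b ^ (-κ) ≤ a ^ (-κ) :=
  Real.rpow_le_rpow_of_nonpos ha hab (by linarith)

theorem integrable_one_add_norm_E3 {κ : ℝ} (hκ : 3 < κ) :
    Integrable fun y : E3 => (1 + ‖y‖) ^ (-κ) :=
  integrable_one_add_norm (by simpa using hκ)

theorem Decays.planePt_bound {κ : ℝ} (hκ : 0 ≤ κ) {f : M → ℝ} (hf : Decays κ f) :
    ∃ C, 0 ≤ C ∧ ∀ s x y, |f (planePt s x y)| ≤ C * (1 + ‖y‖) ^ (-κ) := by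
  obtain ⟨C, h0, hC⟩ := hf.bound_zero
  refine ⟨C, h0, fun s x y => (hC _).trans (mul_le_mul_of_nonneg_left ?_ h0)⟩
  exact rpow_neg_le_of_le hκ (by linarith [one_le_one_add_norm y])
    (by linarith [norm_le_planePt s x y])

theorem Decays.integrable_planePt {κ : ℝ} (hκ : 3 < κ) {f : M → ℝ} (hf : Decays κ f) (s : ℝ)
    (x : E3) : Integrable fun y => f (planePt s x y) := by
  obtain ⟨C, h0, hC⟩ := hf.planePt_bound (by linarith)
  exact ((integrable_one_add_norm_E3 hκ).const_mul C).mono'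
    (hf.smooth.continuous.comp (continuous_planePt s x)).aestronglyMeasurable
    (Eventually.of_forall fun y => hC s x y)

theorem nullInt_add {κ : ℝ} (hκ : 3 < κ) {f g : M → ℝ} (hf : Decays κ f) (hg : Decays κ g)
    (s : ℝ) (x : E3) : nullInt (fun z => f z + g z) s x = nullInt f s x + nullInt g s x := by
  simp only [nullInt]
  rw [integral_add (hf.integrable_planePt hκ s x) (hg.integrable_planePt hκ s x)]
  ring

theorem nullInt_const_mul (f : M → ℝ) (c s : ℝ) (x : E3) :
    nullInt (fun z => c * f z) s x = c * nullInt f s x := by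
  simp only [nullInt, integral_const_mul]
  ring

theorem nullInt_sub {κ : ℝ} (hκ : 3 < κ) {f g : M → ℝ} (hf : Decays κ f) (hg : Decays κ g)
    (s : ℝ) (x : E3) : nullInt (fun z => f z - g z) s x = nullInt f s x - nullInt g s x := by
  simp only [nullInt]
  rw [integral_sub (hf.integrable_planePt hκ s x) (hg.integrable_planePt hκ s x)]
  ring

theorem nullInt_smul (f : M → ℝ) {μ : ℝ} (hμ : 0 < μ) (s : ℝ) (x : E3) :
    nullInt f (μ * s) (μ • x) = μ⁻¹ * nullInt f s x := by
  have h : ∀ y, planePt (μ * s) (μ • x) y = planePt s x y := by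
    intro y
    simp only [planePt, norm_smul, inner_smul_left, Real.norm_eq_abs, abs_of_pos hμ, conj_trivial]
    rw [← mul_add, mul_div_mul_left _ _ hμ.ne']
  simp only [nullInt, h, norm_smul, Real.norm_eq_abs, abs_of_pos hμ, mul_inv]
  ring

/-- Integration by parts in null hyperplanes. -/
theorem integral_planePt_partial {κ : ℝ} (hκ : 2 < κ) {g : M → ℝ} (hg : Decays κ g) (s : ℝ)
    (x : E3) (i : Fin 3) :
    ∫ y, (x i / ‖x‖ * pd 0 g (planePt s x y) + pd i.succ g (planePt s x y)) = 0 := by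
  obtain ⟨C, h0, hC⟩ := hg.planePt_bound (by linarith)
  refine integral_partial_eq_zero i (G := fun y => g (planePt s x y)) (fun y _ => ?_) ?_ ?_
  · have h1 : HasDerivAt (fun t : ℝ => planePt s x (y + t • EuclideanSpace.single i 1))
        (mkVec (x i / ‖x‖) (EuclideanSpace.single i 1)) 0 := by
      have h2 : HasDerivAt (fun t : ℝ => ((s + inner ℝ x y) / ‖x‖ + t * (x i / ‖x‖),
          y + t • (EuclideanSpace.single i 1 : E3)))
          (1 * (x i / ‖x‖), (1 : ℝ) • (EuclideanSpace.single i 1 : E3)) 0 :=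
        (((hasDerivAt_id (0 : ℝ)).mul_const (x i / ‖x‖)).const_add _).prodMk
          (((hasDerivAt_id (0 : ℝ)).smul_const (EuclideanSpace.single i 1 : E3)).const_add y)
      have h3 := mkVecL.hasFDerivAt.comp_hasDerivAt (0 : ℝ) h2
      simp only [mkVecL_apply, one_mul, one_smul] at h3
      refine h3.congr_of_eventuallyEq (Eventually.of_forall fun t => ?_)
      simp only [planePt, Function.comp, mkVecL_apply, inner_add_right, inner_smul_right]
      congr 1
      rw [EuclideanSpace.inner_single_right]
      simp
      ring
    have h4 := (smooth_diffAt hg.smooth (planePt s x (y + (0 : ℝ) • EuclideanSpace.single i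
      1))).hasFDerivAt.comp_hasDerivAt (0 : ℝ) h1
    refine h4.congr_deriv ?_
    rw [fderiv_mkVec]
    simp
  · exact (((hg.pd 0).integrable_planePt (by linarith) s x).const_mul _).add
      ((hg.pd i.succ).integrable_planePt (by linarith) s x)
  · rw [← Metric.cobounded_eq_cocompact]
    refine squeeze_zero_norm (fun y => hC s x y) ?_
    rw [← mul_zero C]
    refine Tendsto.const_mul C ((tendsto_rpow_neg_atTop (by linarith)).comp ?_)
    exact tendsto_atTop_add_const_left _ _ tendsto_norm_cobounded_atTop

theorem nullInt_pd_succ {κ : ℝ} (hκ : 2 < κ) {f : M → ℝ} (hf : Decays κ f) (s : ℝ)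
    (x : E3) (i : Fin 3) :
    nullInt (pd i.succ f) s x = -(x i / ‖x‖ * nullInt (pd 0 f) s x) := by
  have h := integral_planePt_partial hκ hf s x i
  rw [integral_add (((hf.pd 0).integrable_planePt (by linarith) s x).const_mul _)
    ((hf.pd i.succ).integrable_planePt (by linarith) s x), integral_const_mul] at h
  simp only [nullInt]
  linear_combination ‖x‖⁻¹ * h

/-- The derivative of the time component of `planePt`. -/
def planeDeriv (p : ℝ × E3) (y : E3) : ℝ × E3 →L[ℝ] ℝ :=
  ‖p.2‖⁻¹ • (ContinuousLinearMap.fst ℝ ℝ E3 + (innerSL ℝ y).comp (ContinuousLinearMap.snd ℝ ℝ E3))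
    - ((p.1 + inner ℝ p.2 y) / ‖p.2‖ ^ 3) • (innerSL ℝ p.2).comp (ContinuousLinearMap.snd ℝ ℝ E3)

theorem hasFDerivAt_norm_E3 {x : E3} (hx : x ≠ 0) :
    HasFDerivAt (fun x : E3 => ‖x‖) (‖x‖⁻¹ • innerSL ℝ x) x := by
  have h1 := ((contDiffAt_norm ℝ hx).differentiableAt (n := 1) (by simp)).hasFDerivAt
  have g1 : HasFDerivAt (fun y : E3 => ‖y‖ ^ 2) (2 • innerSL ℝ x) x :=
    (hasStrictFDerivAt_norm_sq _).hasFDerivAt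
  have g2 := h1.pow 2
  refine h1.congr_fderiv ?_
  have hx' := norm_ne_zero_iff.2 hx
  ext v
  have := congrArg (fun L : E3 →L[ℝ] ℝ => L v) (g1.unique g2)
  simp at this ⊢
  field_simp
  linarith

theorem hasDerivAt_line (i : Fin 3) (y : E3) :
    HasDerivAt (fun t : ℝ => y + t • (EuclideanSpace.single i 1 : E3)) (EuclideanSpace.single i 1)
      0 := by
  simpa using ((hasDerivAt_id (0 : ℝ)).smul_const (EuclideanSpace.single i 1 : E3)).const_add y

theorem hasDerivAt_norm_line (i : Fin 3) {y : E3} (hy : y ≠ 0) :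
    HasDerivAt (fun t : ℝ => ‖y + t • (EuclideanSpace.single i 1 : E3)‖) (‖y‖⁻¹ * y i) 0 := by
  have h2 : HasFDerivAt (fun x : E3 => ‖x‖) (‖y‖⁻¹ • innerSL ℝ y)
    (y + (0 : ℝ) • (EuclideanSpace.single i 1 : E3)) := by simpa using hasFDerivAt_norm_E3 hy
  refine (h2.comp_hasDerivAt (0 : ℝ) (hasDerivAt_line i y)).congr_deriv ?_
  simp [EuclideanSpace.inner_single_right]

theorem hasFDerivAt_planeTime {p : ℝ × E3} (hp : p.2 ≠ 0) (y : E3) :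
    HasFDerivAt (fun p : ℝ × E3 => (p.1 + inner ℝ p.2 y) / ‖p.2‖) (planeDeriv p y) p := by
  have hx' := norm_ne_zero_iff.2 hp
  have h1 : HasFDerivAt (fun p : ℝ × E3 => p.1 + inner ℝ p.2 y)
      (ContinuousLinearMap.fst ℝ ℝ E3 + (innerSL ℝ y).comp (ContinuousLinearMap.snd ℝ ℝ E3)) p := by
    have := (ContinuousLinearMap.fst ℝ ℝ E3 + (innerSL ℝ y).comp
      (ContinuousLinearMap.snd ℝ ℝ E3)).hasFDerivAt (x := p)
    refine this.congr_of_eventuallyEq (Eventually.of_forall fun q => ?_)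
    simp [real_inner_comm]
  have h2 := (hasFDerivAt_norm_E3 hp).comp p (ContinuousLinearMap.snd ℝ ℝ E3).hasFDerivAt
  have h3 := h1.mul ((hasDerivAt_inv (x := ‖p.2‖) hx').comp_hasFDerivAt p h2)
  have h4 : HasFDerivAt (fun p : ℝ × E3 => (p.1 + inner ℝ p.2 y) / ‖p.2‖) _ p := h3
  refine h4.congr_fderiv ?_
  refine ContinuousLinearMap.ext fun v => ?_
  simp [planeDeriv]
  field_simp
  ring

theorem norm_planeDeriv_le {p : ℝ × E3} (hp : p.2 ≠ 0) (y : E3) :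
    ‖planeDeriv p y‖ ≤ ‖p.2‖⁻¹ * (1 + ‖y‖) + (|p.1| * ‖p.2‖⁻¹ ^ 2 + ‖p.2‖⁻¹ * ‖y‖) := by
  have hx' : 0 < ‖p.2‖ := norm_pos_iff.2 hp
  have hf : ‖ContinuousLinearMap.fst ℝ ℝ E3‖ ≤ 1 := ContinuousLinearMap.norm_fst_le ..
  have hs : ‖ContinuousLinearMap.snd ℝ ℝ E3‖ ≤ 1 := ContinuousLinearMap.norm_snd_le ..
  have hi : ∀ z : E3, ‖(innerSL ℝ z).comp (ContinuousLinearMap.snd ℝ ℝ E3)‖ ≤ ‖z‖ := by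
    intro z
    refine (ContinuousLinearMap.opNorm_comp_le _ _).trans ?_
    rw [innerSL_apply_norm]
    exact mul_le_of_le_one_right (norm_nonneg _) hs
  refine (norm_sub_le _ _).trans (add_le_add ?_ ?_)
  · rw [norm_smul, norm_inv, norm_norm]
    exact mul_le_mul_of_nonneg_left ((norm_add_le _ _).trans (add_le_add hf (hi y)))
      (inv_nonneg.2 hx'.le)
  · rw [norm_smul, norm_div, norm_pow, norm_norm, Real.norm_eq_abs]
    have h1 : |p.1 + inner ℝ p.2 y| ≤ |p.1| + ‖p.2‖ * ‖y‖ :=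
      (abs_add_le _ _).trans (add_le_add le_rfl (abs_real_inner_le_norm _ _))
    calc |p.1 + inner ℝ p.2 y| / ‖p.2‖ ^ 3 *
          ‖(innerSL ℝ p.2).comp (ContinuousLinearMap.snd ℝ ℝ E3)‖
        ≤ (|p.1| + ‖p.2‖ * ‖y‖) / ‖p.2‖ ^ 3 * ‖p.2‖ := by
          gcongr
          exact hi p.2
      _ = |p.1| * ‖p.2‖⁻¹ ^ 2 + ‖p.2‖⁻¹ * ‖y‖ := by
          field_simp

theorem hasFDerivAt_integral_planePt {κ : ℝ} (hκ : 3 < κ) {f : M → ℝ} (hf : Decays κ f)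
    {p : ℝ × E3} (hp : p.2 ≠ 0) :
    HasFDerivAt (fun p : ℝ × E3 => ∫ y, f (planePt p.1 p.2 y))
      (∫ y, pd 0 f (planePt p.1 p.2 y) • planeDeriv p y) p ∧
    Integrable (fun y => pd 0 f (planePt p.1 p.2 y) • planeDeriv p y) := by
  have hx' : 0 < ‖p.2‖ := norm_pos_iff.2 hp
  set a := ‖p.2‖ / 2 with ha
  have ha0 : 0 < a := by positivity
  set K := 2 * a⁻¹ + (|p.1| + 1) * a⁻¹ ^ 2 with hK
  have hK0 : 0 ≤ K := by positivity
  obtain ⟨C, h0, hC⟩ := (hf.pd 0).planePt_bound (by linarith)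
  let s : Set (ℝ × E3) := {q | a < ‖q.2‖ ∧ |q.1| < |p.1| + 1}
  have hs : s ∈ 𝓝 p := by
    have ho : IsOpen s := (isOpen_lt continuous_const (continuous_norm.comp continuous_snd)).inter
      (isOpen_lt (continuous_abs.comp continuous_fst) continuous_const)
    refine ho.mem_nhds ⟨?_, ?_⟩
    · linarith [ha, hx']
    · linarith
  have hbound : ∀ y, ∀ q ∈ s, ‖pd 0 f (planePt q.1 q.2 y) • planeDeriv q y‖
      ≤ C * K * (1 + ‖y‖) ^ (-κ) := by
    intro y q hq
    have hq0 : q.2 ≠ 0 := norm_pos_iff.1 (ha0.trans hq.1)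
    have h1 : ‖q.2‖⁻¹ ≤ a⁻¹ := inv_anti₀ ha0 hq.1.le
    have h2 : ‖planeDeriv q y‖ ≤ K * (1 + ‖y‖) := by
      refine (norm_planeDeriv_le hq0 y).trans ?_
      have h3 : |q.1| * ‖q.2‖⁻¹ ^ 2 ≤ (|p.1| + 1) * a⁻¹ ^ 2 := by
        gcongr
        exact hq.2.le
      have h4 : ‖q.2‖⁻¹ * (1 + ‖y‖) ≤ a⁻¹ * (1 + ‖y‖) := by gcongr
      have h5 : ‖q.2‖⁻¹ * ‖y‖ ≤ a⁻¹ * ‖y‖ := by gcongr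
      have h6 : 0 ≤ (|p.1| + 1) * a⁻¹ ^ 2 * ‖y‖ := by positivity
      have h7 : 0 < a⁻¹ := by positivity
      rw [hK]
      linarith
    have hy : 0 < 1 + ‖y‖ := by linarith [one_le_one_add_norm y]
    rw [norm_smul, Real.norm_eq_abs]
    calc _ ≤ (C * (1 + ‖y‖) ^ (-(κ + 1))) * (K * (1 + ‖y‖)) :=
          mul_le_mul (hC _ _ _) h2 (norm_nonneg _) (by positivity)
      _ = _ := by
          rw [show -κ = -(κ + 1) + 1 by ring, Real.rpow_add_one hy.ne']
          ring
  have hmeas : AEStronglyMeasurable (fun y => pd 0 f (planePt p.1 p.2 y) • planeDeriv p y)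
      volume := by
    refine Continuous.aestronglyMeasurable ?_
    refine ((hf.pd 0).smooth.continuous.comp (continuous_planePt p.1 p.2)).smul ?_
    unfold planeDeriv
    fun_prop
  have hint : Integrable fun y : E3 => C * K * (1 + ‖y‖) ^ (-κ) :=
    (integrable_one_add_norm_E3 hκ).const_mul _
  refine ⟨hasFDerivAt_integral_of_dominated_of_fderiv_le (𝕜 := ℝ) hs
    (F := fun p y => f (planePt p.1 p.2 y))
    (F' := fun p y => pd 0 f (planePt p.1 p.2 y) • planeDeriv p y)
    (bound := fun y => C * K * (1 + ‖y‖) ^ (-κ)) ?_ ?_ ?_ ?_ ?_ ?_, ?_⟩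
  · exact Eventually.of_forall fun q => (hf.integrable_planePt hκ q.1 q.2).aestronglyMeasurable
  · exact hf.integrable_planePt hκ p.1 p.2
  · exact hmeas
  · exact Eventually.of_forall fun y q hq => hbound y q hq
  · exact hint
  · refine Eventually.of_forall fun y q hq => ?_
    have hq0 : q.2 ≠ 0 := norm_pos_iff.1 (ha0.trans hq.1)
    have h1 := mkVecL.hasFDerivAt.comp q
      ((hasFDerivAt_planeTime hq0 y).prodMk (hasFDerivAt_const y q))
    have h2 := hasFDerivAt_pd hf.smooth h1
    refine HasFDerivAt.congr_fderiv h2 ?_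
    refine ContinuousLinearMap.ext fun v => ?_
    simp [fderiv_mkVec, planePt]
    ring
  · exact hint.mono' hmeas (Eventually.of_forall fun y => hbound y p (mem_of_mem_nhds hs))

/-- The derivative of `nullInt`, in terms of `∂_0` and of the generators of boosts. -/
theorem hasFDerivAt_nullInt {κ : ℝ} (hκ : 3 < κ) {f : M → ℝ} (hf : Decays κ f)
    {p : ℝ × E3} (hp : p.2 ≠ 0) :
    HasFDerivAt (fun p : ℝ × E3 => nullInt f p.1 p.2)
      ((‖p.2‖⁻¹ * nullInt (pd 0 f) p.1 p.2) • ContinuousLinearMap.fst ℝ ℝ E3 +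
        ∑ i : Fin 3, (‖p.2‖⁻¹ * nullInt (boost i f) p.1 p.2) •
          (EuclideanSpace.proj i : E3 →L[ℝ] ℝ).comp (ContinuousLinearMap.snd ℝ ℝ E3)) p := by
  have hx' : 0 < ‖p.2‖ := norm_pos_iff.2 hp
  obtain ⟨h1, hI⟩ := hasFDerivAt_integral_planePt hκ hf hp
  have h2 := (hasFDerivAt_norm_E3 hp).comp p (ContinuousLinearMap.snd ℝ ℝ E3).hasFDerivAt
  have h3 := ((hasDerivAt_inv (x := ‖p.2‖) hx'.ne').comp_hasFDerivAt p h2).mul h1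
  have h4 : HasFDerivAt (fun p : ℝ × E3 => nullInt f p.1 p.2) _ p := h3
  refine h4.congr_fderiv ?_
  have hin : ∀ (z : E3) (i : Fin 3), inner ℝ z (EuclideanSpace.single i 1) = z i := by
    intro z i
    rw [EuclideanSpace.inner_single_right]
    simp
  have hb : ∀ i : Fin 3, (∫ y, pd 0 f (planePt p.1 p.2 y) • planeDeriv p y)
      (0, EuclideanSpace.single i 1) = p.2 i * ‖p.2‖⁻¹ ^ 2 * (∫ y, f (planePt p.1 p.2 y))
        + ‖p.2‖⁻¹ * ∫ y, boost i f (planePt p.1 p.2 y) := by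
    intro i
    have hg : Decays (κ - 1) fun x => x 0 * f x :=
      Decays.coord_mul (by simpa using hf) 0
    have h5 := integral_planePt_partial (by linarith) hg p.1 p.2 i
    rw [ContinuousLinearMap.integral_apply hI]
    have h6 : ∀ y, (pd 0 f (planePt p.1 p.2 y) • planeDeriv p y) (0, EuclideanSpace.single i 1)
        = p.2 i * ‖p.2‖⁻¹ ^ 2 * f (planePt p.1 p.2 y)
        + ‖p.2‖⁻¹ * boost i f (planePt p.1 p.2 y)
        - ‖p.2‖⁻¹ * (p.2 i / ‖p.2‖ * pd 0 (fun x => x 0 * f x) (planePt p.1 p.2 y)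
          + pd i.succ (fun x => x 0 * f x) (planePt p.1 p.2 y)) := by
      intro y
      rw [pd_coord_mul hf.smooth, pd_coord_mul hf.smooth]
      simp only [planeDeriv, boost, planePt]
      simp [hin]
      field_simp
      ring
    simp only [h6]
    have i1 := (hf.integrable_planePt hκ p.1 p.2).const_mul (p.2 i * ‖p.2‖⁻¹ ^ 2)
    have i2 := ((hf.boost i).integrable_planePt hκ p.1 p.2).const_mul ‖p.2‖⁻¹
    have i3 : Integrable fun y => ‖p.2‖⁻¹ * (p.2 i / ‖p.2‖ * pd 0 (fun x => x 0 * f x)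
        (planePt p.1 p.2 y) + pd i.succ (fun x => x 0 * f x) (planePt p.1 p.2 y)) := ((((hg.pd 0).integrable_planePt (by linarith) p.1 p.2).const_mul
      (p.2 i / ‖p.2‖)).add ((hg.pd i.succ).integrable_planePt (by linarith) p.1 p.2)).const_mul
      ‖p.2‖⁻¹
    have i12 : Integrable fun y => p.2 i * ‖p.2‖⁻¹ ^ 2 * f (planePt p.1 p.2 y)
        + ‖p.2‖⁻¹ * boost i f (planePt p.1 p.2 y) := i1.add i2
    rw [integral_sub i12 i3, integral_add i1 i2, integral_const_mul, integral_const_mul,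
      integral_const_mul, h5]
    ring
  have ha : (∫ y, pd 0 f (planePt p.1 p.2 y) • planeDeriv p y) (1, 0)
      = ‖p.2‖⁻¹ * ∫ y, pd 0 f (planePt p.1 p.2 y) := by
    rw [ContinuousLinearMap.integral_apply hI, ← integral_const_mul]
    congr 1
    funext y
    simp [planeDeriv]
    ring
  refine ContinuousLinearMap.ext fun v => ?_
  have hv : v = v.1 • ((1 : ℝ), (0 : E3)) + ∑ i, v.2 i • ((0 : ℝ), EuclideanSpace.single i 1) := by
    refine Prod.ext ?_ ?_
    · simp [Prod.fst_sum]
    · ext k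
      simp [Prod.snd_sum, Pi.single_apply]
  rw [hv]
  simp only [map_add, map_smul, map_sum]
  congr 1
  · simp [ha, nullInt]
  · refine Finset.sum_congr rfl fun i _ => ?_
    congr 1
    simp only [_root_.add_apply, _root_.smul_apply, hb i, nullInt]
    simp [hin]
    generalize (∫ y, boost i f (planePt p.1 p.2 y)) = I1
    generalize (∫ y, f (planePt p.1 p.2 y)) = I2
    field_simp
    ring

theorem isOpen_snd_ne : IsOpen {p : ℝ × E3 | p.2 ≠ 0} :=
  isOpen_ne.preimage continuous_snd

theorem contDiffOn_norm_inv_snd : ContDiffOn ℝ ∞ (fun p : ℝ × E3 => ‖p.2‖⁻¹) {p | p.2 ≠ 0} :=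
  fun p hp => ((contDiffAt_snd.norm ℝ hp).inv (norm_ne_zero_iff.2 hp)).contDiffWithinAt

theorem contDiffOn_nullInt {κ : ℝ} (hκ : 3 < κ) {f : M → ℝ} (hf : Decays κ f) :
    ContDiffOn ℝ ∞ (fun p : ℝ × E3 => nullInt f p.1 p.2) {p | p.2 ≠ 0} := by
  refine contDiffOn_of_closed isOpen_snd_ne
    (fun F => ∃ f, Decays κ f ∧ F = fun p : ℝ × E3 => nullInt f p.1 p.2) ?_ ⟨f, hf, rfl⟩
  rintro F ⟨f, hf, rfl⟩
  refine ⟨4, Fin.cons (fun p : ℝ × E3 => ‖p.2‖⁻¹ • ContinuousLinearMap.fst ℝ ℝ E3)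
    (fun i p => ‖p.2‖⁻¹ • (EuclideanSpace.proj i : E3 →L[ℝ] ℝ).comp
      (ContinuousLinearMap.snd ℝ ℝ E3)),
    Fin.cons (fun p => nullInt (pd 0 f) p.1 p.2) (fun i p => nullInt (boost i f) p.1 p.2),
    ?_, ?_, ?_⟩
  · refine Fin.cases ?_ fun i => ?_
    · exact contDiffOn_norm_inv_snd.smul contDiffOn_const
    · exact contDiffOn_norm_inv_snd.smul contDiffOn_const
  · refine Fin.cases ?_ fun i => ?_
    · exact ⟨pd 0 f, (hf.pd 0).mono (by linarith), rfl⟩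
    · exact ⟨boost i f, hf.boost i, rfl⟩
  · intro _ hp
    refine (hasFDerivAt_nullInt hκ hf hp).congr_fderiv ?_
    rw [Fin.sum_univ_succ (n := 3)]
    simp only [Fin.cons_zero, Fin.cons_succ, smul_smul, mul_comm]

theorem nullInt_bound {κ : ℝ} (hκ : 3 < κ) {f : M → ℝ} (hf : Decays κ f) :
    ∃ C, 0 ≤ C ∧ ∀ s x, x ≠ 0 → |nullInt f s x| ≤ C * ‖x‖⁻¹ * (1 + |s| / ‖x‖) ^ (3 - κ) := by
  obtain ⟨C, h0, hC⟩ := hf.bound_zero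
  set I := ∫ z : E3, (1 + ‖z‖) ^ (-κ) with hI
  have hI0 : 0 ≤ I := integral_nonneg fun z => by positivity
  refine ⟨C * 3 ^ κ * I, by positivity, fun s x hx => ?_⟩
  have hx' : 0 < ‖x‖ := norm_pos_iff.2 hx
  set σ := |s| / ‖x‖ with hσ
  have hσ0 : 0 ≤ σ := by positivity
  have h1σ : 0 < 1 + σ := by positivity
  have hb : ∀ y, |f (planePt s x y)| ≤ C * 3 ^ κ * ((1 + σ) + ‖y‖) ^ (-κ) := by
    intro y
    refine (hC _).trans ?_
    rw [mul_assoc]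
    refine mul_le_mul_of_nonneg_left ?_ h0
    have h1 : σ ≤ 2 * ‖planePt s x y‖ := by
      have h2 : |s| ≤ |s + inner ℝ x y| + ‖x‖ * ‖y‖ := by
        have h3 := abs_sub (s + inner ℝ x y) (inner ℝ x y)
        have h4 := abs_real_inner_le_norm x y
        rw [add_sub_cancel_right] at h3
        linarith
      have h5 : |(s + inner ℝ x y) / ‖x‖| ≤ ‖planePt s x y‖ := abs_le_norm_mkVec _ _
      have h6 := norm_le_planePt s x y
      rw [abs_div, abs_of_pos hx'] at h5
      rw [hσ]
      calc |s| / ‖x‖ ≤ (|s + inner ℝ x y| + ‖x‖ * ‖y‖) / ‖x‖ := by gcongr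
        _ = |s + inner ℝ x y| / ‖x‖ + ‖y‖ := by field_simp
        _ ≤ _ := by linarith
    have h2 : ((1 + σ) + ‖y‖) ≤ 3 * (1 + ‖planePt s x y‖) := by
      linarith [norm_le_planePt s x y]
    have h3 : (3 * (1 + ‖planePt s x y‖)) ^ (-κ) ≤ ((1 + σ) + ‖y‖) ^ (-κ) :=
      rpow_neg_le_of_le (by linarith) (by positivity) h2
    rw [Real.mul_rpow (by norm_num) (by positivity), Real.rpow_neg (by norm_num),
      inv_mul_le_iff₀ (by positivity)] at h3
    exact h3
  have hscale : ∀ y : E3, ((1 + σ) + ‖y‖) ^ (-κ)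
      = (1 + σ) ^ (-κ) * (1 + ‖(1 + σ)⁻¹ • y‖) ^ (-κ) := by
    intro y
    rw [norm_smul, norm_inv, Real.norm_eq_abs, abs_of_pos h1σ, ← Real.mul_rpow (by positivity)
      (by positivity)]
    congr 1
    field_simp
  have hint : Integrable fun y : E3 => C * 3 ^ κ * ((1 + σ) + ‖y‖) ^ (-κ) := by
    simp only [hscale]
    exact (((integrable_one_add_norm_E3 hκ).comp_smul (inv_ne_zero h1σ.ne')).const_mul _).const_mul _
  have hval : ∫ y : E3, C * 3 ^ κ * ((1 + σ) + ‖y‖) ^ (-κ) = C * 3 ^ κ * I * (1 + σ) ^ (3 - κ) := by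
    simp only [hscale]
    rw [integral_const_mul, integral_const_mul,
      Measure.integral_comp_inv_smul volume (fun y : E3 => (1 + ‖y‖) ^ (-κ)) (1 + σ), ← hI,
      finrank_euclideanSpace_fin, abs_of_pos (by positivity), smul_eq_mul,
      show 3 - κ = (3 : ℕ) + -κ by push_cast; ring, Real.rpow_add h1σ, Real.rpow_natCast]
    ring
  have hle := norm_integral_le_of_norm_le hint (Eventually.of_forall fun y => by
    rw [Real.norm_eq_abs]
    exact hb y)
  rw [hval, Real.norm_eq_abs] at hle
  rw [nullInt, abs_mul, abs_of_pos (inv_pos.2 hx')]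
  calc _ ≤ ‖x‖⁻¹ * (C * 3 ^ κ * I * (1 + σ) ^ (3 - κ)) := by gcongr
    _ = _ := by ring

/-! ### The flux of asymptotically homogeneous functions -/

/-- The divergence theorem for the vector field `q(y) y`. -/
theorem integral_euler {q : E3 → ℝ} (hq : Differentiable ℝ q)
    (hint : Integrable fun y => fderiv ℝ q y y + 3 * q y) {φ : S2 → ℝ}
    (hφ : ∀ n : S2, Tendsto (fun r : ℝ => r ^ (3 : ℝ) * q (r • (n : E3))) atTop (𝓝 (φ n))) :
    ∫ y, (fderiv ℝ q y y + 3 * q y) = ∫ n, φ n ∂sphereMeasure := by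
  rw [integral_polar hint]
  refine integral_congr_ae ?_
  filter_upwards [(integrable_polar hint).prod_right_ae] with n hn
  have hd : ∀ r ∈ Ioi (0 : ℝ), HasDerivAt (fun r : ℝ => r ^ 3 * q (r • (n : E3)))
      (r ^ 2 * (fderiv ℝ q (r • (n : E3)) (r • (n : E3)) + 3 * q (r • (n : E3)))) r := by
    intro r _
    have h1 : HasDerivAt (fun r : ℝ => q (r • (n : E3))) (fderiv ℝ q (r • (n : E3)) n) r :=
      ((hq _).hasFDerivAt.comp_hasDerivAt r ((hasDerivAt_id r).smul_const (n : E3))).congr_deriv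
        (by simp)
    refine ((hasDerivAt_pow 3 r).mul h1).congr_deriv ?_
    simp
    ring
  have ht : Tendsto (fun r : ℝ => r ^ 3 * q (r • (n : E3))) atTop (𝓝 (φ n)) := by
    refine (hφ n).congr fun r => ?_
    rw [show (3 : ℝ) = (3 : ℕ) by norm_num, Real.rpow_natCast]
  have hc : ContinuousWithinAt (fun r : ℝ => r ^ 3 * q (r • (n : E3))) (Ici 0) 0 := by
    have := hq.continuous
    exact Continuous.continuousWithinAt (by fun_prop)
  have := integral_Ioi_of_hasDerivAt_of_tendsto hc hd hn ht
  simpa using this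

theorem integral_euler_of_odd {q : E3 → ℝ} (hq : Differentiable ℝ q)
    (hint : Integrable fun y => fderiv ℝ q y y + 3 * q y) {φ : S2 → ℝ}
    (hφ : ∀ n : S2, Tendsto (fun r : ℝ => r ^ (3 : ℝ) * q (r • (n : E3))) atTop (𝓝 (φ n)))
    (hodd : ∀ n, φ (-n) = -φ n) :
    ∫ y, (fderiv ℝ q y y + 3 * q y) = 0 := by
  have h1 := integral_euler hq hint hφ
  have hf : ∀ y, fderiv ℝ (fun y => q (-y)) y y + 3 * q (-y)
      = fderiv ℝ q (-y) (-y) + 3 * q (-y) := by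
    intro y
    have h0 := (hq (-y)).hasFDerivAt.comp y (hasFDerivAt_id y).neg
    have h0' : HasFDerivAt (fun y => q (-y)) _ y := h0
    rw [h0'.fderiv]
    simp
  have h2 := integral_euler (q := fun y => q (-y)) (φ := fun n => φ (-n)) (by fun_prop)
    (by simpa only [hf] using hint.comp_neg) (fun n => by simpa using hφ (-n))
  simp only [hf, hodd, integral_neg] at h2
  rw [integral_neg_eq_self (fun y => fderiv ℝ q y y + 3 * q y) volume, h1] at h2
  rw [h1]
  linarith

theorem hasFDerivAt_planePt {f : M → ℝ} (hf : ContDiff ℝ ∞ f) (s : ℝ) (x y : E3) :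
    HasFDerivAt (fun y => f (planePt s x y)) ((fderiv ℝ f (planePt s x y)).comp
      (mkVecL.comp ((‖x‖⁻¹ • innerSL ℝ x).prod (ContinuousLinearMap.id ℝ E3)))) y := by
  refine hasFDerivAt_pd hf ?_
  refine mkVecL.hasFDerivAt.comp y (HasFDerivAt.prodMk (f₁ := fun y => (s + inner ℝ x y) / ‖x‖)
    ?_ (hasFDerivAt_id y))
  have h := ((innerSL ℝ x).hasFDerivAt (x := y)).const_add s |>.const_mul ‖x‖⁻¹
  refine h.congr_of_eventuallyEq (Eventually.of_forall fun z => ?_)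
  simp [div_eq_inv_mul]

theorem eul_planePt {f : M → ℝ} (hf : ContDiff ℝ ∞ f) (κ s : ℝ) (x y : E3) :
    eul κ f (planePt s x y) = s / ‖x‖ * pd 0 f (planePt s x y)
      + (fderiv ℝ (fun y => f (planePt s x y)) y y + κ * f (planePt s x y)) := by
  rw [(hasFDerivAt_planePt hf s x y).fderiv, eul]
  have h : planePt s x y = (s / ‖x‖) • EuclideanSpace.single 0 1
      + mkVec (‖x‖⁻¹ * inner ℝ x y) y := by
    ext a
    refine Fin.cases ?_ (fun i => ?_) a
    · simp [planePt, div_eq_inv_mul, mul_add]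
    · simp [planePt]
  have h2 : fderiv ℝ f (planePt s x y) (planePt s x y) = s / ‖x‖ * pd 0 f (planePt s x y)
      + fderiv ℝ f (planePt s x y) (mkVec (‖x‖⁻¹ * inner ℝ x y) y) := by
    conv_lhs => rw [h]
    rw [map_add, map_smul, ← h]
    rfl
  rw [h2]
  simp
  ring

theorem abs_shift_le {κ : ℝ} (hκ : 0 ≤ κ) {f : M → ℝ} (hf : ContDiff ℝ ∞ f)
    (h : Decays κ (pd 0 f)) : ∃ C, 0 ≤ C ∧ ∀ (a t : ℝ) (y : E3),
      |f (mkVec (t + a) y) - f (mkVec t y)| ≤ C * (1 + ‖y‖) ^ (-κ) * |a| := by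
  obtain ⟨C, h0, hC⟩ := h.bound_zero
  refine ⟨C, h0, fun a t y => ?_⟩
  have hd : ∀ t, HasDerivAt (fun t => f (mkVec t y)) (pd 0 f (mkVec t y)) t := by
    intro t
    have h1 := mkVecL.hasFDerivAt.comp_hasDerivAt t ((hasDerivAt_id t).prodMk (hasDerivAt_const t y))
    refine ((smooth_diffAt hf (mkVec t y)).hasFDerivAt.comp_hasDerivAt t h1).congr_deriv ?_
    rw [mkVecL_apply, fderiv_mkVec]
    simp
  have := Convex.norm_image_sub_le_of_norm_hasDerivWithin_le (f := fun t => f (mkVec t y))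
    (C := C * (1 + ‖y‖) ^ (-κ)) (s := univ) (x := t) (y := t + a)
    (fun t _ => (hd t).hasDerivWithinAt) (fun t _ => ?_) convex_univ (mem_univ _) (mem_univ _)
  · simpa using this
  · refine (hC _).trans (mul_le_mul_of_nonneg_left ?_ h0)
    exact rpow_neg_le_of_le hκ (by linarith [one_le_one_add_norm y])
      (by linarith [norm_le_norm_mkVec t y])

/-- Scalar functions in `𝒮³_{3+ε}` with odd asymptote. -/
structure OddHom (ε : ℝ) (f : M → ℝ) : Prop where
  smooth : ContDiff ℝ ∞ f
  decays : Decays (3 + ε) (eul 3 f)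
  odd : ∃ φ : M → ℝ, (∀ x, x ≠ 0 → Tendsto (fun R : ℝ => R ^ (3 : ℝ) * f (R • x)) atTop (𝓝 (φ x))) ∧
    ∀ x, x ≠ 0 → φ (-x) = -φ x

theorem OddHom.decays_three {ε : ℝ} (hε : 0 < ε) {f : M → ℝ} (h : OddHom ε f) : Decays 3 f :=
  Decays.of_eul (by norm_num) hε h.smooth h.decays

theorem mkVec_ne_zero {t : ℝ} {y : E3} (hy : y ≠ 0) : mkVec t y ≠ 0 := by
  intro h
  apply hy
  rw [← spatial_mkVec t y, h]
  exact map_zero spatialL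

theorem mkVec_smul (r t : ℝ) (y : E3) : r • mkVec t y = mkVec (r * t) (r • y) :=
  (map_smul mkVecL r (t, y)).symm

theorem mkVec_neg (t : ℝ) (y : E3) : -mkVec t y = mkVec (-t) (-y) := (map_neg mkVecL (t, y)).symm

/-- `∫ δ(s - x·l) H₃f = s ∫ δ(s - x·l) ∂₀f` at `l⁰ = 1`, for odd asymptotes. -/
theorem OddHom.nullInt_eul {ε : ℝ} (hε : 0 < ε) {f : M → ℝ} (h : OddHom ε f) (s : ℝ) {x : E3}
    (hx : x ≠ 0) : nullInt (eul 3 f) s x = s / ‖x‖ * nullInt (pd 0 f) s x := by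
  have h3 := h.decays_three hε
  obtain ⟨φ, hφ, hodd⟩ := h.odd
  have hx' : 0 < ‖x‖ := norm_pos_iff.2 hx
  have i1 := h.decays.integrable_planePt (by linarith) s x
  have i2 := (((h3.pd 0).integrable_planePt (by linarith) s x).const_mul (s / ‖x‖))
  have i3 : Integrable fun y => fderiv ℝ (fun y => f (planePt s x y)) y y
      + 3 * f (planePt s x y) := by
    refine (i1.sub i2).congr (Eventually.of_forall fun y => ?_)
    simp only [Pi.sub_apply, eul_planePt h.smooth]
    ring
  have hz : ∀ n : S2, planePt 0 x n ≠ 0 := fun n => mkVec_ne_zero n.ne_zero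
  have key : ∫ y, (fderiv ℝ (fun y => f (planePt s x y)) y y + 3 * f (planePt s x y)) = 0 := by
    refine integral_euler_of_odd (φ := fun n => φ (planePt 0 x n))
      (fun y => (hasFDerivAt_planePt h.smooth s x y).differentiableAt) i3 (fun n => ?_)
      (fun n => ?_)
    · obtain ⟨C, h0, hC⟩ := abs_shift_le (by norm_num) h.smooth (h3.pd 0)
      have e1 : ∀ r : ℝ, f (planePt s x (r • (n : E3)))
          = f (mkVec (r * (inner ℝ x n / ‖x‖) + s / ‖x‖) (r • (n : E3))) := by
        intro r
        simp only [planePt, inner_smul_right]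
        congr 2
        ring
      have e2 : ∀ r : ℝ, f (r • planePt 0 x n)
          = f (mkVec (r * (inner ℝ x n / ‖x‖)) (r • (n : E3))) := by
        intro r
        rw [planePt, mkVec_smul, zero_add]
      have hlim : Tendsto (fun r : ℝ => C * |s / ‖x‖| * r⁻¹) atTop (𝓝 0) := by
        simpa using tendsto_inv_atTop_zero.const_mul (C * |s / ‖x‖|)
      have hdiff : Tendsto (fun r : ℝ => r ^ (3 : ℝ) * f (planePt s x (r • (n : E3)))
          - r ^ (3 : ℝ) * f (r • planePt 0 x n)) atTop (𝓝 0) := by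
        refine squeeze_zero_norm' ?_ hlim
        filter_upwards [eventually_gt_atTop 0] with r hr
        rw [← mul_sub, e1, e2, norm_mul, Real.norm_eq_abs, Real.norm_eq_abs,
          abs_of_pos (Real.rpow_pos_of_pos hr _)]
        have h4 := hC (s / ‖x‖) (r * (inner ℝ x n / ‖x‖)) (r • (n : E3))
        have h5 : (1 + ‖r • (n : E3)‖) ^ (-(3 + 1) : ℝ) ≤ r ^ (-(3 + 1) : ℝ) := by
          rw [norm_smul, n.norm, Real.norm_eq_abs, abs_of_pos hr]
          exact rpow_neg_le_of_le (by norm_num) hr (by linarith)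
        calc _ ≤ r ^ (3 : ℝ) * (C * r ^ (-(3 + 1) : ℝ) * |s / ‖x‖|) := by
              refine mul_le_mul_of_nonneg_left (h4.trans ?_) (by positivity)
              gcongr
          _ = C * |s / ‖x‖| * (r ^ (3 : ℝ) * r ^ (-(3 + 1) : ℝ)) := by ring
          _ = _ := by
              rw [← Real.rpow_add hr]
              norm_num [Real.rpow_neg_one]
      simpa using hdiff.add (hφ _ (hz n))
    · have : planePt 0 x ((-n : S2) : E3) = -planePt 0 x n := by
        rw [planePt, planePt, mkVec_neg]
        simp [neg_div]
      simp only [this]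
      exact hodd _ (hz n)
  simp only [nullInt]
  have e : ∀ y, eul 3 f (planePt s x y) = s / ‖x‖ * pd 0 f (planePt s x y)
      + (fderiv ℝ (fun y => f (planePt s x y)) y y + 3 * f (planePt s x y)) :=
    fun y => eul_planePt h.smooth 3 s x y
  simp only [e]
  rw [integral_add i2 i3, key, integral_const_mul]
  ring

theorem OddHom.nullInt_eul_zero {ε : ℝ} (hε : 0 < ε) {f : M → ℝ} (h : OddHom ε f) {x : E3}
    (hx : x ≠ 0) : nullInt (eul 3 f) 0 x = 0 := by
  rw [h.nullInt_eul hε 0 hx]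
  simp

/-! ### The quotient `s⁻¹ ∫ δ(s - x·l) f` -/

theorem hasDerivAt_nullInt {κ : ℝ} (hκ : 3 < κ) {f : M → ℝ} (hf : Decays κ f) (s : ℝ) {x : E3}
    (hx : x ≠ 0) :
    HasDerivAt (fun s => nullInt f s x) (‖x‖⁻¹ * nullInt (pd 0 f) s x) s := by
  refine ((hasFDerivAt_nullInt hκ hf (p := (s, x)) hx).comp_hasDerivAt s
    ((hasDerivAt_id s).prodMk (hasDerivAt_const s x))).congr_deriv ?_
  simp

theorem continuous_nullInt {κ : ℝ} (hκ : 3 < κ) {f : M → ℝ} (hf : Decays κ f) {x : E3}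
    (hx : x ≠ 0) : Continuous fun s => nullInt f s x :=
  continuous_iff_continuousAt.2 fun s => (hasDerivAt_nullInt hκ hf s hx).continuousAt

/-- Functions `f` with `∫ δ(x·l) f = 0` for all `l`. -/
structure NullVanishing (ε : ℝ) (f : M → ℝ) : Prop where
  decays : Decays (3 + ε) f
  zero : ∀ x : E3, x ≠ 0 → nullInt f 0 x = 0

theorem OddHom.nullVanishing {ε : ℝ} (hε : 0 < ε) {f : M → ℝ} (h : OddHom ε f) :
    NullVanishing ε (eul 3 f) :=
  ⟨h.decays, fun _ hx => h.nullInt_eul_zero hε hx⟩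

theorem NullVanishing.add {ε : ℝ} (hε : 0 < ε) {f g : M → ℝ} (hf : NullVanishing ε f)
    (hg : NullVanishing ε g) : NullVanishing ε fun x => f x + g x :=
  ⟨hf.decays.add hg.decays, fun x hx => by
    rw [nullInt_add (by linarith) hf.decays hg.decays, hf.zero x hx, hg.zero x hx, add_zero]⟩

theorem NullVanishing.const_mul {ε : ℝ} {f : M → ℝ} (hf : NullVanishing ε f) (c : ℝ) :
    NullVanishing ε fun x => c * f x :=
  ⟨hf.decays.const_mul c, fun x hx => by rw [nullInt_const_mul, hf.zero x hx, mul_zero]⟩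

protected theorem NullVanishing.boost {ε : ℝ} (hε : 0 < ε) {f : M → ℝ} (hf : NullVanishing ε f)
    (i : Fin 3) : NullVanishing ε (boost i f) := by
  refine ⟨hf.decays.boost i, fun x hx => ?_⟩
  have h1 := (hasFDerivAt_nullInt (by linarith) hf.decays (p := (0, x)) hx).comp x
    ((hasFDerivAt_const (0 : ℝ) x).prodMk (hasFDerivAt_id x))
  have h2 : (fun p : ℝ × E3 => nullInt f p.1 p.2) ∘ (fun x => ((0 : ℝ), id x)) =ᶠ[𝓝 x]
      fun _ => (0 : ℝ) := by
    filter_upwards [isOpen_ne.mem_nhds hx] with y hy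
    exact hf.zero y hy
  have h3 := congrArg (fun L : E3 →L[ℝ] ℝ => L (EuclideanSpace.single i 1))
    (h1.unique ((hasFDerivAt_const (0 : ℝ) x).congr_of_eventuallyEq h2))
  simp at h3
  exact h3.resolve_left hx

/-- `s⁻¹ ∫ δ(s - x·l) f`, for `f` with `∫ δ(x·l) f = 0`, as a smooth function of `s`. -/
def nullQuot (f : M → ℝ) (s : ℝ) (x : E3) : ℝ :=
  ‖x‖⁻¹ * ∫ u in (0 : ℝ)..1, nullInt (pd 0 f) (u * s) x

section

variable {ε : ℝ} {f : M → ℝ}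

theorem NullVanishing.mul_nullQuot (hε : 0 < ε) (hf : NullVanishing ε f) (s : ℝ)
    {x : E3} (hx : x ≠ 0) : s * nullQuot f s x = nullInt f s x := by
  have hd : ∀ u ∈ uIcc (0 : ℝ) 1, HasDerivAt (fun u => nullInt f (u * s) x)
      (s * ‖x‖⁻¹ * nullInt (pd 0 f) (u * s) x) u := by
    intro u _
    refine ((hasDerivAt_nullInt (by linarith) hf.decays (u * s) hx).comp u
      ((hasDerivAt_id u).mul_const s)).congr_deriv ?_
    ring
  have hc := continuous_nullInt (by linarith) (hf.decays.pd 0) hx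
  have h := intervalIntegral.integral_eq_sub_of_hasDerivAt hd
    (Continuous.intervalIntegrable (by fun_prop) _ _)
  rw [intervalIntegral.integral_const_mul, one_mul, zero_mul, hf.zero x hx, sub_zero] at h
  rw [← h, nullQuot]
  ring

theorem NullVanishing.nullQuot_eq (hε : 0 < ε) (hf : NullVanishing ε f) {s : ℝ} (hs : s ≠ 0)
    {x : E3} (hx : x ≠ 0) : nullQuot f s x = s⁻¹ * nullInt f s x := by
  rw [← hf.mul_nullQuot hε s hx, inv_mul_cancel_left₀ hs]

theorem contDiffOn_nullQuot (hε : 0 < ε) (hf : Decays (3 + ε) f) :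
    ContDiffOn ℝ ∞ (fun p : ℝ × E3 => nullQuot f p.1 p.2) {p | p.2 ≠ 0} := by
  refine contDiffOn_norm_inv_snd.mul (contDiffOn_infty.2 fun n => ?_)
  refine contDiffOn_integral_unit isOpen_snd_ne n
    (G := fun q : ℝ × ℝ × E3 => nullInt (pd 0 f) (q.1 * q.2.1) q.2.2) ?_
  refine (contDiffOn_nullInt (by linarith) (hf.pd 0)).comp
    (f := fun q : ℝ × ℝ × E3 => (q.1 * q.2.1, q.2.2)) ?_ fun q hq => hq.2
  exact ContDiff.contDiffOn (by fun_prop)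

theorem continuous_nullQuot (hε : 0 < ε) (hf : Decays (3 + ε) f) {x : E3} (hx : x ≠ 0) :
    Continuous fun s => nullQuot f s x :=
  (contDiffOn_nullQuot hε hf).continuousOn.comp_continuous (f := fun s => (s, x)) (by fun_prop)
    fun _ => hx

theorem NullVanishing.hasFDerivAt_nullQuot (hε : 0 < ε) (hf : NullVanishing ε f) (s : ℝ)
    {x : E3} (hx : x ≠ 0) :
    HasFDerivAt (fun x => nullQuot f s x) (∑ i : Fin 3, (‖x‖⁻¹ * nullQuot (boost i f) s x) •
      (EuclideanSpace.proj i : E3 →L[ℝ] ℝ)) x := by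
  have hs := contDiffOn_nullQuot hε hf.decays
  have hdiff : ∀ s, HasFDerivAt (fun x => nullQuot f s x)
      ((fderiv ℝ (fun p : ℝ × E3 => nullQuot f p.1 p.2) (s, x)).comp
        (ContinuousLinearMap.inr ℝ ℝ E3)) x := by
    intro s
    have h1 := ((hs.contDiffAt (isOpen_snd_ne.mem_nhds (x := (s, x)) hx)).differentiableAt
      (by simp)).hasFDerivAt
    exact h1.comp x ((hasFDerivAt_const s x).prodMk (hasFDerivAt_id x))
  have hc1 : Continuous fun s => (fderiv ℝ (fun p : ℝ × E3 => nullQuot f p.1 p.2) (s, x)).comp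
        (ContinuousLinearMap.inr ℝ ℝ E3) := by
    have := (hs.continuousOn_fderiv_of_isOpen isOpen_snd_ne (by simp)).comp_continuous
      (f := fun s => (s, x)) (by fun_prop) fun _ => hx
    exact this.clm_comp continuous_const
  have hc2 : Continuous fun s => ∑ i : Fin 3, (‖x‖⁻¹ * nullQuot (boost i f) s x) •
      (EuclideanSpace.proj i : E3 →L[ℝ] ℝ) :=
    continuous_finsetSum _ fun i _ =>
      ((continuous_nullQuot hε (hf.decays.boost i) hx).const_mul _).smul continuous_const
  have heq : EqOn (fun s => (fderiv ℝ (fun p : ℝ × E3 => nullQuot f p.1 p.2) (s, x)).comp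
      (ContinuousLinearMap.inr ℝ ℝ E3)) (fun s => ∑ i : Fin 3,
        (‖x‖⁻¹ * nullQuot (boost i f) s x) •
      (EuclideanSpace.proj i : E3 →L[ℝ] ℝ)) {0}ᶜ := by
    intro s hs0
    have hs0 : s ≠ 0 := hs0
    have h1 := ((hasFDerivAt_nullInt (by linarith) hf.decays (p := (s, x)) hx).comp x
      ((hasFDerivAt_const s x).prodMk (hasFDerivAt_id x))).const_mul s⁻¹
    have h2 : HasFDerivAt (fun x => nullQuot f s x) _ x := h1.congr_of_eventuallyEq (by
      filter_upwards [isOpen_ne.mem_nhds hx] with y hy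
      exact hf.nullQuot_eq hε hs0 hy)
    refine (hdiff s).unique (h2.congr_fderiv ?_)
    refine ContinuousLinearMap.ext fun v => ?_
    simp only [(hf.boost hε _).nullQuot_eq hε hs0 hx]
    simp [Finset.mul_sum]
    refine Finset.sum_congr rfl fun i _ => ?_
    ring
  have := congrFun (Continuous.ext_on (dense_compl_singleton (0 : ℝ)) hc1 hc2 heq) s
  exact (hdiff s).congr_fderiv this

theorem NullVanishing.nullQuot_bound (hε : 0 < ε) (hf : NullVanishing ε f) :
    ∃ C, 0 ≤ C ∧ ∀ s x, x ≠ 0 →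
      |nullQuot f s x| ≤ C / (‖x‖ ^ 2 * (1 + |s| / ‖x‖) ^ (1 + ε)) := by
  obtain ⟨C₁, h₁, hC₁⟩ := nullInt_bound (by linarith) hf.decays
  obtain ⟨C₂, h₂, hC₂⟩ := nullInt_bound (by linarith) (hf.decays.pd 0)
  refine ⟨2 * C₁ + C₂ * 2 ^ (1 + ε), by positivity, fun s x hx => ?_⟩
  have hx' : 0 < ‖x‖ := norm_pos_iff.2 hx
  set σ := |s| / ‖x‖ with hσ
  have hσ0 : 0 ≤ σ := by positivity
  have hp : 0 < (1 + σ) ^ (1 + ε) := by positivity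
  rw [le_div_iff₀ (by positivity)]
  by_cases h : 1 ≤ σ
  · have hs : s ≠ 0 := by
      rintro rfl
      simp [hσ] at h
      linarith
    have hs' : |s| = σ * ‖x‖ := by
      rw [hσ]
      field_simp
    rw [hf.nullQuot_eq hε hs hx, abs_mul, abs_inv, hs']
    have e : (1 + σ) ^ (3 - (3 + ε)) * (1 + σ) ^ (1 + ε) = 1 + σ := by
      rw [← Real.rpow_add (by positivity)]
      norm_num
    calc (σ * ‖x‖)⁻¹ * |nullInt f s x| * (‖x‖ ^ 2 * (1 + σ) ^ (1 + ε))
        ≤ (σ * ‖x‖)⁻¹ * (C₁ * ‖x‖⁻¹ * (1 + σ) ^ (3 - (3 + ε))) * (‖x‖ ^ 2 * (1 + σ) ^ (1 + ε)) := by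
          gcongr
          exact hC₁ s x hx
      _ = C₁ * σ⁻¹ * ((1 + σ) ^ (3 - (3 + ε)) * (1 + σ) ^ (1 + ε)) := by
          field_simp
      _ = C₁ * σ⁻¹ * (1 + σ) := by rw [e]
      _ ≤ C₁ * σ⁻¹ * (2 * σ) := by gcongr; linarith
      _ = 2 * C₁ := by field_simp
      _ ≤ _ := by
          have : 0 ≤ C₂ * 2 ^ (1 + ε) := by positivity
          linarith
  · push Not at h
    have h3 : ∀ τ, |nullInt (pd 0 f) τ x| ≤ C₂ * ‖x‖⁻¹ := by
      intro τ
      refine (hC₂ τ x hx).trans (mul_le_of_le_one_right (by positivity) ?_)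
      exact Real.rpow_le_one_of_one_le_of_nonpos (by linarith [show 0 ≤ |τ| / ‖x‖ by positivity])
        (by linarith)
    have h4 : |nullQuot f s x| ≤ ‖x‖⁻¹ * (C₂ * ‖x‖⁻¹) := by
      rw [nullQuot, abs_mul, abs_of_pos (inv_pos.2 hx')]
      refine mul_le_mul_of_nonneg_left ?_ (inv_nonneg.2 hx'.le)
      have := intervalIntegral.norm_integral_le_of_norm_le_const (a := (0 : ℝ)) (b := 1)
        (f := fun u => nullInt (pd 0 f) (u * s) x) (C := C₂ * ‖x‖⁻¹) fun u _ => h3 _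
      simpa using this
    calc _ ≤ ‖x‖⁻¹ * (C₂ * ‖x‖⁻¹) * (‖x‖ ^ 2 * 2 ^ (1 + ε)) := by
          gcongr
          linarith
      _ = C₂ * 2 ^ (1 + ε) := by field_simp
      _ ≤ _ := by linarith

theorem nullQuot_smul (f : M → ℝ) {μ : ℝ} (hμ : 0 < μ) (s : ℝ) (x : E3) :
    nullQuot f (μ * s) (μ • x) = (μ ^ 2)⁻¹ * nullQuot f s x := by
  have : ∀ u : ℝ, nullInt (pd 0 f) (u * (μ * s)) (μ • x) = μ⁻¹ * nullInt (pd 0 f) (u * s) x := by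
    intro u
    rw [← nullInt_smul _ hμ]
    congr 1
    ring
  simp only [nullQuot, this, norm_smul, Real.norm_eq_abs, abs_of_pos hμ,
    intervalIntegral.integral_const_mul]
  rw [mul_inv]
  ring

/-- A bound of `nullQuot` for `x` bounded away from `0` and `∞`. -/
theorem div_sq_mul_rpow_le {a b r t : ℝ} (hε : 0 < ε) (ha : 0 < a) (har : a ≤ r) (hrb : r ≤ b) :
    1 / (r ^ 2 * (1 + |t| / r) ^ (1 + ε)) ≤ 1 / (a ^ 2 * (1 + ‖b⁻¹ * t‖) ^ (1 + ε)) := by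
  have hb : 0 < b := by linarith
  have hr : 0 < r := by linarith
  rw [norm_mul, norm_inv, Real.norm_eq_abs, Real.norm_eq_abs, abs_of_pos hb]
  have h1 : b⁻¹ * |t| ≤ |t| / r := by
    rw [div_eq_inv_mul]
    gcongr
  gcongr

theorem NullVanishing.integrable_nullQuot (hε : 0 < ε) (hf : NullVanishing ε f) {x : E3}
    (hx : x ≠ 0) : Integrable fun s => nullQuot f s x := by
  obtain ⟨C, h0, hC⟩ := hf.nullQuot_bound hε
  have hx' : 0 < ‖x‖ := norm_pos_iff.2 hx
  have h1 : Integrable fun s : ℝ => (1 + ‖‖x‖⁻¹ * s‖) ^ (-(1 + ε)) :=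
    (integrable_one_add_norm (E := ℝ) (μ := volume) (r := 1 + ε) (by simpa using hε)).comp_mul_left'
      (R := ‖x‖⁻¹) (by positivity)
  refine (h1.const_mul (C * (‖x‖ ^ 2)⁻¹)).mono'
    (continuous_nullQuot hε hf.decays hx).aestronglyMeasurable (Eventually.of_forall fun s => ?_)
  refine (hC s x hx).trans (le_of_eq ?_)
  rw [norm_mul, norm_inv, norm_norm, Real.norm_eq_abs, Real.rpow_neg (by positivity)]
  field_simp

end

/-! ### Integrals over `s` -/

/-- Weighted integrals of `nullQuot`. -/
def weightedInt (w : ℝ → ℝ) (f : M → ℝ) (x : E3) : ℝ := ∫ s, w s * nullQuot f s x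

section

variable {ε : ℝ} {f g : M → ℝ}

theorem NullVanishing.integrable_weighted (hε : 0 < ε) (hf : NullVanishing ε f) {w : ℝ → ℝ}
    (hw : Measurable w) (hw1 : ∀ s, |w s| ≤ 1) {x : E3} (hx : x ≠ 0) :
    Integrable fun s => w s * nullQuot f s x :=
  (hf.integrable_nullQuot hε hx).bdd_mul (c := 1) hw.aestronglyMeasurable (Eventually.of_forall hw1)

theorem NullVanishing.hasFDerivAt_weightedInt (hε : 0 < ε) (hf : NullVanishing ε f) {w : ℝ → ℝ}
    (hw : Measurable w) (hw1 : ∀ s, |w s| ≤ 1) {x : E3} (hx : x ≠ 0) :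
    HasFDerivAt (weightedInt w f) (∑ i : Fin 3,
      (‖x‖⁻¹ * weightedInt w (boost i f) x) • (EuclideanSpace.proj i : E3 →L[ℝ] ℝ)) x := by
  have hx' : 0 < ‖x‖ := norm_pos_iff.2 hx
  set a := ‖x‖ / 2 with ha
  have ha0 : 0 < a := by positivity
  choose C h0 hC using fun i => (hf.boost hε i).nullQuot_bound hε
  let S : Set E3 := {y | a < ‖y‖ ∧ ‖y‖ < 3 * a}
  have hS : S ∈ 𝓝 x := by
    have ho : IsOpen S := (isOpen_lt continuous_const continuous_norm).inter
      (isOpen_lt continuous_norm continuous_const)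
    exact ho.mem_nhds ⟨by linarith, by linarith⟩
  let L : Fin 3 → (E3 →L[ℝ] ℝ) := fun i => EuclideanSpace.proj i
  have hb : Integrable fun s : ℝ => ∑ i, a⁻¹ * (C i * (1 / (a ^ 2 * (1 + ‖(3 * a)⁻¹ * s‖) ^ (1 + ε))))
      * ‖L i‖ := by
    refine integrable_finsetSum _ fun i _ => ?_
    have h1 : Integrable fun s : ℝ => (1 + ‖(3 * a)⁻¹ * s‖) ^ (-(1 + ε)) :=
      (integrable_one_add_norm (E := ℝ) (μ := volume) (r := 1 + ε) (by simpa using hε)).comp_mul_left'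
        (R := (3 * a)⁻¹) (by positivity)
    refine (h1.const_mul (a⁻¹ * C i * (a ^ 2)⁻¹ * ‖L i‖)).congr (Eventually.of_forall fun s => ?_)
    simp only
    rw [Real.rpow_neg (by positivity)]
    field_simp
  have hmeas : ∀ y, y ≠ 0 → ∀ g, NullVanishing ε g →
      AEStronglyMeasurable (fun s => w s * nullQuot g s y) volume := fun y hy g hg =>
    (hg.integrable_weighted hε hw hw1 hy).aestronglyMeasurable
  have hne : ∀ y ∈ S, y ≠ 0 := fun y hy => norm_pos_iff.1 (ha0.trans hy.1)
  have h := hasFDerivAt_integral_of_dominated_of_fderiv_le (𝕜 := ℝ) hS (μ := volume)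
    (F := fun y s => w s * nullQuot f s y)
    (F' := fun y s => ∑ i : Fin 3, (‖y‖⁻¹ * (w s * nullQuot (boost i f) s y)) • L i)
    (bound := fun s : ℝ =>
      ∑ i, a⁻¹ * (C i * (1 / (a ^ 2 * (1 + ‖(3 * a)⁻¹ * s‖) ^ (1 + ε)))) * ‖L i‖)
    (by
      filter_upwards [hS] with y hy
      exact hmeas y (hne y hy) f hf)
    (hf.integrable_weighted hε hw hw1 hx)
    (by
      refine Finset.aestronglyMeasurable_fun_sum _ fun i _ => ?_
      exact ((hmeas x hx _ (hf.boost hε i)).const_mul _).smul_const _)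
    (Eventually.of_forall fun s y hy => by
      refine norm_sum_le_of_le _ fun i _ => ?_
      rw [norm_smul]
      refine mul_le_mul_of_nonneg_right ?_ (norm_nonneg _)
      rw [norm_mul, norm_mul, norm_inv, norm_norm]
      have h1 : ‖y‖⁻¹ ≤ a⁻¹ := inv_anti₀ ha0 hy.1.le
      have h2 := hC i s y (hne y hy)
      rw [div_eq_mul_one_div] at h2
      have h3 := h2.trans (mul_le_mul_of_nonneg_left
        (div_sq_mul_rpow_le (t := s) hε ha0 hy.1.le hy.2.le) (h0 i))
      refine mul_le_mul h1 ?_ (by positivity) (by positivity)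
      calc _ ≤ 1 * ‖nullQuot (boost i f) s y‖ :=
            mul_le_mul_of_nonneg_right (hw1 s) (norm_nonneg _)
        _ ≤ _ := by rw [one_mul]; exact h3)
    hb
    (Eventually.of_forall fun s y hy => by
      refine ((hf.hasFDerivAt_nullQuot hε s (hne y hy)).const_mul (w s)).congr_fderiv ?_
      rw [Finset.smul_sum]
      refine Finset.sum_congr rfl fun i _ => ?_
      rw [smul_smul]
      congr 1
      ring)
  refine HasFDerivAt.congr_fderiv h ?_
  rw [integral_finsetSum _ fun i _ => (((hf.boost hε i).integrable_weighted hε hw hw1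
    hx).const_mul _).smul_const _]
  refine Finset.sum_congr rfl fun i _ => ?_
  rw [integral_smul_const, integral_const_mul, weightedInt]

theorem contDiffOn_norm_inv : ContDiffOn ℝ ∞ (fun x : E3 => ‖x‖⁻¹) {x | x ≠ 0} :=
  fun x hx => ((contDiffAt_norm ℝ hx).inv (norm_ne_zero_iff.2 hx)).contDiffWithinAt

theorem NullVanishing.contDiffOn_weightedInt (hε : 0 < ε) (hf : NullVanishing ε f) {w : ℝ → ℝ}
    (hw : Measurable w) (hw1 : ∀ s, |w s| ≤ 1) :
    ContDiffOn ℝ ∞ (weightedInt w f) {x | x ≠ 0} := by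
  refine contDiffOn_of_closed isOpen_ne (fun F => ∃ f, NullVanishing ε f ∧ F = weightedInt w f) ?_
    ⟨f, hf, rfl⟩
  rintro F ⟨f, hf, rfl⟩
  refine ⟨3, fun i (x : E3) => ‖x‖⁻¹ • (EuclideanSpace.proj i : E3 →L[ℝ] ℝ),
    fun i => weightedInt w (boost i f), fun i => ?_, fun i => ⟨_, hf.boost hε i, rfl⟩,
    fun x hx => ?_⟩
  · exact contDiffOn_norm_inv.smul contDiffOn_const
  · refine (hf.hasFDerivAt_weightedInt hε hw hw1 hx).congr_fderiv ?_
    simp only [smul_smul, mul_comm]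

/-- `∫ s⁻¹ (∫ δ(s - x·l) f) ds`. -/
def tailInt (f : M → ℝ) (x : E3) : ℝ := ∫ s, nullQuot f s x

theorem tailInt_eq (f : M → ℝ) : tailInt f = weightedInt (fun _ => 1) f := by
  funext x
  simp [tailInt, weightedInt]

theorem NullVanishing.contDiffOn_tailInt (hε : 0 < ε) (hf : NullVanishing ε f) :
    ContDiffOn ℝ ∞ (tailInt f) {x | x ≠ 0} := by
  rw [tailInt_eq]
  exact hf.contDiffOn_weightedInt hε measurable_const (by simp)

theorem NullVanishing.hasFDerivAt_tailInt (hε : 0 < ε) (hf : NullVanishing ε f) {x : E3}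
    (hx : x ≠ 0) : HasFDerivAt (tailInt f) (∑ i : Fin 3,
      (‖x‖⁻¹ * tailInt (boost i f) x) • (EuclideanSpace.proj i : E3 →L[ℝ] ℝ)) x := by
  simp only [tailInt_eq]
  exact hf.hasFDerivAt_weightedInt hε measurable_const (by simp) hx

/-- `½ ∫ sgn(s - τ) τ⁻¹ (∫ δ(τ - x·l) f) dτ`. -/
def profInt (f : M → ℝ) (s : ℝ) (x : E3) : ℝ :=
  (∫ τ in Iic s, nullQuot f τ x) - 1 / 2 * tailInt f x

theorem NullVanishing.profInt_eq_sign (hε : 0 < ε) (hf : NullVanishing ε f) (s : ℝ) {x : E3}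
    (hx : x ≠ 0) : 1 / 2 * ∫ τ, Real.sign (s - τ) * nullQuot f τ x = profInt f s x := by
  have hi := hf.integrable_nullQuot hε hx
  rw [profInt, ← integral_indicator measurableSet_Iic, tailInt, ← integral_const_mul,
    ← integral_const_mul, ← integral_sub (hi.indicator measurableSet_Iic) (hi.const_mul _)]
  refine integral_congr_ae ?_
  have hne : ∀ᵐ τ : ℝ, τ ≠ s := by simp [ae_iff, measure_singleton]
  filter_upwards [hne] with τ hτ
  rcases lt_or_gt_of_ne hτ with h | h
  · rw [Real.sign_of_pos (by linarith), indicator_of_mem (by exact h.le)]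
    ring
  · rw [Real.sign_of_neg (by linarith), indicator_of_notMem (by simpa using h)]
    ring

theorem NullVanishing.profInt_eq (hε : 0 < ε) (hf : NullVanishing ε f) (s : ℝ) {x : E3}
    (hx : x ≠ 0) : profInt f s x = weightedInt ((Iic 0).indicator fun _ => 1) f x
      + s * (∫ u in (0 : ℝ)..1, nullQuot f (u * s) x) - 1 / 2 * tailInt f x := by
  have hi := hf.integrable_nullQuot hε hx
  have h1 : s * (∫ u in (0 : ℝ)..1, nullQuot f (u * s) x) = ∫ τ in (0 : ℝ)..s, nullQuot f τ x := by
    have := intervalIntegral.smul_integral_comp_mul_right (a := 0) (b := 1)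
      (fun τ => nullQuot f τ x) s
    simpa using this
  have h2 : weightedInt ((Iic 0).indicator fun _ => 1) f x = ∫ τ in Iic (0 : ℝ), nullQuot f τ x := by
    rw [weightedInt, ← integral_indicator measurableSet_Iic]
    congr 1
    funext τ
    by_cases h : τ ∈ Iic (0 : ℝ) <;> simp [indicator, h]
  rw [h1, h2, ← intervalIntegral.integral_Iic_sub_Iic hi.integrableOn hi.integrableOn, profInt]
  ring

theorem NullVanishing.contDiffOn_profInt (hε : 0 < ε) (hf : NullVanishing ε f) :
    ContDiffOn ℝ ∞ (fun p : ℝ × E3 => profInt f p.1 p.2) {p | p.2 ≠ 0} := by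
  have h1 : ContDiffOn ℝ ∞ (fun p : ℝ × E3 => weightedInt ((Iic 0).indicator fun _ => 1) f p.2)
      {p | p.2 ≠ 0} := by
    refine (hf.contDiffOn_weightedInt hε (measurable_const.indicator measurableSet_Iic)
      fun s => ?_).comp contDiffOn_snd fun p hp => hp
    by_cases h : s ∈ Iic (0 : ℝ) <;> simp [indicator, h]
  have h2 : ContDiffOn ℝ ∞ (fun p : ℝ × E3 => tailInt f p.2) {p | p.2 ≠ 0} :=
    (hf.contDiffOn_tailInt hε).comp contDiffOn_snd fun p hp => hp
  have h3 : ContDiffOn ℝ ∞ (fun p : ℝ × E3 => ∫ u in (0 : ℝ)..1, nullQuot f (u * p.1) p.2)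
      {p | p.2 ≠ 0} := by
    refine contDiffOn_infty.2 fun n => ?_
    refine contDiffOn_integral_unit isOpen_snd_ne n
      (G := fun q : ℝ × ℝ × E3 => nullQuot f (q.1 * q.2.1) q.2.2) ?_
    refine (contDiffOn_nullQuot hε hf.decays).comp
      (f := fun q : ℝ × ℝ × E3 => (q.1 * q.2.1, q.2.2)) ?_ fun q hq => hq.2
    exact ContDiff.contDiffOn (by fun_prop)
  refine ((h1.add (contDiffOn_fst.mul h3)).sub ((contDiffOn_const (c := (1 / 2 : ℝ))).mul h2)).congr fun p hp => ?_
  exact hf.profInt_eq hε p.1 hp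

theorem NullVanishing.hasDerivAt_profInt (hε : 0 < ε) (hf : NullVanishing ε f) (s : ℝ) {x : E3}
    (hx : x ≠ 0) : HasDerivAt (fun s => profInt f s x) (nullQuot f s x) s := by
  have hi := hf.integrable_nullQuot hε hx
  have hc := continuous_nullQuot hε hf.decays hx
  have h1 := intervalIntegral.integral_hasDerivAt_right (a := 0) (b := s)
    (hc.intervalIntegrable _ _) (hc.stronglyMeasurableAtFilter _ _) hc.continuousAt
  have h2 := (h1.const_add (∫ τ in Iic (0 : ℝ), nullQuot f τ x)).sub_const (1 / 2 * tailInt f x)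
  refine h2.congr_of_eventuallyEq (Eventually.of_forall fun s => ?_)
  simp only [profInt]
  rw [← intervalIntegral.integral_Iic_sub_Iic hi.integrableOn hi.integrableOn]
  ring

theorem NullVanishing.tendsto_profInt_atTop (hε : 0 < ε) (hf : NullVanishing ε f) {x : E3}
    (hx : x ≠ 0) : Tendsto (fun s => profInt f s x) atTop (𝓝 (1 / 2 * tailInt f x)) := by
  have hi := hf.integrable_nullQuot hε hx
  have h1 := (aecover_Iic (μ := volume) (l := atTop) tendsto_id).integral_tendsto_of_countably_generated hi
  have h2 := h1.sub_const (1 / 2 * tailInt f x)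
  rw [show 1 / 2 * tailInt f x = (∫ τ, nullQuot f τ x) - 1 / 2 * tailInt f x by rw [tailInt]; ring]
  exact h2

theorem NullVanishing.tendsto_profInt_atBot (hε : 0 < ε) (hf : NullVanishing ε f) {x : E3}
    (hx : x ≠ 0) : Tendsto (fun s => profInt f s x) atBot (𝓝 (-(1 / 2 * tailInt f x))) := by
  have hi := hf.integrable_nullQuot hε hx
  have h1 := (aecover_Ioi (μ := volume) (l := atBot) tendsto_id).integral_tendsto_of_countably_generated hi
  have h2 := h1.const_sub (1 / 2 * tailInt f x)
  rw [show -(1 / 2 * tailInt f x) = 1 / 2 * tailInt f x - (∫ τ, nullQuot f τ x) by rw [tailInt]; ring]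
  refine h2.congr fun s => ?_
  have h3 := intervalIntegral.integral_Iic_add_Ioi (b := s) hi.integrableOn hi.integrableOn
  simp only [profInt, tailInt, id] at h3 ⊢
  linarith

theorem nullQuot_add (hε : 0 < ε) (hf : Decays (3 + ε) f) (hg : Decays (3 + ε) g) (s : ℝ) {x : E3}
    (hx : x ≠ 0) : nullQuot (fun z => f z + g z) s x = nullQuot f s x + nullQuot g s x := by
  have h : ∀ {f : M → ℝ}, Decays (3 + ε) f →
      IntervalIntegrable (fun u => nullInt (pd 0 f) (u * s) x) volume 0 1 := fun hf => by
    have := continuous_nullInt (by linarith) (hf.pd 0) hx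
    exact Continuous.intervalIntegrable (by fun_prop) _ _
  simp only [nullQuot]
  rw [← mul_add, ← intervalIntegral.integral_add (h hf) (h hg), pd_add hf.smooth hg.smooth]
  congr 2
  funext u
  exact nullInt_add (by linarith) (hf.pd 0) (hg.pd 0) _ _

theorem nullQuot_const_mul (hf : ContDiff ℝ ∞ f) (c s : ℝ) (x : E3) :
    nullQuot (fun z => c * f z) s x = c * nullQuot f s x := by
  simp only [nullQuot, pd_const_mul hf, nullInt_const_mul, intervalIntegral.integral_const_mul]
  ring

theorem NullVanishing.tailInt_add (hε : 0 < ε) (hf : NullVanishing ε f) (hg : NullVanishing ε g)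
    {x : E3} (hx : x ≠ 0) : tailInt (fun z => f z + g z) x = tailInt f x + tailInt g x := by
  simp only [tailInt, nullQuot_add hε hf.decays hg.decays _ hx]
  exact integral_add (hf.integrable_nullQuot hε hx) (hg.integrable_nullQuot hε hx)

theorem tailInt_const_mul (hf : ContDiff ℝ ∞ f) (c : ℝ) (x : E3) :
    tailInt (fun z => c * f z) x = c * tailInt f x := by
  simp only [tailInt, nullQuot_const_mul hf, integral_const_mul]

theorem profInt_smul (f : M → ℝ) {μ : ℝ} (hμ : 0 < μ) (s : ℝ) (x : E3) :
    profInt f (μ * s) (μ • x) = μ⁻¹ * profInt f s x := by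
  have h1 : ∀ F : ℝ → ℝ, ∫ τ, F τ = μ * ∫ τ, F (μ * τ) := by
    intro F
    rw [Measure.integral_comp_mul_left, abs_of_pos (inv_pos.2 hμ), smul_eq_mul,
      mul_inv_cancel_left₀ hμ.ne']
  simp only [profInt, tailInt, ← integral_indicator measurableSet_Iic]
  rw [h1 ((Iic (μ * s)).indicator _), h1 (fun τ => nullQuot f τ (μ • x))]
  have h2 : ∀ τ, (Iic (μ * s)).indicator (fun τ => nullQuot f τ (μ • x)) (μ * τ)
      = (μ ^ 2)⁻¹ * (Iic s).indicator (fun τ => nullQuot f τ x) τ := by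
    intro τ
    by_cases h : τ ≤ s
    · rw [indicator_of_mem (by exact mul_le_mul_of_nonneg_left h hμ.le), indicator_of_mem (by exact h),
        nullQuot_smul f hμ]
    · rw [indicator_of_notMem (by simpa [hμ] using h), indicator_of_notMem (by simpa using h), mul_zero]
  simp only [h2, nullQuot_smul f hμ, integral_const_mul]
  field_simp

end

/-! ### Functions on the cone -/

theorem coneExtend_comp_spatial_eventuallyEq (h : E3 → ℝ) (l : Cone) :
    coneExtend (fun k : Cone => h (spatial k)) =ᶠ[𝓝 (l : M)] fun x => h (spatial x) := by
  filter_upwards [isOpen_coneDomain.mem_nhds l.mem_domain] with x hx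
  rw [coneExtend_of_mem _ hx]
  exact congrArg h (spatial_mkVec _ _)

theorem coneDeriv_comp_spatial {h : E3 → ℝ} {l : Cone} {L : E3 →L[ℝ] ℝ}
    (hh : HasFDerivAt h L (spatial l)) (a b : Fin 4) :
    coneDeriv a b (fun k : Cone => h (spatial k)) l
      = L (spatial (lower l a • EuclideanSpace.single b 1 - lower l b • EuclideanSpace.single a 1)) := by
  rw [coneDeriv, (coneExtend_comp_spatial_eventuallyEq h l).fderiv_eq]
  have h1 : HasFDerivAt (fun x : M => h (spatial x)) (L.comp spatialL) (l : M) :=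
    HasFDerivAt.comp (l : M) (f := spatial) hh spatialL.hasFDerivAt
  rw [h1.fderiv]
  rfl

/-- The covariant components of `(1, x/|x|)`. -/
def conormal (x : E3) : Fin 4 → ℝ := Fin.cons 1 fun i => -(x i / ‖x‖)

@[simp] theorem conormal_zero (x : E3) : conormal x 0 = 1 := rfl

@[simp] theorem conormal_succ (x : E3) (i : Fin 3) : conormal x i.succ = -(x i / ‖x‖) := rfl

@[simp] theorem lower_zero (x : M) : lower x 0 = x 0 := by simp [lower]

@[simp] theorem lower_succ (x : M) (i : Fin 3) : lower x i.succ = -x i.succ := by simp [lower]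

theorem Cone.spatial_ne_zero (l : Cone) : spatial l ≠ 0 := l.mem_domain

theorem Cone.lower_eq (l : Cone) (a : Fin 4) :
    lower l a = ‖spatial l‖ * conormal (spatial l) a := by
  have h0 : ‖spatial l‖ ≠ 0 := norm_ne_zero_iff.2 l.spatial_ne_zero
  refine Fin.cases ?_ (fun i => ?_) a
  · rw [lower_zero, l.norm_spatial, conormal_zero, mul_one]
  · rw [lower_succ, conormal_succ, spatial_apply]
    field_simp

theorem coneDeriv_comp_spatial_sum {h : E3 → ℝ} {l : Cone} {D : Fin 3 → ℝ}
    (hh : HasFDerivAt h (∑ i, (‖spatial l‖⁻¹ * D i) • (EuclideanSpace.proj i : E3 →L[ℝ] ℝ))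
      (spatial l)) (a b : Fin 4) :
    coneDeriv a b (fun k : Cone => h (spatial k)) l
      = ∑ i : Fin 3, ((if b = i.succ then conormal (spatial l) a else 0)
        - if a = i.succ then conormal (spatial l) b else 0) * D i := by
  have h0 : ‖spatial l‖ ≠ 0 := norm_ne_zero_iff.2 l.spatial_ne_zero
  rw [coneDeriv_comp_spatial hh]
  simp only [_root_.sum_apply, _root_.smul_apply]
  refine Finset.sum_congr rfl fun i _ => ?_
  simp [l.lower_eq, eq_comm]
  split_ifs <;> field_simp <;> ring

/-- The smallest family containing the functions `nullQuot f` and closed under linear combinations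
and multiplication by the components of `x/|x|`. -/
inductive ConeFamily (ε : ℝ) : (ℝ → E3 → ℝ) → Prop
  | base {f : M → ℝ} (hf : NullVanishing ε f) : ConeFamily ε (nullQuot f)
  | add {g h : ℝ → E3 → ℝ} (hg : ConeFamily ε g) (hh : ConeFamily ε h) :
      ConeFamily ε fun s x => g s x + h s x
  | const_mul (c : ℝ) {h : ℝ → E3 → ℝ} (hh : ConeFamily ε h) : ConeFamily ε fun s x => c * h s x
  | dir_mul (j : Fin 3) {h : ℝ → E3 → ℝ} (hh : ConeFamily ε h) :
      ConeFamily ε fun s x => x j / ‖x‖ * h s x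

theorem abs_dir_le (x : E3) (j : Fin 3) : |x j / ‖x‖| ≤ 1 := by
  rw [abs_div, abs_norm]
  exact div_le_one_of_le₀ (PiLp.norm_apply_le x j) (norm_nonneg _)

theorem ConeFamily.bound {ε : ℝ} (hε : 0 < ε) {h : ℝ → E3 → ℝ} (hh : ConeFamily ε h) :
    ∃ C, 0 ≤ C ∧ ∀ s x, x ≠ 0 → |h s x| ≤ C / (‖x‖ ^ 2 * (1 + |s| / ‖x‖) ^ (1 + ε)) := by
  induction hh with
  | base hf => exact hf.nullQuot_bound hε
  | add _ _ ih ih' =>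
    obtain ⟨C, h0, hC⟩ := ih
    obtain ⟨C', h0', hC'⟩ := ih'
    refine ⟨C + C', by positivity, fun s x hx => ?_⟩
    rw [add_div]
    exact (abs_add_le _ _).trans (add_le_add (hC s x hx) (hC' s x hx))
  | const_mul c _ ih =>
    obtain ⟨C, h0, hC⟩ := ih
    refine ⟨|c| * C, by positivity, fun s x hx => ?_⟩
    rw [abs_mul, mul_div_assoc]
    exact mul_le_mul_of_nonneg_left (hC s x hx) (abs_nonneg c)
  | dir_mul j _ ih =>
    obtain ⟨C, h0, hC⟩ := ih
    refine ⟨C, h0, fun s x hx => ?_⟩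
    rw [abs_mul]
    exact (mul_le_of_le_one_left (abs_nonneg _) (abs_dir_le x j)).trans (hC s x hx)

theorem hasFDerivAt_dir (j : Fin 3) {x : E3} (hx : x ≠ 0) :
    HasFDerivAt (fun x : E3 => x j / ‖x‖) (∑ i : Fin 3,
      (‖x‖⁻¹ * ((if i = j then 1 else 0) - x i / ‖x‖ * (x j / ‖x‖))) •
        (EuclideanSpace.proj i : E3 →L[ℝ] ℝ)) x := by
  have h0 : ‖x‖ ≠ 0 := norm_ne_zero_iff.2 hx
  have h1 := ((EuclideanSpace.proj j : E3 →L[ℝ] ℝ).hasFDerivAt (x := x)).mul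
    ((hasDerivAt_inv h0).comp_hasFDerivAt x (hasFDerivAt_norm_E3 hx))
  have h2 : HasFDerivAt (fun x : E3 => x j / ‖x‖) _ x := h1
  refine h2.congr_fderiv ?_
  refine ContinuousLinearMap.ext fun v => ?_
  have h3 : inner ℝ x v = ∑ i, x i * v i := by
    rw [PiLp.inner_apply]
    refine Finset.sum_congr rfl fun i _ => ?_
    simp [mul_comm]
  simp [h3, Fin.sum_univ_three, mul_sub, sub_mul]
  fin_cases j <;> simp <;> field_simp <;> ring

theorem ConeFamily.hasFDerivAt {ε : ℝ} (hε : 0 < ε) {h : ℝ → E3 → ℝ} (hh : ConeFamily ε h) :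
    ∃ D : Fin 3 → ℝ → E3 → ℝ, (∀ i, ConeFamily ε (D i)) ∧ ∀ s x, x ≠ 0 →
      HasFDerivAt (h s) (∑ i, (‖x‖⁻¹ * D i s x) • (EuclideanSpace.proj i : E3 →L[ℝ] ℝ)) x := by
  induction hh with
  | base hf => exact ⟨fun i => nullQuot (boost i _), fun i => .base (hf.boost hε i),
      fun s x hx => hf.hasFDerivAt_nullQuot hε s hx⟩
  | add _ _ ih ih' =>
    obtain ⟨D, hD, hd⟩ := ih
    obtain ⟨D', hD', hd'⟩ := ih'
    refine ⟨fun i s x => D i s x + D' i s x, fun i => (hD i).add (hD' i), fun s x hx => ?_⟩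
    refine ((hd s x hx).add (hd' s x hx)).congr_fderiv ?_
    simp only [mul_add, add_smul, Finset.sum_add_distrib]
  | const_mul c _ ih =>
    obtain ⟨D, hD, hd⟩ := ih
    refine ⟨fun i s x => c * D i s x, fun i => (hD i).const_mul c, fun s x hx => ?_⟩
    refine ((hd s x hx).const_mul c).congr_fderiv ?_
    simp only [Finset.smul_sum, smul_smul]
    exact Finset.sum_congr rfl fun i _ => by congr 1; ring
  | @dir_mul j h hh ih =>
    obtain ⟨D, hD, hd⟩ := ih
    refine ⟨fun i s x => x j / ‖x‖ * D i s x + ((if i = j then 1 else 0) * h s x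
      + (-1) * (x i / ‖x‖ * (x j / ‖x‖ * h s x))), fun i => ((hD i).dir_mul j).add
        ((hh.const_mul _).add ((hh.dir_mul j).dir_mul i |>.const_mul (-1))), fun s x hx => ?_⟩
    refine ((hasFDerivAt_dir j hx).mul (hd s x hx)).congr_fderiv ?_
    rw [Finset.smul_sum, Finset.smul_sum, ← Finset.sum_add_distrib]
    refine Finset.sum_congr rfl fun i _ => ?_
    rw [smul_smul, smul_smul, ← add_smul]
    congr 1
    ring

theorem ConeFamily.zero_mul {ε : ℝ} {h : ℝ → E3 → ℝ} (hh : ConeFamily ε h) :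
    ConeFamily ε fun _ _ => 0 := by
  simpa using hh.const_mul 0

theorem ConeFamily.conormal_mul {ε : ℝ} {h : ℝ → E3 → ℝ} (hh : ConeFamily ε h) (a : Fin 4) :
    ConeFamily ε fun s x => conormal x a * h s x := by
  refine Fin.cases ?_ (fun i => ?_) a
  · simpa using hh
  · simpa using (hh.dir_mul i).const_mul (-1)

protected theorem ConeFamily.coneDeriv {ε : ℝ} (hε : 0 < ε) {h : ℝ → E3 → ℝ} (hh : ConeFamily ε h)
    (a b : Fin 4) : ∃ h', ConeFamily ε h' ∧ ∀ s (l : Cone),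
      coneDeriv a b (fun k : Cone => h s (spatial k)) l = h' s (spatial l) := by
  obtain ⟨D, hD, hd⟩ := hh.hasFDerivAt hε
  have ht : ∀ i : Fin 3, ConeFamily ε fun s x => ((if b = i.succ then conormal x a else 0)
        - if a = i.succ then conormal x b else 0) * D i s x := by
    intro i
    have h1 : ConeFamily ε fun s x => (if b = i.succ then conormal x a else 0) * D i s x := by
      split_ifs
      · exact (hD i).conormal_mul a
      · simpa using (hD i).zero_mul
    have h2 : ConeFamily ε fun s x => (if a = i.succ then conormal x b else 0) * D i s x := by
      split_ifs
      · exact (hD i).conormal_mul b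
      · simpa using (hD i).zero_mul
    have h3 := h1.add (h2.const_mul (-1))
    refine (congrArg (ConeFamily ε) ?_).mp h3
    funext s x
    ring
  refine ⟨_, ((ht 0).add (ht 1)).add (ht 2), fun s l => ?_⟩
  rw [coneDeriv_comp_spatial_sum (hd s _ l.spatial_ne_zero), Fin.sum_univ_three]

protected theorem ConeFamily.coneDerivs {ε : ℝ} (hε : 0 < ε) {h : ℝ → E3 → ℝ} (hh : ConeFamily ε h)
    (I : List (Fin 4 × Fin 4)) : ∃ h', ConeFamily ε h' ∧ ∀ s (l : Cone),
      coneDerivs I (fun k : Cone => h s (spatial k)) l = h' s (spatial l) := by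
  induction I with
  | nil => exact ⟨h, hh, fun _ _ => rfl⟩
  | cons p I ih =>
    obtain ⟨h', hh', he⟩ := ih
    obtain ⟨h'', hh'', he'⟩ := hh'.coneDeriv hε p.1 p.2
    refine ⟨h'', hh'', fun s l => ?_⟩
    rw [← he' s l]
    change coneDeriv p.1 p.2 (coneDerivs I _) l = _
    congr 1
    funext k
    exact he s k

theorem mdot_eq (x y : M) : mdot x y = x 0 * y 0 - inner ℝ (spatial x) (spatial y) := by
  rw [PiLp.inner_apply, Fin.sum_univ_three]
  simp [mdot]
  ring

theorem IsUnitFuture.norm_lt {t : M} (ht : IsUnitFuture t) : ‖spatial t‖ < t 0 := by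
  have h1 := ht.1
  rw [mdot_eq, real_inner_self_eq_norm_sq] at h1
  refine (sq_lt_sq₀ (norm_nonneg _) ht.2.le).1 ?_
  nlinarith

theorem IsUnitFuture.falloff_le {t : M} (ht : IsUnitFuture t) {ε : ℝ} (hε : 0 < ε) :
    ∃ C, 0 ≤ C ∧ ∀ (s : ℝ) (l : Cone), 1 / (‖spatial l‖ ^ 2 * (1 + |s| / ‖spatial l‖) ^ (1 + ε))
      ≤ C / (mdot t l ^ 2 * (1 + |s| / mdot t l) ^ (1 + ε)) := by
  set c := t 0 - ‖spatial t‖ with hc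
  have hc0 : 0 < c := by linarith [ht.norm_lt]
  refine ⟨(2 * t 0) ^ 2 * (1 + c⁻¹) ^ (1 + ε), by positivity, fun s l => ?_⟩
  have hm := ht.mdot_pos l
  have hr : 0 < ‖spatial l‖ := norm_pos_iff.2 l.spatial_ne_zero
  set r := ‖spatial l‖ with hrdef
  set m := mdot t l with hmdef
  have h1 : |inner ℝ (spatial t) (spatial l)| ≤ ‖spatial t‖ * r := abs_real_inner_le_norm _ _
  rw [abs_le] at h1
  have h2 : m = t 0 * r - inner ℝ (spatial t) (spatial l) := by
    rw [hmdef, mdot_eq, ← l.norm_spatial]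
  have h3 : c * r ≤ m := by rw [h2, hc]; linarith
  have h4 : m ≤ 2 * t 0 * r := by
    have := mul_le_mul_of_nonneg_right ht.norm_lt.le hr.le
    linarith
  rw [div_le_div_iff₀ (by positivity) (by positivity), one_mul]
  have h5 : 1 + |s| / m ≤ (1 + c⁻¹) * (1 + |s| / r) := by
    have h6 : |s| / m ≤ c⁻¹ * (|s| / r) := by
      calc |s| / m ≤ |s| / (c * r) := by gcongr
        _ = _ := by field_simp
    have h7 : 0 ≤ |s| / r := by positivity
    have h8 : 0 < c⁻¹ := by positivity
    nlinarith
  calc m ^ 2 * (1 + |s| / m) ^ (1 + ε) ≤ (2 * t 0 * r) ^ 2 * ((1 + c⁻¹) * (1 + |s| / r)) ^ (1 + ε) := by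
        gcongr
    _ = _ := by
        rw [Real.mul_rpow (by positivity) (by positivity)]
        ring

theorem ConeFamily.falloff {ε : ℝ} (hε : 0 < ε) {h : ℝ → E3 → ℝ} (hh : ConeFamily ε h) {t : M}
    (ht : IsUnitFuture t) (k : ℕ) : ∃ C, 0 ≤ C ∧ ∀ I : List (Fin 4 × Fin 4), I.length = k →
      ∀ (s : ℝ) (l : Cone), |coneDerivs I (fun k : Cone => h s (spatial k)) l|
        ≤ C / (mdot t l ^ 2 * (1 + |s| / mdot t l) ^ (1 + ε)) := by
  obtain ⟨B, hB0, hB⟩ := ht.falloff_le hε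
  have h1 : ∀ I : List (Fin 4 × Fin 4), ∃ C, 0 ≤ C ∧ ∀ (s : ℝ) (l : Cone),
      |coneDerivs I (fun k : Cone => h s (spatial k)) l|
        ≤ C / (mdot t l ^ 2 * (1 + |s| / mdot t l) ^ (1 + ε)) := by
    intro I
    obtain ⟨h', hh', he⟩ := hh.coneDerivs hε I
    obtain ⟨C, hC0, hC⟩ := hh'.bound hε
    refine ⟨C * B, by positivity, fun s l => ?_⟩
    rw [he]
    refine (hC s _ l.spatial_ne_zero).trans ?_
    rw [div_eq_mul_one_div, mul_div_assoc]
    exact mul_le_mul_of_nonneg_left (hB s l) hC0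
  choose C hC0 hC using h1
  obtain ⟨D, hD⟩ := ((List.finite_length_eq (Fin 4 × Fin 4) k).image C).bddAbove
  refine ⟨max D 0, le_max_right _ _, fun I hI s l => (hC I s l).trans ?_⟩
  have hm := ht.mdot_pos l
  gcongr
  exact (hD (mem_image_of_mem C hI)).trans (le_max_left _ _)

/-! ### The profile of a current -/

theorem integral_M_apply {X : Type*} [MeasurableSpace X] {μ : Measure X} {F : X → M}
    (h : ∀ a, Integrable (fun t => F t a) μ) (a : Fin 4) : (∫ t, F t ∂μ) a = ∫ t, F t a ∂μ := by
  have hF : Integrable F μ := by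
    have : F = fun t => ∑ a, F t a • EuclideanSpace.single a (1 : ℝ) :=
      funext fun t => M.sum_single (F t)
    rw [this]
    exact integrable_finsetSum _ fun a _ => (h a).smul_const _
  exact ((EuclideanSpace.proj a : M →L[ℝ] ℝ).integral_comp_comm hF).symm

theorem tendsto_M {X : Type*} {F : X → M} {L : Filter X} {v : M}
    (h : ∀ a, Tendsto (fun t => F t a) L (𝓝 (v a))) : Tendsto F L (𝓝 v) := by
  have h1 : Tendsto (fun t => ∑ a, F t a • EuclideanSpace.single a (1 : ℝ)) L
      (𝓝 (∑ a, v a • EuclideanSpace.single a (1 : ℝ))) :=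
    tendsto_finsetSum _ fun a _ => (h a).smul_const _
  rw [← M.sum_single v] at h1
  exact h1.congr fun t => (M.sum_single (F t)).symm

theorem hasDerivAt_M {F : ℝ → M} {v : M} {s : ℝ} (h : ∀ a, HasDerivAt (fun t => F t a) (v a) s) :
    HasDerivAt F v s := by
  have h1 : HasDerivAt (fun t => ∑ a, F t a • EuclideanSpace.single a (1 : ℝ))
      (∑ a, v a • EuclideanSpace.single a (1 : ℝ)) s :=
    HasDerivAt.fun_sum fun a _ => (h a).smul_const _
  rw [← M.sum_single v] at h1
  exact h1.congr_of_eventuallyEq (Eventually.of_forall fun t => M.sum_single (F t))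

/-- The components of `H₃ J`. -/
def eulComp (J : M → M) (a : Fin 4) : M → ℝ := eul 3 fun x => J x a

theorem Cone.planePt_eq (l : Cone) (s : ℝ) (y : E3) :
    mkVec ((s + inner ℝ (spatial l) y) / (l : M) 0) y = planePt s (spatial l) y := by
  rw [planePt, l.norm_spatial]

section

variable {ε : ℝ} {J : M → M}

theorem currentV0_apply (hε : 0 < ε) (hJ : ContDiff ℝ ∞ J)
    (hd : ∀ a, Decays (3 + ε) (eulComp J a)) (s : ℝ) (l : Cone) (a : Fin 4) :
    currentV0 J s l a = nullInt (eulComp J a) s (spatial l) := by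
  rw [currentV0, nullPlaneIntegral, PiLp.smul_apply, integral_M_apply, nullInt, l.norm_spatial,
    smul_eq_mul]
  · congr 1
    refine integral_congr_ae (Eventually.of_forall fun y => ?_)
    simp only [dilation_component hJ, l.planePt_eq]
    rfl
  · intro b
    simp only [dilation_component hJ, l.planePt_eq]
    exact (hd b).integrable_planePt (by linarith) s _

theorem ae_ne (s : ℝ) : ∀ᵐ τ : ℝ, τ ≠ s := by simp [ae_iff, measure_singleton]

theorem currentProfile_apply (hε : 0 < ε) (hJ : ContDiff ℝ ∞ J)
    (hn : ∀ a, NullVanishing ε (eulComp J a)) (s : ℝ) (l : Cone) (a : Fin 4) :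
    currentProfile J s l a = profInt (eulComp J a) s (spatial l) := by
  have he : ∀ b, (fun τ => (Real.sign (s - τ) • τ⁻¹ • (currentV0 J τ l - currentV0 J 0 l)) b)
      =ᵐ[volume] fun τ => Real.sign (s - τ) * nullQuot (eulComp J b) τ (spatial l) := by
    intro b
    filter_upwards [ae_ne 0] with τ hτ
    rw [(hn b).nullQuot_eq hε hτ l.spatial_ne_zero]
    simp only [PiLp.smul_apply, PiLp.sub_apply, smul_eq_mul,
      currentV0_apply hε hJ fun a => (hn a).decays, (hn b).zero _ l.spatial_ne_zero, sub_zero]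
  have hs : Measurable fun τ : ℝ => Real.sign (s - τ) := by
    have : (fun τ : ℝ => Real.sign (s - τ)) = fun τ =>
        if s - τ < 0 then (-1 : ℝ) else if 0 < s - τ then 1 else 0 := rfl
    rw [this]
    refine Measurable.ite (measurableSet_lt (by fun_prop) (by fun_prop)) measurable_const ?_
    exact Measurable.ite (measurableSet_lt (by fun_prop) (by fun_prop)) measurable_const
      measurable_const
  have hs1 : ∀ τ : ℝ, |Real.sign (s - τ)| ≤ 1 := fun τ => by
    rcases Real.sign_apply_eq (s - τ) with h | h | h <;> simp [h]
  rw [currentProfile, PiLp.smul_apply, integral_M_apply, smul_eq_mul, integral_congr_ae (he a)]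
  · exact (hn a).profInt_eq_sign hε s l.spatial_ne_zero
  · exact fun b => ((hn b).integrable_weighted hε hs hs1 l.spatial_ne_zero).congr (he b).symm

theorem sDeriv_currentProfile (hε : 0 < ε) (hJ : ContDiff ℝ ∞ J)
    (hn : ∀ a, NullVanishing ε (eulComp J a)) (s : ℝ) (l : Cone) (a : Fin 4) :
    sDeriv (currentProfile J) s l a = nullQuot (eulComp J a) s (spatial l) := by
  have h : HasDerivAt (fun τ => currentProfile J τ l)
      (WithLp.toLp 2 fun b => nullQuot (eulComp J b) s (spatial l)) s := by
    refine hasDerivAt_M fun b => ?_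
    simp only [currentProfile_apply hε hJ hn]
    exact (hn b).hasDerivAt_profInt hε s l.spatial_ne_zero
  rw [sDeriv, h.deriv]

theorem tendsto_currentProfile (hε : 0 < ε) (hJ : ContDiff ℝ ∞ J)
    (hn : ∀ a, NullVanishing ε (eulComp J a)) (l : Cone) :
    Tendsto (fun s => currentProfile J s l) atTop
      (𝓝 ((1 / 2 : ℝ) • (WithLp.toLp 2 fun a => tailInt (eulComp J a) (spatial l)))) ∧
    Tendsto (fun s => currentProfile J s l) atBot
      (𝓝 (-((1 / 2 : ℝ) • (WithLp.toLp 2 fun a => tailInt (eulComp J a) (spatial l))))) := by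
  constructor
  · refine tendsto_M fun a => ?_
    simp only [currentProfile_apply hε hJ hn]
    simpa using (hn a).tendsto_profInt_atTop hε l.spatial_ne_zero
  · refine tendsto_M fun a => ?_
    simp only [currentProfile_apply hε hJ hn]
    simpa using (hn a).tendsto_profInt_atBot hε l.spatial_ne_zero

theorem tail_currentProfile (hε : 0 < ε) (hJ : ContDiff ℝ ∞ J)
    (hn : ∀ a, NullVanishing ε (eulComp J a)) (l : Cone) (a : Fin 4) :
    tail (currentProfile J) l a = tailInt (eulComp J a) (spatial l) := by
  rw [tail_eq_of_tendsto (tendsto_currentProfile hε hJ hn l).1]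

/-- `∂·(H₃ J) = H₄ (∂·J)`, for a conserved `J`. -/
theorem IsConserved.sum_pd_eulComp (hJ : ContDiff ℝ ∞ J) (hc : IsConserved J) (x : M) :
    ∑ a, pd a (eulComp J a) x = 0 := by
  have hcomp : ∀ a, ContDiff ℝ ∞ fun x => J x a := contDiff_component hJ
  have h0 : (fun x => ∑ a, pd a (fun x => J x a) x) = fun _ => 0 := by
    funext x
    rw [← hc x]
    refine Finset.sum_congr rfl fun a _ => ?_
    have h1 : HasFDerivAt (fun x => J x a) ((EuclideanSpace.proj a : M →L[ℝ] ℝ).comp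
      (fderiv ℝ J x)) x := (EuclideanSpace.proj a : M →L[ℝ] ℝ).hasFDerivAt.comp x
        ((hJ.differentiable (by simp)) x).hasFDerivAt
    rw [pd, h1.fderiv]
    rfl
  have h2 : ∀ a, pd a (eulComp J a) x = fderiv ℝ (pd a fun x => J x a) x x
      + 4 * pd a (fun x => J x a) x := by
    intro a
    rw [eulComp, pd_eul (hcomp a), eul]
    norm_num
  have h3 : fderiv ℝ (fun x => ∑ a, pd a (fun x => J x a) x) x x
      = ∑ a, fderiv ℝ (pd a fun x => J x a) x x := by
    rw [fderiv_fun_sum fun a _ => smooth_diffAt (contDiff_pd (hcomp a) a) x]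
    simp
  simp only [h2]
  rw [Finset.sum_add_distrib, ← h3, ← Finset.mul_sum, h0]
  simp [congrFun h0 x]

theorem sum_nullInt_pd {f : Fin 4 → M → ℝ} {κ : ℝ} (hκ : 2 < κ) (hf : ∀ a, Decays κ (f a))
    (hdiv : ∀ x, ∑ a, pd a (f a) x = 0) (s : ℝ) {x : E3} (hx : x ≠ 0) :
    ‖x‖ * nullInt (pd 0 (f 0)) s x - ∑ i : Fin 3, x i * nullInt (pd 0 (f i.succ)) s x = 0 := by
  have h0 : ‖x‖ ≠ 0 := norm_ne_zero_iff.2 hx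
  have h1 : ∀ i : Fin 3, x i * nullInt (pd 0 (f i.succ)) s x
      = -(‖x‖ * nullInt (pd i.succ (f i.succ)) s x) := by
    intro i
    rw [nullInt_pd_succ hκ (hf i.succ)]
    field_simp
  have hd : ∀ a, Decays (κ + 1) (pd a (f a)) := fun a => (hf a).pd a
  have h2 : nullInt (fun x => pd 0 (f 0) x + (pd 1 (f 1) x + (pd 2 (f 2) x + pd 3 (f 3) x))) s x
      = 0 := by
    have : (fun x => pd 0 (f 0) x + (pd 1 (f 1) x + (pd 2 (f 2) x + pd 3 (f 3) x)))
        = fun _ => 0 := by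
      funext z
      have := hdiv z
      rw [Fin.sum_univ_four] at this
      linarith
    rw [this]
    simp [nullInt]
  have hκ' : 3 < κ + 1 := by linarith
  rw [nullInt_add hκ' (hd 0) ((hd 1).add ((hd 2).add (hd 3))),
    nullInt_add hκ' (hd 1) ((hd 2).add (hd 3)), nullInt_add hκ' (hd 2) (hd 3)] at h2
  simp only [h1, Fin.sum_univ_three]
  simp only [Fin.succ_zero_eq_one, Fin.succ_one_eq_two, show Fin.succ (2 : Fin 3) = 3 from rfl]
  linear_combination ‖x‖ * h2

theorem sum_nullQuot {f : Fin 4 → M → ℝ} (hε : 0 < ε) (hf : ∀ a, Decays (3 + ε) (f a))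
    (hdiv : ∀ x, ∑ a, pd a (f a) x = 0) (s : ℝ) {x : E3} (hx : x ≠ 0) :
    ‖x‖ * nullQuot (f 0) s x - ∑ i : Fin 3, x i * nullQuot (f i.succ) s x = 0 := by
  have hi : ∀ a, IntervalIntegrable (fun u => nullInt (pd 0 (f a)) (u * s) x) volume 0 1 := by
    intro a
    have := continuous_nullInt (by linarith) ((hf a).pd 0) hx
    exact Continuous.intervalIntegrable (by fun_prop) _ _
  have h1 : ∫ u in (0 : ℝ)..1, (‖x‖ * nullInt (pd 0 (f 0)) (u * s) x
      - ∑ i : Fin 3, x i * nullInt (pd 0 (f i.succ)) (u * s) x) = 0 := by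
    simp only [sum_nullInt_pd (by linarith) hf hdiv _ hx]
    simp
  have hi2 : ∀ i : Fin 3, IntervalIntegrable
      (fun u => x i * nullInt (pd 0 (f i.succ)) (u * s) x) volume 0 1 :=
    fun i => (hi i.succ).const_mul _
  have hi3 : IntervalIntegrable
      (fun u => ∑ i : Fin 3, x i * nullInt (pd 0 (f i.succ)) (u * s) x) volume 0 1 := by
    refine Continuous.intervalIntegrable (continuous_finsetSum _ fun i _ => ?_) _ _
    have := continuous_nullInt (by linarith) ((hf i.succ).pd 0) hx
    fun_prop
  rw [intervalIntegral.integral_sub ((hi 0).const_mul _) hi3,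
    intervalIntegral.integral_finsetSum fun i _ => hi2 i] at h1
  simp only [intervalIntegral.integral_const_mul] at h1
  simp only [nullQuot]
  calc _ = ‖x‖⁻¹ * (‖x‖ * (∫ u in (0 : ℝ)..1, nullInt (pd 0 (f 0)) (u * s) x)
        - ∑ i : Fin 3, x i * ∫ u in (0 : ℝ)..1, nullInt (pd 0 (f i.succ)) (u * s) x) := by
        rw [mul_sub, Finset.mul_sum]
        congr 1
        · ring
        · exact Finset.sum_congr rfl fun i _ => by ring
    _ = 0 := by rw [h1, mul_zero]

/-- The profile of a conserved current is orthogonal to `l`. -/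
theorem mdot_currentProfile (hε : 0 < ε) (hJ : ContDiff ℝ ∞ J)
    (hn : ∀ a, NullVanishing ε (eulComp J a)) (hc : IsConserved J) (s : ℝ) (l : Cone) :
    mdot l (currentProfile J s l) = 0 := by
  set x := spatial (l : M) with hxdef
  have hx : x ≠ 0 := l.spatial_ne_zero
  have hm : ∀ s, mdot l (currentProfile J s l) = ‖x‖ * profInt (eulComp J 0) s x
      - ∑ i : Fin 3, x i * profInt (eulComp J i.succ) s x := by
    intro s
    rw [mdot_eq, PiLp.inner_apply, l.norm_spatial]
    simp [currentProfile_apply hε hJ hn, mul_comm, hxdef]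
  have hd : ∀ s, HasDerivAt (fun s => ‖x‖ * profInt (eulComp J 0) s x
      - ∑ i : Fin 3, x i * profInt (eulComp J i.succ) s x) 0 s := by
    intro s
    rw [← sum_nullQuot hε (fun a => (hn a).decays) (hc.sum_pd_eulComp hJ) s hx]
    exact (((hn 0).hasDerivAt_profInt hε s hx).const_mul _).sub
      (HasDerivAt.fun_sum fun i _ => ((hn i.succ).hasDerivAt_profInt hε s hx).const_mul _)
  have hconst := fun s t => is_const_of_deriv_eq_zero (fun s => (hd s).differentiableAt)
    (fun s => (hd s).deriv) s t
  have h1 := ((((hn 0).tendsto_profInt_atTop hε hx).const_mul ‖x‖).sub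
    (tendsto_finsetSum Finset.univ fun i _ =>
      ((hn (Fin.succ i)).tendsto_profInt_atTop hε hx).const_mul (x i))).congr fun t => hconst t s
  have h2 := ((((hn 0).tendsto_profInt_atBot hε hx).const_mul ‖x‖).sub
    (tendsto_finsetSum Finset.univ fun i _ =>
      ((hn (Fin.succ i)).tendsto_profInt_atBot hε hx).const_mul (x i))).congr fun t => hconst t s
  have h3 := tendsto_nhds_unique tendsto_const_nhds h1
  have h4 := tendsto_nhds_unique tendsto_const_nhds h2
  rw [hm]
  simp only [mul_neg, Finset.sum_neg_distrib] at h4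
  linarith

theorem contDiff_spatial : ContDiff ℝ ∞ spatial := spatialL.contDiff

/-- The profile of a conserved current belongs to `𝒱_ε` if its tail is curl free. -/
theorem isProfile_currentProfile (hε : 0 < ε) (hJ : ContDiff ℝ ∞ J)
    (hn : ∀ a, NullVanishing ε (eulComp J a)) (hc : IsConserved J)
    (hcurl : IsCurlFree (tail (currentProfile J))) : IsProfile ε (currentProfile J) where
  smooth := by
    refine contDiffOn_euclidean.2 fun a => ?_
    have h1 := ((hn a).contDiffOn_profInt hε).comp
      (s := (univ : Set ℝ) ×ˢ coneDomain) (f := fun p : ℝ × M => (p.1, spatial p.2))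
      (contDiff_fst.prodMk (contDiff_spatial.comp contDiff_snd)).contDiffOn fun p hp => hp.2
    refine h1.congr fun p hp => ?_
    rw [coneExtend_of_mem _ hp.2, currentProfile_apply hε hJ hn]
    simp [Cone.ofSpace]
  homog μ hμ s l := by
    ext a
    rw [PiLp.smul_apply, currentProfile_apply hε hJ hn, currentProfile_apply hε hJ hn,
      smul_eq_mul, ← profInt_smul _ hμ]
    congr 1
    exact map_smul spatialL μ (l : M)
  orthog := mdot_currentProfile hε hJ hn hc
  falloff t ht k := by
    choose C hC0 hC using fun a => (ConeFamily.base (hn a)).falloff hε ht k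
    refine ⟨∑ a, C a, fun I hI a s l => ?_⟩
    simp only [sDeriv_currentProfile hε hJ hn]
    refine (hC a I hI s l).trans ?_
    have hm := ht.mdot_pos l
    gcongr
    exact Finset.single_le_sum (f := C) (fun b _ => hC0 b) (Finset.mem_univ a)
  limits l := by
    have h : tail (currentProfile J) l
        = WithLp.toLp 2 fun a => tailInt (eulComp J a) (spatial l) :=
      tail_eq_of_tendsto (tendsto_currentProfile hε hJ hn l).1
    rw [h]
    exact tendsto_currentProfile hε hJ hn l
  smooth_tail := by
    refine contDiffOn_euclidean.2 fun a => ?_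
    have h1 := ((hn a).contDiffOn_tailInt hε).comp (s := coneDomain) (f := spatial)
      contDiff_spatial.contDiffOn fun p hp => hp
    refine h1.congr fun p hp => ?_
    rw [coneExtend_of_mem _ hp, tail_currentProfile hε hJ hn]
    simp [Cone.ofSpace]
  closed := hcurl

theorem IsHomTestField.oddHom {W : Set M} (h : IsHomTestField 3 ε W J) {Jas : M → M}
    (has : HasAsymptote 3 J Jas) (hodd : ∀ x, x ≠ 0 → Jas (-x) = -Jas x) (a : Fin 4) :
    OddHom ε fun x => J x a := by
  refine ⟨contDiff_component h.1 a, h.decays_eul a, fun x => Jas x a, fun x hx => ?_, fun x hx => ?_⟩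
  · have := ((EuclideanSpace.proj a : M →L[ℝ] ℝ).continuous.tendsto _).comp (has x hx)
    refine this.congr fun R => ?_
    simp
  · simp [hodd x hx]

theorem IsHomTestField.nullVanishing (hε : 0 < ε) {W : Set M} (h : IsHomTestField 3 ε W J)
    {Jas : M → M} (has : HasAsymptote 3 J Jas) (hodd : ∀ x, x ≠ 0 → Jas (-x) = -Jas x)
    (a : Fin 4) : NullVanishing ε (eulComp J a) :=
  (h.oddHom has hodd a).nullVanishing hε

end

/-! ### Asymptotes of scalar functions -/

/-- The asymptote `lim R^κ f(R x)`. -/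
def asym (κ : ℝ) (f : M → ℝ) (x : M) : ℝ := limUnder atTop fun R : ℝ => R ^ κ * f (R • x)

/-- Smooth functions with `(x·∂ + κ) f ∈ 𝒮_{κ+ε}`. -/
structure AsymHom (κ ε : ℝ) (f : M → ℝ) : Prop where
  nonneg : 0 ≤ κ
  smooth : ContDiff ℝ ∞ f
  decays : Decays (κ + ε) (eul κ f)

theorem OddHom.asymHom {ε : ℝ} {f : M → ℝ} (h : OddHom ε f) : AsymHom 3 ε f :=
  ⟨by norm_num, h.smooth, h.decays⟩

section

variable {κ ε : ℝ} {f : M → ℝ}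

protected theorem AsymHom.pd (h : AsymHom κ ε f) (a : Fin 4) : AsymHom (κ + 1) ε (pd a f) := by
  refine ⟨by linarith [h.nonneg], contDiff_pd h.smooth a, ?_⟩
  have := h.decays.pd a
  rw [pd_eul h.smooth] at this
  exact this.mono (by linarith)

theorem AsymHom.tendsto (hε : 0 < ε) (h : AsymHom κ ε f) {x : M} (hx : x ≠ 0) :
    Tendsto (fun R : ℝ => R ^ κ * f (R • x)) atTop (𝓝 (asym κ f x)) := by
  obtain ⟨C, h0, hC⟩ := abs_rescale_sub_le h.nonneg hε h.smooth h.decays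
  have hlim : Tendsto (fun r : ℝ => C * ‖x‖ ^ (-(κ + ε)) * r ^ (-ε)) atTop (𝓝 0) := by
    simpa using (tendsto_rpow_neg_atTop hε).const_mul (C * ‖x‖ ^ (-(κ + ε)))
  have hc : CauchySeq fun R : ℝ => R ^ κ * f (R • x) := by
    refine Metric.cauchySeq_iff'.2 fun η hη => ?_
    obtain ⟨N, hN, hN1⟩ := ((hlim.eventually (gt_mem_nhds hη)).and (eventually_ge_atTop 1)).exists
    exact ⟨N, fun n hn => (hC x hx N n (by linarith) hn).trans_lt hN⟩
  obtain ⟨c, hc⟩ := cauchySeq_tendsto_of_complete hc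
  rwa [asym, hc.limUnder_eq]

theorem AsymHom.abs_asym_sub_le (hε : 0 < ε) (h : AsymHom κ ε f) :
    ∃ C, 0 ≤ C ∧ ∀ x : M, x ≠ 0 → ∀ r : ℝ, 0 < r →
      |asym κ f x - r ^ κ * f (r • x)| ≤ C * ‖x‖ ^ (-(κ + ε)) * r ^ (-ε) := by
  obtain ⟨C, h0, hC⟩ := abs_rescale_sub_le h.nonneg hε h.smooth h.decays
  refine ⟨C, h0, fun x hx r hr => ?_⟩
  refine le_of_tendsto ((h.tendsto hε hx).sub_const _).abs ?_
  filter_upwards [eventually_ge_atTop r] with R hR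
  exact hC x hx r R hr hR

theorem AsymHom.eq_asym (hε : 0 < ε) (h : AsymHom κ ε f) {x : M} (hx : x ≠ 0) {c : ℝ}
    (hc : Tendsto (fun R : ℝ => R ^ κ * f (R • x)) atTop (𝓝 c)) : asym κ f x = c :=
  tendsto_nhds_unique (h.tendsto hε hx) hc

theorem AsymHom.asym_smul (hε : 0 < ε) (h : AsymHom κ ε f) {x : M} (hx : x ≠ 0) {r : ℝ}
    (hr : 0 < r) : asym κ f (r • x) = r ^ (-κ) * asym κ f x := by
  refine h.eq_asym hε (smul_ne_zero hr.ne' hx) ?_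
  have h1 : Tendsto (fun R : ℝ => R * r) atTop atTop := tendsto_id.atTop_mul_const hr
  refine (((h.tendsto hε hx).comp h1).const_mul (r ^ (-κ))).congr' ?_
  filter_upwards [eventually_gt_atTop 0] with R hR
  simp only [Function.comp, smul_smul]
  rw [Real.mul_rpow hR.le hr.le, Real.rpow_neg hr.le]
  have := (Real.rpow_pos_of_pos hr κ).ne'
  field_simp

theorem AsymHom.tendstoLocallyUniformlyOn (hε : 0 < ε) (h : AsymHom κ ε f) :
    TendstoLocallyUniformlyOn (fun (R : ℝ) (x : M) => R ^ κ * f (R • x)) (asym κ f) atTop {0}ᶜ := by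
  obtain ⟨C, h0, hC⟩ := h.abs_asym_sub_le hε
  refine Metric.tendstoLocallyUniformlyOn_iff.2 fun η hη x hx => ?_
  have hx : x ≠ 0 := hx
  have hx' : 0 < ‖x‖ / 2 := by positivity
  have hlim : Tendsto (fun r : ℝ => C * (‖x‖ / 2) ^ (-(κ + ε)) * r ^ (-ε)) atTop (𝓝 0) := by
    simpa using (tendsto_rpow_neg_atTop hε).const_mul (C * (‖x‖ / 2) ^ (-(κ + ε)))
  refine ⟨{y | ‖x‖ / 2 < ‖y‖}, mem_nhdsWithin_of_mem_nhds
    ((isOpen_lt continuous_const continuous_norm).mem_nhds (by simpa using hx)), ?_⟩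
  filter_upwards [hlim.eventually (gt_mem_nhds hη), eventually_gt_atTop 0] with R hR hR0 y hy
  have hy0 : y ≠ 0 := norm_pos_iff.1 (hx'.trans hy)
  refine ((hC y hy0 R hR0).trans ?_).trans_lt hR
  have := rpow_neg_le_of_le (κ := κ + ε) (by linarith [h.nonneg]) hx' (le_of_lt hy)
  gcongr

theorem AsymHom.hasFDerivAt (hε : 0 < ε) (h : AsymHom κ ε f) {x : M} (hx : x ≠ 0) :
    HasFDerivAt (asym κ f) (∑ a, asym (κ + 1) (pd a f) x •
      (EuclideanSpace.proj a : M →L[ℝ] ℝ)) x := by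
  have hu : TendstoLocallyUniformlyOn (fun (R : ℝ) (x : M) => ∑ a,
      (R ^ (κ + 1) * pd a f (R • x)) • (EuclideanSpace.proj a : M →L[ℝ] ℝ))
      (fun x => ∑ a, asym (κ + 1) (pd a f) x • (EuclideanSpace.proj a : M →L[ℝ] ℝ))
      atTop {0}ᶜ := by
    have h1 : ∀ a, TendstoLocallyUniformlyOn (fun (R : ℝ) (x : M) =>
        (R ^ (κ + 1) * pd a f (R • x)) • (EuclideanSpace.proj a : M →L[ℝ] ℝ))
        (fun x => asym (κ + 1) (pd a f) x • (EuclideanSpace.proj a : M →L[ℝ] ℝ))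
        atTop {0}ᶜ := fun a =>
      (((ContinuousLinearMap.id ℝ ℝ).smulRight (EuclideanSpace.proj a : M →L[ℝ] ℝ)).uniformContinuous
        ).comp_tendstoLocallyUniformlyOn ((h.pd a).tendstoLocallyUniformlyOn hε)
    simp only [Fin.sum_univ_four]
    exact (((h1 0).add (h1 1)).add (h1 2)).add (h1 3)
  have hu' := tendstoLocallyUniformlyOn_iff_filter.1 hu x hx
  rw [isOpen_compl_singleton.nhdsWithin_eq hx] at hu'
  refine hasFDerivAt_of_tendstoUniformlyOnFilter (𝕜 := ℝ) hu'
    (f := fun R x => R ^ κ * f (R • x)) ?_ (by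
      filter_upwards [isOpen_ne.mem_nhds hx] with y hy
      exact h.tendsto hε hy)
  filter_upwards [(eventually_gt_atTop (0 : ℝ)).prod_inl (𝓝 x)] with q hR
  obtain ⟨R, y⟩ := q
  have hR : 0 < R := hR
  have h1 := (hasFDerivAt_pd h.smooth (g := fun y : M => R • y) (p := y)
    ((hasFDerivAt_id y).const_smul R)).const_mul (R ^ κ)
  refine h1.congr_fderiv (ContinuousLinearMap.ext fun v => ?_)
  simp [fderiv_eq_sum_pd, Finset.mul_sum, Real.rpow_add_one hR.ne']
  refine Finset.sum_congr rfl fun a _ => ?_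
  ring

theorem AsymHom.pd_asym (hε : 0 < ε) (h : AsymHom κ ε f) {x : M} (hx : x ≠ 0) (a : Fin 4) :
    pd a (asym κ f) x = asym (κ + 1) (pd a f) x := by
  rw [pd, (h.hasFDerivAt hε hx).fderiv]
  simp

theorem AsymHom.contDiffOn (hε : 0 < ε) (h : AsymHom κ ε f) :
    ContDiffOn ℝ ∞ (asym κ f) {0}ᶜ := by
  refine contDiffOn_of_closed isOpen_compl_singleton
    (fun F => ∃ κ f, AsymHom κ ε f ∧ F = asym κ f) ?_ ⟨κ, f, h, rfl⟩
  rintro F ⟨κ, f, h, rfl⟩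
  exact ⟨4, fun a _ => EuclideanSpace.proj a, fun a => asym (κ + 1) (pd a f),
    fun a => contDiffOn_const, fun a => ⟨_, _, h.pd a, rfl⟩, fun x hx => h.hasFDerivAt hε hx⟩

end

/-! ### Boosts and rotations -/

/-- The generator of rotations `x^i ∂_j - x^j ∂_i`. -/
def rot (i j : Fin 3) (f : M → ℝ) : M → ℝ := fun x =>
  x i.succ * pd j.succ f x - x j.succ * pd i.succ f x

theorem boost_comm {f : M → ℝ} (hf : ContDiff ℝ ∞ f) (i j : Fin 3) :
    rot i j f = fun x => boost i (boost j f) x - boost j (boost i f) x := by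
  funext x
  have hc : ∀ (a b c : Fin 4), pd a (fun x => x b * pd c f x) = fun x =>
      x b * pd a (pd c f) x + (if a = b then 1 else 0) * pd c f x := fun a b c =>
    pd_coord_mul (contDiff_pd hf c) a b
  have hb : ∀ (a : Fin 4) (i : Fin 3), pd a (boost i f) x =
      (x i.succ * pd a (pd 0 f) x + (if a = i.succ then 1 else 0) * pd 0 f x)
      + (x 0 * pd a (pd i.succ f) x + (if a = 0 then 1 else 0) * pd i.succ f x) := by
    intro a i
    have := pd_add ((contDiff_coord i.succ).mul (contDiff_pd hf 0))
      ((contDiff_coord 0).mul (contDiff_pd hf i.succ)) a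
    rw [hc, hc] at this
    exact congrFun this x
  simp only [boost, rot] at hb ⊢
  rw [hb, hb, hb, hb, pd_comm hf i.succ 0, pd_comm hf j.succ 0, pd_comm hf j.succ i.succ]
  have e1 : (if (0 : Fin 4) = i.succ then (1 : ℝ) else 0) = 0 := if_neg (Fin.succ_ne_zero i).symm
  have e2 : (if (0 : Fin 4) = j.succ then (1 : ℝ) else 0) = 0 := if_neg (Fin.succ_ne_zero j).symm
  have e3 : (if i.succ = (0 : Fin 4) then (1 : ℝ) else 0) = 0 := if_neg (Fin.succ_ne_zero i)
  have e4 : (if j.succ = (0 : Fin 4) then (1 : ℝ) else 0) = 0 := if_neg (Fin.succ_ne_zero j)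
  have e5 : (if i.succ = j.succ then (1 : ℝ) else 0) = if j.succ = i.succ then 1 else 0 := by
    simp only [eq_comm]
  rw [e1, e2, e3, e4, e5, if_pos rfl]
  ring

theorem contDiff_rot {f : M → ℝ} (hf : ContDiff ℝ ∞ f) (i j : Fin 3) : ContDiff ℝ ∞ (rot i j f) :=
  ((contDiff_coord _).mul (contDiff_pd hf _)).sub ((contDiff_coord _).mul (contDiff_pd hf _))

theorem eul_add {f g : M → ℝ} (hf : ContDiff ℝ ∞ f) (hg : ContDiff ℝ ∞ g) (κ : ℝ) :
    eul κ (fun x => f x + g x) = fun x => eul κ f x + eul κ g x := by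
  funext x
  simp only [eul_eq, pd_add hf hg, mul_add, Finset.sum_add_distrib]
  ring

theorem eul_sub {f g : M → ℝ} (hf : ContDiff ℝ ∞ f) (hg : ContDiff ℝ ∞ g) (κ : ℝ) :
    eul κ (fun x => f x - g x) = fun x => eul κ f x - eul κ g x := by
  funext x
  simp only [eul_eq, pd_sub hf hg, mul_sub, Finset.sum_sub_distrib]
  ring

theorem rot_eul {f : M → ℝ} (hf : ContDiff ℝ ∞ f) (κ : ℝ) (i j : Fin 3) :
    rot i j (eul κ f) = eul κ (rot i j f) := by
  have hb := contDiff_boost hf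
  rw [boost_comm (contDiff_eul hf κ), boost_comm hf, eul_sub (contDiff_boost (hb j) i)
    (contDiff_boost (hb i) j)]
  simp only [boost_eul hf, boost_eul (hb _)]

/-- Rotations act on integrals over null hyperplanes as tangential derivatives. -/
theorem nullInt_rot {κ : ℝ} (hκ : 3 < κ) {f : M → ℝ} (hf : Decays κ f) (s : ℝ) (x : E3)
    (i j : Fin 3) : nullInt (rot i j f) s x
      = x i / ‖x‖ * nullInt (boost j f) s x - x j / ‖x‖ * nullInt (boost i f) s x := by
  have hm : ∀ a, Decays (κ - 1) fun x => x a * f x := fun a =>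
    Decays.coord_mul (by simpa using hf) a
  have hd : ∀ a b, Decays κ fun x => x a * pd b f x := fun a b => (hf.pd b).coord_mul a
  have hδ : ∀ c : ℝ, Decays κ fun x => c * f x := hf.const_mul
  have hN : ∀ a b, nullInt (pd b fun x => x a * f x) s x
      = nullInt (fun x => x a * pd b f x) s x + (if b = a then 1 else 0) * nullInt f s x := by
    intro a b
    rw [pd_coord_mul hf.smooth b a, nullInt_add hκ (hd a b) (hδ _), nullInt_const_mul]
  have hp : ∀ a (k : Fin 3), nullInt (pd k.succ fun x => x a * f x) s x
      = -(x k / ‖x‖ * nullInt (pd 0 fun x => x a * f x) s x) := fun a k =>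
    nullInt_pd_succ (by linarith) (hm a) s x k
  have hb : ∀ k, nullInt (boost k f) s x
      = nullInt (fun x => x k.succ * pd 0 f x) s x + nullInt (fun x => x 0 * pd k.succ f x) s x :=
    fun k => nullInt_add hκ (hd _ _) (hd _ _) s x
  have hr : nullInt (rot i j f) s x = nullInt (fun x => x i.succ * pd j.succ f x) s x
      - nullInt (fun x => x j.succ * pd i.succ f x) s x := nullInt_sub hκ (hd _ _) (hd _ _) s x
  have h1 := hp i.succ j
  have h2 := hp j.succ i
  have h3 := hp 0 i
  have h4 := hp 0 j
  simp only [hN] at h1 h2 h3 h4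
  have e : (if j.succ = i.succ then (1 : ℝ) else 0) = if i.succ = j.succ then 1 else 0 := by
    simp only [eq_comm]
  have e1 : ∀ k : Fin 3, (if (0 : Fin 4) = k.succ then (1 : ℝ) else 0) = 0 := fun k =>
    if_neg (Fin.succ_ne_zero k).symm
  have e2 : ∀ k : Fin 3, (if k.succ = (0 : Fin 4) then (1 : ℝ) else 0) = 0 := fun k =>
    if_neg (Fin.succ_ne_zero k)
  simp only [e, e1, e2] at h1 h2 h3 h4
  rw [hr, hb, hb]
  linear_combination h1 - h2 + x j / ‖x‖ * h3 - x i / ‖x‖ * h4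

theorem NullVanishing.sub {ε : ℝ} (hε : 0 < ε) {f g : M → ℝ} (hf : NullVanishing ε f)
    (hg : NullVanishing ε g) : NullVanishing ε fun x => f x - g x :=
  ⟨hf.decays.sub hg.decays, fun x hx => by
    rw [nullInt_sub (by linarith) hf.decays hg.decays, hf.zero x hx, hg.zero x hx, sub_zero]⟩

protected theorem NullVanishing.rot {ε : ℝ} (hε : 0 < ε) {f : M → ℝ} (hf : NullVanishing ε f)
    (i j : Fin 3) : NullVanishing ε (rot i j f) := by
  rw [boost_comm hf.decays.smooth]
  exact ((hf.boost hε j).boost hε i).sub hε ((hf.boost hε i).boost hε j)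

/-- Linear relations between integrals over null hyperplanes carry over to `tailInt`. -/
theorem tailInt_eq_of_nullInt {ε : ℝ} (hε : 0 < ε) {f g h : M → ℝ} (hf : NullVanishing ε f)
    (hg : NullVanishing ε g) (hh : NullVanishing ε h) {x : E3} (hx : x ≠ 0) {b c : ℝ}
    (he : ∀ s, nullInt f s x = b * nullInt g s x + c * nullInt h s x) :
    tailInt f x = b * tailInt g x + c * tailInt h x := by
  simp only [tailInt]
  rw [← integral_const_mul, ← integral_const_mul, ← integral_add
    ((hg.integrable_nullQuot hε hx).const_mul _) ((hh.integrable_nullQuot hε hx).const_mul _)]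
  refine integral_congr_ae ?_
  filter_upwards [ae_ne 0] with s hs
  rw [hf.nullQuot_eq hε hs hx, hg.nullQuot_eq hε hs hx, hh.nullQuot_eq hε hs hx, he]
  ring

theorem NullVanishing.tailInt_rot {ε : ℝ} (hε : 0 < ε) {f : M → ℝ} (hf : NullVanishing ε f)
    (i j : Fin 3) {x : E3} (hx : x ≠ 0) : tailInt (rot i j f) x
      = x i / ‖x‖ * tailInt (boost j f) x
        - x j / ‖x‖ * tailInt (boost i f) x := by
  rw [tailInt_eq_of_nullInt hε (hf.rot hε i j) (hf.boost hε j) (hf.boost hε i) hx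
    (b := x i / ‖x‖) (c := -(x j / ‖x‖)) fun s => ?_]
  · ring
  · rw [nullInt_rot (by linarith) hf.decays]
    ring

/-! ### Oddness of asymptotes -/

theorem OddHom.asym_neg {ε : ℝ} (hε : 0 < ε) {f : M → ℝ} (h : OddHom ε f) {x : M} (hx : x ≠ 0) :
    asym 3 f (-x) = -asym 3 f x := by
  obtain ⟨φ, hφ, hodd⟩ := h.odd
  rw [h.asymHom.eq_asym hε hx (hφ x hx), h.asymHom.eq_asym hε (neg_ne_zero.2 hx)
    (hφ _ (neg_ne_zero.2 hx)), hodd x hx]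

theorem pd_neg_of_odd {h : M → ℝ} (hodd : ∀ x, x ≠ 0 → h (-x) = -h x) {x : M} (hx : x ≠ 0)
    (hd : DifferentiableAt ℝ h (-x)) (a : Fin 4) : pd a h (-x) = pd a h x := by
  have h1 : HasFDerivAt (fun y => -h (-y)) (-((fderiv ℝ h (-x)).comp (-ContinuousLinearMap.id ℝ M)))
      x := (hd.hasFDerivAt.comp x (hasFDerivAt_id x).neg).neg
  have h2 : h =ᶠ[𝓝 x] fun y => -h (-y) := by
    filter_upwards [isOpen_ne.mem_nhds hx] with y hy
    rw [hodd y hy, neg_neg]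
  simp [pd, h2.fderiv_eq, h1.fderiv]

theorem OddHom.asym_pd_neg {ε : ℝ} (hε : 0 < ε) {f : M → ℝ} (h : OddHom ε f) {x : M} (hx : x ≠ 0)
    (a : Fin 4) : asym (3 + 1) (pd a f) (-x) = asym (3 + 1) (pd a f) x := by
  have hx' : -x ≠ 0 := neg_ne_zero.2 hx
  rw [← h.asymHom.pd_asym hε hx, ← h.asymHom.pd_asym hε hx']
  exact pd_neg_of_odd (fun x hx => h.asym_neg hε hx) hx
    (h.asymHom.hasFDerivAt hε hx').differentiableAt a

theorem AsymHom.tendsto_coord_pd {ε κ : ℝ} (hε : 0 < ε) {f : M → ℝ} (h : AsymHom κ ε f) {x : M}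
    (hx : x ≠ 0) (a b : Fin 4) : Tendsto (fun R : ℝ => R ^ κ * ((R • x) a * pd b f (R • x)))
      atTop (𝓝 (x a * pd b (asym κ f) x)) := by
  rw [h.pd_asym hε hx]
  refine (((h.pd b).tendsto hε hx).const_mul (x a)).congr' ?_
  filter_upwards [eventually_gt_atTop 0] with R hR
  rw [Real.rpow_add_one hR.ne', PiLp.smul_apply, smul_eq_mul]
  ring

protected theorem OddHom.boost {ε : ℝ} (hε : 0 < ε) {f : M → ℝ} (h : OddHom ε f) (i : Fin 3) :
    OddHom ε (boost i f) := by
  refine ⟨contDiff_boost h.smooth i, ?_, boost i (asym 3 f), fun x hx => ?_, fun x hx => ?_⟩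
  · rw [← boost_eul h.smooth]
    exact h.decays.boost i
  · simp only [boost, mul_add]
    exact (h.asymHom.tendsto_coord_pd hε hx _ _).add (h.asymHom.tendsto_coord_pd hε hx _ _)
  · have hx' : -x ≠ 0 := neg_ne_zero.2 hx
    simp only [boost, h.asymHom.pd_asym hε hx, h.asymHom.pd_asym hε hx',
      h.asym_pd_neg hε hx]
    simp
    ring

theorem OddHom.add {ε : ℝ} {f g : M → ℝ} (hf : OddHom ε f) (hg : OddHom ε g) :
    OddHom ε fun x => f x + g x := by
  obtain ⟨φ, hφ, hφ'⟩ := hf.odd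
  obtain ⟨ψ, hψ, hψ'⟩ := hg.odd
  refine ⟨hf.smooth.add hg.smooth, ?_, fun x => φ x + ψ x, fun x hx => ?_, fun x hx => ?_⟩
  · rw [eul_add hf.smooth hg.smooth]
    exact hf.decays.add hg.decays
  · simpa only [mul_add] using (hφ x hx).add (hψ x hx)
  · simp only [hφ' x hx, hψ' x hx]
    ring

theorem OddHom.sub {ε : ℝ} {f g : M → ℝ} (hf : OddHom ε f) (hg : OddHom ε g) :
    OddHom ε fun x => f x - g x := by
  obtain ⟨φ, hφ, hφ'⟩ := hf.odd
  obtain ⟨ψ, hψ, hψ'⟩ := hg.odd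
  refine ⟨hf.smooth.sub hg.smooth, ?_, fun x => φ x - ψ x, fun x hx => ?_, fun x hx => ?_⟩
  · rw [eul_sub hf.smooth hg.smooth]
    exact hf.decays.sub hg.decays
  · simpa only [mul_sub] using (hφ x hx).sub (hψ x hx)
  · simp only [hφ' x hx, hψ' x hx]
    ring

protected theorem OddHom.rot {ε : ℝ} (hε : 0 < ε) {f : M → ℝ} (h : OddHom ε f) (i j : Fin 3) :
    OddHom ε (rot i j f) := by
  rw [boost_comm h.smooth]
  exact ((h.boost hε j).boost hε i).sub ((h.boost hε i).boost hε j)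

theorem AsymHom.asym_boost {ε κ : ℝ} (hε : 0 < ε) {f : M → ℝ} (h : AsymHom κ ε f) {x : M}
    (hx : x ≠ 0) (i : Fin 3) : Tendsto (fun R : ℝ => R ^ κ * boost i f (R • x)) atTop
      (𝓝 (boost i (asym κ f) x)) := by
  simp only [boost, mul_add]
  exact (h.tendsto_coord_pd hε hx _ _).add (h.tendsto_coord_pd hε hx _ _)

theorem AsymHom.asym_rot {ε κ : ℝ} (hε : 0 < ε) {f : M → ℝ} (h : AsymHom κ ε f) {x : M}
    (hx : x ≠ 0) (i j : Fin 3) : Tendsto (fun R : ℝ => R ^ κ * rot i j f (R • x)) atTop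
      (𝓝 (rot i j (asym κ f) x)) := by
  simp only [rot, mul_sub]
  exact (h.tendsto_coord_pd hε hx _ _).sub (h.tendsto_coord_pd hε hx _ _)

/-! ### Homogeneous currents -/

/-- Odd conserved currents, homogeneous of degree `-3`, with support in `|x⁰| ≤ δ |x⃗|`. -/
structure HomCurrent (δ : ℝ) (u : Fin 4 → M → ℝ) : Prop where
  smooth : ∀ a, ContDiffOn ℝ ∞ (u a) {0}ᶜ
  homog : ∀ a (r : ℝ) x, 0 < r → x ≠ 0 → u a (r • x) = r ^ (-3 : ℝ) * u a x
  odd : ∀ a x, x ≠ 0 → u a (-x) = -u a x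
  supp : ∀ a x, x ≠ 0 → δ * ‖spatial x‖ < |x 0| → u a x = 0
  div : ∀ x, x ≠ 0 → ∑ a, pd a (u a) x = 0

theorem mdot_eq_sum (x y : M) : mdot x y = ∑ a, lower x a * y a := by
  simp [mdot, lower, Fin.sum_univ_four]
  ring

theorem IsConserved.sum_pd {J : M → M} (hJ : ContDiff ℝ ∞ J) (hc : IsConserved J) (x : M) :
    ∑ a, pd a (fun x => J x a) x = 0 := by
  rw [← hc x]
  refine Finset.sum_congr rfl fun a _ => ?_
  have h1 : HasFDerivAt (fun x => J x a) ((EuclideanSpace.proj a : M →L[ℝ] ℝ).comp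
    (fderiv ℝ J x)) x := (EuclideanSpace.proj a : M →L[ℝ] ℝ).hasFDerivAt.comp x
      ((hJ.differentiable (by simp)) x).hasFDerivAt
  rw [pd, h1.fderiv]
  rfl

theorem spatial_smul (r : ℝ) (x : M) : spatial (r • x) = r • spatial x := map_smul spatialL r x

theorem asym_eq_zero_of_support {κ γ δ : ℝ} {f : M → ℝ}
    (hf : Function.support f ⊆ region γ δ) {x : M} (hx : δ * ‖spatial x‖ < |x 0|) :
    asym κ f x = 0 := by
  have h1 : Tendsto (fun R : ℝ => R * (|x 0| - δ * ‖spatial x‖)) atTop atTop :=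
    tendsto_id.atTop_mul_const (by linarith)
  refine Tendsto.limUnder_eq ((tendsto_congr' ?_).2 tendsto_const_nhds)
  filter_upwards [h1.eventually_gt_atTop γ, eventually_gt_atTop 0] with R hR hR0
  have h0 : f (R • x) = 0 := Function.notMem_support.1 fun h => ?_
  · rw [h0, mul_zero]
  have h2 : |(R • x) 0| ≤ γ + δ * ‖spatial (R • x)‖ := hf h
  rw [spatial_smul, norm_smul, Real.norm_eq_abs, PiLp.smul_apply, smul_eq_mul, abs_mul,
    abs_of_pos hR0] at h2
  linarith

theorem IsHomTestField.homCurrent {ε γ δ : ℝ} (hε : 0 < ε) {J Jas : M → M}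
    (h : IsHomTestField 3 ε (region γ δ) J) (hc : IsConserved J) (has : HasAsymptote 3 J Jas)
    (hodd : ∀ x, x ≠ 0 → Jas (-x) = -Jas x) : HomCurrent δ fun a => asym 3 fun x => J x a where
  smooth a := (h.oddHom has hodd a).asymHom.contDiffOn hε
  homog a r x hr hx := (h.oddHom has hodd a).asymHom.asym_smul hε hx hr
  odd a x hx := (h.oddHom has hodd a).asym_neg hε hx
  supp a x _ hx := by
    refine asym_eq_zero_of_support (fun y hy => h.2.1 ?_) hx
    intro h0
    rw [Function.mem_support] at hy
    exact hy (by simp [h0])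
  div x hx := by
    have h1 : ∀ a, AsymHom 3 ε fun x => J x a := fun a => (h.oddHom has hodd a).asymHom
    have h2 := tendsto_finsetSum Finset.univ fun a _ => ((h1 a).pd a).tendsto hε hx
    simp only [← Finset.mul_sum, hc.sum_pd h.1, mul_zero] at h2
    simp only [fun a => (h1 a).pd_asym hε hx a]
    exact tendsto_nhds_unique h2 tendsto_const_nhds

theorem pd_coord_mul_at {f : M → ℝ} {x : M} (hf : DifferentiableAt ℝ f x) (a b : Fin 4) :
    pd a (fun x => x b * f x) x = x b * pd a f x + (if a = b then 1 else 0) * f x := by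
  have h := ((EuclideanSpace.proj b : M →L[ℝ] ℝ).hasFDerivAt (x := x)).mul hf.hasFDerivAt
  have h' : HasFDerivAt (fun x : M => x b * f x) _ x := h
  simp [pd, h'.fderiv, eq_comm]

theorem pd_sub_at {f g : M → ℝ} {x : M} (hf : DifferentiableAt ℝ f x)
    (hg : DifferentiableAt ℝ g x) (a : Fin 4) :
    pd a (fun x => f x - g x) x = pd a f x - pd a g x := by
  simp [pd, fderiv_fun_sub hf hg]

/-- Euler's identity. -/
theorem fderiv_self_of_homog {κ : ℝ} {f : M → ℝ} {x : M} (hd : DifferentiableAt ℝ f x)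
    (hh : ∀ r : ℝ, 0 < r → f (r • x) = r ^ κ * f x) : fderiv ℝ f x x = κ * f x := by
  have h1 : HasDerivAt (fun r : ℝ => f (r • x)) (fderiv ℝ f x x) 1 := by
    have h2 : HasFDerivAt f (fderiv ℝ f x) ((fun r : ℝ => r • x) 1) := by
      simpa using hd.hasFDerivAt
    exact (h2.comp_hasDerivAt 1 ((hasDerivAt_id (1 : ℝ)).smul_const x)).congr_deriv (by simp)
  have h3 : HasDerivAt (fun r : ℝ => r ^ κ * f x) (κ * f x) 1 := by
    have := (Real.hasDerivAt_rpow_const (x := 1) (p := κ) (Or.inl one_ne_zero)).mul_const (f x)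
    simpa using this
  refine h1.unique (h3.congr_of_eventuallyEq ?_)
  filter_upwards [lt_mem_nhds (zero_lt_one' ℝ)] with r hr
  exact hh r hr

/-- The radial part `x·u / x²` of a current. -/
def radialPart (u : Fin 4 → M → ℝ) (x : M) : ℝ := (∑ a, lower x a * u a x) / mdot x x

/-- The part of a current orthogonal to `x`. -/
def tangentialPart (u : Fin 4 → M → ℝ) (a : Fin 4) (x : M) : ℝ := u a x - x a * radialPart u x

theorem mdot_self (x : M) : mdot x x = x 0 ^ 2 - ‖spatial x‖ ^ 2 := by
  rw [mdot_eq, real_inner_self_eq_norm_sq]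
  ring

theorem eq_zero_of_spatial {x : M} (h0 : x 0 = 0) (h : spatial x = 0) : x = 0 := by
  rw [← mkVec_spatial x, h0, h]
  exact map_zero mkVecL

namespace HomCurrent

variable {δ : ℝ} {u : Fin 4 → M → ℝ}

theorem supp_of_mdot (hδ' : δ < 1) (h : HomCurrent δ u) {x : M} (hx : x ≠ 0)
    (hm : 0 ≤ mdot x x) (a : Fin 4) : u a x = 0 := by
  refine h.supp a x hx ?_
  rw [mdot_self] at hm
  have h1 : ‖spatial x‖ ≤ |x 0| := by
    have := sq_le_sq.1 (show ‖spatial x‖ ^ 2 ≤ x 0 ^ 2 by linarith)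
    rwa [abs_norm] at this
  by_cases h2 : spatial x = 0
  · rw [h2, norm_zero, mul_zero, abs_pos]
    exact fun h0 => hx (eq_zero_of_spatial h0 h2)
  · have : 0 < ‖spatial x‖ := norm_pos_iff.2 h2
    nlinarith

theorem contDiffOn_radialPart (hδ' : δ < 1) (h : HomCurrent δ u) :
    ContDiffOn ℝ ∞ (radialPart u) {0}ᶜ := by
  intro x hx
  have hx : x ≠ 0 := hx
  refine ContDiffAt.contDiffWithinAt ?_
  by_cases hm : mdot x x = 0
  · have hc : ContinuousAt (fun x : M => |x 0| - δ * ‖spatial x‖) x :=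
      (Continuous.continuousAt (by have := spatialL.continuous; simp only [← spatialL_apply]; fun_prop))
    have h1 : 0 < |x 0| - δ * ‖spatial x‖ := by
      rw [mdot_self] at hm
      have h1 : ‖spatial x‖ = |x 0| := by
        rw [← abs_norm]
        exact (sq_eq_sq_iff_abs_eq_abs _ _).1 (by linarith)
      have h2 : 0 < |x 0| := abs_pos.2 fun h0 => hx (eq_zero_of_spatial h0 (by
        rw [h0, abs_zero] at h1
        exact norm_eq_zero.1 h1))
      rw [h1]
      nlinarith
    refine (contDiffAt_const (c := (0 : ℝ))).congr_of_eventuallyEq ?_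
    filter_upwards [hc.eventually (lt_mem_nhds h1), isOpen_ne.mem_nhds hx] with y hy hy0
    simp only [radialPart, fun a => h.supp a y hy0 (by linarith), mul_zero, Finset.sum_const_zero,
      zero_div]
  · have hl : ∀ c : Fin 4, ContDiff ℝ ∞ (fun x : M => lower x c) := by
      intro c
      unfold lower
      split_ifs <;> fun_prop
    refine ContDiffAt.div (ContDiffAt.sum fun a _ => ?_) ?_ hm
    · exact (hl a).contDiffAt.mul ((h.smooth a).contDiffAt (isOpen_compl_singleton.mem_nhds hx))
    · unfold mdot
      fun_prop

theorem radialPart_smul (h : HomCurrent δ u) {r : ℝ} (hr : 0 < r) {x : M} (hx : x ≠ 0) :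
    radialPart u (r • x) = r ^ (-4 : ℝ) * radialPart u x := by
  have h1 : mdot (r • x) (r • x) = r ^ 2 * mdot x x := by
    simp [mdot]
    ring
  have h2 : ∀ a, lower (r • x) a * u a (r • x) = r * r ^ (-3 : ℝ) * (lower x a * u a x) := by
    intro a
    rw [lower_smul, h.homog a r x hr hx]
    ring
  simp only [radialPart, h1, h2, ← Finset.mul_sum]
  rw [show (-4 : ℝ) = -3 - 1 by norm_num, Real.rpow_sub_one hr.ne']
  field_simp

theorem radialPart_neg (h : HomCurrent δ u) {x : M} (hx : x ≠ 0) :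
    radialPart u (-x) = radialPart u x := by
  have h1 : mdot (-x) (-x) = mdot x x := by simp [mdot]
  have h2 : ∀ a, lower (-x) a * u a (-x) = lower x a * u a x := by
    intro a
    rw [h.odd a x hx, ← neg_one_smul ℝ x, lower_smul]
    ring
  simp only [radialPart, h1, h2]

theorem radialPart_supp (h : HomCurrent δ u) {x : M} (hx : x ≠ 0)
    (hs : δ * ‖spatial x‖ < |x 0|) : radialPart u x = 0 := by
  simp only [radialPart, fun a => h.supp a x hx hs, mul_zero, Finset.sum_const_zero, zero_div]

theorem diffAt_radialPart (hδ' : δ < 1) (h : HomCurrent δ u) {x : M} (hx : x ≠ 0) :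
    DifferentiableAt ℝ (radialPart u) x :=
  ((h.contDiffOn_radialPart hδ').contDiffAt (isOpen_compl_singleton.mem_nhds hx)).differentiableAt
    (by simp)

theorem diffAt (h : HomCurrent δ u) (a : Fin 4) {x : M} (hx : x ≠ 0) :
    DifferentiableAt ℝ (u a) x :=
  ((h.smooth a).contDiffAt (isOpen_compl_singleton.mem_nhds hx)).differentiableAt (by simp)

theorem pd_tangentialPart (hδ' : δ < 1) (h : HomCurrent δ u) {x : M} (hx : x ≠ 0)
    (a b : Fin 4) : pd a (tangentialPart u b) x = pd a (u b) x
      - (x b * pd a (radialPart u) x + (if a = b then 1 else 0) * radialPart u x) := by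
  have hg := h.diffAt_radialPart hδ' hx
  have h1 : DifferentiableAt ℝ (fun x : M => x b * radialPart u x) x :=
    (EuclideanSpace.proj b : M →L[ℝ] ℝ).differentiableAt.mul hg
  rw [← pd_coord_mul_at hg, ← pd_sub_at (h.diffAt b hx) h1]
  rfl

protected theorem tangentialPart (hδ' : δ < 1) (h : HomCurrent δ u) :
    HomCurrent δ (tangentialPart u) where
  smooth a := (h.smooth a).sub (ContDiffOn.mul (by fun_prop) (h.contDiffOn_radialPart hδ'))
  homog a r x hr hx := by
    simp only [tangentialPart, h.homog a r x hr hx, h.radialPart_smul hr hx,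
      PiLp.smul_apply, smul_eq_mul]
    rw [show (-4 : ℝ) = -3 - 1 by norm_num, Real.rpow_sub_one hr.ne']
    field_simp
  odd a x hx := by
    simp only [tangentialPart, h.odd a x hx, h.radialPart_neg hx, PiLp.neg_apply]
    ring
  supp a x hx hs := by
    simp only [tangentialPart, h.supp a x hx hs, h.radialPart_supp hx hs]
    ring
  div x hx := by
    have hg := fderiv_self_of_homog (h.diffAt_radialPart hδ' hx)
      fun r hr => h.radialPart_smul hr hx
    rw [fderiv_eq_sum_pd] at hg
    simp only [h.pd_tangentialPart hδ' hx, if_true]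
    rw [Finset.sum_sub_distrib, h.div x hx, Finset.sum_add_distrib, hg]
    simp

theorem mdot_tangentialPart (hδ' : δ < 1) (h : HomCurrent δ u) {x : M} (hx : x ≠ 0) :
    ∑ a, lower x a * tangentialPart u a x = 0 := by
  have h1 : ∑ a, lower x a * tangentialPart u a x
      = ∑ a, lower x a * u a x - mdot x x * radialPart u x := by
    simp only [tangentialPart, mul_sub, Finset.sum_sub_distrib, mdot_eq_sum, Finset.sum_mul]
    congr 1
    exact Finset.sum_congr rfl fun a _ => by ring
  rw [h1]
  by_cases hm : mdot x x = 0
  · simp [hm, fun a => h.supp_of_mdot hδ' hx hm.ge a]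
  · rw [radialPart, mul_div_cancel₀ _ hm, sub_self]

/-- The dual of `x ∧ du` is not changed by the addition of a multiple of `x`. -/
theorem curl_tangentialPart (hδ' : δ < 1) (h : HomCurrent δ u) {x : M} (hx : x ≠ 0)
    (i j : Fin 3) :
    boost i (tangentialPart u j.succ) x - boost j (tangentialPart u i.succ) x
      + rot i j (tangentialPart u 0) x
    = boost i (u j.succ) x - boost j (u i.succ) x + rot i j (u 0) x := by
  simp only [boost, rot, h.pd_tangentialPart hδ' hx]
  have e1 : ∀ k : Fin 3, (if (0 : Fin 4) = k.succ then (1 : ℝ) else 0) = 0 := fun k =>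
    if_neg (Fin.succ_ne_zero k).symm
  have e2 : ∀ k : Fin 3, (if k.succ = (0 : Fin 4) then (1 : ℝ) else 0) = 0 := fun k =>
    if_neg (Fin.succ_ne_zero k)
  have e5 : (if i.succ = j.succ then (1 : ℝ) else 0) = if j.succ = i.succ then 1 else 0 := by
    simp only [eq_comm]
  rw [e1, e1, e2, e2, e5]
  ring

end HomCurrent

/-! ### The mean value of the radial part of an asymptote -/

theorem hasCompactSupport_comp_mkVec {f : M → ℝ} (hc : HasCompactSupport f) :
    HasCompactSupport fun p : ℝ × E3 => f (mkVec p.1 p.2) := by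
  obtain ⟨ρ, hρ⟩ := hc.isCompact.isBounded.subset_closedBall (0 : M)
  refine HasCompactSupport.intro (isCompact_closedBall (0 : ℝ × E3) ρ) fun p hp => ?_
  refine image_eq_zero_of_notMem_tsupport (f := f) fun h => hp ?_
  have h1 := hρ h
  rw [mem_closedBall_zero_iff] at h1 ⊢
  exact le_trans (norm_prod_le_iff.2 ⟨abs_le_norm_mkVec p.1 p.2, norm_le_norm_mkVec p.1 p.2⟩) h1

theorem integral_pd_eq_zero {f : M → ℝ} (hf : ContDiff ℝ ∞ f) (hc : HasCompactSupport f)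
    (a : Fin 4) : ∫ p : ℝ × E3, pd a f (mkVec p.1 p.2) = 0 := by
  let v : ℝ × E3 := ((EuclideanSpace.single a 1 : M) 0, spatial (EuclideanSpace.single a 1))
  have hv : mkVecL v = EuclideanSpace.single a 1 :=
    mkVec_spatial (EuclideanSpace.single a 1)
  let F : ℝ × E3 → ℝ := fun p => f (mkVecL p)
  have hF : ContDiff ℝ ∞ F := hf.comp mkVecL.contDiff
  have hFc : HasCompactSupport F := hasCompactSupport_comp_mkVec hc
  have hd : ∀ p, fderiv ℝ F p v = pd a f (mkVec p.1 p.2) := by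
    intro p
    have h1 : HasFDerivAt F ((fderiv ℝ f (mkVecL p)).comp mkVecL) p :=
      ((hf.differentiable (by simp)) _).hasFDerivAt.comp p mkVecL.hasFDerivAt
    rw [h1.fderiv, ContinuousLinearMap.comp_apply, hv]
    rfl
  have hF' : Integrable (fun p => fderiv ℝ F p v)
      ((volume : Measure ℝ).prod (volume : Measure E3)) :=
    ((hF.continuous_fderiv (by simp)).clm_apply continuous_const).integrable_of_hasCompactSupport
      (hFc.fderiv_apply ℝ v)
  have key := integral_mul_fderiv_eq_neg_fderiv_mul_of_integrable 
    (μ := (volume : Measure ℝ).prod (volume : Measure E3))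
    (f := fun _ => (1 : ℝ)) (g := F) (v := v) (by simp) (by simpa using hF')
    (by simpa using hF.continuous.integrable_of_hasCompactSupport hFc)
    (fun x _ => differentiableAt_const _) (fun x _ => (hF.differentiable (by simp)) x)
  rw [Measure.volume_eq_prod]
  simpa [hd] using key

theorem norm_le_of_mem_region {γ δ b : ℝ} (hγ : 0 < γ) (hδ : 0 < δ) (hδ' : δ < 1) (hb : 0 ≤ b)
    {x : M} (hx : x ∈ region γ δ) (hm : -mdot x x ≤ b ^ 2) :
    ‖x‖ ≤ γ + 2 * ((b + γ) / (1 - δ)) := by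
  have hx : |x 0| ≤ γ + δ * ‖spatial x‖ := hx
  rw [mdot_self] at hm
  have hn := norm_nonneg (spatial x)
  have h1 : ‖spatial x‖ ^ 2 ≤ (b + (γ + δ * ‖spatial x‖)) ^ 2 := by
    have h2 : x 0 ^ 2 ≤ (γ + δ * ‖spatial x‖) ^ 2 := by
      rw [← sq_abs (x 0)]
      exact pow_le_pow_left₀ (abs_nonneg _) hx 2
    nlinarith [mul_nonneg hb (show 0 ≤ γ + δ * ‖spatial x‖ by positivity)]
  have h2 := abs_le_of_sq_le_sq h1 (by positivity)
  rw [abs_norm] at h2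
  have h3 : ‖spatial x‖ ≤ (b + γ) / (1 - δ) := by
    rw [le_div_iff₀ (by linarith)]
    linarith
  have h4 : ‖x‖ ≤ |x 0| + ‖spatial x‖ := by
    conv_lhs => rw [← mkVec_spatial x]
    exact norm_mkVec_le _ _
  nlinarith

/-- A smooth function on the line, equal to one for `s ≤ 1` and to zero for `s ≥ 2`. -/
def cutoff (s : ℝ) : ℝ := Real.smoothTransition (2 - s)

theorem contDiff_cutoff : ContDiff ℝ ∞ cutoff :=
  Real.smoothTransition.contDiff.comp (contDiff_const.sub contDiff_id)

theorem cutoff_of_le {s : ℝ} (h : s ≤ 1) : cutoff s = 1 :=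
  Real.smoothTransition.one_of_one_le (by linarith)

theorem cutoff_of_ge {s : ℝ} (h : 2 ≤ s) : cutoff s = 0 :=
  Real.smoothTransition.zero_of_nonpos (by linarith)

theorem hasDerivAt_cutoff (s : ℝ) : HasDerivAt cutoff (deriv cutoff s) s :=
  ((contDiff_cutoff.differentiable (by simp)) s).hasDerivAt

theorem continuous_deriv_cutoff : Continuous (deriv cutoff) :=
  contDiff_cutoff.continuous_deriv (by simp)

theorem deriv_cutoff_of_lt {s : ℝ} (h : s < 1) : deriv cutoff s = 0 := by
  have h1 : cutoff =ᶠ[𝓝 s] fun _ => 1 := by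
    filter_upwards [gt_mem_nhds h] with u hu using cutoff_of_le hu.le
  rw [h1.deriv_eq, deriv_const]

theorem deriv_cutoff_of_gt {s : ℝ} (h : 2 < s) : deriv cutoff s = 0 := by
  have h1 : cutoff =ᶠ[𝓝 s] fun _ => 0 := by
    filter_upwards [lt_mem_nhds h] with u hu using cutoff_of_ge hu.le
  rw [h1.deriv_eq, deriv_const]

theorem contDiff_mdot_self : ContDiff ℝ ∞ fun x : M => mdot x x := by
  unfold mdot
  fun_prop

theorem pd_mdot_self (a : Fin 4) (x : M) : pd a (fun x => mdot x x) x = 2 * lower x a := by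
  have h : (fun x : M => mdot x x) = fun x => x 0 * x 0 - x 1 * x 1 - x 2 * x 2 - x 3 * x 3 := rfl
  have hc : ∀ b : Fin 4, ContDiff ℝ ∞ fun x : M => x b := fun b => contDiff_coord b
  rw [h, pd_sub (((hc 0).mul (hc 0)).sub ((hc 1).mul (hc 1)) |>.sub ((hc 2).mul (hc 2)))
    ((hc 3).mul (hc 3)), pd_sub (((hc 0).mul (hc 0)).sub ((hc 1).mul (hc 1))) ((hc 2).mul (hc 2)),
    pd_sub ((hc 0).mul (hc 0)) ((hc 1).mul (hc 1))]
  simp only [pd_coord_mul (hc _), pd_coord]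
  fin_cases a <;> simp [lower] <;> ring

/-- The flux of a conserved current through the smeared hyperboloid vanishes. -/
theorem integral_cutoff_flux {γ δ : ℝ} (hγ : 0 < γ) (hδ : 0 < δ) (hδ' : δ < 1)
    {u : Fin 4 → M → ℝ} (hu : ∀ a, ContDiff ℝ ∞ (u a)) (hs : ∀ a, Function.support (u a) ⊆ region γ δ)
    (hc : ∀ x, ∑ a, pd a (u a) x = 0) :
    ∫ p : ℝ × E3, deriv cutoff (-mdot (mkVec p.1 p.2) (mkVec p.1 p.2))
      * ∑ a, lower (mkVec p.1 p.2) a * u a (mkVec p.1 p.2) = 0 := by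
  let χ : M → ℝ := fun x => cutoff (-mdot x x)
  have hχ : ContDiff ℝ ∞ χ := contDiff_cutoff.comp contDiff_mdot_self.neg
  have hpχ : ∀ a x, pd a χ x = -2 * (deriv cutoff (-mdot x x) * lower x a) := by
    intro a x
    have h0 : HasFDerivAt (fun x : M => -mdot x x) _ x :=
      ((contDiff_mdot_self.differentiable (by simp)) x).hasFDerivAt.neg
    have h1 : HasFDerivAt χ _ x := HasDerivAt.comp_hasFDerivAt (h₂ := cutoff) x
      (hasDerivAt_cutoff (-mdot x x)) h0
    have h2 := pd_mdot_self a x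
    rw [pd] at h2 ⊢
    rw [h1.fderiv]
    simp [h2]
    ring
  have hcs : ∀ a, HasCompactSupport fun x => χ x * u a x := by
    intro a
    refine HasCompactSupport.intro
      (isCompact_closedBall (0 : M) (γ + 2 * ((2 + γ) / (1 - δ)))) fun x hx => ?_
    by_contra h0
    refine hx (mem_closedBall_zero_iff.2 (norm_le_of_mem_region hγ hδ hδ' (by norm_num)
      (hs a (right_ne_zero_of_mul h0)) ?_))
    by_contra h1
    exact left_ne_zero_of_mul h0 (cutoff_of_ge (by linarith))
  have hdiff : ∀ a, ContDiff ℝ ∞ fun x => χ x * u a x := fun a => hχ.mul (hu a)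
  have key : ∑ a, ∫ p : ℝ × E3, pd a (fun x => χ x * u a x) (mkVec p.1 p.2) = 0 :=
    Finset.sum_eq_zero fun a _ => integral_pd_eq_zero (hdiff a) (hcs a) a
  have hint : ∀ a, Integrable fun p : ℝ × E3 => pd a (fun x => χ x * u a x) (mkVec p.1 p.2) := by
    intro a
    have h1 : HasCompactSupport (pd a fun x => χ x * u a x) := (hcs a).fderiv_apply ℝ _
    exact ((contDiff_pd (hdiff a) a).continuous.comp mkVecL.continuous).integrable_of_hasCompactSupport
      (hasCompactSupport_comp_mkVec h1)
  rw [← integral_finsetSum _ fun a _ => hint a] at key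
  have h2 : ∀ p : ℝ × E3, ∑ a, pd a (fun x => χ x * u a x) (mkVec p.1 p.2)
      = -2 * (deriv cutoff (-mdot (mkVec p.1 p.2) (mkVec p.1 p.2))
      * ∑ a, lower (mkVec p.1 p.2) a * u a (mkVec p.1 p.2)) := by
    intro p
    simp only [fun a => pd_mul hχ (hu a), Finset.sum_add_distrib, ← Finset.mul_sum, hc, hpχ]
    rw [mul_zero, zero_add, Finset.mul_sum, Finset.mul_sum]
    exact Finset.sum_congr rfl fun a _ => by ring
  simp only [h2] at key
  rw [integral_const_mul] at key
  simpa using key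

theorem pd_comp_smul {f : M → ℝ} {r : ℝ} {x : M} (hf : DifferentiableAt ℝ f (r • x)) (a : Fin 4) :
    pd a (fun x => f (r • x)) x = r * pd a f (r • x) := by
  have h := hf.hasFDerivAt.comp x ((hasFDerivAt_id x).const_smul r)
  have h' : HasFDerivAt (fun x : M => f (r • x)) _ x := h
  rw [pd, h'.fderiv]
  simp [pd]

theorem integral_cutoff_asym_flux {ε γ δ : ℝ} (hε : 0 < ε) (hγ : 0 < γ) (hδ : 0 < δ) (hδ' : δ < 1)
    {u : Fin 4 → M → ℝ} (hu : ∀ a, OddHom ε (u a)) (hs : ∀ a, Function.support (u a) ⊆ region γ δ)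
    (hc : ∀ x, ∑ a, pd a (u a) x = 0) :
    ∫ p : ℝ × E3, deriv cutoff (-mdot (mkVec p.1 p.2) (mkVec p.1 p.2))
      * ∑ a, lower (mkVec p.1 p.2) a * asym 3 (u a) (mkVec p.1 p.2) = 0 := by
  let F : ℝ → ℝ × E3 → ℝ := fun R p => deriv cutoff (-mdot (mkVec p.1 p.2) (mkVec p.1 p.2))
      * ∑ a, lower (mkVec p.1 p.2) a * (R ^ (3 : ℝ) * u a (R • mkVec p.1 p.2))
  have hsm : ∀ (R : ℝ) a, ContDiff ℝ ∞ fun x : M => R ^ (3 : ℝ) * u a (R • x) := fun R a =>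
    contDiff_const.mul ((hu a).smooth.comp (contDiff_id.const_smul R))
  have hsR : ∀ R : ℝ, 1 ≤ R → ∀ a, Function.support (fun x : M => R ^ (3 : ℝ) * u a (R • x))
      ⊆ region γ δ := by
    intro R hR a x hx
    have h1 : |(R • x) 0| ≤ γ + δ * ‖spatial (R • x)‖ := hs a (right_ne_zero_of_mul hx)
    have hR0 : 0 < R := by linarith
    rw [spatial_smul, norm_smul, Real.norm_eq_abs, PiLp.smul_apply, smul_eq_mul, abs_mul,
      abs_of_pos hR0] at h1
    change |x 0| ≤ γ + δ * ‖spatial x‖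
    have h2 : R * |x 0| ≤ R * (γ + δ * ‖spatial x‖) := by nlinarith
    exact le_of_mul_le_mul_left h2 hR0
  have hF0 : ∀ R : ℝ, 1 ≤ R → ∫ p, F R p = 0 := by
    intro R hR
    refine integral_cutoff_flux hγ hδ hδ' (hsm R) (hsR R hR) fun x => ?_
    have h1 : ∀ a, pd a (fun x : M => R ^ (3 : ℝ) * u a (R • x)) x
        = R ^ (3 : ℝ) * R * pd a (u a) (R • x) := by
      intro a
      have hd : DifferentiableAt ℝ (u a) (R • x) := (hu a).smooth.differentiable (by simp) _
      have h2 : ContDiff ℝ ∞ fun x : M => u a (R • x) :=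
        (hu a).smooth.comp (contDiff_id.const_smul R)
      rw [pd_const_mul h2]
      simp only
      rw [pd_comp_smul hd a, mul_assoc]
    simp only [h1, ← Finset.mul_sum, hc, mul_zero]
  obtain ⟨C, hC⟩ : ∃ C : ℝ, ∀ a x, |u a x| ≤ C * (1 + ‖x‖) ^ (-3 : ℝ) := by
    choose C hC0 hC using fun a => ((hu a).decays_three hε).bound_zero
    refine ⟨∑ a, C a, fun a x => (hC a x).trans ?_⟩
    have h2 : 0 < 1 + ‖x‖ := by positivity
    exact mul_le_mul_of_nonneg_right (Finset.single_le_sum (fun b _ => hC0 b) (Finset.mem_univ a))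
      (Real.rpow_nonneg h2.le _)
  have hCp : 0 ≤ C := by
    have h1 := hC 0 0
    rw [norm_zero, add_zero, Real.one_rpow, mul_one] at h1
    exact (abs_nonneg _).trans h1
  obtain ⟨D, hD⟩ : ∃ D : ℝ, ∀ s, |deriv cutoff s| ≤ D := by
    have hcc : HasCompactSupport (deriv cutoff) :=
      HasCompactSupport.intro (isCompact_Icc (a := (1 : ℝ)) (b := 2)) fun s hs => by
        rcases lt_or_ge s 1 with h | h
        · exact deriv_cutoff_of_lt h
        · exact deriv_cutoff_of_gt (not_le.1 fun h2 => hs ⟨h, h2⟩)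
    obtain ⟨D, hD⟩ := hcc.exists_bound_of_continuous continuous_deriv_cutoff
    exact ⟨D, hD⟩
  set ρ : ℝ := γ + 2 * ((2 + γ) / (1 - δ)) with hρ
  have hD0 : 0 ≤ D := (abs_nonneg _).trans (hD 0)
  have hρ0 : 0 ≤ ρ := by
    have : 0 < 1 - δ := by linarith
    positivity
  have hlow : ∀ (x : M) a, |lower x a| ≤ ‖x‖ := by
    intro x a
    have h1 : |x a| ≤ ‖x‖ := PiLp.norm_apply_le x a
    unfold lower
    split_ifs
    · exact h1
    · rwa [abs_neg]
  have hlim : Tendsto (fun R => ∫ p, F R p) atTop (𝓝 (∫ p : ℝ × E3,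
      deriv cutoff (-mdot (mkVec p.1 p.2) (mkVec p.1 p.2))
      * ∑ a, lower (mkVec p.1 p.2) a * asym 3 (u a) (mkVec p.1 p.2))) := by
    refine tendsto_integral_filter_of_dominated_convergence
      ((Metric.closedBall (0 : ℝ × E3) ρ).indicator fun _ => D * (4 * (ρ * C))) ?_ ?_ ?_ ?_
    · refine Eventually.of_forall fun R => Continuous.aestronglyMeasurable ?_
      have hm : Continuous fun p : ℝ × E3 => mkVec p.1 p.2 := mkVecL.continuous
      have hl : ∀ a, Continuous fun x : M => lower x a := fun a => by
        unfold lower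
        split_ifs <;> fun_prop
      exact (continuous_deriv_cutoff.comp (contDiff_mdot_self.continuous.comp hm).neg).mul
        (continuous_finsetSum _ fun a _ => ((hl a).comp hm).mul ((hsm R a).continuous.comp hm))
    · filter_upwards [eventually_ge_atTop 1] with R hR
      refine Eventually.of_forall fun p => ?_
      set x := mkVec p.1 p.2 with hx
      have hnn : 0 ≤ D * (4 * (ρ * C)) := by positivity
      by_cases h0 : F R p = 0
      · rw [h0, norm_zero]
        exact indicator_nonneg (fun _ _ => hnn) _
      have h1 : deriv cutoff (-mdot x x) ≠ 0 := left_ne_zero_of_mul h0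
      have h2 : -mdot x x ≤ 2 := not_lt.1 fun h => h1 (deriv_cutoff_of_gt h)
      have h3 : 1 ≤ -mdot x x := not_lt.1 fun h => h1 (deriv_cutoff_of_lt h)
      have h4 : 1 ≤ ‖x‖ := by
        have h5 : ‖spatial x‖ ≤ ‖x‖ := by
          conv_rhs => rw [← mkVec_spatial x]
          exact norm_le_norm_mkVec _ _
        rw [mdot_self] at h3
        nlinarith [norm_nonneg (spatial x), norm_nonneg x, sq_nonneg (x 0)]
      obtain ⟨a, -, ha⟩ := Finset.exists_ne_zero_of_sum_ne_zero (right_ne_zero_of_mul h0)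
      have h5 : ‖x‖ ≤ ρ := norm_le_of_mem_region hγ hδ hδ' (by norm_num)
        (hsR R hR a (right_ne_zero_of_mul ha)) (by linarith)
      rw [indicator_of_mem]
      · rw [Real.norm_eq_abs, abs_mul]
        refine mul_le_mul (hD _) ?_ (abs_nonneg _) hD0
        refine (Finset.abs_sum_le_sum_abs _ _).trans ?_
        have h6 : ∀ a ∈ Finset.univ, |lower x a * (R ^ (3 : ℝ) * u a (R • x))| ≤ ρ * C := by
          intro a _
          rw [abs_mul]
          refine mul_le_mul ((hlow x a).trans h5) ?_ (abs_nonneg _) hρ0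
          have hR0 : 0 < R := by linarith
          rw [abs_mul, abs_of_pos (Real.rpow_pos_of_pos hR0 _)]
          have h7 := hC a (R • x)
          have h8 : (1 + ‖R • x‖) ^ (-3 : ℝ) ≤ R ^ (-3 : ℝ) := by
            refine Real.rpow_le_rpow_of_nonpos hR0 ?_ (by norm_num)
            rw [norm_smul, Real.norm_eq_abs, abs_of_pos hR0]
            nlinarith
          calc R ^ (3 : ℝ) * |u a (R • x)| ≤ R ^ (3 : ℝ) * (C * R ^ (-3 : ℝ)) := by
                gcongr
                exact h7.trans (mul_le_mul_of_nonneg_left h8 hCp)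
            _ = C := by
                rw [mul_left_comm, ← Real.rpow_add hR0]
                norm_num
        refine (Finset.sum_le_sum h6).trans (le_of_eq ?_)
        simp
      · rw [mem_closedBall_zero_iff]
        exact le_trans (norm_prod_le_iff.2 ⟨abs_le_norm_mkVec p.1 p.2, norm_le_norm_mkVec p.1 p.2⟩) h5
    · refine (integrable_indicator_iff Metric.isClosed_closedBall.measurableSet).2 ?_
      exact integrableOn_const (isCompact_closedBall _ _).measure_lt_top.ne
    · refine Eventually.of_forall fun p => ?_
      by_cases hp : mkVec p.1 p.2 = 0
      · simp [F, hp, mdot, lower]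
      · exact (tendsto_finsetSum _ fun a _ =>
          ((hu a).asymHom.tendsto hε hp).const_mul _).const_mul _
  refine tendsto_nhds_unique (hlim.congr' ?_) tendsto_const_nhds
  filter_upwards [eventually_ge_atTop 1] with R hR using hF0 R hR

theorem integral_Ioi_deriv_cutoff {c : ℝ} (hc : 0 < c) :
    ∫ r in Ioi (0 : ℝ), -(r * c * deriv cutoff (c * r ^ 2)) = 1 / 2 := by
  have h1 : ∀ r ∈ Ioi (0 : ℝ), HasDerivAt (fun r : ℝ => -(1 / 2) * cutoff (c * r ^ 2))
      (-(r * c * deriv cutoff (c * r ^ 2))) r := by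
    intro r _
    have h2 : HasDerivAt (fun r : ℝ => c * r ^ 2) (c * (2 * r)) r := by
      simpa using (hasDerivAt_pow 2 r).const_mul c
    have h3 : HasDerivAt (fun r : ℝ => cutoff (c * r ^ 2)) _ r :=
      HasDerivAt.comp (h₂ := cutoff) r (hasDerivAt_cutoff (c * r ^ 2)) h2
    exact (h3.const_mul _).congr_deriv (by ring)
  have hlim : Tendsto (fun r : ℝ => c * r ^ 2) atTop atTop :=
    (tendsto_pow_atTop two_ne_zero).const_mul_atTop hc
  have h2 : Tendsto (fun r : ℝ => -(1 / 2) * cutoff (c * r ^ 2)) atTop (𝓝 0) := by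
    refine tendsto_const_nhds.congr' ?_
    filter_upwards [hlim.eventually_ge_atTop 2] with r hr
    rw [cutoff_of_ge hr, mul_zero]
  have hcont : Continuous fun r : ℝ => -(r * c * deriv cutoff (c * r ^ 2)) := by
    have := continuous_deriv_cutoff
    fun_prop
  obtain ⟨b, hb⟩ := (hlim.eventually_gt_atTop 2).exists_forall_of_atTop
  have hcs : HasCompactSupport fun r : ℝ => -(r * c * deriv cutoff (c * r ^ 2)) := by
    refine HasCompactSupport.intro (isCompact_Icc (a := -|b|) (b := |b|)) fun r hr => ?_
    have h3 : |b| < |r| := not_le.1 fun h => hr (abs_le.1 h)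
    have h4 := hb |r| ((le_abs_self b).trans h3.le)
    rw [sq_abs] at h4
    rw [deriv_cutoff_of_gt h4, mul_zero, neg_zero]
  have hcut := contDiff_cutoff.continuous
  rw [integral_Ioi_of_hasDerivAt_of_tendsto (Continuous.continuousWithinAt (by fun_prop)) h1
    (hcont.integrable_of_hasCompactSupport hcs).integrableOn h2]
  rw [cutoff_of_le (by norm_num)]
  norm_num

/-- The integral over the hyperboloid in the coordinates `x = r (v, n)`. -/
theorem hyperboloidIntegral_eq {δ : ℝ} (hδ' : δ < 1) {g : M → ℝ}
    (hg : ContinuousOn g {0}ᶜ)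
    (hh : ∀ (r : ℝ) x, 0 < r → x ≠ 0 → g (r • x) = r ^ (-4 : ℝ) * g x)
    (hs : ∀ x, x ≠ 0 → δ * ‖spatial x‖ < |x 0| → g x = 0) :
    hyperboloidIntegral g = ∫ n : S2, (∫ v : ℝ, g (mkVec v (n : E3))) ∂sphereMeasure := by
  have hcont : Continuous fun p : S2 × ℝ => g (mkVec p.2 (p.1 : E3)) := by
    refine hg.comp_continuous (mkVecL.continuous.comp
      (continuous_snd.prodMk (continuous_subtype_val.comp continuous_fst))) fun p => ?_
    exact mkVec_ne_zero (t := p.2) (S2.ne_zero p.1)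
  have hz : ∀ (v : ℝ) (n : S2), δ < |v| → g (mkVec v (n : E3)) = 0 := by
    intro v n hv
    refine hs _ (mkVec_ne_zero (t := v) n.ne_zero) ?_
    rwa [spatial_mkVec, n.norm, mul_one, mkVec_zero]
  have hint : Integrable (fun p : S2 × ℝ => g (mkVec p.2 (p.1 : E3)))
      (sphereMeasure.prod volume) := by
    refine hcont.integrable_of_hasCompactSupport (HasCompactSupport.intro
      ((isCompact_univ (X := S2)).prod (isCompact_Icc (a := -δ) (b := δ))) fun p hp => ?_)
    exact hz _ _ (not_le.1 fun h => hp ⟨mem_univ _, abs_le.1 h⟩)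
  rw [integral_integral_swap hint]
  set k : ℝ → ℝ := fun v => ∫ n : S2, g (mkVec v (n : E3)) ∂sphereMeasure with hk
  let V : ℝ → ℝ := fun τ => τ / √(1 + τ ^ 2)
  have hpos : ∀ τ : ℝ, 0 < 1 + τ ^ 2 := fun τ => by positivity
  have hsq : ∀ τ : ℝ, 0 < √(1 + τ ^ 2) := fun τ => Real.sqrt_pos.2 (hpos τ)
  have hV : ∀ τ ∈ univ, HasDerivWithinAt V ((√(1 + τ ^ 2) ^ 3)⁻¹) univ τ := by
    intro τ _
    have h1 : HasDerivAt (fun τ : ℝ => √(1 + τ ^ 2)) (τ / √(1 + τ ^ 2)) τ := by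
      have h2 : HasDerivAt (fun τ : ℝ => 1 + τ ^ 2) (2 * τ) τ := by
        simpa using (hasDerivAt_pow 2 τ).const_add 1
      refine (h2.sqrt (hpos τ).ne').congr_deriv ?_
      field_simp
    refine (((hasDerivAt_id τ).div h1 (hsq τ).ne').congr_deriv ?_).hasDerivWithinAt
    have h3 := Real.sq_sqrt (hpos τ).le
    have h4 := (hsq τ).ne'
    simp only [id]
    field_simp
    rw [h3]
    ring
  have hinv : ∀ v : ℝ, |v| < 1 → V (v / √(1 - v ^ 2)) = v := by
    intro v hv
    have h1 : 0 < 1 - v ^ 2 := by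
      have := (sq_lt_one_iff_abs_lt_one v).2 hv
      linarith
    have h2 := Real.sq_sqrt h1.le
    have h3 : 0 < √(1 - v ^ 2) := Real.sqrt_pos.2 h1
    have h4 : 1 + (v / √(1 - v ^ 2)) ^ 2 = (1 / √(1 - v ^ 2)) ^ 2 := by
      field_simp
      rw [h2]
      ring
    simp only [V]
    rw [h4, Real.sqrt_sq (by positivity)]
    field_simp
  have hinj : InjOn V univ := by
    have hmono : StrictMono V := strictMono_of_hasDerivAt_pos
      (f' := fun τ => (√(1 + τ ^ 2) ^ 3)⁻¹)
      (fun τ => (hV τ (mem_univ _)).hasDerivAt Filter.univ_mem)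
      (fun τ => by have := hsq τ; positivity)
    exact hmono.injective.injOn
  have h5 := integral_image_eq_integral_abs_deriv_smul MeasurableSet.univ hV hinj k
  have h6 : ∫ v in V '' univ, k v = ∫ v, k v := by
    refine setIntegral_eq_integral_of_forall_compl_eq_zero fun v hv => ?_
    have h7 : δ < |v| := by
      refine lt_of_lt_of_le hδ' (not_lt.1 fun h => hv ⟨_, mem_univ _, hinv v h⟩)
    simp only [hk, fun n => hz v n h7, integral_zero]
  rw [← h6, h5, setIntegral_univ, hyperboloidIntegral]
  refine integral_congr_ae (Eventually.of_forall fun τ => ?_)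
  simp only [hk, smul_eq_mul]
  rw [integral_mul_const, mul_comm, abs_of_pos (by have := hsq τ; positivity)]
  have h8 : ∀ n : S2, g (mkVec τ (√(1 + τ ^ 2) • (n : E3)))
      = (√(1 + τ ^ 2) ^ 4)⁻¹ * g (mkVec (V τ) (n : E3)) := by
    intro n
    have h9 : mkVec τ (√(1 + τ ^ 2) • (n : E3)) = √(1 + τ ^ 2) • mkVec (V τ) (n : E3) := by
      rw [mkVec_smul, mul_div_cancel₀ _ (hsq τ).ne']
    rw [h9, hh _ _ (hsq τ) (mkVec_ne_zero (t := _) n.ne_zero), Real.rpow_neg (hsq τ).le]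
    norm_cast
  simp only [h8]
  rw [integral_const_mul]
  have := (hsq τ).ne'
  field_simp

theorem HomCurrent.hyperboloidIntegral_radialPart {δ : ℝ} (hδ : 0 < δ) (hδ' : δ < 1)
    {u : Fin 4 → M → ℝ} (h : HomCurrent δ u)
    (hflux : ∫ p : ℝ × E3, deriv cutoff (-mdot (mkVec p.1 p.2) (mkVec p.1 p.2))
      * ∑ a, lower (mkVec p.1 p.2) a * u a (mkVec p.1 p.2) = 0) :
    hyperboloidIntegral (radialPart u) = 0 := by
  set g := radialPart u with hgdef
  have hgc : ContinuousOn g {0}ᶜ := (h.contDiffOn_radialPart hδ').continuousOn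
  rw [hyperboloidIntegral_eq hδ' hgc (fun r x hr hx => h.radialPart_smul hr hx)
    (fun x hx hs => h.radialPart_supp hx hs)]
  let F : ℝ × E3 → ℝ := fun p => deriv cutoff (-mdot (mkVec p.1 p.2) (mkVec p.1 p.2))
      * (mdot (mkVec p.1 p.2) (mkVec p.1 p.2) * g (mkVec p.1 p.2))
  have hFe : ∀ p, deriv cutoff (-mdot (mkVec p.1 p.2) (mkVec p.1 p.2))
      * ∑ a, lower (mkVec p.1 p.2) a * u a (mkVec p.1 p.2) = F p := by
    intro p
    by_cases hm : mdot (mkVec p.1 p.2) (mkVec p.1 p.2) = 0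
    · simp only [F, hm, neg_zero, deriv_cutoff_of_lt zero_lt_one, zero_mul]
    · simp only [F, hgdef, radialPart]
      rw [mul_div_cancel₀ _ hm]
  simp only [hFe] at hflux
  have hmm : ∀ (t : ℝ) (y : E3), mdot (mkVec t y) (mkVec t y) = t ^ 2 - ‖y‖ ^ 2 := fun t y => by
    rw [mdot_self, spatial_mkVec, mkVec_zero]
  have hFs : ∀ p, F p ≠ 0 → |p.1| ≤ δ * ‖p.2‖ ∧ 1 ≤ ‖p.2‖ ∧ ‖p.2‖ ^ 2 * (1 - δ ^ 2) ≤ 2 := by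
    intro p hp
    have h1 : deriv cutoff (-mdot (mkVec p.1 p.2) (mkVec p.1 p.2)) ≠ 0 := left_ne_zero_of_mul hp
    have h2 : -mdot (mkVec p.1 p.2) (mkVec p.1 p.2) ≤ 2 := not_lt.1 fun h => h1 (deriv_cutoff_of_gt h)
    have h3 : 1 ≤ -mdot (mkVec p.1 p.2) (mkVec p.1 p.2) :=
      not_lt.1 fun h => h1 (deriv_cutoff_of_lt h)
    rw [hmm] at h2 h3
    have h4 : 1 ≤ ‖p.2‖ := by nlinarith [norm_nonneg p.2, sq_nonneg p.1]
    have hy : p.2 ≠ 0 := norm_pos_iff.1 (by linarith)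
    have h5 : |p.1| ≤ δ * ‖p.2‖ := by
      by_contra hcon
      refine right_ne_zero_of_mul (right_ne_zero_of_mul hp) (h.radialPart_supp (mkVec_ne_zero (t := _) hy) ?_)
      rw [spatial_mkVec, mkVec_zero]
      exact not_le.1 hcon
    refine ⟨h5, h4, ?_⟩
    have h6 : p.1 ^ 2 ≤ (δ * ‖p.2‖) ^ 2 := by
      rw [← sq_abs p.1]
      exact pow_le_pow_left₀ (abs_nonneg _) h5 2
    nlinarith
  have hδ2 : 0 < 1 - δ ^ 2 := by nlinarith
  have hbd : ∀ r : ℝ, 0 ≤ r → r ^ 2 * (1 - δ ^ 2) ≤ 2 → r ≤ 1 + 2 / (1 - δ ^ 2) := by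
    intro r hr h1
    have h2 : r ^ 2 ≤ 2 / (1 - δ ^ 2) := by rwa [le_div_iff₀ hδ2]
    nlinarith
  have hFc : Continuous F := by
    have hm : Continuous fun p : ℝ × E3 => mkVec p.1 p.2 := mkVecL.continuous
    have hmd : Continuous fun p : ℝ × E3 => mdot (mkVec p.1 p.2) (mkVec p.1 p.2) :=
      contDiff_mdot_self.continuous.comp hm
    rw [continuous_iff_continuousAt]
    intro p
    by_cases hp : mkVec p.1 p.2 = 0
    · refine (continuousAt_const (y := (0 : ℝ))).congr ?_
      have h1 : ∀ᶠ q : ℝ × E3 in 𝓝 p, -mdot (mkVec q.1 q.2) (mkVec q.1 q.2) < 1 := by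
        refine hmd.neg.continuousAt.eventually (gt_mem_nhds ?_)
        rw [Pi.neg_apply, hp]
        simp [mdot]
      filter_upwards [h1] with q hq
      simp only [F, deriv_cutoff_of_lt hq, zero_mul]
    · refine ContinuousAt.mul ?_ (hmd.continuousAt.mul ?_)
      · exact (continuous_deriv_cutoff.comp hmd.neg).continuousAt
      · exact ContinuousAt.comp (f := fun p : ℝ × E3 => mkVec p.1 p.2)
          (hgc.continuousAt (isOpen_compl_singleton.mem_nhds hp)) hm.continuousAt
  set B := 1 + 2 / (1 - δ ^ 2) with hB
  have hB0 : 0 < B := by positivity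
  have hFi : Integrable F (volume.prod volume) := by
    refine hFc.integrable_of_hasCompactSupport (HasCompactSupport.intro
      (isCompact_closedBall (0 : ℝ × E3) B) fun p hp => ?_)
    by_contra h0
    obtain ⟨h1, -, h3⟩ := hFs p h0
    have h4 := hbd _ (norm_nonneg _) h3
    refine hp (mem_closedBall_zero_iff.2 (norm_prod_le_iff.2 ⟨?_, h4⟩))
    exact h1.trans (by nlinarith [norm_nonneg p.2])
  rw [Measure.volume_eq_prod, integral_prod_symm _ hFi, integral_polar hFi.integral_prod_right]
    at hflux
  have hscale : ∀ (n : S2) (r : ℝ), r ∈ Ioi (0 : ℝ) → r ^ 2 * ∫ t : ℝ, F (t, r • (n : E3))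
      = ∫ v : ℝ, -(r * (1 - v ^ 2) * deriv cutoff ((1 - v ^ 2) * r ^ 2)) * g (mkVec v (n : E3)) := by
    intro n r hr
    have hr : 0 < r := hr
    have h1 := Measure.integral_comp_mul_left (fun t => F (t, r • (n : E3))) r
    rw [abs_of_pos (inv_pos.2 hr), smul_eq_mul, eq_inv_mul_iff_mul_eq₀ hr.ne'] at h1
    rw [← h1, ← mul_assoc, ← integral_const_mul]
    refine integral_congr_ae (Eventually.of_forall fun v => ?_)
    have hgs : g (r • mkVec v (n : E3)) = r ^ (-4 : ℝ) * g (mkVec v (n : E3)) :=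
      h.radialPart_smul hr (mkVec_ne_zero n.ne_zero)
    simp only [F]
    rw [hmm, norm_smul, n.norm, Real.norm_eq_abs, mul_one, sq_abs, ← mkVec_smul,
      hgs, Real.rpow_neg hr.le,
      show -((r * v) ^ 2 - r ^ 2) = (1 - v ^ 2) * r ^ 2 by ring,
      show (r * v) ^ 2 - r ^ 2 = -((1 - v ^ 2) * r ^ 2) by ring]
    have h2 : r ^ (4 : ℝ) = r ^ 4 := by norm_cast
    rw [h2]
    field_simp
  have hz : ∀ (v : ℝ) (n : S2), δ < |v| → g (mkVec v (n : E3)) = 0 := by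
    intro v n hv
    refine h.radialPart_supp (mkVec_ne_zero (t := v) n.ne_zero) ?_
    rwa [spatial_mkVec, n.norm, mul_one, mkVec_zero]
  have hn : ∀ n : S2, ∫ r in Ioi (0 : ℝ), r ^ 2 * ∫ t : ℝ, F (t, r • (n : E3))
      = (∫ v : ℝ, g (mkVec v (n : E3))) * (1 / 2) := by
    intro n
    rw [setIntegral_congr_fun measurableSet_Ioi fun r hr => hscale n r hr]
    rw [integral_integral_swap]
    · rw [← integral_mul_const]
      refine integral_congr_ae (Eventually.of_forall fun v => ?_)
      simp only
      rcases le_or_gt |v| δ with hv | hv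
      · have h1 : 0 < 1 - v ^ 2 := by
          have := (sq_lt_one_iff_abs_lt_one v).2 (hv.trans_lt hδ')
          linarith
        rw [integral_mul_const, integral_Ioi_deriv_cutoff h1, mul_comm]
      · simp only [hz v n hv, mul_zero, zero_mul, integral_zero]
    · have hcont : Continuous (Function.uncurry fun r v : ℝ =>
          -(r * (1 - v ^ 2) * deriv cutoff ((1 - v ^ 2) * r ^ 2)) * g (mkVec v (n : E3))) := by
        have h1 : Continuous fun p : ℝ × ℝ => g (mkVec p.2 (n : E3)) :=
          hgc.comp_continuous (mkVecL.continuous.comp (continuous_snd.prodMk continuous_const))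
            fun p => mkVec_ne_zero (t := p.2) n.ne_zero
        have h2 : Continuous fun p : ℝ × ℝ => deriv cutoff ((1 - p.2 ^ 2) * p.1 ^ 2) :=
          continuous_deriv_cutoff.comp (by fun_prop)
        exact ((continuous_fst.mul (by fun_prop)).mul h2).neg.mul h1
      have hcs : HasCompactSupport (Function.uncurry fun r v : ℝ =>
          -(r * (1 - v ^ 2) * deriv cutoff ((1 - v ^ 2) * r ^ 2)) * g (mkVec v (n : E3))) := by
        refine HasCompactSupport.intro ((isCompact_Icc (a := -B) (b := B)).prod
          (isCompact_Icc (a := -δ) (b := δ))) fun p hp => ?_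
        by_contra h0
        have h1 : |p.2| ≤ δ := not_lt.1 fun h => right_ne_zero_of_mul h0 (hz _ n h)
        have h2 : (1 - p.2 ^ 2) * p.1 ^ 2 ≤ 2 := not_lt.1 fun h =>
          right_ne_zero_of_mul (neg_ne_zero.1 (left_ne_zero_of_mul h0)) (deriv_cutoff_of_gt h)
        have h3 : p.2 ^ 2 ≤ δ ^ 2 := by
          rw [← sq_abs p.2]
          exact pow_le_pow_left₀ (abs_nonneg _) h1 2
        have h4 : |p.1| ≤ B := hbd _ (abs_nonneg _) (by rw [sq_abs]; nlinarith [sq_nonneg p.1])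
        exact hp ⟨abs_le.1 h4, abs_le.1 h1⟩
      have h1 := hcont.integrable_of_hasCompactSupport (μ := volume.prod volume) hcs
      have h2 := h1.restrict (s := Ioi (0 : ℝ) ×ˢ univ)
      rwa [← Measure.prod_restrict, Measure.restrict_univ] at h2
  simp only [hn] at hflux
  rw [integral_mul_const] at hflux
  simpa using hflux

/-! ### Integrals over light cones -/

theorem integrable_of_bound_inv_sq {F : E3 → ℝ} (hm : AEStronglyMeasurable F) {C ρ : ℝ}
    (hb : ∀ y, |F y| ≤ C * (1 + (‖y‖ ^ 2)⁻¹)) (hs : ∀ y, ρ < ‖y‖ → F y = 0) : Integrable F := by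
  let g : ℝ → ℝ := (Iic ρ).indicator fun r => |C| * (1 + (r ^ 2)⁻¹)
  have hg : Integrable fun y : E3 => g ‖y‖ := by
    rw [integrable_fun_norm_addHaar]
    have h1 : IntegrableOn (fun r : ℝ => |C| * (r ^ 2 + 1)) (Ioc 0 ρ) :=
      (Continuous.integrableOn_Icc (by fun_prop)).mono_set Ioc_subset_Icc_self
    have h2 : IntegrableOn ((Ioc 0 ρ).indicator fun r : ℝ => |C| * (r ^ 2 + 1)) (Ioi 0) :=
      ((integrable_indicator_iff measurableSet_Ioc).2 h1).integrableOn
    refine h2.congr_fun (fun r hr => ?_) measurableSet_Ioi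
    have hr : 0 < r := hr
    simp only [finrank_euclideanSpace, Fintype.card_fin, g, indicator, mem_Ioc, mem_Iic, hr,
      true_and, smul_eq_mul]
    split_ifs
    · field_simp
    · simp
  refine hg.mono' hm (Eventually.of_forall fun y => ?_)
  rw [Real.norm_eq_abs]
  simp only [g, indicator, mem_Iic]
  split_ifs with h
  · exact (hb y).trans (mul_le_mul_of_nonneg_right (le_abs_self C) (by positivity))
  · rw [hs y (not_le.1 h), abs_zero]

/-- The vector `(σ |y|, y)`. -/
def coneVec (σ : ℝ) (y : E3) : M := mkVec (σ * ‖y‖) y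

/-- The integral `∫ w(y) f(x⁰ - σ |y|, x⃗ - y) d³y` over a light cone with apex `x`. -/
def coneInt (w : E3 → ℝ) (σ : ℝ) (f : M → ℝ) (x : M) : ℝ := ∫ y, w y * f (x - coneVec σ y)

/-- Smooth functions supported in `|x⁰| ≤ γ + δ |x⃗|`. -/
structure RegionSmooth (γ δ : ℝ) (f : M → ℝ) : Prop where
  nonneg : 0 ≤ δ
  lt_one : δ < 1
  smooth : ContDiff ℝ ∞ f
  supp : ∀ x, f x ≠ 0 → |x 0| ≤ γ + δ * ‖spatial x‖

/-- Weights admitted in the integrals over light cones. -/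
structure ConeWeight (w : E3 → ℝ) : Prop where
  meas : Measurable w
  bound : ∃ C, ∀ y, |w y| ≤ C * (1 + (‖y‖ ^ 2)⁻¹)

theorem ConeWeight.of_le {w : E3 → ℝ} (hw : Measurable w) (C : ℝ)
    (h : ∀ y, y ≠ 0 → |w y| ≤ C * (1 + (‖y‖ ^ 2)⁻¹)) : ConeWeight w := by
  refine ⟨hw, max C |w 0|, fun y => ?_⟩
  by_cases hy : y = 0
  · subst hy
    simp
  · exact (h y hy).trans (mul_le_mul_of_nonneg_right (le_max_left _ _) (by positivity))

theorem continuous_coneVec (σ : ℝ) : Continuous (coneVec σ) := by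
  have h : coneVec σ = fun y => mkVecL (σ * ‖y‖, y) := rfl
  rw [h]
  fun_prop

theorem coneVec_zero_apply (σ : ℝ) (y : E3) : coneVec σ y 0 = σ * ‖y‖ := mkVec_zero _ _

theorem coneVec_succ (σ : ℝ) (y : E3) (i : Fin 3) : coneVec σ y i.succ = y i := mkVec_succ _ _ i

theorem spatial_sub (x y : M) : spatial (x - y) = spatial x - spatial y := map_sub spatialL x y

theorem spatial_coneVec (σ : ℝ) (y : E3) : spatial (coneVec σ y) = y := spatial_mkVec _ _

theorem norm_spatial_le (x : M) : ‖spatial x‖ ≤ ‖x‖ := by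
  conv_rhs => rw [← mkVec_spatial x]
  exact norm_le_norm_mkVec _ _

theorem abs_zero_le_norm (x : M) : |x 0| ≤ ‖x‖ := PiLp.norm_apply_le x 0

theorem norm_coneVec_le {σ : ℝ} (hσ : |σ| = 1) (y : E3) : ‖coneVec σ y‖ ≤ 2 * ‖y‖ := by
  refine (norm_mkVec_le _ _).trans (le_of_eq ?_)
  rw [abs_mul, hσ, abs_norm]
  ring

namespace RegionSmooth

variable {γ δ σ : ℝ} {f g : M → ℝ} {w w' : E3 → ℝ}

theorem add (hf : RegionSmooth γ δ f) (hg : RegionSmooth γ δ g) :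
    RegionSmooth γ δ fun x => f x + g x where
  nonneg := hf.nonneg
  lt_one := hf.lt_one
  smooth := hf.smooth.add hg.smooth
  supp x hx := by
    by_cases h : f x = 0
    · exact hg.supp x fun h' => hx (by rw [h, h', add_zero])
    · exact hf.supp x h

theorem mul (hf : RegionSmooth γ δ f) (hg : ContDiff ℝ ∞ g) :
    RegionSmooth γ δ fun x => g x * f x where
  nonneg := hf.nonneg
  lt_one := hf.lt_one
  smooth := hg.mul hf.smooth
  supp x hx := hf.supp x (right_ne_zero_of_mul hx)

theorem const_mul (hf : RegionSmooth γ δ f) (c : ℝ) : RegionSmooth γ δ fun x => c * f x :=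
  hf.mul contDiff_const

theorem sub (hf : RegionSmooth γ δ f) (hg : RegionSmooth γ δ g) :
    RegionSmooth γ δ fun x => f x - g x := by
  simpa [sub_eq_add_neg] using hf.add (hg.const_mul (-1))

protected theorem pd (hf : RegionSmooth γ δ f) (a : Fin 4) : RegionSmooth γ δ (pd a f) where
  nonneg := hf.nonneg
  lt_one := hf.lt_one
  smooth := contDiff_pd hf.smooth a
  supp x hx := by
    have hc : IsClosed {x : M | |x 0| ≤ γ + δ * ‖spatial x‖} := by
      have := spatialL.continuous
      simp only [← spatialL_apply]
      exact isClosed_le (by fun_prop) (by fun_prop)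
    have h1 : tsupport f ⊆ {x : M | |x 0| ≤ γ + δ * ‖spatial x‖} :=
      closure_minimal (fun y hy => hf.supp y hy) hc
    refine h1 (not_not.1 fun h => hx ?_)
    have h2 : fderiv ℝ f x = 0 := by
      by_contra h3
      exact h (support_fderiv_subset ℝ h3)
    rw [pd, h2]
    rfl

protected theorem boost (hf : RegionSmooth γ δ f) (i : Fin 3) :
    RegionSmooth γ δ (boost i f) :=
  ((hf.pd 0).mul (contDiff_coord i.succ)).add ((hf.pd i.succ).mul (contDiff_coord 0))

protected theorem rot (hf : RegionSmooth γ δ f) (i j : Fin 3) :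
    RegionSmooth γ δ (rot i j f) :=
  ((hf.pd j.succ).mul (contDiff_coord i.succ)).sub ((hf.pd i.succ).mul (contDiff_coord j.succ))

theorem norm_le (hf : RegionSmooth γ δ f) (hσ : |σ| = 1) {x : M} {y : E3}
    (h : f (x - coneVec σ y) ≠ 0) : ‖y‖ ≤ (γ + 2 * ‖x‖) / (1 - δ) := by
  have h0 := hf.nonneg
  have h1 := hf.lt_one
  have h2 := hf.supp _ h
  rw [spatial_sub, spatial_coneVec, PiLp.sub_apply, coneVec_zero_apply] at h2
  have h3 : ‖spatial x - y‖ ≤ ‖x‖ + ‖y‖ := (norm_sub_le _ _).trans (by linarith [norm_spatial_le x])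
  have h4 : |σ * ‖y‖| - |x 0| ≤ |x 0 - σ * ‖y‖| := by
    have := abs_sub_abs_le_abs_sub (σ * ‖y‖) (x 0)
    rwa [abs_sub_comm] at this
  rw [abs_mul, hσ, one_mul, abs_norm] at h4
  have h5 := abs_zero_le_norm x
  rw [le_div_iff₀ (by linarith)]
  nlinarith [norm_nonneg x, norm_nonneg y]

/-- A locally uniform majorant of the integrand. -/
theorem exists_bound (hf : RegionSmooth γ δ f) (hσ : |σ| = 1) (b : ℝ) :
    ∃ C ρ : ℝ, ∀ x : M, ‖x‖ ≤ b → ∀ y, |f (x - coneVec σ y)| ≤ C ∧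
      (ρ < ‖y‖ → f (x - coneVec σ y) = 0) := by
  have h1 := hf.lt_one
  set ρ := (γ + 2 * b) / (1 - δ) with hρ
  have h2 : ∀ x : M, ‖x‖ ≤ b → ∀ y, f (x - coneVec σ y) ≠ 0 → ‖y‖ ≤ ρ := by
    intro x hx y h
    refine (hf.norm_le hσ h).trans ?_
    rw [hρ]
    have : 0 < 1 - δ := by linarith
    gcongr
  obtain ⟨C, hC⟩ := (isCompact_closedBall (0 : M) (b + 2 * ρ)).exists_bound_of_continuousOn
    hf.smooth.continuous.continuousOn
  refine ⟨max C 0, ρ, fun x hx y => ⟨?_, fun hy => not_not.1 fun h => not_lt.2 (h2 x hx y h) hy⟩⟩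
  by_cases h : f (x - coneVec σ y) = 0
  · rw [h, abs_zero]
    exact le_max_right _ _
  · refine (hC _ (mem_closedBall_zero_iff.2 ?_)).trans (le_max_left _ _)
    have h3 := h2 x hx y h
    have h4 := norm_coneVec_le hσ y
    exact (norm_sub_le _ _).trans (by linarith)

theorem aestronglyMeasurable (hf : RegionSmooth γ δ f) (hw : ConeWeight w) (x : M) :
    AEStronglyMeasurable fun y => w y * f (x - coneVec σ y) :=
  hw.meas.aestronglyMeasurable.mul (hf.smooth.continuous.comp
    (continuous_const.sub (continuous_coneVec σ))).aestronglyMeasurable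

theorem integrable (hf : RegionSmooth γ δ f) (hσ : |σ| = 1) (hw : ConeWeight w) (x : M) :
    Integrable fun y => w y * f (x - coneVec σ y) := by
  obtain ⟨C, ρ, h⟩ := hf.exists_bound hσ ‖x‖
  obtain ⟨D, hD⟩ := hw.bound
  refine integrable_of_bound_inv_sq (hf.aestronglyMeasurable hw x) (C := D * C) (ρ := ρ)
    (fun y => ?_) fun y hy => ?_
  · rw [abs_mul]
    refine (mul_le_mul (hD y) (h x le_rfl y).1 (abs_nonneg _)
      ((abs_nonneg _).trans (hD y))).trans (le_of_eq (by ring))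
  · rw [(h x le_rfl y).2 hy, mul_zero]

theorem hasFDerivAt_coneInt (hf : RegionSmooth γ δ f) (hσ : |σ| = 1) (hw : ConeWeight w) (x : M) :
    HasFDerivAt (coneInt w σ f)
      (∑ a : Fin 4, coneInt w σ (pd a f) x • (EuclideanSpace.proj a : M →L[ℝ] ℝ)) x := by
  choose C ρ h using fun a => (hf.pd a).exists_bound hσ (‖x‖ + 1)
  obtain ⟨D, hD⟩ := hw.bound
  have hD0 : 0 ≤ D := by
    have := (abs_nonneg _).trans (hD 0)
    simpa using this
  have hC0 : ∀ a, 0 ≤ C a := fun a => (abs_nonneg _).trans (h a x (by linarith) 0).1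
  let F' : M → E3 → (M →L[ℝ] ℝ) := fun x y => ∑ a : Fin 4,
    (w y * pd a f (x - coneVec σ y)) • (EuclideanSpace.proj a : M →L[ℝ] ℝ)
  let B : ℝ := ∑ a, |ρ a|
  have hbi : Integrable fun y : E3 => (Metric.closedBall (0 : E3) B).indicator
      (fun y => D * (1 + (‖y‖ ^ 2)⁻¹) * ∑ a, C a * ‖(EuclideanSpace.proj a : M →L[ℝ] ℝ)‖) y := by
    refine integrable_of_bound_inv_sq (C := D * ∑ a, C a * ‖(EuclideanSpace.proj a : M →L[ℝ] ℝ)‖)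
      (ρ := B) ?_ (fun y => ?_) fun y hy => ?_
    · exact (((by fun_prop : Measurable fun y : E3 => D * (1 + (‖y‖ ^ 2)⁻¹) *
        ∑ a, C a * ‖(EuclideanSpace.proj a : M →L[ℝ] ℝ)‖)).indicator
        Metric.isClosed_closedBall.measurableSet).aestronglyMeasurable
    · have h0 : 0 ≤ ∑ a, C a * ‖(EuclideanSpace.proj a : M →L[ℝ] ℝ)‖ :=
        Finset.sum_nonneg fun a _ => mul_nonneg (hC0 a) (norm_nonneg _)
      simp only [indicator]
      split_ifs
      · rw [abs_of_nonneg (by positivity)]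
        exact le_of_eq (by ring)
      · rw [abs_zero]
        positivity
    · exact indicator_of_notMem (fun hm => not_lt.2 (mem_closedBall_zero_iff.1 hm) hy) _
  have key := hasFDerivAt_integral_of_dominated_of_fderiv_le
    (F := fun x y => w y * f (x - coneVec σ y)) (F' := F') (x₀ := x)
    (bound := (Metric.closedBall (0 : E3) B).indicator
      (fun y => D * (1 + (‖y‖ ^ 2)⁻¹) * ∑ a, C a * ‖(EuclideanSpace.proj a : M →L[ℝ] ℝ)‖))
    (Metric.ball_mem_nhds x one_pos) (Eventually.of_forall fun x => hf.aestronglyMeasurable hw x)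
    (hf.integrable hσ hw x) ?_ ?_ hbi ?_
  · refine key.congr_fderiv ?_
    rw [integral_finsetSum _ fun a _ => ((hf.pd a).integrable hσ hw x).smul_const _]
    exact Finset.sum_congr rfl fun a _ => integral_smul_const _ _
  · exact Finset.aestronglyMeasurable_fun_sum _ fun a _ =>
      ((hf.pd a).aestronglyMeasurable hw x).smul_const _
  · refine Eventually.of_forall fun y z hz => ?_
    have hz1 : ‖z‖ ≤ ‖x‖ + 1 := by
      have h1 := (mem_ball_iff_norm.1 hz).le
      have h2 := norm_add_le (z - x) x
      rw [sub_add_cancel] at h2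
      linarith
    by_cases hy : B < ‖y‖
    · have h1 : F' z y = 0 := Finset.sum_eq_zero fun a _ => by
        have h2 : ρ a ≤ B := (le_abs_self _).trans
          (Finset.single_le_sum (f := fun a => |ρ a|) (fun b _ => abs_nonneg _) (Finset.mem_univ a))
        rw [(h a z hz1 y).2 (h2.trans_lt hy), mul_zero, zero_smul]
      rw [h1, norm_zero]
      exact indicator_nonneg (fun y _ => mul_nonneg (by positivity)
        (Finset.sum_nonneg fun a _ => mul_nonneg (hC0 a) (norm_nonneg _))) _
    · rw [indicator_of_mem (mem_closedBall_zero_iff.2 (not_lt.1 hy)), Finset.mul_sum]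
      refine norm_sum_le_of_le _ fun a _ => ?_
      rw [norm_smul, Real.norm_eq_abs, abs_mul, ← mul_assoc]
      exact mul_le_mul_of_nonneg_right (mul_le_mul (hD y) (h a z hz1 y).1 (abs_nonneg _)
        (by positivity)) (norm_nonneg _)
  · refine Eventually.of_forall fun y z _ => ?_
    have h1 := (hasFDerivAt_pd hf.smooth ((hasFDerivAt_id z).sub_const (coneVec σ y))).const_mul (w y)
    refine HasFDerivAt.congr_fderiv h1 (ContinuousLinearMap.ext fun v => ?_)
    simp only [F', ContinuousLinearMap.comp_id, _root_.smul_apply, id, _root_.sum_apply, smul_eq_mul]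
    rw [fderiv_eq_sum_pd, Finset.mul_sum]
    exact Finset.sum_congr rfl fun a _ => by
      change _ = _ * v a
      ring

theorem pd_coneInt (hf : RegionSmooth γ δ f) (hσ : |σ| = 1) (hw : ConeWeight w) (a : Fin 4) :
    pd a (coneInt w σ f) = coneInt w σ (pd a f) := by
  funext x
  rw [pd, (hf.hasFDerivAt_coneInt hσ hw x).fderiv]
  simp

theorem contDiff_coneInt (hf : RegionSmooth γ δ f) (hσ : |σ| = 1) (hw : ConeWeight w) :
    ContDiff ℝ ∞ (coneInt w σ f) := by
  rw [← contDiffOn_univ]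
  refine contDiffOn_of_closed isOpen_univ (fun F => ∃ f, RegionSmooth γ δ f ∧ F = coneInt w σ f) ?_
    ⟨f, hf, rfl⟩
  rintro F ⟨f, hf, rfl⟩
  exact ⟨4, fun a _ => EuclideanSpace.proj a, fun a => coneInt w σ (pd a f),
    fun _ => contDiffOn_const, fun a => ⟨_, hf.pd a, rfl⟩,
    fun x _ => hf.hasFDerivAt_coneInt hσ hw x⟩

theorem coneInt_add (hf : RegionSmooth γ δ f) (hg : RegionSmooth γ δ g) (hσ : |σ| = 1)
    (hw : ConeWeight w) (x : M) :
    coneInt w σ (fun x => f x + g x) x = coneInt w σ f x + coneInt w σ g x := by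
  simp only [coneInt, mul_add]
  exact integral_add (hf.integrable hσ hw x) (hg.integrable hσ hw x)

theorem coneInt_sub (hf : RegionSmooth γ δ f) (hg : RegionSmooth γ δ g) (hσ : |σ| = 1)
    (hw : ConeWeight w) (x : M) :
    coneInt w σ (fun x => f x - g x) x = coneInt w σ f x - coneInt w σ g x := by
  simp only [coneInt, mul_sub]
  exact integral_sub (hf.integrable hσ hw x) (hg.integrable hσ hw x)

theorem coneInt_coord_mul (hf : RegionSmooth γ δ f) (hσ : |σ| = 1) (hw : ConeWeight w) {b : Fin 4}
    (hw' : ConeWeight w') (h : ∀ y, y ≠ 0 → w' y = w y * coneVec σ y b) (x : M) :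
    coneInt w σ (fun x => x b * f x) x = x b * coneInt w σ f x - coneInt w' σ f x := by
  have h1 : coneInt w' σ f x = ∫ y, w y * coneVec σ y b * f (x - coneVec σ y) := by
    refine integral_congr_ae ?_
    filter_upwards [compl_mem_ae_iff.2 (measure_singleton (0 : E3))] with y hy
    simp only [h y hy]
  rw [h1]
  simp only [coneInt]
  rw [← integral_const_mul, ← integral_sub ((hf.integrable hσ hw x).const_mul _)]
  · congr 1
    funext y
    rw [PiLp.sub_apply]
    ring
  · refine (hf.integrable hσ hw' x).congr ?_
    filter_upwards [compl_mem_ae_iff.2 (measure_singleton (0 : E3))] with y hy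
    simp only [h y hy]

/-- Integration by parts in `y`. -/
theorem coneInt_parts (hf : RegionSmooth γ δ f) (hσ : |σ| = 1) {W W' W₀ : E3 → ℝ}
    (hW : ConeWeight W) (hW' : ConeWeight W') (hW₀ : ConeWeight W₀) (i : Fin 3)
    (h₀ : ∀ y, y ≠ 0 → W₀ y = σ * (y i / ‖y‖) * W y)
    (hd : ∀ y, y ≠ 0 → HasDerivAt (fun t : ℝ => W (y + t • EuclideanSpace.single i 1)) (W' y) 0)
    (x : M) : coneInt W' σ f x
      = coneInt W₀ σ (pd 0 f) x + coneInt W σ (pd i.succ f) x := by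
  have i1 := hf.integrable hσ hW' x
  have i2 := (hf.pd 0).integrable hσ hW₀ x
  have i3 := (hf.pd i.succ).integrable hσ hW x
  have i23 : Integrable fun y => W₀ y * pd 0 f (x - coneVec σ y)
      + W y * pd i.succ f (x - coneVec σ y) := i2.add i3
  have key := integral_partial_eq_zero i (G := fun y => W y * f (x - coneVec σ y))
    (G' := fun y => W' y * f (x - coneVec σ y) - (W₀ y * pd 0 f (x - coneVec σ y)
      + W y * pd i.succ f (x - coneVec σ y))) ?_ (i1.sub i23) ?_
  · rw [integral_sub i1 i23, integral_add i2 i3, sub_eq_zero] at key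
    exact key
  · intro y hy
    have hl := hasDerivAt_line i y
    have h1 := hasDerivAt_norm_line i hy
    have h2 : HasDerivAt (fun t : ℝ => x - coneVec σ (y + t • (EuclideanSpace.single i 1 : E3)))
        (-mkVecL (σ * (‖y‖⁻¹ * y i), EuclideanSpace.single i 1)) 0 :=
      (mkVecL.hasFDerivAt.comp_hasDerivAt (0 : ℝ) ((h1.const_mul σ).prodMk hl)).const_sub x
    have h3 : HasFDerivAt f (fderiv ℝ f (x - coneVec σ y))
        (x - coneVec σ (y + (0 : ℝ) • (EuclideanSpace.single i 1 : E3))) := by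
      simpa using (smooth_diffAt hf.smooth _).hasFDerivAt
    refine ((hd y hy).mul (h3.comp_hasDerivAt (0 : ℝ) h2)).congr_deriv ?_
    have h4 : mkVecL (σ * (‖y‖⁻¹ * y i), EuclideanSpace.single i 1)
        = mkVec (σ * (‖y‖⁻¹ * y i)) (EuclideanSpace.single i 1) := rfl
    rw [map_neg, h4, fderiv_mkVec, h₀ y hy]
    simp
    ring
  · refine (tendsto_const_nhds (x := (0 : ℝ))).congr' ?_
    obtain ⟨C, ρ, h⟩ := hf.exists_bound hσ ‖x‖
    filter_upwards [(isCompact_closedBall (0 : E3) ρ).compl_mem_cocompact] with y hy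
    rw [(h x le_rfl y).2 (not_le.1 fun h' => hy (mem_closedBall_zero_iff.2 h')), mul_zero]

end RegionSmooth

theorem coneInt_eq_zero {w : E3 → ℝ} {σ : ℝ} {f : M → ℝ} {x : M}
    (h : ∀ y, f (x - coneVec σ y) = 0) : coneInt w σ f x = 0 := by
  simp [coneInt, h]

theorem coneInt_congr {w : E3 → ℝ} {σ : ℝ} {f g : M → ℝ} {x : M}
    (h : ∀ y, f (x - coneVec σ y) = g (x - coneVec σ y)) : coneInt w σ f x = coneInt w σ g x := by
  simp [coneInt, h]

theorem coneInt_const_mul (w : E3 → ℝ) (σ c : ℝ) (f : M → ℝ) (x : M) :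
    coneInt w σ (fun x => c * f x) x = c * coneInt w σ f x := by
  simp only [coneInt, mul_left_comm _ c]
  exact integral_const_mul _ _

theorem coneInt_weight_const_mul (w : E3 → ℝ) (σ c : ℝ) (f : M → ℝ) (x : M) :
    coneInt (fun y => c * w y) σ f x = c * coneInt w σ f x := by
  simp only [coneInt, mul_assoc]
  exact integral_const_mul _ _

/-! ### Retarded and advanced potentials -/

theorem ConeWeight.const_mul {w : E3 → ℝ} (hw : ConeWeight w) (c : ℝ) :
    ConeWeight fun y => c * w y := by
  obtain ⟨C, hC⟩ := hw.bound
  refine ⟨hw.meas.const_mul c, |c| * C, fun y => ?_⟩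
  rw [abs_mul, mul_assoc]
  exact mul_le_mul_of_nonneg_left (hC y) (abs_nonneg c)

theorem ConeWeight.add {w w' : E3 → ℝ} (hw : ConeWeight w) (hw' : ConeWeight w') :
    ConeWeight fun y => w y + w' y := by
  obtain ⟨C, hC⟩ := hw.bound
  obtain ⟨D, hD⟩ := hw'.bound
  refine ⟨hw.meas.add hw'.meas, C + D, fun y => ?_⟩
  rw [add_mul]
  exact (abs_add_le _ _).trans (add_le_add (hC y) (hD y))

/-- The weight `(yⁱ)^p / |y|^m`. -/
def coneMonomial (i : Fin 3) (p m : ℕ) (y : E3) : ℝ := y i ^ p / ‖y‖ ^ m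

theorem coneWeight_monomial (i : Fin 3) {p m : ℕ} (h₁ : p ≤ m) (h₂ : m ≤ p + 2) :
    ConeWeight (coneMonomial i p m) := by
  refine ConeWeight.of_le (by unfold coneMonomial; fun_prop) 1 fun y hy => ?_
  have hr : 0 < ‖y‖ := norm_pos_iff.2 hy
  have hi : |y i| ≤ ‖y‖ := PiLp.norm_apply_le y i
  have h1 : |coneMonomial i p m y| ≤ ‖y‖ ^ p / ‖y‖ ^ m := by
    rw [coneMonomial, abs_div, abs_pow, abs_of_pos (pow_pos hr m)]
    gcongr
  refine h1.trans ?_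
  obtain ⟨k, rfl⟩ := Nat.exists_eq_add_of_le h₁
  have hk : k ≤ 2 := by omega
  rw [pow_add, div_mul_cancel_left₀ (pow_pos hr p).ne', one_mul]
  interval_cases k
  · simp
  · rw [pow_one, ← inv_pow]
    nlinarith [sq_nonneg (‖y‖⁻¹ - 1 / 2)]
  · linarith

theorem hasDerivAt_coneMonomial_one (i : Fin 3) (m : ℕ) {y : E3} (hy : y ≠ 0) :
    HasDerivAt (fun t : ℝ => coneMonomial i 1 m (y + t • EuclideanSpace.single i 1))
      (coneMonomial i 0 m y + -(m : ℝ) * coneMonomial i 2 (m + 2) y) 0 := by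
  have hr : 0 < ‖y‖ := norm_pos_iff.2 hy
  have h1 := hasDerivAt_norm_line i hy
  have h2 : HasDerivAt (fun t : ℝ => (y + t • (EuclideanSpace.single i 1 : E3)) i) 1 0 := by
    simpa using (hasDerivAt_id (0 : ℝ)).const_add (y i)
  have h3 := (h2.pow 1).div (h1.pow m) (by simpa using (pow_pos hr m).ne')
  refine HasDerivAt.congr_deriv h3 ?_
  simp only [coneMonomial]
  rcases m with _ | m
  · simp
  · simp
    field_simp
    ring

theorem hasDerivAt_coneMonomial_zero (i : Fin 3) (m : ℕ) {y : E3} (hy : y ≠ 0) :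
    HasDerivAt (fun t : ℝ => coneMonomial i 0 m (y + t • EuclideanSpace.single i 1))
      (-(m : ℝ) * coneMonomial i 1 (m + 2) y) 0 := by
  have hr : 0 < ‖y‖ := norm_pos_iff.2 hy
  have h1 := hasDerivAt_norm_line i hy
  have h3 := (hasDerivAt_const (0 : ℝ) (1 : ℝ)).div (h1.pow m) (by simpa using (pow_pos hr m).ne')
  have h4 : (fun t : ℝ => coneMonomial i 0 m (y + t • EuclideanSpace.single i 1))
      = fun t : ℝ => 1 / ‖y + t • (EuclideanSpace.single i 1 : E3)‖ ^ m := by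
    funext t
    simp [coneMonomial]
  rw [h4]
  refine HasDerivAt.congr_deriv h3 ?_
  simp only [coneMonomial]
  rcases m with _ | m
  · simp
  · simp
    field_simp
    ring

theorem sum_coneMonomial_two (m : ℕ) {y : E3} (hy : y ≠ 0) :
    ∑ i, coneMonomial i 2 (m + 2) y = (‖y‖ ^ m)⁻¹ := by
  have hr : 0 < ‖y‖ := norm_pos_iff.2 hy
  simp only [coneMonomial]
  rw [← Finset.sum_div, ← EuclideanSpace.real_norm_sq_eq, pow_add]
  field_simp

/-- The potential `∫ |y|⁻¹ f(x⁰ - σ |y|, x⃗ - y) d³y`. -/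
def conePot (σ : ℝ) (f : M → ℝ) : M → ℝ := coneInt (fun y => ‖y‖⁻¹) σ f

/-- The wave operator. -/
def box (f : M → ℝ) (x : M) : ℝ := pd 0 (pd 0 f) x - ∑ i : Fin 3, pd i.succ (pd i.succ f) x

theorem coneWeight_inv : ConeWeight fun y : E3 => ‖y‖⁻¹ := by
  have h := coneWeight_monomial 0 (p := 0) (m := 1) (by norm_num) (by norm_num)
  unfold coneMonomial at h
  simpa using h

theorem coneWeight_const (c : ℝ) : ConeWeight fun _ : E3 => c := by
  have h := (coneWeight_monomial 0 (p := 0) (m := 0) (by norm_num) (by norm_num)).const_mul c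
  unfold coneMonomial at h
  simpa using h

theorem coneInt_congr_weight {w w' : E3 → ℝ} (h : ∀ y, y ≠ 0 → w y = w' y) (σ : ℝ) (f : M → ℝ)
    (x : M) : coneInt w σ f x = coneInt w' σ f x := by
  refine integral_congr_ae ?_
  filter_upwards [compl_mem_ae_iff.2 (measure_singleton (0 : E3))] with y hy
  simp only [h y hy]

namespace RegionSmooth

variable {γ δ σ : ℝ} {f g : M → ℝ} {w w' : E3 → ℝ}

theorem sum {ι : Type*} {s : Finset ι} (hs : s.Nonempty) {F : ι → M → ℝ}
    (hF : ∀ i ∈ s, RegionSmooth γ δ (F i)) : RegionSmooth γ δ fun x => ∑ i ∈ s, F i x where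
  nonneg := (hF _ hs.choose_spec).nonneg
  lt_one := (hF _ hs.choose_spec).lt_one
  smooth := ContDiff.sum fun i hi => (hF i hi).smooth
  supp x hx := by
    obtain ⟨i, hi, h⟩ := Finset.exists_ne_zero_of_sum_ne_zero hx
    exact (hF i hi).supp x h

theorem coneInt_sum {ι : Type*} {s : Finset ι} {F : ι → M → ℝ}
    (hF : ∀ i ∈ s, RegionSmooth γ δ (F i)) (hσ : |σ| = 1) (hw : ConeWeight w) (x : M) :
    coneInt w σ (fun x => ∑ i ∈ s, F i x) x = ∑ i ∈ s, coneInt w σ (F i) x := by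
  simp only [coneInt, Finset.mul_sum]
  exact integral_finsetSum _ fun i hi => (hF i hi).integrable hσ hw x

theorem coneInt_weight_sum {ι : Type*} {s : Finset ι} (hf : RegionSmooth γ δ f) (hσ : |σ| = 1)
    {W : ι → E3 → ℝ} (hW : ∀ i ∈ s, ConeWeight (W i)) (x : M) :
    coneInt (fun y => ∑ i ∈ s, W i y) σ f x = ∑ i ∈ s, coneInt (W i) σ f x := by
  simp only [coneInt, Finset.sum_mul]
  exact integral_finsetSum _ fun i hi => hf.integrable hσ (hW i hi) x

theorem pd_conePot (hf : RegionSmooth γ δ f) (hσ : |σ| = 1) (a : Fin 4) :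
    pd a (conePot σ f) = conePot σ (pd a f) :=
  hf.pd_coneInt hσ coneWeight_inv a

theorem contDiff_conePot (hf : RegionSmooth γ δ f) (hσ : |σ| = 1) : ContDiff ℝ ∞ (conePot σ f) :=
  hf.contDiff_coneInt hσ coneWeight_inv

theorem conePot_zero_mul (hf : RegionSmooth γ δ f) (hσ : |σ| = 1) (x : M) :
    conePot σ (fun x => x 0 * f x) x = x 0 * conePot σ f x - σ * coneInt (fun _ => 1) σ f x := by
  rw [← coneInt_weight_const_mul]
  refine hf.coneInt_coord_mul hσ coneWeight_inv ((coneWeight_const 1).const_mul σ) (fun y hy => ?_) x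
  rw [coneVec_zero_apply]
  have : ‖y‖ ≠ 0 := norm_ne_zero_iff.2 hy
  field_simp

theorem conePot_succ_mul (hf : RegionSmooth γ δ f) (hσ : |σ| = 1) (i : Fin 3) (x : M) :
    conePot σ (fun x => x i.succ * f x) x
      = x i.succ * conePot σ f x - coneInt (coneMonomial i 1 1) σ f x := by
  refine hf.coneInt_coord_mul hσ coneWeight_inv (coneWeight_monomial i le_rfl (by norm_num))
    (fun y hy => ?_) x
  rw [coneVec_succ, coneMonomial]
  simp
  ring

theorem coneInt_one_parts (hf : RegionSmooth γ δ f) (hσ : |σ| = 1) (i : Fin 3) (x : M) :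
    σ * coneInt (coneMonomial i 1 1) σ (pd 0 f) x
      + coneInt (fun _ => 1) σ (pd i.succ f) x = 0 := by
  have h := hf.coneInt_parts hσ (coneWeight_const 1) (coneWeight_const 0)
    ((coneWeight_monomial i (p := 1) (m := 1) le_rfl (by norm_num)).const_mul σ) i
    (fun y hy => by simp [coneMonomial]) (fun y _ => hasDerivAt_const _ _) x
  rw [coneInt_weight_const_mul] at h
  rw [← h]
  simp [coneInt]

theorem boost_conePot (hf : RegionSmooth γ δ f) (hσ : |σ| = 1) (i : Fin 3) :
    boost i (conePot σ f) = conePot σ (boost i f) := by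
  funext x
  have h1 : conePot σ (boost i f) x = _ :=
    ((hf.pd 0).mul (contDiff_coord i.succ)).coneInt_add ((hf.pd i.succ).mul (contDiff_coord 0)) hσ
      coneWeight_inv x
  have h2 := (hf.pd 0).conePot_succ_mul hσ i x
  have h3 := (hf.pd i.succ).conePot_zero_mul hσ x
  have h4 := hf.coneInt_one_parts hσ i x
  have h5 : σ * σ = 1 := by rw [← abs_mul_abs_self, hσ, one_mul]
  rw [conePot] at h2 h3
  rw [h1, h2, h3, boost, hf.pd_conePot hσ, hf.pd_conePot hσ]
  simp only [conePot]
  linear_combination σ * h4 - coneInt (coneMonomial i 1 1) σ (pd 0 f) x * h5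

theorem rot_conePot (hf : RegionSmooth γ δ f) (hσ : |σ| = 1) (i j : Fin 3) :
    rot i j (conePot σ f) = conePot σ (rot i j f) := by
  funext x
  rw [boost_comm (hf.contDiff_conePot hσ), boost_comm hf.smooth, hf.boost_conePot hσ,
    hf.boost_conePot hσ, (hf.boost j).boost_conePot hσ, (hf.boost i).boost_conePot hσ]
  exact (((hf.boost j).boost i).coneInt_sub ((hf.boost i).boost j) hσ coneWeight_inv x).symm

theorem eul_conePot (hf : RegionSmooth γ δ f) (hσ : |σ| = 1) (x : M) :
    eul 1 (conePot σ f) x = conePot σ (eul 3 f) x := by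
  have hparts : ∀ i : Fin 3, coneInt (fun y => coneMonomial i 0 1 y
        + -((1 : ℕ) : ℝ) * coneMonomial i 2 3 y) σ f x
      = σ * coneInt (coneMonomial i 2 2) σ (pd 0 f) x
        + coneInt (coneMonomial i 1 1) σ (pd i.succ f) x := by
    intro i
    rw [← coneInt_weight_const_mul]
    refine hf.coneInt_parts hσ (coneWeight_monomial i le_rfl (by norm_num))
      ((coneWeight_monomial i (by norm_num) (by norm_num)).add
        ((coneWeight_monomial i (by norm_num) (by norm_num)).const_mul _))
      ((coneWeight_monomial i (by norm_num) (by norm_num)).const_mul _) i (fun y hy => ?_)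
      (fun y hy => hasDerivAt_coneMonomial_one i 1 hy) x
    simp only [coneMonomial]
    ring
  have hsum := Finset.sum_congr (rfl : (Finset.univ : Finset (Fin 3)) = Finset.univ)
    fun i _ => hparts i
  rw [← hf.coneInt_weight_sum hσ fun i _ => (coneWeight_monomial i (by norm_num) (by norm_num)).add
      ((coneWeight_monomial i (by norm_num) (by norm_num)).const_mul _),
    Finset.sum_add_distrib, ← Finset.mul_sum, ← (hf.pd 0).coneInt_weight_sum hσ fun i _ =>
      coneWeight_monomial i (by norm_num) (by norm_num),
    coneInt_congr_weight (w' := fun y => 2 * ‖y‖⁻¹) (fun y hy => by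
      rw [Finset.sum_add_distrib, ← Finset.mul_sum, sum_coneMonomial_two 1 hy]
      simp [coneMonomial]
      ring),
    coneInt_congr_weight (w := fun y => ∑ i, coneMonomial i 2 2 y) (w' := fun _ => 1) (fun y hy => by
      rw [sum_coneMonomial_two 0 hy]
      simp), coneInt_weight_const_mul] at hsum
  have h1 : conePot σ (eul 3 f) x
      = conePot σ (fun x => x 0 * pd 0 f x) x
        + ∑ i : Fin 3, conePot σ (fun x => x i.succ * pd i.succ f x) x
        + 3 * conePot σ f x := by
    have e1 : eul 3 f = fun x => (x 0 * pd 0 f x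
        + ∑ i : Fin 3, x i.succ * pd i.succ f x) + 3 * f x := by
      funext x
      rw [eul_eq, Fin.sum_univ_succ]
    have r1 := (hf.pd 0).mul (contDiff_coord 0)
    have r2 : ∀ i ∈ (Finset.univ : Finset (Fin 3)), RegionSmooth γ δ
        fun x => x i.succ * pd i.succ f x :=
      fun i _ => (hf.pd i.succ).mul (contDiff_coord i.succ)
    have r3 := RegionSmooth.sum Finset.univ_nonempty r2
    simp only [conePot]
    rw [e1, (r1.add r3).coneInt_add (hf.const_mul 3) hσ coneWeight_inv,
      r1.coneInt_add r3 hσ coneWeight_inv, coneInt_sum r2 hσ coneWeight_inv, coneInt_const_mul]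
  rw [h1, (hf.pd 0).conePot_zero_mul hσ]
  simp only [(hf.pd _).conePot_succ_mul hσ, Finset.sum_sub_distrib]
  rw [eul_eq, Fin.sum_univ_succ]
  simp only [hf.pd_conePot hσ]
  simp only [conePot] at hsum ⊢
  linarith

theorem conePot_box (hf : RegionSmooth γ δ f) (hσ : |σ| = 1) (x : M) :
    conePot σ (box f) x = sphereArea * f x := by
  have h5 : σ * σ = 1 := by rw [← abs_mul_abs_self, hσ, one_mul]
  have p1 : ∀ i : Fin 3, -((1 : ℕ) : ℝ) * coneInt (coneMonomial i 1 3) σ (pd i.succ f) x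
      = σ * coneInt (coneMonomial i 1 2) σ (pd i.succ (pd 0 f)) x
        + conePot σ (pd i.succ (pd i.succ f)) x := by
    intro i
    rw [← coneInt_weight_const_mul, ← coneInt_weight_const_mul, pd_comm hf.smooth i.succ 0,
      conePot, coneInt_congr_weight (w := fun y => ‖y‖⁻¹) (w' := coneMonomial i 0 1)
        (fun y _ => by simp [coneMonomial])]
    refine (hf.pd i.succ).coneInt_parts hσ (coneWeight_monomial i (by norm_num) (by norm_num))
      ((coneWeight_monomial i (by norm_num) (by norm_num)).const_mul _)
      ((coneWeight_monomial i (by norm_num) (by norm_num)).const_mul _) i (fun y hy => ?_)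
      (fun y hy => hasDerivAt_coneMonomial_zero i 1 hy) x
    simp only [coneMonomial]
    ring
  have p2 : ∀ i : Fin 3, coneInt (fun y => coneMonomial i 0 2 y
        + -((2 : ℕ) : ℝ) * coneMonomial i 2 4 y) σ (pd 0 f) x
      = σ * coneInt (coneMonomial i 2 3) σ (pd 0 (pd 0 f)) x
        + coneInt (coneMonomial i 1 2) σ (pd i.succ (pd 0 f)) x := by
    intro i
    rw [← coneInt_weight_const_mul]
    refine (hf.pd 0).coneInt_parts hσ (coneWeight_monomial i (by norm_num) (by norm_num))
      ((coneWeight_monomial i (by norm_num) (by norm_num)).add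
        ((coneWeight_monomial i (by norm_num) (by norm_num)).const_mul _))
      ((coneWeight_monomial i (by norm_num) (by norm_num)).const_mul _) i (fun y hy => ?_)
      (fun y hy => hasDerivAt_coneMonomial_one i 2 hy) x
    simp only [coneMonomial]
    ring
  have s1 := Finset.sum_congr (rfl : (Finset.univ : Finset (Fin 3)) = Finset.univ)
    fun i _ => p1 i
  have s2 := Finset.sum_congr (rfl : (Finset.univ : Finset (Fin 3)) = Finset.univ)
    fun i _ => p2 i
  rw [← (hf.pd 0).coneInt_weight_sum hσ fun i _ =>
      (coneWeight_monomial i (by norm_num) (by norm_num)).add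
      ((coneWeight_monomial i (by norm_num) (by norm_num)).const_mul _),
    Finset.sum_add_distrib, ← Finset.mul_sum, ← ((hf.pd 0).pd 0).coneInt_weight_sum hσ fun i _ =>
      coneWeight_monomial i (by norm_num) (by norm_num),
    coneInt_congr_weight (w' := fun y => (‖y‖ ^ 2)⁻¹) (fun y hy => by
      rw [Finset.sum_add_distrib, ← Finset.mul_sum, sum_coneMonomial_two 2 hy]
      simp [coneMonomial]
      ring),
    coneInt_congr_weight (w := fun y => ∑ i, coneMonomial i 2 3 y) (w' := fun y => ‖y‖⁻¹)
      (fun y hy => by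
      rw [sum_coneMonomial_two 1 hy]
      simp)] at s2
  rw [Finset.sum_add_distrib, ← Finset.mul_sum, ← Finset.mul_sum] at s1
  have hbox : conePot σ (box f) x = conePot σ (pd 0 (pd 0 f)) x
      - ∑ i : Fin 3, conePot σ (pd i.succ (pd i.succ f)) x := by
    have r2 : ∀ i ∈ (Finset.univ : Finset (Fin 3)), RegionSmooth γ δ
        (pd i.succ (pd i.succ f)) :=
      fun i _ => (hf.pd i.succ).pd i.succ
    have := ((hf.pd 0).pd 0).coneInt_sub (RegionSmooth.sum Finset.univ_nonempty r2) hσ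
      coneWeight_inv x
    rw [coneInt_sum r2 hσ coneWeight_inv] at this
    exact this
  have w2 : ConeWeight fun y : E3 => (‖y‖ ^ 2)⁻¹ :=
    ConeWeight.of_le (by fun_prop) 1 fun y _ => by
      rw [abs_of_nonneg (by positivity)]
      linarith
  have w3 : ∀ i, ConeWeight (coneMonomial i 1 3) := fun i =>
    coneWeight_monomial i (by norm_num) (by norm_num)
  have hrad : conePot σ (box f) x = ∫ y, (σ * ((‖y‖ ^ 2)⁻¹ * pd 0 f (x - coneVec σ y))
      + ∑ i : Fin 3, coneMonomial i 1 3 y * pd i.succ f (x - coneVec σ y)) := by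
    rw [integral_add (((hf.pd 0).integrable hσ w2 x).const_mul σ)
      (integrable_finsetSum _ fun i _ => (hf.pd i.succ).integrable hσ (w3 i) x),
      integral_const_mul, integral_finsetSum _ fun i _ => (hf.pd i.succ).integrable hσ (w3 i) x, hbox]
    simp only [conePot, coneInt, Nat.cast_one] at s1 s2 ⊢
    linear_combination -σ * s2 + s1 - (∫ y, ‖y‖⁻¹ * pd 0 (pd 0 f)
      (x - coneVec σ y)) * h5
  have hint : Integrable fun y => σ * ((‖y‖ ^ 2)⁻¹ * pd 0 f (x - coneVec σ y))
      + ∑ i : Fin 3, coneMonomial i 1 3 y * pd i.succ f (x - coneVec σ y) :=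
    (((hf.pd 0).integrable hσ w2 x).const_mul σ).add
      (integrable_finsetSum _ fun i _ => (hf.pd i.succ).integrable hσ (w3 i) x)
  rw [hrad, integral_polar hint]
  have hn : ∀ n : S2, ∫ r in Ioi (0 : ℝ), r ^ 2 * (σ * ((‖r • (n : E3)‖ ^ 2)⁻¹
      * pd 0 f (x - coneVec σ (r • (n : E3))))
      + ∑ i : Fin 3, coneMonomial i 1 3 (r • (n : E3))
        * pd i.succ f (x - coneVec σ (r • (n : E3)))) = f x := by
    intro n
    let F : ℝ → ℝ := fun r => -f (x - r • mkVec σ (n : E3))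
    have hline : ∀ r : ℝ, HasDerivAt (fun r : ℝ => x - r • mkVec σ (n : E3)) (-mkVec σ (n : E3)) r := by
      intro r
      simpa using ((hasDerivAt_id r).smul_const (mkVec σ (n : E3))).const_sub x
    have hF : ∀ r, HasDerivAt F (fderiv ℝ f (x - r • mkVec σ (n : E3)) (mkVec σ (n : E3))) r := by
      intro r
      refine ((smooth_diffAt hf.smooth _).hasFDerivAt.comp_hasDerivAt r (hline r)).neg.congr_deriv ?_
      simp
    have hpt : ∀ r : ℝ, 0 ≤ r → x - coneVec σ (r • (n : E3)) = x - r • mkVec σ (n : E3) := by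
      intro r hr
      rw [coneVec, norm_smul, n.norm, Real.norm_eq_abs, abs_of_nonneg hr, mkVec_smul]
      simp [mul_comm]
    have hzero : ∀ r : ℝ, (γ + 2 * ‖x‖) / (1 - δ) < r → 0 ≤ r → ∀ g, RegionSmooth γ δ g →
        g (x - r • mkVec σ (n : E3)) = 0 := by
      intro r hr h0 g hg
      by_contra hne
      rw [← hpt r h0] at hne
      have := hg.norm_le hσ hne
      rw [norm_smul, n.norm, Real.norm_eq_abs, abs_of_nonneg h0] at this
      linarith
    have hcont : Continuous fun r : ℝ =>
        fderiv ℝ f (x - r • mkVec σ (n : E3)) (mkVec σ (n : E3)) :=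
      ((hf.smooth.continuous_fderiv (by simp)).comp (by fun_prop)).clm_apply continuous_const
    have hI : IntegrableOn (fun r : ℝ =>
        fderiv ℝ f (x - r • mkVec σ (n : E3)) (mkVec σ (n : E3))) (Ioi 0) := by
      set b := max 0 ((γ + 2 * ‖x‖) / (1 - δ)) with hb
      rw [← Ioc_union_Ioi_eq_Ioi (le_max_left 0 ((γ + 2 * ‖x‖) / (1 - δ))), ← hb]
      refine IntegrableOn.union
        ((Continuous.integrableOn_Icc (by fun_prop)).mono_set Ioc_subset_Icc_self) ?_
      refine integrableOn_zero.congr_fun (fun r hr => ?_) measurableSet_Ioi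
      have hr : b < r := hr
      have h1 := hzero r ((le_max_right _ _).trans_lt hr) ((le_max_left _ _).trans hr.le)
      rw [fderiv_eq_sum_pd]
      simp [fun a => h1 _ (hf.pd a)]
    have hlim : Tendsto F atTop (𝓝 0) := by
      refine tendsto_const_nhds.congr' ?_
      filter_upwards [eventually_gt_atTop ((γ + 2 * ‖x‖) / (1 - δ)), eventually_ge_atTop 0]
        with r h1 h2
      simp only [F, hzero r h1 h2 f hf, neg_zero]
    have key := integral_Ioi_of_hasDerivAt_of_tendsto (hF 0).continuousAt.continuousWithinAt
      (fun r _ => hF r) hI hlim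
    simp only [F, zero_smul, sub_zero, sub_neg_eq_add, zero_add] at key
    rw [← key]
    refine setIntegral_congr_fun measurableSet_Ioi fun r hr => ?_
    have hr : 0 < r := hr
    rw [hpt r hr.le, fderiv_mkVec, norm_smul, n.norm, Real.norm_eq_abs, abs_of_pos hr, mul_add,
      Finset.mul_sum]
    congr 1
    · field_simp
    · refine Finset.sum_congr rfl fun i _ => ?_
      rw [coneMonomial, norm_smul, n.norm, Real.norm_eq_abs, abs_of_pos hr, PiLp.smul_apply,
        smul_eq_mul]
      field_simp
  simp only [hn]
  rw [integral_const, smul_eq_mul]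
  rfl

end RegionSmooth

/-! ### The radiation field -/

/-- The difference of the retarded and the advanced potential. -/
def radField (f : M → ℝ) (x : M) : ℝ := conePot 1 f x - conePot (-1) f x

theorem one_lt_norm_sub_coneVec {σ : ℝ} (hσ : |σ| = 1) {x : M} (hx : σ * x 0 + 2 < ‖spatial x‖)
    (y : E3) : 1 < ‖x - coneVec σ y‖ := by
  have h1 := norm_spatial_le (x - coneVec σ y)
  have h2 := abs_zero_le_norm (x - coneVec σ y)
  rw [spatial_sub, spatial_coneVec] at h1
  rw [PiLp.sub_apply, coneVec_zero_apply] at h2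
  have h3 : ‖spatial x‖ - ‖y‖ ≤ ‖spatial x - y‖ := norm_sub_norm_le _ _
  have h4 : ‖y‖ - σ * x 0 ≤ |x 0 - σ * ‖y‖| := by
    have h5 : σ * σ = 1 := by rw [← abs_mul_abs_self, hσ, one_mul]
    have h6 : |σ * (x 0 - σ * ‖y‖)| = |x 0 - σ * ‖y‖| := by rw [abs_mul, hσ, one_mul]
    rw [← h6]
    refine le_trans (le_of_eq ?_) (neg_le_abs _)
    linear_combination -‖y‖ * h5
  linarith

theorem hasDerivAt_mkVec_time {f : M → ℝ} (hf : ContDiff ℝ ∞ f) (t : ℝ) (y : E3) (u : ℝ) :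
    HasDerivAt (fun u => f (mkVec (t + u) y)) (pd 0 f (mkVec (t + u) y)) u := by
  have h1 : HasDerivAt (fun u : ℝ => mkVec (t + u) y) (mkVec 1 0) u :=
    mkVecL.hasFDerivAt.comp_hasDerivAt u (((hasDerivAt_id u).const_add t).prodMk
      (hasDerivAt_const u y))
  refine ((smooth_diffAt hf _).hasFDerivAt.comp_hasDerivAt u h1).congr_deriv ?_
  rw [fderiv_mkVec]
  simp

/-- The radiation field as a superposition of plane waves. -/
theorem integral_sphere_nullInt {γ δ : ℝ} {f : M → ℝ} (hr : RegionSmooth γ δ f) (hf : Decays 3 f)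
    (x : M) : ∫ n : S2, nullInt (pd 0 f) (x 0 - inner ℝ (n : E3) (spatial x)) n ∂sphereMeasure
      = -(sphereArea / 2) * radField f x := by
  have hd := hf.pd 0
  obtain ⟨C, h0, hC⟩ := hd.planePt_bound (by norm_num)
  have e1 : ∀ n : S2, nullInt (pd 0 f) (x 0 - inner ℝ (n : E3) (spatial x)) n
      = ∫ y, pd 0 f (mkVec (x 0 + inner ℝ (n : E3) (y - spatial x)) y) := by
    intro n
    rw [nullInt, n.norm, inv_one, one_mul]
    congr 1
    funext y
    rw [planePt, n.norm, div_one, inner_sub_right]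
    congr 2
    ring
  simp only [e1]
  have hcont : Continuous fun p : S2 × E3 =>
      pd 0 f (mkVec (x 0 + inner ℝ (p.1 : E3) (p.2 - spatial x)) p.2) := by
    have h1 : Continuous fun p : S2 × E3 =>
        (x 0 + inner ℝ (p.1 : E3) (p.2 - spatial x), p.2) := by fun_prop
    exact (contDiff_pd hf.smooth 0).continuous.comp (mkVecL.continuous.comp h1)
  rw [integral_integral_swap]
  · have e2 : ∀ y : E3, y ≠ spatial x →
        ∫ n : S2, pd 0 f (mkVec (x 0 + inner ℝ (n : E3) (y - spatial x)) y) ∂sphereMeasure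
        = sphereArea / 2 * (‖y - spatial x‖⁻¹ * f (mkVec (x 0 + ‖y - spatial x‖) y)
          - ‖y - spatial x‖⁻¹ * f (mkVec (x 0 - ‖y - spatial x‖) y)) := by
      intro y hy
      rw [integral_sphere_deriv_inner (sub_ne_zero.2 hy) (k := fun u => f (mkVec (x 0 + u) y))
        (k' := fun u => pd 0 f (mkVec (x 0 + u) y)) (hasDerivAt_mkVec_time hf.smooth (x 0) y)]
      · simp only [← sub_eq_add_neg]
        ring
      · exact (contDiff_pd hf.smooth 0).continuous.comp
          (mkVecL.continuous.comp (Continuous.prodMk (by fun_prop) continuous_const))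
    have e3 : (∫ y, ∫ n : S2, pd 0 f (mkVec (x 0 + inner ℝ (n : E3) (y - spatial x)) y) ∂sphereMeasure)
        = ∫ y, sphereArea / 2 * (‖y - spatial x‖⁻¹ * f (mkVec (x 0 + ‖y - spatial x‖) y)
          - ‖y - spatial x‖⁻¹ * f (mkVec (x 0 - ‖y - spatial x‖) y)) := by
      refine integral_congr_ae ?_
      filter_upwards [compl_mem_ae_iff.2 (measure_singleton (spatial x))] with y hy using e2 y hy
    rw [e3, integral_const_mul, ← integral_sub_left_eq_self _ _ (spatial x), radField, conePot,
      conePot, coneInt, coneInt]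
    have i1 := hr.integrable (σ := 1) (by simp) coneWeight_inv x
    have i2 := hr.integrable (σ := -1) (by simp) coneWeight_inv x
    rw [← integral_sub i1 i2, neg_mul, ← mul_neg, ← integral_neg]
    congr 1
    refine integral_congr_ae (Eventually.of_forall fun y => ?_)
    have h1 : ∀ σ : ℝ, x - coneVec σ y = mkVec (x 0 - σ * ‖y‖) (spatial x - y) := by
      intro σ
      conv_lhs => rw [← mkVec_spatial x]
      exact (map_sub mkVecL (x 0, spatial x) (σ * ‖y‖, y)).symm
    simp only [sub_sub_cancel_left, norm_neg, h1]
    rw [one_mul, neg_one_mul, sub_neg_eq_add]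
    ring
  · refine ((integrable_const (1 : ℝ)).mul_prod ((integrable_one_add_norm_E3
      (κ := 3 + 1) (by norm_num)).const_mul C)).mono' hcont.aestronglyMeasurable
      (Eventually.of_forall fun p => ?_)
    have := hC (x 0 - inner ℝ (p.1 : E3) (spatial x)) p.1 p.2
    rw [planePt, p.1.norm, div_one, show x 0 - inner ℝ (p.1 : E3) (spatial x) + inner ℝ (p.1 : E3) p.2
      = x 0 + inner ℝ (p.1 : E3) (p.2 - spatial x) by rw [inner_sub_right]; ring] at this
    rw [one_mul]
    exact this

section

variable {ε : ℝ} {f : M → ℝ}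

theorem NullVanishing.profInt_eq_weightedInt (hε : 0 < ε) (hf : NullVanishing ε f) (s : ℝ) {x : E3}
    (hx : x ≠ 0) :
    profInt f s x = weightedInt (fun τ => (Iic s).indicator (fun _ => 1) τ - 1 / 2) f x := by
  have hi := hf.integrable_nullQuot hε hx
  rw [profInt, ← integral_indicator measurableSet_Iic, tailInt, ← integral_const_mul,
    ← integral_sub (hi.indicator measurableSet_Iic) (hi.const_mul _), weightedInt]
  congr 1
  funext τ
  by_cases h : τ ∈ Iic s
  · rw [indicator_of_mem h, indicator_of_mem h]
    ring
  · rw [indicator_of_notMem h, indicator_of_notMem h]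
    ring

theorem abs_indicator_sub_half_le (s τ : ℝ) :
    |(Iic s).indicator (fun _ => (1 : ℝ)) τ - 1 / 2| ≤ 1 := by
  by_cases h : τ ∈ Iic s
  · rw [indicator_of_mem h]
    norm_num [abs_le]
  · rw [indicator_of_notMem h]
    norm_num [abs_le]

theorem NullVanishing.hasFDerivAt_profInt (hε : 0 < ε) (hf : NullVanishing ε f) (s : ℝ) {x : E3}
    (hx : x ≠ 0) : HasFDerivAt (fun p : ℝ × E3 => profInt f p.1 p.2)
      (nullQuot f s x • ContinuousLinearMap.fst ℝ ℝ E3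
        + ∑ i : Fin 3, (‖x‖⁻¹ * profInt (boost i f) s x) •
          (EuclideanSpace.proj i : E3 →L[ℝ] ℝ).comp (ContinuousLinearMap.snd ℝ ℝ E3)) (s, x) := by
  have hd := (((hf.contDiffOn_profInt hε).contDiffAt (isOpen_snd_ne.mem_nhds hx :
    _ ∈ 𝓝 (s, x))).differentiableAt (by simp)).hasFDerivAt
  have h1 : HasDerivAt (fun t => profInt f t x) _ s :=
    HasFDerivAt.comp_hasDerivAt (l := fun p : ℝ × E3 => profInt f p.1 p.2) s hd ((hasDerivAt_id s).prodMk (hasDerivAt_const s x))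
  have h2 : HasFDerivAt (fun z => profInt f s z) _ x :=
    HasFDerivAt.comp (g := fun p : ℝ × E3 => profInt f p.1 p.2) x hd ((hasFDerivAt_const s x).prodMk (hasFDerivAt_id x))
  have h3 := h1.unique (hf.hasDerivAt_profInt hε s hx)
  have h4 : HasFDerivAt (fun z => profInt f s z) _ x :=
    (hf.hasFDerivAt_weightedInt hε (measurable_const.indicator measurableSet_Iic |>.sub
      measurable_const) (abs_indicator_sub_half_le s) hx).congr_of_eventuallyEq (by
      filter_upwards [isOpen_ne.mem_nhds hx] with z hz using hf.profInt_eq_weightedInt hε s hz)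
  have h5 := h2.unique h4
  refine hd.congr_fderiv (ContinuousLinearMap.ext fun v => ?_)
  have h6 := congrArg (fun L => L v.2) h5
  have hv : v = v.1 • ((1 : ℝ), (0 : E3)) + ((0 : ℝ), v.2) := by
    ext <;> simp
  rw [hv, map_add, map_smul, h3]
  simp only [ContinuousLinearMap.comp_apply, ContinuousLinearMap.prod_apply,
    _root_.zero_apply, ContinuousLinearMap.id_apply] at h6
  rw [h6]
  change _ + (∑ i : Fin 3, (‖x‖⁻¹ * weightedInt (fun τ => (Iic s).indicator (fun _ => 1) τ - 1 / 2)
    (boost i f) x) • (EuclideanSpace.proj i : E3 →L[ℝ] ℝ)) v.2 = _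
  simp only [fun i => (hf.boost hε i).profInt_eq_weightedInt hε s hx]
  simp
  ring

theorem NullVanishing.exists_bound_sphere (hε : 0 < ε) (hf : NullVanishing ε f) :
    ∃ C, ∀ (s : ℝ) (n : S2), |profInt f s n| ≤ C := by
  obtain ⟨C, h0, hC⟩ := hf.nullQuot_bound hε
  refine ⟨∫ s : ℝ, C * (1 + ‖s‖) ^ (-(1 + ε)), fun s n => ?_⟩
  rw [hf.profInt_eq_weightedInt hε s n.ne_zero]
  rw [weightedInt, ← Real.norm_eq_abs]
  refine norm_integral_le_of_norm_le ((integrable_one_add_norm (E := ℝ)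
    (μ := volume) (r := 1 + ε) (by simpa using hε)).const_mul C)
    (Eventually.of_forall fun τ => ?_)
  rw [norm_mul]
  have h1 := hC τ n n.ne_zero
  rw [n.norm, one_pow, one_mul, div_one] at h1
  refine (mul_le_mul (abs_indicator_sub_half_le s τ) h1 (abs_nonneg _) zero_le_one).trans
    (le_of_eq ?_)
  rw [one_mul, Real.rpow_neg (by positivity), div_eq_mul_inv, Real.norm_eq_abs]

theorem continuous_sphere_of_contDiffOn {F : ℝ → E3 → ℝ}
    (hF : ContDiffOn ℝ ∞ (fun p : ℝ × E3 => F p.1 p.2) {p | p.2 ≠ 0}) {s : S2 → ℝ}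
    (hs : Continuous s) : Continuous fun n : S2 => F (s n) n :=
  hF.continuousOn.comp_continuous (hs.prodMk continuous_subtype_val) fun n => n.ne_zero

/-- The radiation field of a source with vanishing tail falls off faster than `1/R` in spacelike
directions. -/
theorem OddHom.tendsto_radField (hε : 0 < ε) (hf : OddHom ε f) {γ δ : ℝ} (hr : RegionSmooth γ δ f)
    (hT : ∀ z : E3, z ≠ 0 → tailInt (eul 3 f) z = 0) {x : M} (hx : spatial x ≠ 0)
    (hm : mdot x x ≠ 0) : Tendsto (fun R : ℝ => R * radField f (R • x)) atTop (𝓝 0) := by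
  set φ := eul 3 f with hφ
  have hn : NullVanishing ε φ := hf.nullVanishing hε
  let s : S2 → ℝ := fun n => x 0 - inner ℝ (n : E3) (spatial x)
  have hsc : Continuous s := continuous_const.sub (continuous_sphere_inner _)
  have hs0 : ∀ᵐ n : S2 ∂sphereMeasure, s n ≠ 0 := by
    filter_upwards [sphere_inner_ne hx (x 0)] with n h1 h2
    exact h1 (sub_eq_zero.1 h2).symm
  have hTb : ∀ (i : Fin 3) (z : E3), z ≠ 0 → tailInt (boost i φ) z = 0 := by
    intro i z hz
    have h1 := hn.hasFDerivAt_tailInt hε hz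
    have h2 : HasFDerivAt (tailInt φ) (0 : E3 →L[ℝ] ℝ) z :=
      (hasFDerivAt_const (0 : ℝ) z).congr_of_eventuallyEq (by
        filter_upwards [isOpen_ne.mem_nhds hz] with w hw using hT w hw)
    have h3 := congrArg (fun L => L (EuclideanSpace.single i 1)) (h1.unique h2)
    have h4 : ‖z‖⁻¹ ≠ 0 := inv_ne_zero (norm_ne_zero_iff.2 hz)
    simpa [Finset.sum_apply, Pi.single_apply, h4, hz] using h3
  have hrad : ∀ R : ℝ, 0 < R → -(sphereArea / 2) * radField f (R • x)
      = ∫ n : S2, nullQuot φ (R * s n) n ∂sphereMeasure := by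
    intro R hR
    rw [← integral_sphere_nullInt hr (hf.decays_three hε)]
    refine integral_congr_ae ?_
    filter_upwards [hs0] with n h0
    have h1 : (R • x) 0 - inner ℝ (n : E3) (spatial (R • x)) = R * s n := by
      rw [spatial_smul, inner_smul_right, PiLp.smul_apply, smul_eq_mul]
      ring
    have h2 : R * s n ≠ 0 := mul_ne_zero hR.ne' h0
    rw [h1, hn.nullQuot_eq hε h2 n.ne_zero, hf.nullInt_eul hε _ n.ne_zero, n.norm, div_one,
      inv_mul_cancel_left₀ h2]
  have hid : ∀ R : ℝ, 0 < R → mdot x x * (R * ∫ n : S2, nullQuot φ (R * s n) n ∂sphereMeasure)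
      = (∫ n : S2, x 0 * nullInt φ (R * s n) n ∂sphereMeasure)
        + (∫ n : S2, inner ℝ (n : E3) (spatial x) * profInt φ (R * s n) n ∂sphereMeasure)
        - ∑ i : Fin 3, ∫ n : S2, spatial x i * profInt (boost i φ) (R * s n) n ∂sphereMeasure := by
    intro R hR
    let S : E3 → ℝ := fun w => R * (x 0 * ‖w‖ - inner ℝ w (spatial x))
    have hS : ∀ n : S2, S n = R * s n := fun n => by simp only [S, n.norm, mul_one, s]
    let h : E3 → ℝ := fun w => profInt φ (S w) w
    have hSd : ∀ w : E3, w ≠ 0 → HasFDerivAt S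
        (R • (x 0 • (‖w‖⁻¹ • innerSL ℝ w) - innerSL ℝ (spatial x))) w := by
      intro w hw
      have h1 : HasFDerivAt (fun w : E3 => inner ℝ w (spatial x)) (innerSL ℝ (spatial x)) w := by
        have := (innerSL ℝ (spatial x)).hasFDerivAt (x := w)
        exact this.congr_of_eventuallyEq
          (Eventually.of_forall fun z => by simp [real_inner_comm])
      exact (((hasFDerivAt_norm_E3 hw).const_mul (x 0)).sub h1).const_mul R
    have hh : ContDiffOn ℝ 1 h {0}ᶜ := by
      have h1 : ContDiffOn ℝ 1 S {0}ᶜ := fun w hw => ContDiffAt.contDiffWithinAt <|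
        contDiffAt_const.mul ((contDiffAt_const.mul (contDiffAt_norm ℝ hw)).sub
          (contDiffAt_id.inner ℝ contDiffAt_const))
      exact ((hn.contDiffOn_profInt hε).of_le (by simp)).comp (h1.prodMk contDiffOn_id)
        fun w hw => hw
    have key := integral_sphere_fderiv hh (fun r y hr hy => by
      have h1 : S (r • y) = r * S y := by
        simp only [S, norm_smul, inner_smul_left, Real.norm_eq_abs, abs_of_pos hr]
        simp
        ring
      simp only [h, h1, profInt_smul φ hr]) (spatial x)
    have hfd : ∀ n : S2, fderiv ℝ h n (spatial x) = (-(mdot x x * R) * nullQuot φ (R * s n) n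
        + x 0 * nullInt φ (R * s n) n) * -1 * -1
        + (2 * (mdot x x * R * nullQuot φ (R * s n) n) - 2 * (x 0 * nullInt φ (R * s n) n))
        + ∑ i : Fin 3, spatial x i * profInt (boost i φ) (R * s n) n := by
      intro n
      have h1 : HasFDerivAt h _ (n : E3) := HasFDerivAt.comp (g := fun p : ℝ × E3 => profInt φ p.1 p.2)
        (f := fun w => (S w, w)) (n : E3) (hn.hasFDerivAt_profInt hε (S n) n.ne_zero)
        ((hSd n n.ne_zero).prodMk (hasFDerivAt_id _))
      have h2 := hn.mul_nullQuot hε (R * s n) n.ne_zero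
      have h3 : mdot x x = x 0 ^ 2 - inner ℝ (spatial x) (spatial x) := by
        rw [mdot_self, real_inner_self_eq_norm_sq]
      rw [h1.fderiv, ← h2, h3, hS]
      simp [n.norm, s]
      rw [Finset.sum_congr rfl fun i _ => mul_comm _ _]
      ring
    have c1 : Continuous fun n : S2 => nullQuot φ (R * s n) n :=
      continuous_sphere_of_contDiffOn (contDiffOn_nullQuot hε hn.decays) (by fun_prop)
    have c2 : Continuous fun n : S2 => nullInt φ (R * s n) n :=
      ((hsc.const_mul R).mul c1).congr fun n => hn.mul_nullQuot hε (R * s n) n.ne_zero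
    have c3 : ∀ i, Continuous fun n : S2 => profInt (boost i φ) (R * s n) n := fun i =>
      continuous_sphere_of_contDiffOn ((hn.boost hε i).contDiffOn_profInt hε) (by fun_prop)
    have i1 := (integrable_sphere_of_continuous c1).const_mul (mdot x x * R)
    have i2 := (integrable_sphere_of_continuous c2).const_mul (x 0)
    have i3 : ∀ i ∈ (Finset.univ : Finset (Fin 3)), Integrable (fun n : S2 =>
        spatial x i * profInt (boost i φ) (R * s n) n) sphereMeasure := fun i _ =>
      (integrable_sphere_of_continuous (c3 i)).const_mul _
    have hfd' : ∀ n : S2, fderiv ℝ h n (spatial x) = (mdot x x * R * nullQuot φ (R * s n) n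
        - x 0 * nullInt φ (R * s n) n)
        + ∑ i : Fin 3, spatial x i * profInt (boost i φ) (R * s n) n := fun n => by
      rw [hfd n]
      ring
    have i12 : Integrable (fun n : S2 => mdot x x * R * nullQuot φ (R * s n) n
        - x 0 * nullInt φ (R * s n) n) sphereMeasure := i1.sub i2
    simp only [hfd', h, hS] at key
    rw [integral_add i12 (integrable_finsetSum _ i3), integral_sub i1 i2, integral_const_mul,
      integral_finsetSum _ i3] at key
    linarith
  have hlimR : ∀ n : S2, s n ≠ 0 → Tendsto (fun R : ℝ => |R * s n|) atTop atTop := by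
    intro n h0
    refine ((tendsto_id.atTop_mul_const (abs_pos.2 h0)).congr' ?_)
    filter_upwards [eventually_ge_atTop 0] with R hR
    rw [abs_mul, abs_of_nonneg hR]
    rfl
  have hlimP : ∀ {g : M → ℝ}, NullVanishing ε g → (∀ z : E3, z ≠ 0 → tailInt g z = 0) →
      ∀ n : S2, s n ≠ 0 → Tendsto (fun R : ℝ => profInt g (R * s n) n) atTop (𝓝 0) := by
    intro g hg hgT n h0
    have a1 := hg.tendsto_profInt_atTop hε n.ne_zero
    have a2 := hg.tendsto_profInt_atBot hε n.ne_zero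
    rw [hgT _ n.ne_zero, mul_zero] at a1
    rw [hgT _ n.ne_zero, mul_zero, neg_zero] at a2
    rcases lt_or_gt_of_ne h0 with h | h
    · exact a2.comp (tendsto_id.atTop_mul_const_of_neg h)
    · exact a1.comp (tendsto_id.atTop_mul_const h)
  have hint : ∀ {g : M → ℝ} (c : S2 → ℝ), NullVanishing ε g → (∀ z : E3, z ≠ 0 → tailInt g z = 0) →
      Continuous c → Tendsto (fun R : ℝ => ∫ n : S2, c n * profInt g (R * s n) n ∂sphereMeasure)
        atTop (𝓝 0) := by
    intro g c hg hgT hc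
    obtain ⟨C, hC⟩ := hg.exists_bound_sphere hε
    have := tendsto_integral_filter_of_dominated_convergence (μ := sphereMeasure)
      (F := fun (R : ℝ) (n : S2) => c n * profInt g (R * s n) n) (f := fun _ => 0) (l := atTop)
      (fun n => |c n| * C) (Eventually.of_forall fun R => (hc.mul (continuous_sphere_of_contDiffOn
        (hg.contDiffOn_profInt hε) (hsc.const_mul R))).aestronglyMeasurable)
      (Eventually.of_forall fun R => Eventually.of_forall fun n => by
        rw [norm_mul]
        exact mul_le_mul_of_nonneg_left (hC _ _) (abs_nonneg _))
      (integrable_sphere_of_continuous (hc.abs.mul continuous_const)) (by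
        filter_upwards [hs0] with n h0
        simpa using (hlimP hg hgT n h0).const_mul (c n))
    simpa using this
  have hintN : Tendsto (fun R : ℝ => ∫ n : S2, x 0 * nullInt φ (R * s n) n ∂sphereMeasure)
      atTop (𝓝 0) := by
    obtain ⟨C, h0, hC⟩ := nullInt_bound (by linarith) hn.decays
    have hb : ∀ (t : ℝ) (n : S2), |nullInt φ t n| ≤ C * (1 + |t|) ^ (-ε) := by
      intro t n
      have := hC t n n.ne_zero
      rwa [n.norm, inv_one, mul_one, div_one, show 3 - (3 + ε) = -ε by ring] at this
    have := tendsto_integral_filter_of_dominated_convergence (μ := sphereMeasure)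
      (F := fun (R : ℝ) (n : S2) => x 0 * nullInt φ (R * s n) n) (f := fun _ => 0) (l := atTop)
      (fun n => |x 0| * C) (Eventually.of_forall fun R => ?_)
      (Eventually.of_forall fun R => Eventually.of_forall fun n => ?_)
      (integrable_const _) ?_
    · simpa using this
    · refine Continuous.aestronglyMeasurable (continuous_const.mul ?_)
      have c1 : Continuous fun n : S2 => nullQuot φ (R * s n) n :=
        continuous_sphere_of_contDiffOn (contDiffOn_nullQuot hε hn.decays) (by fun_prop)
      exact ((hsc.const_mul R).mul c1).congr fun n => hn.mul_nullQuot hε (R * s n) n.ne_zero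
    · rw [norm_mul]
      refine mul_le_mul_of_nonneg_left ((hb _ _).trans ?_) (abs_nonneg _)
      refine mul_le_of_le_one_right h0 (Real.rpow_le_one_of_one_le_of_nonpos ?_ (by linarith))
      linarith [abs_nonneg (R * s n)]
    · filter_upwards [hs0] with n hn0
      have h1 : Tendsto (fun R : ℝ => C * (1 + |R * s n|) ^ (-ε)) atTop (𝓝 0) := by
        have h2 := (tendsto_rpow_neg_atTop hε).comp
          (tendsto_atTop_add_const_left atTop (1 : ℝ) (hlimR n hn0))
        simpa using h2.const_mul C
      have h2 := squeeze_zero_norm (f := fun R : ℝ => nullInt φ (R * s n) n) (fun R => hb (R * s n) n) h1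
      simpa using h2.const_mul (x 0)
  have htot : Tendsto (fun R : ℝ => mdot x x * (R * ∫ n : S2, nullQuot φ (R * s n) n ∂sphereMeasure))
      atTop (𝓝 0) := by
    have h1 := (hintN.add (hint _ hn hT (continuous_sphere_inner (spatial x)))).sub
      (tendsto_finsetSum (Finset.univ : Finset (Fin 3)) fun i _ =>
        hint (fun _ => spatial x i) (hn.boost hε i) (hTb i) continuous_const)
    simp only [add_zero, Finset.sum_const_zero, sub_zero] at h1
    refine h1.congr' ?_
    filter_upwards [eventually_gt_atTop 0] with R hR using (hid R hR).symm
  have hA : sphereArea ≠ 0 := sphereArea_pos.ne'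
  have h2 := htot.const_mul ((mdot x x)⁻¹ * (-(sphereArea / 2))⁻¹)
  rw [mul_zero] at h2
  refine h2.congr' ?_
  filter_upwards [eventually_gt_atTop 0] with R hR
  rw [← hrad R hR]
  field_simp

end

/-! ### The radiation field of an asymptote -/

/-- A bump function at the origin. -/
def originBump : ContDiffBump (0 : M) := ⟨1 / 2, 1, by norm_num, by norm_num⟩

/-- A smooth function vanishing near the origin, equal to one for `|x| ≥ 1`. -/
def farCut (x : M) : ℝ := 1 - originBump x

theorem contDiff_farCut : ContDiff ℝ ∞ farCut := contDiff_const.sub originBump.contDiff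

theorem farCut_eq_zero {x : M} (h : ‖x‖ ≤ 1 / 2) : farCut x = 0 := by
  rw [farCut, originBump.one_of_mem_closedBall (mem_closedBall_zero_iff.2 h), sub_self]

theorem farCut_eq_one {x : M} (h : 1 ≤ ‖x‖) : farCut x = 1 := by
  rw [farCut, originBump.zero_of_le_dist (by rwa [dist_zero_right]), sub_zero]

theorem contDiff_farCut_mul {u : M → ℝ} (hu : ContDiffOn ℝ ∞ u {0}ᶜ) :
    ContDiff ℝ ∞ fun x => farCut x * u x := by
  rw [contDiff_iff_contDiffAt]
  intro x
  by_cases hx : x = 0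
  · refine (contDiffAt_const (c := (0 : ℝ))).congr_of_eventuallyEq ?_
    filter_upwards [Metric.ball_mem_nhds x (show (0 : ℝ) < 1 / 2 by norm_num)] with y hy
    rw [hx, mem_ball_zero_iff] at hy
    rw [farCut_eq_zero hy.le, zero_mul]
  · exact contDiff_farCut.contDiffAt.mul (hu.contDiffAt (isOpen_compl_singleton.mem_nhds hx))

theorem farCut_mul_eventuallyEq (u : M → ℝ) {x : M} (hx : 1 < ‖x‖) :
    (fun x => farCut x * u x) =ᶠ[𝓝 x] u := by
  filter_upwards [(isOpen_lt continuous_const continuous_norm).mem_nhds hx] with y hy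
  rw [farCut_eq_one (le_of_lt hy), one_mul]

theorem pd_farCut_mul (u : M → ℝ) {x : M} (hx : 1 < ‖x‖) (a : Fin 4) :
    pd a (fun x => farCut x * u x) x = pd a u x := by
  rw [pd, (farCut_mul_eventuallyEq u hx).fderiv_eq, pd]

theorem regionSmooth_farCut_mul {δ : ℝ} (hδ : 0 < δ) (hδ' : δ < 1) {u : M → ℝ}
    (hu : ContDiffOn ℝ ∞ u {0}ᶜ) (hs : ∀ x, x ≠ 0 → δ * ‖spatial x‖ < |x 0| → u x = 0) :
    RegionSmooth 0 δ fun x => farCut x * u x where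
  nonneg := hδ.le
  lt_one := hδ'
  smooth := contDiff_farCut_mul hu
  supp x hx := by
    by_contra hcon
    have h0 : x ≠ 0 := fun h => left_ne_zero_of_mul hx (by rw [h]; exact farCut_eq_zero (by simp))
    exact right_ne_zero_of_mul hx (hs x h0 (by linarith))

/-- The region in which the radiation field does not depend on the source near the origin. -/
def farRegion : Set M := {x | |x 0| + 2 < ‖spatial x‖}

theorem continuous_spatial : Continuous spatial := spatialL.continuous

theorem isOpen_farRegion : IsOpen farRegion :=
  isOpen_lt (by fun_prop) continuous_spatial.norm

theorem one_lt_of_mem_farRegion {σ : ℝ} (hσ : |σ| = 1) {x : M} (hx : x ∈ farRegion) (y : E3) :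
    1 < ‖x - coneVec σ y‖ := by
  refine one_lt_norm_sub_coneVec hσ ?_ y
  have h1 : |x 0| + 2 < ‖spatial x‖ := hx
  have h2 : σ * x 0 ≤ |σ * x 0| := le_abs_self _
  rw [abs_mul, hσ, one_mul] at h2
  linarith

theorem tendsto_conePot_asym {ε γ δ σ : ℝ} (hε : 0 < ε) (hγ : 0 ≤ γ) (hσ : |σ| = 1) {f : M → ℝ}
    (hf : AsymHom 3 ε f) (hr : RegionSmooth γ δ f) {x : M} (hx : x ∈ farRegion) :
    Tendsto (fun R : ℝ => R * conePot σ f (R • x)) atTop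
      (𝓝 (conePot σ (fun z => farCut z * asym 3 f z) x)) := by
  have hfr : ∀ R : ℝ, 1 ≤ R → RegionSmooth γ δ fun z => R ^ (3 : ℝ) * f (R • z) := by
    intro R hR
    have hR0 : 0 < R := by linarith
    refine ⟨hr.nonneg, hr.lt_one, contDiff_const.mul (hr.smooth.comp (contDiff_id.const_smul R)),
      fun z hz => ?_⟩
    have h1 := hr.supp _ (right_ne_zero_of_mul hz)
    rw [spatial_smul, norm_smul, Real.norm_eq_abs, PiLp.smul_apply, smul_eq_mul, abs_mul,
      abs_of_pos hR0] at h1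
    have h2 : R * |z 0| ≤ R * (γ + δ * ‖spatial z‖) := by nlinarith
    exact le_of_mul_le_mul_left h2 hR0
  have hscale : ∀ R : ℝ, 1 ≤ R → R * conePot σ f (R • x)
      = ∫ y, ‖y‖⁻¹ * (R ^ (3 : ℝ) * f (R • (x - coneVec σ y))) := by
    intro R hR
    have hR0 : 0 < R := by linarith
    have h1 := Measure.integral_comp_smul (volume : Measure E3)
      (fun y => ‖y‖⁻¹ * f (R • x - coneVec σ y)) R
    rw [finrank_euclideanSpace, Fintype.card_fin, abs_of_pos (by positivity), smul_eq_mul,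
      eq_inv_mul_iff_mul_eq₀ (by positivity)] at h1
    rw [conePot, coneInt, ← h1, ← mul_assoc, ← integral_const_mul]
    refine integral_congr_ae (Eventually.of_forall fun y => ?_)
    have h2 : coneVec σ (R • y) = R • coneVec σ y := by
      rw [coneVec, coneVec, norm_smul, Real.norm_eq_abs, abs_of_pos hR0, mul_left_comm, mkVec_smul]
    have h3 : R ^ (3 : ℝ) = R ^ 3 := by norm_cast
    simp only
    rw [h2, ← smul_sub, norm_smul, Real.norm_eq_abs, abs_of_pos hR0, h3]
    field_simp
  obtain ⟨C, hC0, hC⟩ := (Decays.of_eul (by norm_num) hε hf.smooth hf.decays).bound_zero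
  set ρ := (γ + 2 * ‖x‖) / (1 - δ) with hρ
  have hlim : Tendsto (fun R : ℝ => ∫ y, ‖y‖⁻¹ * (R ^ (3 : ℝ) * f (R • (x - coneVec σ y)))) atTop
      (𝓝 (∫ y, ‖y‖⁻¹ * (farCut (x - coneVec σ y) * asym 3 f (x - coneVec σ y)))) := by
    refine tendsto_integral_filter_of_dominated_convergence
      ((Metric.closedBall (0 : E3) ρ).indicator fun y => ‖y‖⁻¹ * C) ?_ ?_ ?_ ?_
    · filter_upwards [eventually_ge_atTop 1] with R hR
      exact (hfr R hR).aestronglyMeasurable coneWeight_inv x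
    · filter_upwards [eventually_ge_atTop 1] with R hR
      refine Eventually.of_forall fun y => ?_
      have hR0 : 0 < R := by linarith
      by_cases h0 : R ^ (3 : ℝ) * f (R • (x - coneVec σ y)) = 0
      · rw [h0, mul_zero, norm_zero]
        exact indicator_nonneg (fun _ _ => by positivity) _
      rw [indicator_of_mem (mem_closedBall_zero_iff.2 ((hfr R hR).norm_le hσ h0)), norm_mul,
        norm_inv, norm_norm]
      refine mul_le_mul_of_nonneg_left ?_ (by positivity)
      rw [Real.norm_eq_abs, abs_mul, abs_of_pos (Real.rpow_pos_of_pos hR0 _)]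
      have h1 : (1 + ‖R • (x - coneVec σ y)‖) ^ (-3 : ℝ) ≤ R ^ (-3 : ℝ) := by
        refine Real.rpow_le_rpow_of_nonpos hR0 ?_ (by norm_num)
        rw [norm_smul, Real.norm_eq_abs, abs_of_pos hR0]
        nlinarith [one_lt_of_mem_farRegion hσ hx y]
      calc R ^ (3 : ℝ) * |f (R • (x - coneVec σ y))| ≤ R ^ (3 : ℝ) * (C * R ^ (-3 : ℝ)) := by
            gcongr
            exact (hC _).trans (mul_le_mul_of_nonneg_left h1 hC0)
        _ = C := by
            rw [mul_left_comm, ← Real.rpow_add hR0]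
            norm_num
    · refine integrable_of_bound_inv_sq (C := C) (ρ := ρ) ?_ (fun y => ?_) fun y hy =>
        indicator_of_notMem (fun h => not_lt.2 (mem_closedBall_zero_iff.1 h) hy) _
      · exact ((by fun_prop : Measurable fun y : E3 => ‖y‖⁻¹ * C).indicator
          Metric.isClosed_closedBall.measurableSet).aestronglyMeasurable
      · simp only [indicator]
        split_ifs
        · rw [abs_of_nonneg (by positivity), mul_comm, ← inv_pow]
          gcongr
          nlinarith [sq_nonneg (‖y‖⁻¹ - 1 / 2)]
        · rw [abs_zero]
          positivity
    · refine Eventually.of_forall fun y => ?_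
      have h1 := one_lt_of_mem_farRegion hσ hx y
      rw [farCut_eq_one h1.le, one_mul]
      exact (hf.tendsto hε (norm_pos_iff.1 (by linarith))).const_mul _
  refine hlim.congr' ?_
  filter_upwards [eventually_ge_atTop 1] with R hR using (hscale R hR).symm

theorem OddHom.radField_asym_eq_zero {ε γ δ : ℝ} (hε : 0 < ε) (hγ : 0 ≤ γ) {f : M → ℝ}
    (hf : OddHom ε f) (hr : RegionSmooth γ δ f)
    (hT : ∀ z : E3, z ≠ 0 → tailInt (eul 3 f) z = 0) {x : M} (hx : x ∈ farRegion) :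
    radField (fun z => farCut z * asym 3 f z) x = 0 := by
  have h0 : |x 0| + 2 < ‖spatial x‖ := hx
  have h1 : 0 < ‖spatial x‖ := by linarith [abs_nonneg (x 0)]
  have h2 : mdot x x ≠ 0 := by
    rw [mdot_self, ← sq_abs (x 0)]
    nlinarith [abs_nonneg (x 0)]
  have h3 := (tendsto_conePot_asym hε hγ (σ := 1) (by simp) hf.asymHom hr hx).sub
    (tendsto_conePot_asym hε hγ (σ := -1) (by simp) hf.asymHom hr hx)
  simp only [← mul_sub] at h3
  exact tendsto_nhds_unique h3 (hf.tendsto_radField hε hr hT (norm_pos_iff.1 h1) h2)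

section

variable {ε γ δ : ℝ} {J : M → M}

/-- The dual of the exterior product of the generators of Lorentz transformations and the current. -/
def boostCurl (u : Fin 4 → M → ℝ) (i j : Fin 3) (x : M) : ℝ :=
  boost i (u j.succ) x - boost j (u i.succ) x + rot i j (u 0) x

theorem tailInt_boostCurl (hε : 0 < ε) (hJ : ContDiff ℝ ∞ J)
    (hn : ∀ a, NullVanishing ε (eulComp J a)) (hcurl : IsCurlFree (tail (currentProfile J)))
    (i j : Fin 3) {z : E3} (hz : z ≠ 0) :
    tailInt (eul 3 (boostCurl (fun a x => J x a) i j)) z = 0 := by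
  have hs : ∀ a, ContDiff ℝ ∞ fun x => J x a := fun a => contDiff_component hJ a
  have e1 : eul 3 (boostCurl (fun a x => J x a) i j) = fun x => (boost i (eulComp J j.succ) x
      + (-1) * boost j (eulComp J i.succ) x) + rot i j (eulComp J 0) x := by
    have h1 := contDiff_boost (hs j.succ) i
    have h2 := contDiff_boost (hs i.succ) j
    have h3 := contDiff_rot (hs 0) i j
    unfold boostCurl eulComp
    rw [eul_add (h1.sub h2) h3, eul_sub h1 h2, boost_eul (hs _), boost_eul (hs _), rot_eul (hs _)]
    funext x
    ring
  have n1 := (hn j.succ).boost hε i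
  have n2 := (hn i.succ).boost hε j
  have n3 := (hn 0).rot hε i j
  rw [e1, (n1.add hε (n2.const_mul (-1))).tailInt_add hε n3 hz,
    n1.tailInt_add hε (n2.const_mul (-1)) hz, tailInt_const_mul n2.decays.smooth,
    (hn 0).tailInt_rot hε i j hz]
  let l : Cone := Cone.ofSpace z hz
  have hl : spatial l = z := spatial_mkVec _ _
  have hd : ∀ a, HasFDerivAt (tailInt (eulComp J a)) (∑ k : Fin 3, (‖spatial l‖⁻¹ *
      tailInt (boost k (eulComp J a)) z) • (EuclideanSpace.proj k : E3 →L[ℝ] ℝ)) (spatial l) := by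
    intro a
    rw [hl]
    exact (hn a).hasFDerivAt_tailInt hε hz
  have h0 : (fun k => lower (tail (currentProfile J) k) 0)
      = fun k : Cone => tailInt (eulComp J 0) (spatial k) := by
    funext k
    rw [lower_zero, tail_currentProfile hε hJ hn]
  have h1 : ∀ m : Fin 3, (fun k => lower (tail (currentProfile J) k) m.succ)
      = fun k : Cone => (fun z => -tailInt (eulComp J m.succ) z) (spatial k) := by
    intro m
    funext k
    rw [lower_succ, tail_currentProfile hε hJ hn]
  have hd' : ∀ a, HasFDerivAt (fun z => -tailInt (eulComp J a) z) (∑ k : Fin 3, (‖spatial l‖⁻¹ *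
      -tailInt (boost k (eulComp J a)) z) • (EuclideanSpace.proj k : E3 →L[ℝ] ℝ)) (spatial l) := by
    intro a
    refine (hd a).neg.congr_fderiv ?_
    rw [← Finset.sum_neg_distrib]
    exact Finset.sum_congr rfl fun k _ => by rw [mul_neg, neg_smul]
  have key := hcurl 0 i.succ j.succ l
  rw [h0, h1, h1, coneDeriv_comp_spatial_sum (hd 0), coneDeriv_comp_spatial_sum (hd' _),
    coneDeriv_comp_spatial_sum (hd' _), hl] at key
  simp only [sub_mul, Finset.sum_sub_distrib, ite_mul, zero_mul, Fin.succ_inj,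
    (Fin.succ_ne_zero _).symm, if_false, Finset.sum_const_zero, Finset.sum_ite_eq,
    Finset.mem_univ, if_true, conormal_zero, conormal_succ] at key
  linarith

theorem boostCurl_asym (hε : 0 < ε) (hJ : ∀ a, OddHom ε fun x => J x a) (i j : Fin 3) {x : M}
    (hx : x ≠ 0) : asym 3 (boostCurl (fun a x => J x a) i j) x
      = boostCurl (fun a => asym 3 fun x => J x a) i j x := by
  have h : OddHom ε (boostCurl (fun a x => J x a) i j) :=
    (((hJ j.succ).boost hε i).sub ((hJ i.succ).boost hε j)).add ((hJ 0).rot hε i j)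
  refine h.asymHom.eq_asym hε hx ?_
  have h1 := (((hJ j.succ).asymHom.asym_boost hε hx i).sub
    ((hJ i.succ).asymHom.asym_boost hε hx j)).add ((hJ 0).asymHom.asym_rot hε hx i j)
  refine h1.congr fun R => ?_
  simp only [boostCurl]
  ring

theorem RegionSmooth.radField_boostCurl {v : Fin 4 → M → ℝ} (hv : ∀ a, RegionSmooth γ δ (v a))
    (i j : Fin 3) (x : M) :
    boostCurl (fun a => radField (v a)) i j x = radField (boostCurl v i j) x := by
  have key : ∀ σ : ℝ, |σ| = 1 → boostCurl (fun a => conePot σ (v a)) i j x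
      = conePot σ (boostCurl v i j) x := by
    intro σ hσ
    have r1 := (hv j.succ).boost i
    have r2 := (hv i.succ).boost j
    have h1 := (r1.sub r2).coneInt_add ((hv 0).rot i j) hσ coneWeight_inv x
    rw [r1.coneInt_sub r2 hσ coneWeight_inv] at h1
    simp only [boostCurl, (hv _).boost_conePot hσ, (hv _).rot_conePot hσ]
    exact h1.symm
  have hd : ∀ a, ∀ σ : ℝ, |σ| = 1 → ContDiff ℝ ∞ (conePot σ (v a)) := fun a σ hσ =>
    (hv a).contDiff_conePot hσ
  have h1 : boostCurl (fun a => radField (v a)) i j x = boostCurl (fun a => conePot 1 (v a)) i j x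
      - boostCurl (fun a => conePot (-1) (v a)) i j x := by
    have h2 : ∀ a, radField (v a) = fun x => conePot 1 (v a) x - conePot (-1) (v a) x :=
      fun a => rfl
    simp only [boostCurl, boost, rot, h2,
      fun a => pd_sub (hd a 1 (by simp)) (hd a (-1) (by simp))]
    ring
  rw [h1, key 1 (by simp), key (-1) (by simp), radField]

/-- The closedness of the tail in terms of the radiation field of the tangential part of the
asymptote. -/
theorem boostCurl_radField_eq_zero (hε : 0 < ε) (hγ : 0 < γ) (hδ : 0 < δ) (hδ' : δ < 1)
    (hJ : ContDiff ℝ ∞ J) (hs : Function.support J ⊆ region γ δ)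
    (ho : ∀ a, OddHom ε fun x => J x a)
    (hu : HomCurrent δ fun a => asym 3 fun x => J x a)
    (hcurl : IsCurlFree (tail (currentProfile J))) (i j : Fin 3) {x : M} (hx : x ∈ farRegion) :
    boostCurl (fun a => radField fun z =>
      farCut z * tangentialPart (fun a => asym 3 fun x => J x a) a z) i j x = 0 := by
  set u : Fin 4 → M → ℝ := fun a => asym 3 fun x => J x a with hudef
  have hv := hu.tangentialPart hδ'
  have hr : ∀ a, RegionSmooth 0 δ fun z => farCut z * tangentialPart u a z := fun a =>
    regionSmooth_farCut_mul hδ hδ' (hv.smooth a) (hv.supp a)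
  have hJr : ∀ a, RegionSmooth γ δ fun x => J x a := fun a =>
    ⟨hδ.le, hδ', contDiff_component hJ a, fun y hy => hs fun h0 => hy (by simp [h0])⟩
  have hf : OddHom ε (boostCurl (fun a x => J x a) i j) :=
    (((ho j.succ).boost hε i).sub ((ho i.succ).boost hε j)).add ((ho 0).rot hε i j)
  have hfr : RegionSmooth γ δ (boostCurl (fun a x => J x a) i j) :=
    (((hJr j.succ).boost i).sub ((hJr i.succ).boost j)).add ((hJr 0).rot i j)
  have h1 := hf.radField_asym_eq_zero hε hγ.le hfr
    (fun z hz => tailInt_boostCurl hε hJ (fun a => (ho a).nullVanishing hε) hcurl i j hz) hx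
  rw [RegionSmooth.radField_boostCurl hr, ← h1]
  have h2 : ∀ z : M, 1 < ‖z‖ → boostCurl (fun a z => farCut z * tangentialPart u a z) i j z
      = farCut z * asym 3 (boostCurl (fun a x => J x a) i j) z := by
    intro z hz
    have hz0 : z ≠ 0 := norm_pos_iff.1 (by linarith)
    have h3 := hu.curl_tangentialPart hδ' hz0 i j
    have h4 : boostCurl (fun a => asym 3 fun x => J x a) i j z = _ := h3.symm
    rw [boostCurl_asym hε ho i j hz0, farCut_eq_one hz.le, one_mul, h4]
    simp only [boostCurl, boost, rot, pd_farCut_mul _ hz]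
  have h4 : ∀ σ : ℝ, |σ| = 1 → conePot σ (boostCurl (fun a z => farCut z * tangentialPart u a z) i j) x
      = conePot σ (fun z => farCut z * asym 3 (boostCurl (fun a x => J x a) i j) z) x :=
    fun σ hσ => coneInt_congr fun y => h2 _ (one_lt_of_mem_farRegion hσ hx y)
  rw [radField, radField, h4 1 (by simp), h4 (-1) (by simp)]

end

/-! ### Potentials of homogeneous currents -/

theorem coneVec_ne_zero_of_farCut {x : M} (h : farCut x ≠ 0) : x ≠ 0 := fun h0 =>
  h (farCut_eq_zero (by rw [h0]; simp))

namespace HomCurrent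

variable {δ σ : ℝ} {v : Fin 4 → M → ℝ}

theorem regionSmooth (hδ : 0 < δ) (hδ' : δ < 1) (hv : HomCurrent δ v) (a : Fin 4) :
    RegionSmooth 0 δ fun z => farCut z * v a z :=
  regionSmooth_farCut_mul hδ hδ' (hv.smooth a) (hv.supp a)

protected theorem coneInt_eq_zero (hδ' : δ < 1) (hv : HomCurrent δ v) (hσ : |σ| = 1) {x : M}
    (hx : σ * x 0 < -(δ * ‖spatial x‖)) (hδ : 0 < δ) (w : E3 → ℝ) (a : Fin 4) :
    coneInt w σ (fun z => farCut z * v a z) x = 0 := by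
  refine coneInt_eq_zero fun y => ?_
  by_contra h0
  refine right_ne_zero_of_mul h0 (hv.supp a _ (coneVec_ne_zero_of_farCut (left_ne_zero_of_mul h0)) ?_)
  rw [spatial_sub, spatial_coneVec, PiLp.sub_apply, coneVec_zero_apply]
  have h1 : ‖spatial x - y‖ ≤ ‖spatial x‖ + ‖y‖ := norm_sub_le _ _
  have h5 : σ * σ = 1 := by rw [← abs_mul_abs_self, hσ, one_mul]
  have h6 : |σ * (x 0 - σ * ‖y‖)| = |x 0 - σ * ‖y‖| := by rw [abs_mul, hσ, one_mul]
  have h7 : -(σ * (x 0 - σ * ‖y‖)) = ‖y‖ - σ * x 0 := by linear_combination ‖y‖ * h5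
  have h8 := neg_le_abs (σ * (x 0 - σ * ‖y‖))
  rw [h6, h7] at h8
  nlinarith [norm_nonneg y]

theorem eul_conePot_eq_zero (hδ : 0 < δ) (hδ' : δ < 1) (hv : HomCurrent δ v) (hσ : |σ| = 1) {x : M}
    (hx : σ * x 0 + 2 < ‖spatial x‖) (a : Fin 4) :
    eul 1 (conePot σ fun z => farCut z * v a z) x = 0 := by
  rw [(hv.regionSmooth hδ hδ' a).eul_conePot hσ]
  refine coneInt_eq_zero fun y => ?_
  have h1 := one_lt_norm_sub_coneVec hσ hx y
  have h0 : x - coneVec σ y ≠ 0 := norm_pos_iff.1 (by linarith)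
  rw [eul, (farCut_mul_eventuallyEq (v a) h1).fderiv_eq, farCut_eq_one h1.le,
    fderiv_self_of_homog (hv.diffAt a h0) fun r hr => hv.homog a r _ hr h0]
  ring

theorem sum_pd_conePot (hδ : 0 < δ) (hδ' : δ < 1) (hv : HomCurrent δ v) (hσ : |σ| = 1) {x : M}
    (hx : σ * x 0 + 2 < ‖spatial x‖) (w : E3 → ℝ) (hw : ConeWeight w) :
    ∑ a, coneInt w σ (pd a fun z => farCut z * v a z) x = 0 := by
  rw [← RegionSmooth.coneInt_sum (fun a _ => (hv.regionSmooth hδ hδ' a).pd a) hσ hw]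
  refine coneInt_eq_zero fun y => ?_
  have h1 := one_lt_norm_sub_coneVec hσ hx y
  simp only [pd_farCut_mul _ h1]
  exact hv.div _ (norm_pos_iff.1 (by linarith))

theorem sum_lower_conePot (hδ : 0 < δ) (hδ' : δ < 1) (hv : HomCurrent δ v)
    (ht : ∀ x, x ≠ 0 → ∑ a, lower x a * v a x = 0) (hσ : |σ| = 1) {x : M}
    (hx : σ * x 0 + 2 < ‖spatial x‖) :
    ∑ a, lower x a * conePot σ (fun z => farCut z * v a z) x = 0 := by
  set g : Fin 4 → M → ℝ := fun a z => farCut z * v a z with hg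
  have hr : ∀ a, RegionSmooth 0 δ (g a) := hv.regionSmooth hδ hδ'
  have h5 : σ * σ = 1 := by rw [← abs_mul_abs_self, hσ, one_mul]
  let c : M → ℝ := fun x => σ * coneInt (fun _ => 1) σ (g 0) x
    - ∑ i : Fin 3, coneInt (coneMonomial i 1 1) σ (g i.succ) x
  have hw1 : ConeWeight fun _ : E3 => (1 : ℝ) := coneWeight_const 1
  have hw2 : ∀ i, ConeWeight (coneMonomial i 1 1) := fun i =>
    coneWeight_monomial i le_rfl (by norm_num)
  have h1 : ∑ a, lower x a * conePot σ (g a) x = c x := by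
    have e1 : conePot σ (fun z => z 0 * g 0 z - ∑ i : Fin 3, z i.succ * g i.succ z) x = 0 := by
      refine coneInt_eq_zero fun y => ?_
      by_cases h0 : farCut (x - coneVec σ y) = 0
      · simp [hg, h0]
      have h2 := ht _ (coneVec_ne_zero_of_farCut h0)
      rw [Fin.sum_univ_succ] at h2
      simp only [lower_zero, lower_succ, neg_mul, Finset.sum_neg_distrib] at h2
      simp only [hg, mul_left_comm _ (farCut _), ← Finset.mul_sum]
      rw [← sub_eq_add_neg] at h2
      rw [← mul_sub, h2, mul_zero]
    have r1 := (hr 0).mul (contDiff_coord 0)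
    have r2 : ∀ i ∈ (Finset.univ : Finset (Fin 3)), RegionSmooth 0 δ
        fun z => z i.succ * g i.succ z := fun i _ => (hr i.succ).mul (contDiff_coord i.succ)
    have e2 : conePot σ (fun z => z 0 * g 0 z - ∑ i : Fin 3, z i.succ * g i.succ z) x
        = conePot σ (fun z => z 0 * g 0 z) x
          - ∑ i : Fin 3, conePot σ (fun z => z i.succ * g i.succ z) x := by
      simp only [conePot]
      rw [r1.coneInt_sub (RegionSmooth.sum Finset.univ_nonempty r2) hσ coneWeight_inv,
        RegionSmooth.coneInt_sum r2 hσ coneWeight_inv]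
    rw [e1, (hr 0).conePot_zero_mul hσ] at e2
    simp only [(hr _).conePot_succ_mul hσ, Finset.sum_sub_distrib] at e2
    rw [Fin.sum_univ_succ]
    simp only [lower_zero, lower_succ, neg_mul, Finset.sum_neg_distrib, c]
    linarith
  rw [h1]
  have hcd : ContDiff ℝ ∞ c := (contDiff_const.mul ((hr 0).contDiff_coneInt hσ hw1)).sub
    (ContDiff.sum fun i _ => (hr i.succ).contDiff_coneInt hσ (hw2 i))
  have hc0 : ∀ z : M, σ * z 0 + 2 < ‖spatial z‖ → pd 0 c z = 0 := by
    intro z hz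
    have e1 : pd 0 c z = σ * coneInt (fun _ => 1) σ (pd 0 (g 0)) z
        - ∑ i : Fin 3, coneInt (coneMonomial i 1 1) σ (pd 0 (g i.succ)) z := by
      have f1 : HasFDerivAt c _ z := (((hr 0).hasFDerivAt_coneInt hσ hw1 z).const_mul σ).sub
        (HasFDerivAt.fun_sum fun i _ => (hr i.succ).hasFDerivAt_coneInt hσ (hw2 i) z)
      rw [pd, f1.fderiv]
      simp
    have e2 := hv.sum_pd_conePot hδ hδ' hσ hz _ hw1
    rw [Fin.sum_univ_succ] at e2
    have e3 := Finset.sum_congr (rfl : (Finset.univ : Finset (Fin 3)) = Finset.univ)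
      fun i _ => (hr i.succ).coneInt_one_parts hσ i z
    rw [Finset.sum_add_distrib, ← Finset.mul_sum, Finset.sum_const_zero] at e3
    rw [e1]
    linear_combination σ * e2 - σ * e3 + (∑ i : Fin 3,
      coneInt (coneMonomial i 1 1) σ (pd 0 (g i.succ)) z) * h5
  let e₀ : M := EuclideanSpace.single 0 1
  have he0 : ∀ t : ℝ, (x - (σ * t) • e₀) 0 = x 0 - σ * t := fun t => by simp [e₀]
  have hes : ∀ t : ℝ, spatial (x - (σ * t) • e₀) = spatial x := by
    intro t
    rw [spatial_sub, spatial_smul]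
    ext i
    simp [e₀, spatial_apply]
  set T := |x 0| + δ * ‖spatial x‖ + 1 with hT
  have hT0 : 0 ≤ T := by positivity
  have hl : ∀ t : ℝ, HasDerivAt (fun t : ℝ => x - (σ * t) • e₀) (-(σ • e₀)) t := by
    intro t
    simpa using (((hasDerivAt_id t).const_mul σ).smul_const e₀).const_sub x
  have key := constant_of_has_deriv_right_zero (f := fun t : ℝ => c (x - (σ * t) • e₀)) (a := 0)
    (b := T) (Continuous.continuousOn (hcd.continuous.comp (by fun_prop))) (fun t ht => by
      refine HasDerivAt.hasDerivWithinAt ?_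
      have h2 := (smooth_diffAt hcd (x - (σ * t) • e₀)).hasFDerivAt.comp_hasDerivAt t (hl t)
      refine HasDerivAt.congr_deriv h2 ?_
      rw [map_neg, map_smul]
      have h3 := hc0 (x - (σ * t) • e₀) (by
        rw [he0, hes]
        have : σ * (x 0 - σ * t) = σ * x 0 - t := by linear_combination -t * h5
        linarith [ht.1])
      rw [pd] at h3
      rw [h3, smul_zero, neg_zero]) T ⟨hT0, le_rfl⟩
  simp only [mul_zero, zero_smul, sub_zero] at key
  rw [← key]
  have h6 : σ * (x - (σ * T) • e₀) 0 < -(δ * ‖spatial (x - (σ * T) • e₀)‖) := by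
    rw [he0, hes]
    have h7 : σ * (x 0 - σ * T) = σ * x 0 - T := by linear_combination -T * h5
    have h8 := le_abs_self (σ * x 0)
    rw [abs_mul, hσ, one_mul] at h8
    rw [h7, hT]
    linarith
  simp only [c, hg, hv.coneInt_eq_zero hδ' hσ h6 hδ]
  simp

theorem box_conePot (hδ : 0 < δ) (hδ' : δ < 1) (hv : HomCurrent δ v) (hσ : |σ| = 1) (a : Fin 4)
    (x : M) : box (conePot σ fun z => farCut z * v a z) x = sphereArea * (farCut x * v a x) := by
  have hr := hv.regionSmooth hδ hδ' a
  rw [← hr.conePot_box hσ]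
  have r2 : ∀ i ∈ (Finset.univ : Finset (Fin 3)), RegionSmooth 0 δ
      (pd i.succ (pd i.succ fun z => farCut z * v a z)) := fun i _ => (hr.pd i.succ).pd i.succ
  have h1 := ((hr.pd 0).pd 0).coneInt_sub (RegionSmooth.sum Finset.univ_nonempty r2) hσ
    coneWeight_inv x
  rw [RegionSmooth.coneInt_sum r2 hσ coneWeight_inv] at h1
  simp only [box, hr.pd_conePot hσ, (hr.pd _).pd_conePot hσ]
  exact h1.symm

end HomCurrent

/-- The sign `g_aa` of the metric. -/
def metricSign (a : Fin 4) : ℝ := if a = 0 then 1 else -1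

@[simp] theorem metricSign_zero : metricSign 0 = 1 := rfl

@[simp] theorem metricSign_succ (i : Fin 3) : metricSign i.succ = -1 := if_neg (Fin.succ_ne_zero i)

theorem lower_eq_metricSign (x : M) (a : Fin 4) : lower x a = metricSign a * x a := by
  refine Fin.cases (by simp) (fun i => by simp) a

/-- The algebra behind the closedness of the radiation field. -/
theorem symm_of_euler_of_dual {x : Fin 4 → ℝ} {A : Fin 4 → ℝ} {G : Fin 4 → Fin 4 → ℝ}
    (h1 : ∀ b, ∑ a, x a * G a b + A b = 0)
    (h2 : ∀ b, ∑ a, metricSign a * x a * G b a + metricSign b * A b = 0)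
    (h3 : ∀ i j : Fin 3, x i.succ * G 0 j.succ + x 0 * G i.succ j.succ
      - (x j.succ * G 0 i.succ + x 0 * G j.succ i.succ)
      + (x i.succ * G j.succ 0 - x j.succ * G i.succ 0) = 0)
    (hm : x 0 ^ 2 ≠ ∑ i : Fin 3, x i.succ ^ 2) (h0 : x 0 ≠ 0) (a b : Fin 4) :
    metricSign b * G a b = metricSign a * G b a := by
  simp only [Fin.sum_univ_succ, Fin.sum_univ_zero, metricSign_zero, metricSign_succ] at h1 h2
  have e0 : ∑ i : Fin 3, x i.succ * (G 0 i.succ + G i.succ 0) = 0 := by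
    simp only [Fin.sum_univ_succ, Fin.sum_univ_zero]
    have h := h2 0
    simp only [metricSign_zero] at h
    linear_combination h1 0 - h
  have ej : ∀ j : Fin 3, x 0 * (G 0 j.succ + G j.succ 0)
      + ∑ i : Fin 3, x i.succ * (G i.succ j.succ - G j.succ i.succ) = 0 := by
    intro j
    have h := h2 j.succ
    simp only [metricSign_succ] at h
    simp only [Fin.sum_univ_succ, Fin.sum_univ_zero]
    linear_combination h1 j.succ + h
  have hE : ∀ j : Fin 3, G 0 j.succ + G j.succ 0 = 0 := by
    intro j
    have h4 := Finset.sum_congr (rfl : (Finset.univ : Finset (Fin 3)) = Finset.univ)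
      fun i _ => congrArg (x i.succ * ·) (h3 i j)
    have h5 := ej j
    simp only [Fin.sum_univ_succ, Fin.sum_univ_zero] at h4 h5 e0 hm
    refine (mul_eq_zero.1 ?_).resolve_left (sub_ne_zero.2 hm)
    linear_combination x 0 * h5 - h4 - x j.succ * e0
  have hB : ∀ i j : Fin 3, G i.succ j.succ = G j.succ i.succ := by
    intro i j
    refine mul_left_cancel₀ h0 ?_
    linear_combination h3 i j - x i.succ * hE j + x j.succ * hE i
  refine Fin.cases ?_ (fun i => ?_) a <;> refine Fin.cases ?_ (fun j => ?_) b
  · rfl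
  · simp only [metricSign_zero, metricSign_succ]
    linear_combination -hE j
  · simp only [metricSign_zero, metricSign_succ]
    linear_combination hE i
  · simp only [metricSign_succ, hB i j]

section

variable {δ : ℝ} {v : Fin 4 → M → ℝ}

/-- The covariant components of the radiation field of a homogeneous current. -/
def radForm (v : Fin 4 → M → ℝ) (a : Fin 4) (x : M) : ℝ :=
  metricSign a * radField (fun z => farCut z * v a z) x

theorem HomCurrent.contDiff_radField (hδ : 0 < δ) (hδ' : δ < 1) (hv : HomCurrent δ v) (a : Fin 4) :
    ContDiff ℝ ∞ (radField fun z => farCut z * v a z) :=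
  ((hv.regionSmooth hδ hδ' a).contDiff_conePot (by simp)).sub
    ((hv.regionSmooth hδ hδ' a).contDiff_conePot (by simp))

theorem HomCurrent.contDiff_radForm (hδ : 0 < δ) (hδ' : δ < 1) (hv : HomCurrent δ v) (a : Fin 4) :
    ContDiff ℝ ∞ (radForm v a) := contDiff_const.mul (hv.contDiff_radField hδ hδ' a)

theorem mem_farRegion_imp {σ : ℝ} (hσ : |σ| = 1) {x : M} (hx : x ∈ farRegion) :
    σ * x 0 + 2 < ‖spatial x‖ := by
  have h1 : |x 0| + 2 < ‖spatial x‖ := hx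
  have h2 : σ * x 0 ≤ |σ * x 0| := le_abs_self _
  rw [abs_mul, hσ, one_mul] at h2
  linarith

theorem HomCurrent.sum_coord_radForm (hδ : 0 < δ) (hδ' : δ < 1) (hv : HomCurrent δ v)
    (ht : ∀ x, x ≠ 0 → ∑ a, lower x a * v a x = 0) {x : M} (hx : x ∈ farRegion) :
    ∑ a, x a * radForm v a x = 0 := by
  have h1 := hv.sum_lower_conePot hδ hδ' ht (by simp) (mem_farRegion_imp (σ := 1) (by simp) hx)
  have h2 := hv.sum_lower_conePot hδ hδ' ht (by simp) (mem_farRegion_imp (σ := -1) (by simp) hx)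
  have h3 : ∀ a, x a * radForm v a x = lower x a * conePot 1 (fun z => farCut z * v a z) x
      - lower x a * conePot (-1) (fun z => farCut z * v a z) x := by
    intro a
    rw [radForm, radField, lower_eq_metricSign]
    ring
  simp only [h3]
  rw [Finset.sum_sub_distrib, h1, h2, sub_zero]

/-- The covariant radiation field is closed. -/
theorem HomCurrent.pd_radForm_comm (hδ : 0 < δ) (hδ' : δ < 1) (hv : HomCurrent δ v)
    (ht : ∀ x, x ≠ 0 → ∑ a, lower x a * v a x = 0)
    (hb : ∀ i j x, x ∈ farRegion → boostCurl (fun a => radField fun z => farCut z * v a z) i j x = 0)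
    {x : M} (hx : x ∈ farRegion) (a b : Fin 4) :
    pd a (radForm v b) x = pd b (radForm v a) x := by
  let A : Fin 4 → M → ℝ := fun a => radField fun z => farCut z * v a z
  have hA : ∀ a, ContDiff ℝ ∞ (A a) := hv.contDiff_radField hδ hδ'
  have hpf : ∀ a b, pd a (radForm v b) = fun x => metricSign b * pd a (A b) x := fun a b =>
    pd_const_mul (hA b) (metricSign b) a
  have key : ∀ z : M, z ∈ farRegion → z 0 ≠ 0 → pd a (radForm v b) z = pd b (radForm v a) z := by
    intro z hz hz0
    simp only [hpf]
    refine symm_of_euler_of_dual (x := fun a => z a) (A := fun a => A a z)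
      (G := fun a b => pd a (A b) z) (fun b => ?_) (fun b => ?_) (fun i j => ?_) ?_ hz0 a b
    · have h1 := hv.eul_conePot_eq_zero hδ hδ' (by simp) (mem_farRegion_imp (σ := 1) (by simp) hz) b
      have h2 := hv.eul_conePot_eq_zero hδ hδ' (by simp) (mem_farRegion_imp (σ := -1) (by simp) hz) b
      have h3 : eul 1 (A b) z = 0 := by
        have h4 := congrFun (eul_sub ((hv.regionSmooth hδ hδ' b).contDiff_conePot (σ := 1) (by simp))
          ((hv.regionSmooth hδ hδ' b).contDiff_conePot (σ := -1) (by simp)) 1) z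
        simp only [h1, h2, sub_zero] at h4
        exact h4
      rwa [eul_eq, one_mul] at h3
    · have h1 : (fun z => ∑ a, z a * (metricSign a * A a z)) =ᶠ[𝓝 z] fun _ => 0 := by
        filter_upwards [isOpen_farRegion.mem_nhds hz] with y hy
        exact hv.sum_coord_radForm hδ hδ' ht hy
      have h2 : HasFDerivAt (fun z : M => ∑ a, z a * (metricSign a * A a z)) _ z :=
        HasFDerivAt.fun_sum fun a _ => (smooth_diffAt
          ((contDiff_coord a).mul (contDiff_const.mul (hA a))) z).hasFDerivAt
      have h3 : fderiv ℝ (fun z : M => ∑ a, z a * (metricSign a * A a z)) z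
          (EuclideanSpace.single b 1) = 0 := by
        rw [h1.fderiv_eq]
        simp
      rw [h2.fderiv, _root_.sum_apply] at h3
      have h4 : ∀ a, fderiv ℝ (fun z : M => z a * (metricSign a * A a z)) z
          (EuclideanSpace.single b 1) = metricSign a * z a * pd b (A a) z
            + (if b = a then 1 else 0) * (metricSign a * A a z) := by
        intro a
        have h5 := congrFun (pd_coord_mul (contDiff_const.mul (hA a) : ContDiff ℝ ∞
          fun z => metricSign a * A a z) b a) z
        rw [pd_const_mul (hA a)] at h5
        simp only at h5
        rw [pd] at h5
        rw [h5]
        ring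
      simp only [h4, Finset.sum_add_distrib, ite_mul, one_mul, zero_mul, Finset.sum_ite_eq,
        Finset.mem_univ, if_true] at h3
      exact h3
    · exact hb i j z hz
    · have h1 : |z 0| + 2 < ‖spatial z‖ := hz
      have h2 : ‖spatial z‖ ^ 2 = ∑ i : Fin 3, z i.succ ^ 2 := by
        rw [EuclideanSpace.real_norm_sq_eq]
        simp [spatial_apply]
      simp only
      rw [← h2, ← sq_abs (z 0)]
      nlinarith [abs_nonneg (z 0)]
  by_cases h0 : x 0 = 0
  · have hc : Continuous fun z => pd a (radForm v b) z - pd b (radForm v a) z :=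
      (contDiff_pd (hv.contDiff_radForm hδ hδ' b) a).continuous.sub
        (contDiff_pd (hv.contDiff_radForm hδ hδ' a) b).continuous
    have hl : Continuous fun t : ℝ => x + t • (EuclideanSpace.single 0 1 : M) := by fun_prop
    have h1 : Tendsto (fun t : ℝ => x + t • (EuclideanSpace.single 0 1 : M)) (𝓝[≠] 0) (𝓝 x) := by
      have := (hl.tendsto 0).mono_left (nhdsWithin_le_nhds (s := {0}ᶜ))
      simpa using this
    have h2 := (hc.tendsto x).comp h1
    refine sub_eq_zero.1 (tendsto_nhds_unique h2 ((tendsto_congr' ?_).2 tendsto_const_nhds))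
    filter_upwards [h1.eventually (isOpen_farRegion.mem_nhds hx), self_mem_nhdsWithin] with t ht1 ht2
    have h3 : (x + t • (EuclideanSpace.single 0 1 : M)) 0 ≠ 0 := by simpa [h0] using ht2
    exact sub_eq_zero.2 (key _ ht1 h3)
  · exact key x hx h0

end

/-! ### Potentials of closed forms in the far spacelike region -/

/-- Convex pieces of the far region. -/
def wedge (v : E3) : Set M := {x | 2 * |x 0| + 4 < inner ℝ v (spatial x)}

theorem isOpen_wedge (v : E3) : IsOpen (wedge v) :=
  isOpen_lt (f := fun x : M => 2 * |x 0| + 4) (g := fun x : M => inner ℝ v (spatial x))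
    (by fun_prop) (continuous_const.inner continuous_spatial)

theorem convex_wedge (v : E3) : Convex ℝ (wedge v) := by
  intro x hx y hy a b ha hb hab
  have h1 : 2 * |x 0| + 4 < inner ℝ v (spatial x) := hx
  have h2 : 2 * |y 0| + 4 < inner ℝ v (spatial y) := hy
  have h3 : spatial (a • x + b • y) = a • spatial x + b • spatial y := by
    simp only [← spatialL_apply, map_add, map_smul]
  have h4 : |a * x 0 + b * y 0| ≤ a * |x 0| + b * |y 0| := by
    refine (abs_add_le _ _).trans_eq ?_
    rw [abs_mul, abs_mul, abs_of_nonneg ha, abs_of_nonneg hb]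
  change 2 * |a * x 0 + b * y 0| + 4 < inner ℝ v (spatial (a • x + b • y))
  rw [h3, inner_add_right, inner_smul_right, inner_smul_right]
  have h5 : a * (2 * |x 0| + 4) + b * (2 * |y 0| + 4)
      < a * inner ℝ v (spatial x) + b * inner ℝ v (spatial y) := by
    rcases ha.eq_or_lt with rfl | ha'
    · have hb1 : b = 1 := by linarith
      subst hb1
      linarith
    · have := mul_lt_mul_of_pos_left h1 ha'
      have := mul_le_mul_of_nonneg_left h2.le hb
      linarith
  have h6 : (4 : ℝ) = a * 4 + b * 4 := by rw [← add_mul, hab, one_mul]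
  linarith

theorem wedge_subset {v : E3} (hv : ‖v‖ ≤ 2) : wedge v ⊆ farRegion := by
  intro x hx
  have h1 : 2 * |x 0| + 4 < inner ℝ v (spatial x) := hx
  have h2 := real_inner_le_norm v (spatial x)
  have h3 := mul_le_mul_of_nonneg_right hv (norm_nonneg (spatial x))
  change |x 0| + 2 < ‖spatial x‖
  linarith

/-- The projection to the hyperplane `x⁰ = 0`. -/
def slice (x : M) : M := mkVec 0 (spatial x)

theorem slice_mem {v : E3} {x : M} (hx : x ∈ wedge v) : slice x ∈ wedge v := by
  have h1 : 2 * |x 0| + 4 < inner ℝ v (spatial x) := hx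
  change 2 * |slice x 0| + 4 < inner ℝ v (spatial (slice x))
  rw [slice, mkVec_zero, spatial_mkVec, abs_zero]
  have := abs_nonneg (x 0)
  linarith

theorem continuous_slice : Continuous slice :=
  continuous_mkVec.comp (continuous_const.prodMk continuous_spatial)

/-- The direction of the space part, of length two. -/
def dirTwo (x : M) : E3 := (2 * ‖spatial x‖⁻¹) • spatial x

theorem norm_dirTwo_le (x : M) : ‖dirTwo x‖ ≤ 2 := by
  rw [dirTwo, norm_smul, norm_mul, norm_inv, norm_norm, Real.norm_two, mul_assoc]
  have := inv_mul_le_one (a := ‖spatial x‖)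
  linarith

theorem mem_wedge_dirTwo {x : M} (hx : x ∈ farRegion) : x ∈ wedge (dirTwo x) := by
  have h1 : |x 0| + 2 < ‖spatial x‖ := hx
  have h0 : 0 < ‖spatial x‖ := by
    have := abs_nonneg (x 0)
    linarith
  change 2 * |x 0| + 4 < inner ℝ (dirTwo x) (spatial x)
  rw [dirTwo, real_inner_smul_left, real_inner_self_eq_norm_sq, pow_two, ← mul_assoc,
    mul_assoc 2, inv_mul_cancel₀ h0.ne']
  linarith

/-- The vertices of a regular tetrahedron. -/
def tetra : Fin 4 → E3 := ![!₂[1, 1, 1], !₂[1, -1, -1], !₂[-1, 1, -1], !₂[-1, -1, 1]]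

theorem norm_tetra_le (k : Fin 4) : ‖tetra k‖ ≤ 2 := by
  refine abs_le_of_sq_le_sq' ?_ (by norm_num) |>.2
  rw [EuclideanSpace.real_norm_sq_eq, Fin.sum_univ_three]
  fin_cases k <;> simp [tetra] <;> norm_num

theorem tetra_point_mem {k m : Fin 4} (h : k ≠ m) :
    mkVec 0 ((-5 : ℝ) • tetra m) ∈ wedge (tetra k) := by
  change 2 * |mkVec 0 ((-5 : ℝ) • tetra m) 0| + 4 < inner ℝ (tetra k) (spatial (mkVec 0 _))
  rw [mkVec_zero, spatial_mkVec, PiLp.inner_apply, Fin.sum_univ_three]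
  fin_cases k <;> fin_cases m <;> simp [tetra] at h ⊢ <;> norm_num

theorem exists_mem_wedge_tetra {x : M} (hx : 12 < ‖spatial x‖) :
    ∃ k, slice x ∈ wedge (tetra k) := by
  by_contra! hc
  have h1 : ∀ k, inner ℝ (tetra k) (spatial x) ≤ 4 := fun k => by
    refine not_lt.1 fun h => hc k ?_
    change 2 * |slice x 0| + 4 < inner ℝ (tetra k) (spatial (slice x))
    rw [slice, mkVec_zero, spatial_mkVec, abs_zero]
    linarith
  simp only [PiLp.inner_apply, Fin.sum_univ_three] at h1
  have a0 := h1 0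
  have a1 := h1 1
  have a2 := h1 2
  have a3 := h1 3
  simp [tetra] at a0 a1 a2 a3
  have h2 := spatial_norm_sq x
  have e : ∀ p q r : ℝ, p + q + r ≤ 4 → p - q - r ≤ 4 → -p + q - r ≤ 4 → -p - q + r ≤ 4 →
      p ^ 2 + q ^ 2 + r ^ 2 ≤ 144 := by
    intro p q r b0 b1 b2 b3
    nlinarith [mul_nonneg (sub_nonneg.2 b0) (by linarith : 0 ≤ p + q + r + 12),
      mul_nonneg (sub_nonneg.2 b1) (by linarith : 0 ≤ p - q - r + 12),
      mul_nonneg (sub_nonneg.2 b2) (by linarith : 0 ≤ -p + q - r + 12),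
      mul_nonneg (sub_nonneg.2 b3) (by linarith : 0 ≤ -p - q + r + 12)]
  have h3 := e (x 1) (x 2) (x 3) (by linarith) (by linarith) (by linarith) (by linarith)
  nlinarith

/-- The linear functional with components `F a x`. -/
def formOf (F : Fin 4 → M → ℝ) (x : M) : M →L[ℝ] ℝ :=
  ∑ a, F a x • EuclideanSpace.proj (𝕜 := ℝ) a

theorem formOf_apply (F : Fin 4 → M → ℝ) (x v : M) : formOf F x v = ∑ a, F a x * v a := by
  rw [formOf, _root_.sum_apply]
  rfl

theorem contDiff_formOf {F : Fin 4 → M → ℝ} (hF : ∀ a, ContDiff ℝ ∞ (F a)) :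
    ContDiff ℝ ∞ (formOf F) := ContDiff.sum fun a _ => (hF a).smul contDiff_const

theorem exists_potential_of_convex {F : Fin 4 → M → ℝ} (hF : ∀ a, ContDiff ℝ ∞ (F a)) {C : Set M}
    (hcl : ∀ x ∈ C, ∀ a b, pd a (F b) x = pd b (F a) x) (hC : Convex ℝ C) (hCo : IsOpen C) :
    ∃ f : M → ℝ, ∀ x ∈ C, HasFDerivAt f (formOf F x) x := by
  have hd := (contDiff_formOf hF).differentiable (by simp)
  refine hC.exists_forall_hasFDerivAt_of_fderiv_symmetric hCo hd.differentiableOn ?_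
  intro x hx u w
  have h1 : HasFDerivAt (formOf F) _ x := HasFDerivAt.fun_sum fun a _ =>
    (smooth_diffAt (hF a) x).hasFDerivAt.smul_const (EuclideanSpace.proj (𝕜 := ℝ) a)
  have h2 : ∀ u w : M, fderiv ℝ (formOf F) x u w = ∑ a, ∑ b, u b * w a * pd b (F a) x := by
    intro u w
    rw [h1.fderiv]
    simp only [_root_.sum_apply]
    refine Finset.sum_congr rfl fun a _ => ?_
    change fderiv ℝ (F a) x u * w a = _
    rw [fderiv_eq_sum_pd, Finset.sum_mul]
    exact Finset.sum_congr rfl fun b _ => by ring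
  rw [h2, h2, Finset.sum_comm]
  refine Finset.sum_congr rfl fun a _ => Finset.sum_congr rfl fun b _ => ?_
  rw [hcl x hx a b]
  ring

theorem sub_eq_sub_of_hasFDerivAt {ω' : M → M →L[ℝ] ℝ} {f g : M → ℝ} {C C' : Set M}
    (hC : Convex ℝ C) (hC' : Convex ℝ C') (hf : ∀ x ∈ C, HasFDerivAt f (ω' x) x)
    (hg : ∀ x ∈ C', HasFDerivAt g (ω' x) x) {x y : M} (hx : x ∈ C) (hx' : x ∈ C') (hy : y ∈ C)
    (hy' : y ∈ C') : f x - g x = f y - g y := by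
  have h := (hC.inter hC').norm_image_sub_le_of_norm_hasFDerivWithin_le (C := 0)
    (f := fun z => f z - g z) (f' := fun z => ω' z - ω' z)
    (fun z hz => ((hf z hz.1).sub (hg z hz.2)).hasFDerivWithinAt) (by simp) ⟨hy, hy'⟩ ⟨hx, hx'⟩
  rw [zero_mul] at h
  exact sub_eq_zero.1 (norm_le_zero_iff.1 h)

/-- The region in which the radiation field has a potential. -/
def potentialRegion : Set M := {x | |x 0| + 12 < ‖spatial x‖}

theorem isOpen_potentialRegion : IsOpen potentialRegion :=
  isOpen_lt (f := fun x : M => |x 0| + 12) (by fun_prop) continuous_spatial.norm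

theorem potentialRegion_subset : potentialRegion ⊆ farRegion := fun x hx => by
  have h : |x 0| + 12 < ‖spatial x‖ := hx
  change |x 0| + 2 < ‖spatial x‖
  linarith

theorem exists_potential {F : Fin 4 → M → ℝ} (hF : ∀ a, ContDiff ℝ ∞ (F a))
    (hcl : ∀ x ∈ farRegion, ∀ a b, pd a (F b) x = pd b (F a) x) :
    ∃ f : M → ℝ, ∀ x ∈ potentialRegion, HasFDerivAt f (formOf F x) x := by
  have h1 : ∀ v : E3, ∃ f : M → ℝ, ‖v‖ ≤ 2 → ∀ x ∈ wedge v, HasFDerivAt f (formOf F x) x := by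
    intro v
    by_cases hv : ‖v‖ ≤ 2
    · obtain ⟨f, hf⟩ := exists_potential_of_convex hF (fun x hx => hcl x (wedge_subset hv hx))
        (convex_wedge v) (isOpen_wedge v)
      exact ⟨f, fun _ => hf⟩
    · exact ⟨0, fun h => absurd h hv⟩
  choose f hf using h1
  have glue : ∀ {v w : E3}, ‖v‖ ≤ 2 → ‖w‖ ≤ 2 → ∀ {x y : M}, x ∈ wedge v → x ∈ wedge w →
      y ∈ wedge v → y ∈ wedge w → f v x - f w x = f v y - f w y := fun hv hw _ _ hx hx' hy hy' =>
    sub_eq_sub_of_hasFDerivAt (convex_wedge _) (convex_wedge _) (hf _ hv) (hf _ hw) hx hx' hy hy'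
  let q : Fin 4 → M := fun m => mkVec 0 ((-5 : ℝ) • tetra m)
  let p : Fin 4 → M := fun k => if k = 1 then q 2 else q 1
  let c : Fin 4 → ℝ := fun k => f (tetra k) (p k) - f (tetra 0) (p k)
  have hp : ∀ k, p k ∈ wedge (tetra k) ∧ p k ∈ wedge (tetra 0) := by
    intro k
    by_cases hk : k = 1
    · simp only [p, hk, if_true]
      exact ⟨tetra_point_mem (by decide), tetra_point_mem (by decide)⟩
    · simp only [p, hk, if_false]
      exact ⟨tetra_point_mem hk, tetra_point_mem (by decide)⟩
  have hglue : ∀ j k {x : M}, x ∈ wedge (tetra j) → x ∈ wedge (tetra k) →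
      f (tetra j) x - c j = f (tetra k) x - c k := by
    intro j k x hj hk
    obtain ⟨m, m0, mj, mk⟩ : ∃ m : Fin 4, 0 ≠ m ∧ j ≠ m ∧ k ≠ m :=
      (by decide : ∀ j k : Fin 4, ∃ m : Fin 4, 0 ≠ m ∧ j ≠ m ∧ k ≠ m) j k
    have n := norm_tetra_le
    have h2 := glue (n j) (n k) hj hk (tetra_point_mem mj) (tetra_point_mem mk)
    have h3 := glue (n j) (n 0) (hp j).1 (hp j).2 (tetra_point_mem mj) (tetra_point_mem m0)
    have h4 := glue (n k) (n 0) (hp k).1 (hp k).2 (tetra_point_mem mk) (tetra_point_mem m0)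
    simp only [c]
    linarith
  have hk : ∀ x : M, ∃ k, x ∈ potentialRegion → slice x ∈ wedge (tetra k) := by
    intro x
    by_cases hx : x ∈ potentialRegion
    · have h5 : |x 0| + 12 < ‖spatial x‖ := hx
      obtain ⟨k, hk⟩ := exists_mem_wedge_tetra (x := x) (by have := abs_nonneg (x 0); linarith)
      exact ⟨k, fun _ => hk⟩
    · exact ⟨0, fun h => absurd h hx⟩
  choose K hK using hk
  refine ⟨fun x => f (tetra (K x)) (slice x) - c (K x) + (f (dirTwo x) x - f (dirTwo x) (slice x)),
    fun x hx => ?_⟩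
  have hxv := mem_wedge_dirTwo (potentialRegion_subset hx)
  have hd := hf _ (norm_dirTwo_le x) x hxv
  refine (hd.add_const (f (tetra (K x)) (slice x) - c (K x) - f (dirTwo x) (slice x)))
    |>.congr_of_eventuallyEq ?_
  have e1 : ∀ᶠ z in 𝓝 x, z ∈ wedge (dirTwo x) := (isOpen_wedge _).mem_nhds hxv
  have e2 : ∀ᶠ z in 𝓝 x, slice z ∈ wedge (tetra (K x)) :=
    continuous_slice.continuousAt ((isOpen_wedge _).mem_nhds (hK x hx))
  have e3 : ∀ᶠ z in 𝓝 x, z ∈ potentialRegion := isOpen_potentialRegion.mem_nhds hx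
  filter_upwards [e1, e2, e3] with z z1 z2 z3
  have z4 := mem_wedge_dirTwo (potentialRegion_subset z3)
  have g1 := glue (norm_dirTwo_le x) (norm_dirTwo_le z) z1 z4 (slice_mem z1) (slice_mem z4)
  have g2 := hglue (K z) (K x) (hK z z3) z2
  have g3 := glue (norm_tetra_le (K x)) (norm_dirTwo_le x) z2 (slice_mem z1) (hK x hx)
    (slice_mem hxv)
  linarith

theorem contDiffOn_of_hasFDerivAt_formOf {F : Fin 4 → M → ℝ} (hF : ∀ a, ContDiff ℝ ∞ (F a))
    {f : M → ℝ} {C : Set M} (hC : IsOpen C) (hf : ∀ x ∈ C, HasFDerivAt f (formOf F x) x) :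
    ContDiffOn ℝ ∞ f C := by
  rw [contDiffOn_infty_iff_fderiv_of_isOpen hC]
  exact ⟨fun x hx => (hf x hx).differentiableAt.differentiableWithinAt,
    (contDiff_formOf hF).contDiffOn.congr fun x hx => (hf x hx).fderiv⟩

theorem pd_of_hasFDerivAt_formOf {F : Fin 4 → M → ℝ} {f : M → ℝ} {x : M}
    (hf : HasFDerivAt f (formOf F x) x) (a : Fin 4) : pd a f x = F a x := by
  rw [pd, hf.fderiv, formOf_apply]
  simp

/-! ### The Maxwell operator -/

theorem contDiff_of_union {f : M → ℝ} {D Z : Set M} (hD : IsOpen D) (hZ : IsOpen Z)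
    (h : ∀ x, x ∈ D ∨ x ∈ Z) (hf : ContDiffOn ℝ ∞ f D) (h0 : ∀ x ∈ Z, f x = 0) :
    ContDiff ℝ ∞ f := by
  rw [contDiff_iff_contDiffAt]
  intro x
  rcases h x with hx | hx
  · exact hf.contDiffAt (hD.mem_nhds hx)
  · refine (contDiffAt_const (c := (0 : ℝ))).congr_of_eventuallyEq ?_
    filter_upwards [hZ.mem_nhds hx] with y hy using h0 y hy

theorem exists_contDiff_eventuallyEq {f : M → ℝ} {D : Set M} (hD : IsOpen D)
    (hf : ContDiffOn ℝ ∞ f D) {x : M} (hx : x ∈ D) : ∃ g, ContDiff ℝ ∞ g ∧ g =ᶠ[𝓝 x] f := by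
  obtain ⟨r, hr, hrD⟩ := Metric.isOpen_iff.1 hD x hx
  let b : ContDiffBump x := ⟨r / 3, r / 2, by positivity, by linarith⟩
  refine ⟨fun y => b y * f y, contDiff_of_union hD (Metric.isClosed_closedBall (x := x)
    (ε := r / 2)).isOpen_compl (fun y => ?_) (b.contDiff.contDiffOn.mul hf) fun y hy => ?_, ?_⟩
  · by_cases hy : y ∈ D
    · exact Or.inl hy
    · refine Or.inr fun h => hy (hrD ?_)
      have h1 : dist y x ≤ r / 2 := h
      exact lt_of_le_of_lt h1 (by linarith)
  · rw [b.zero_of_le_dist, zero_mul]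
    have h1 : ¬dist y x ≤ r / 2 := hy
    exact (not_le.1 h1).le
  · filter_upwards [b.eventuallyEq_one] with y hy
    simp [hy]

theorem pd_eventuallyEq {f g : M → ℝ} {x : M} (h : f =ᶠ[𝓝 x] g) (a : Fin 4) :
    pd a f =ᶠ[𝓝 x] pd a g := by
  filter_upwards [h.fderiv (𝕜 := ℝ)] with y hy
  rw [pd, pd, hy]

theorem box_eq_sum (f : M → ℝ) (x : M) : box f x = ∑ b, metricSign b * pd b (pd b f) x := by
  rw [box, Fin.sum_univ_succ fun b : Fin 4 => metricSign b * pd b (pd b f) x]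
  simp [sub_eq_add_neg]

theorem contDiff_box {f : M → ℝ} (hf : ContDiff ℝ ∞ f) : ContDiff ℝ ∞ (box f) :=
  (contDiff_pd (contDiff_pd hf 0) 0).sub
    (ContDiff.sum fun i _ => contDiff_pd (contDiff_pd hf i.succ) i.succ)

theorem box_eventuallyEq {f g : M → ℝ} {x : M} (h : f =ᶠ[𝓝 x] g) : box f =ᶠ[𝓝 x] box g := by
  have h1 : ∀ᶠ y in 𝓝 x, ∀ b : Fin 4, pd b (pd b f) y = pd b (pd b g) y := by
    rw [eventually_all]
    exact fun b => pd_eventuallyEq (pd_eventuallyEq h b) b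
  filter_upwards [h1] with y hy
  simp only [box, hy]

/-- The divergence. -/
def dvg (A : Fin 4 → M → ℝ) (x : M) : ℝ := ∑ b, pd b (A b) x

theorem contDiff_dvg {A : Fin 4 → M → ℝ} (hA : ∀ a, ContDiff ℝ ∞ (A a)) : ContDiff ℝ ∞ (dvg A) :=
  ContDiff.sum fun b _ => contDiff_pd (hA b) b

theorem pd_sum {ι : Type*} (s : Finset ι) {f : ι → M → ℝ} (hf : ∀ i ∈ s, ContDiff ℝ ∞ (f i))
    (a : Fin 4) : pd a (fun x => ∑ i ∈ s, f i x) = fun x => ∑ i ∈ s, pd a (f i) x := by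
  funext x
  have h : HasFDerivAt (fun x => ∑ i ∈ s, f i x) _ x :=
    HasFDerivAt.fun_sum fun i hi => (smooth_diffAt (hf i hi) x).hasFDerivAt
  rw [pd, h.fderiv, _root_.sum_apply]
  rfl

theorem pd_dvg {A : Fin 4 → M → ℝ} (hA : ∀ a, ContDiff ℝ ∞ (A a)) (a : Fin 4) :
    pd a (dvg A) = fun x => ∑ b, pd a (pd b (A b)) x :=
  pd_sum Finset.univ (fun b _ => contDiff_pd (hA b) b) a

theorem pd_box {f : M → ℝ} (hf : ContDiff ℝ ∞ f) (a : Fin 4) : pd a (box f) = box (pd a f) := by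
  have h1 : box f = fun x => ∑ b, metricSign b * pd b (pd b f) x := funext (box_eq_sum f)
  have h2 : ∀ b, ContDiff ℝ ∞ (pd b (pd b f)) := fun b => contDiff_pd (contDiff_pd hf b) b
  rw [h1, pd_sum _ fun b _ => contDiff_const.mul (h2 b)]
  funext x
  rw [box_eq_sum]
  refine Finset.sum_congr rfl fun b _ => ?_
  rw [pd_const_mul (h2 b), pd_comm (contDiff_pd hf b), pd_comm hf a b]

theorem box_sub {f g : M → ℝ} (hf : ContDiff ℝ ∞ f) (hg : ContDiff ℝ ∞ g) (x : M) :
    box (fun x => f x - g x) x = box f x - box g x := by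
  simp only [box_eq_sum, ← Finset.sum_sub_distrib]
  refine Finset.sum_congr rfl fun b _ => ?_
  rw [pd_sub hf hg, pd_sub (contDiff_pd hf b) (contDiff_pd hg b)]
  ring

theorem box_const_mul {f : M → ℝ} (hf : ContDiff ℝ ∞ f) (c : ℝ) (x : M) :
    box (fun x => c * f x) x = c * box f x := by
  simp only [box_eq_sum, Finset.mul_sum]
  refine Finset.sum_congr rfl fun b _ => ?_
  rw [pd_const_mul hf, pd_const_mul (contDiff_pd hf b)]
  ring

theorem eul_sum {ι : Type*} (s : Finset ι) {f : ι → M → ℝ} (hf : ∀ i ∈ s, ContDiff ℝ ∞ (f i))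
    (κ : ℝ) (x : M) : eul κ (fun x => ∑ i ∈ s, f i x) x = ∑ i ∈ s, eul κ (f i) x := by
  simp only [eul_eq, pd_sum s hf, Finset.mul_sum, Finset.sum_add_distrib]
  rw [Finset.sum_comm]

theorem eul_const_mul {f : M → ℝ} (hf : ContDiff ℝ ∞ f) (κ c : ℝ) (x : M) :
    eul κ (fun x => c * f x) x = c * eul κ f x := by
  simp only [eul_eq, pd_const_mul hf, mul_add, Finset.mul_sum]
  congr 1
  · exact Finset.sum_congr rfl fun a _ => by ring
  · ring

/-- The current `□ A^a - ∂^a ∂·A` of a potential with the contravariant components `A a`. -/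
def maxwell (A : Fin 4 → M → ℝ) (a : Fin 4) (x : M) : ℝ :=
  box (A a) x - metricSign a * pd a (dvg A) x

section

variable {A B : Fin 4 → M → ℝ}

theorem contDiff_maxwell (hA : ∀ a, ContDiff ℝ ∞ (A a)) (a : Fin 4) : ContDiff ℝ ∞ (maxwell A a) :=
  (contDiff_box (hA a)).sub (contDiff_const.mul (contDiff_pd (contDiff_dvg hA) a))

theorem maxwell_congr {x : M} (h : ∀ a, A a =ᶠ[𝓝 x] B a) (a : Fin 4) :
    maxwell A a =ᶠ[𝓝 x] maxwell B a := by
  have h1 : ∀ᶠ y in 𝓝 x, ∀ b : Fin 4, pd b (A b) y = pd b (B b) y := by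
    rw [eventually_all]
    exact fun b => pd_eventuallyEq (h b) b
  have h2 : dvg A =ᶠ[𝓝 x] dvg B := by
    filter_upwards [h1] with y hy
    simp only [dvg, hy]
  filter_upwards [box_eventuallyEq (h a), pd_eventuallyEq h2 a] with y y1 y2
  rw [maxwell, maxwell, y1, y2]

theorem maxwell_eq_zero {x : M} (h : ∀ a, A a =ᶠ[𝓝 x] fun _ => 0) (a : Fin 4) :
    maxwell A a =ᶠ[𝓝 x] fun _ => 0 := by
  refine (maxwell_congr (B := fun _ _ => 0) h a).trans (Eventually.of_forall fun y => ?_)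
  have hz : ∀ b, pd b (fun _ : M => (0 : ℝ)) = fun _ => 0 := fun b => by
    funext z
    simp [pd]
  have hd : dvg (fun _ _ => 0) = fun _ => 0 := by
    funext z
    simp [dvg, hz]
  simp [maxwell, box, hz, hd]

theorem maxwell_sub (hA : ∀ a, ContDiff ℝ ∞ (A a)) (hB : ∀ a, ContDiff ℝ ∞ (B a)) (a : Fin 4)
    (x : M) : maxwell (fun a x => A a x - B a x) a x = maxwell A a x - maxwell B a x := by
  have h1 : dvg (fun a x => A a x - B a x) = fun x => dvg A x - dvg B x := by
    funext y
    simp only [dvg, pd_sub (hA _) (hB _), Finset.sum_sub_distrib]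
  rw [maxwell, maxwell, maxwell, box_sub (hA a) (hB a), h1,
    pd_sub (contDiff_dvg hA) (contDiff_dvg hB)]
  ring

/-- Gauge invariance. -/
theorem maxwell_gradient {ψ : M → ℝ} (hψ : ContDiff ℝ ∞ ψ) (a : Fin 4) (x : M) :
    maxwell (fun a x => metricSign a * pd a ψ x) a x = 0 := by
  have h1 : dvg (fun a x => metricSign a * pd a ψ x) = box ψ := by
    funext y
    rw [box_eq_sum]
    exact Finset.sum_congr rfl fun b _ => by rw [pd_const_mul (contDiff_pd hψ b)]
  rw [maxwell, h1, box_const_mul (contDiff_pd hψ a), pd_box hψ, sub_self]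

theorem dvg_maxwell (hA : ∀ a, ContDiff ℝ ∞ (A a)) (x : M) : dvg (maxwell A) x = 0 := by
  have h1 : ∀ a, pd a (maxwell A a) x = pd a (box (A a)) x
      - metricSign a * pd a (pd a (dvg A)) x := by
    intro a
    have h2 := contDiff_pd (contDiff_dvg hA) a
    have h3 := congrFun (pd_sub (contDiff_box (hA a)) (contDiff_const.mul h2) a
      (f := box (A a)) (g := fun x => metricSign a * pd a (dvg A) x)) x
    rw [pd_const_mul h2] at h3
    exact h3
  simp only [dvg, h1, Finset.sum_sub_distrib]
  rw [← box_eq_sum]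
  have h4 : ∀ b, ContDiff ℝ ∞ (pd b (dvg A)) := fun b => contDiff_pd (contDiff_dvg hA) b
  have h5 : box (dvg A) x = ∑ a, box (pd a (A a)) x := by
    simp only [box_eq_sum]
    rw [Finset.sum_comm]
    refine Finset.sum_congr rfl fun b _ => ?_
    rw [pd_dvg hA, pd_sum _ fun a _ => contDiff_pd (contDiff_pd (hA a) a) b, Finset.mul_sum]
  rw [h5, sub_eq_zero]
  exact Finset.sum_congr rfl fun a _ => by rw [pd_box (hA a)]

theorem eul_box {f : M → ℝ} (hf : ContDiff ℝ ∞ f) (κ : ℝ) (x : M) :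
    eul (κ + 2) (box f) x = box (eul κ f) x := by
  have h1 : box f = fun x => ∑ b, metricSign b * pd b (pd b f) x := funext (box_eq_sum f)
  have h2 : ∀ b, ContDiff ℝ ∞ (pd b (pd b f)) := fun b => contDiff_pd (contDiff_pd hf b) b
  rw [h1, eul_sum _ fun b _ => contDiff_const.mul (h2 b), box_eq_sum]
  refine Finset.sum_congr rfl fun b _ => ?_
  rw [eul_const_mul (h2 b), pd_eul hf, pd_eul (contDiff_pd hf b), add_assoc, one_add_one_eq_two]

theorem eul_maxwell (hA : ∀ a, ContDiff ℝ ∞ (A a)) (a : Fin 4) (x : M) :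
    eul 3 (maxwell A a) x = maxwell (fun a => eul 1 (A a)) a x := by
  have h1 : dvg (fun a => eul 1 (A a)) = eul 2 (dvg A) := by
    funext y
    have h2 : eul 2 (dvg A) y = _ := eul_sum Finset.univ (fun b _ => contDiff_pd (hA b) b) 2 y
    rw [h2]
    refine Finset.sum_congr rfl fun b _ => ?_
    rw [pd_eul (hA b), one_add_one_eq_two]
  have h2 := contDiff_pd (contDiff_dvg hA) a
  have h3 : eul 3 (maxwell A a) x = _ := congrFun (eul_sub (contDiff_box (hA a))
    (contDiff_const.mul h2) 3 (g := fun x => metricSign a * pd a (dvg A) x)) x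
  rw [h3, eul_const_mul h2, maxwell, h1, pd_eul (contDiff_dvg hA)]
  have h4 := eul_box (hA a) 1 x
  norm_num at h4 ⊢
  rw [h4]

end

/-! ### Switching off the radiation potential in the past -/

theorem exists_interpolation {δ : ℝ} (hδ : 0 < δ) {F : Fin 4 → M → ℝ}
    (hF : ∀ a, ContDiff ℝ ∞ (F a))
    (hcl : ∀ x ∈ farRegion, ∀ a b, pd a (F b) x = pd b (F a) x)
    (hx : ∀ x ∈ farRegion, ∑ a, x a * F a x = 0) :
    ∃ ψ : M → ℝ, ContDiffOn ℝ ∞ ψ potentialRegion ∧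
      (∀ x ∈ potentialRegion, fderiv ℝ ψ x x = 0) ∧
      (∀ x ∈ potentialRegion, δ * ‖spatial x‖ < x 0 → ∀ a, pd a ψ x = F a x) ∧
      ∀ x ∈ potentialRegion, x 0 < -(δ * ‖spatial x‖) → ∀ a, pd a ψ x = 0 := by
  obtain ⟨f, hf⟩ := exists_potential hF hcl
  let χ : M → ℝ := fun x => Real.smoothTransition ((x 0 / ‖spatial x‖ + δ) / (2 * δ))
  have hpos : ∀ x ∈ potentialRegion, 0 < ‖spatial x‖ := by
    intro x hx
    have h : |x 0| + 12 < ‖spatial x‖ := hx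
    have := abs_nonneg (x 0)
    linarith
  have hχ : ContDiffOn ℝ ∞ χ potentialRegion := by
    refine Real.smoothTransition.contDiff.comp_contDiffOn ?_
    refine ((ContDiffOn.div (contDiff_coord 0).contDiffOn (contDiffOn_norm_spatial.mono ?_)
      fun x hx => (hpos x hx).ne').add contDiffOn_const).div_const _
    exact fun x hx => norm_pos_iff.1 (hpos x hx)
  have hfs := contDiffOn_of_hasFDerivAt_formOf hF isOpen_potentialRegion hf
  have hχd : ∀ x ∈ potentialRegion, DifferentiableAt ℝ χ x := fun x hx =>
    (hχ.contDiffAt (isOpen_potentialRegion.mem_nhds hx)).differentiableAt (by simp)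
  have hc1 : Continuous fun x : M => δ * ‖spatial x‖ := continuous_const.mul continuous_spatial.norm
  refine ⟨fun x => χ x * f x, hχ.mul hfs, fun x hxD => ?_, fun x hxD h a => ?_, fun x hxD h a => ?_⟩
  · have h0 : fderiv ℝ χ x x = 0 * χ x := fderiv_self_of_homog (hχd x hxD) fun r hr => by
      rw [Real.rpow_zero, one_mul]
      simp only [χ]
      rw [spatial_smul, norm_smul, Real.norm_eq_abs, abs_of_pos hr, PiLp.smul_apply, smul_eq_mul,
        mul_div_mul_left _ _ hr.ne']
    rw [fderiv_fun_mul (hχd x hxD) (hf x hxD).differentiableAt, _root_.add_apply,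
      _root_.smul_apply, _root_.smul_apply, h0, (hf x hxD).fderiv, formOf_apply]
    have h1 := hx x (potentialRegion_subset hxD)
    simp only [mul_comm (x _)] at h1
    simp [h1]
  · have h1 : (fun x => χ x * f x) =ᶠ[𝓝 x] f := by
      filter_upwards [isOpen_potentialRegion.mem_nhds hxD,
        (isOpen_lt hc1 (by fun_prop : Continuous fun x : M => x 0)).mem_nhds h] with y y1 y2
      have y3 := hpos y y1
      rw [show χ y = 1 from Real.smoothTransition.one_of_one_le ?_, one_mul]
      rw [le_div_iff₀ (by positivity)]
      have : δ ≤ y 0 / ‖spatial y‖ := (le_div_iff₀ y3).2 (le_of_lt y2)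
      linarith
    rw [(pd_eventuallyEq h1 a).eq_of_nhds, pd_of_hasFDerivAt_formOf (hf x hxD)]
  · have h1 : (fun x => χ x * f x) =ᶠ[𝓝 x] fun _ => 0 := by
      filter_upwards [isOpen_potentialRegion.mem_nhds hxD,
        (isOpen_lt (by fun_prop : Continuous fun x : M => x 0) hc1.neg).mem_nhds h] with y y1 y2
      have y3 := hpos y y1
      rw [show χ y = 0 from Real.smoothTransition.zero_of_nonpos ?_, zero_mul]
      refine div_nonpos_of_nonpos_of_nonneg ?_ (by positivity)
      have y4 : y 0 < -(δ * ‖spatial y‖) := y2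
      have : y 0 / ‖spatial y‖ ≤ -δ := (div_le_iff₀ y3).2 (by linarith)
      linarith
    rw [(pd_eventuallyEq h1 a).eq_of_nhds]
    simp [pd]

/-! ### A localized potential of a homogeneous current -/

/-- Potentials in the directions of the current, whose current agrees with `v` at large distances
and which are homogeneous and orthogonal to the radius there. -/
structure LocalPotential (δ r : ℝ) (v A : Fin 4 → M → ℝ) : Prop where
  smooth : ∀ a, ContDiff ℝ ∞ (A a)
  supp : ∀ a x, δ * ‖spatial x‖ < |x 0| → A a x = 0
  near : ∀ a x, ‖x‖ < 1 → A a x = 0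
  orth : ∀ x, ∑ a, lower x a * A a x = 0
  euler : ∀ a x, r < ‖x‖ → eul 1 (A a) x = 0
  far : ∀ a x, r < ‖x‖ → maxwell A a x = sphereArea * v a x

theorem norm_le_abs_add (x : M) : ‖x‖ ≤ |x 0| + ‖spatial x‖ := by
  refine abs_le_of_sq_le_sq' ?_ (by positivity) |>.2
  rw [EuclideanSpace.real_norm_sq_eq, Fin.sum_univ_four]
  have h1 := spatial_norm_sq x
  nlinarith [sq_abs (x 0), mul_nonneg (abs_nonneg (x 0)) (norm_nonneg (spatial x))]

theorem mem_potentialRegion {δ : ℝ} (hδ' : δ < 1) {x : M} (h : |x 0| ≤ δ * ‖spatial x‖)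
    (hx : 24 / (1 - δ) < ‖x‖) : x ∈ potentialRegion := by
  have h1 := norm_le_abs_add x
  rw [div_lt_iff₀ (by linarith)] at hx
  have h0 := norm_nonneg (spatial x)
  have h2 : ‖x‖ * (1 - δ) ≤ 2 * ‖spatial x‖ * (1 - δ) :=
    mul_le_mul_of_nonneg_right (by nlinarith) (by linarith)
  change |x 0| + 12 < ‖spatial x‖
  linarith

theorem HomCurrent.exists_localPotential {δ : ℝ} (hδ : 0 < δ) (hδ' : δ < 1)
    {v : Fin 4 → M → ℝ} (hv : HomCurrent δ v)
    (ht : ∀ x, x ≠ 0 → ∑ a, lower x a * v a x = 0)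
    (hb : ∀ i j x, x ∈ farRegion → boostCurl (fun a => radField fun z => farCut z * v a z) i j x = 0) :
    ∃ r A, LocalPotential δ r v A := by
  obtain ⟨ψ, hψ, hψe, hψp, hψn⟩ := exists_interpolation hδ (hv.contDiff_radForm hδ hδ')
    (fun x hx a b => hv.pd_radForm_comm hδ hδ' ht hb hx a b)
    fun x hx => hv.sum_coord_radForm hδ hδ' ht hx
  set D := potentialRegion with hD
  have hDo : IsOpen D := isOpen_potentialRegion
  set P : Fin 4 → M → ℝ := fun a => conePot 1 fun z => farCut z * v a z with hP
  have hPs : ∀ a, ContDiff ℝ ∞ (P a) := fun a =>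
    (hv.regionSmooth hδ hδ' a).contDiff_conePot (by simp)
  set r : ℝ := 50 / (1 - δ) with hr
  have hd : 0 < 1 - δ := by linarith
  have hr24 : 24 / (1 - δ) < r / 2 := by
    rw [hr, div_div, div_lt_div_iff₀ hd (by linarith)]
    linarith
  have hr1 : 1 < 24 / (1 - δ) := by
    rw [lt_div_iff₀ hd]
    linarith
  have hr0 : 0 < r := by linarith
  let A : Fin 4 → M → ℝ := fun a => D.indicator fun x =>
    farCut (r⁻¹ • x) * (P a x - metricSign a * pd a ψ x)
  let Z : Set M := {x | δ * ‖spatial x‖ < |x 0|} ∪ {x | ‖x‖ < r / 2}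
  have hZ1 : IsOpen {x : M | δ * ‖spatial x‖ < |x 0|} :=
    isOpen_lt (continuous_const.mul continuous_spatial.norm) (by fun_prop)
  have hZo : IsOpen Z := hZ1.union (isOpen_lt continuous_norm continuous_const)
  have hn : ∀ x : M, ‖r⁻¹ • x‖ = ‖x‖ / r := fun x => by
    rw [norm_smul, norm_inv, Real.norm_eq_abs, abs_of_pos hr0, inv_mul_eq_div]
  have hA1 : ∀ a x, δ * ‖spatial x‖ < |x 0| → A a x = 0 := by
    intro a x hx
    by_cases hxD : x ∈ D
    · have hm : metricSign a * metricSign a = 1 := by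
        refine Fin.cases (by simp) (fun i => by simp) a
      simp only [A, indicator_of_mem hxD]
      rcases lt_abs.1 hx with h | h
      · rw [hψp x hxD h, radForm, radField, ← mul_assoc, hm, one_mul, hP, sub_sub_cancel]
        have h0 : conePot (-1) (fun z => farCut z * v a z) x = 0 :=
          hv.coneInt_eq_zero hδ' (by simp) (by linarith) hδ _ a
        rw [h0, mul_zero]
      · have h0 : P a x = 0 := hv.coneInt_eq_zero hδ' (by simp) (by linarith) hδ _ a
        rw [hψn x hxD (by linarith), h0]
        simp
    · exact indicator_of_notMem hxD _
  have hA2 : ∀ a x, ‖x‖ < r / 2 → A a x = 0 := by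
    intro a x hx
    have h0 : farCut (r⁻¹ • x) = 0 := farCut_eq_zero (by
      rw [hn, div_le_iff₀ hr0]
      linarith)
    by_cases hxD : x ∈ D
    · simp only [A, indicator_of_mem hxD, h0, zero_mul]
    · exact indicator_of_notMem hxD _
  have hcov : ∀ x, x ∈ D ∨ x ∈ Z := by
    intro x
    by_cases h1 : δ * ‖spatial x‖ < |x 0|
    · exact Or.inr (Or.inl h1)
    by_cases h2 : ‖x‖ < r / 2
    · exact Or.inr (Or.inr h2)
    exact Or.inl (mem_potentialRegion hδ' (not_lt.1 h1) (by linarith))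
  have hpdψ : ∀ a, ContDiffOn ℝ ∞ (pd a ψ) D := fun a =>
    (hψ.fderiv_of_isOpen hDo (by simp)).clm_apply contDiffOn_const
  have hAs : ∀ a, ContDiff ℝ ∞ (A a) := by
    intro a
    refine contDiff_of_union hDo hZo hcov ?_ fun x hx => hx.elim (hA1 a x) (hA2 a x)
    refine ContDiffOn.congr (((contDiff_farCut.comp (by fun_prop : ContDiff ℝ ∞ fun x : M => r⁻¹ • x)).contDiffOn).mul
      ((hPs a).contDiffOn.sub ((contDiffOn_const (c := metricSign a)).mul (hpdψ a)))) fun x hx => ?_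
    exact indicator_of_mem hx _
  have hloc : ∀ x ∈ D, r < ‖x‖ → ∃ φ : M → ℝ, ContDiff ℝ ∞ φ ∧ φ =ᶠ[𝓝 x] ψ ∧
      ∀ a, A a =ᶠ[𝓝 x] fun x => P a x - metricSign a * pd a φ x := by
    intro x hxD hxr
    obtain ⟨φ, hφ, he⟩ := exists_contDiff_eventuallyEq hDo hψ hxD
    refine ⟨φ, hφ, he, fun a => ?_⟩
    filter_upwards [hDo.mem_nhds hxD, (isOpen_lt continuous_const continuous_norm).mem_nhds hxr,
      pd_eventuallyEq he a] with y y1 y2 y3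
    have y4 : r < ‖y‖ := y2
    simp only [A, indicator_of_mem y1]
    rw [farCut_eq_one (by rw [hn, le_div_iff₀ hr0]; linarith), one_mul, y3]
  have hZ0 : ∀ a x, δ * ‖spatial x‖ < |x 0| → A a =ᶠ[𝓝 x] fun _ => 0 := fun a x hx => by
    filter_upwards [hZ1.mem_nhds hx] with y hy using hA1 a y hy
  refine ⟨r, A, ⟨hAs, hA1, fun a x hx => hA2 a x (by linarith), fun x => ?_, fun a x hx => ?_,
    fun a x hx => ?_⟩⟩
  · by_cases hxD : x ∈ D
    · have h1 := hv.sum_lower_conePot hδ hδ' ht (by simp)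
        (mem_farRegion_imp (σ := 1) (by simp) (potentialRegion_subset hxD))
      have h2 := hψe x hxD
      rw [fderiv_eq_sum_pd] at h2
      have h3 : ∀ a, lower x a * A a x = farCut (r⁻¹ • x) * (lower x a * P a x
          - x a * pd a ψ x) := by
        intro a
        have hm : metricSign a * metricSign a = 1 := by
          refine Fin.cases (by simp) (fun i => by simp) a
        simp only [A, indicator_of_mem hxD, lower_eq_metricSign]
        linear_combination -(farCut (r⁻¹ • x) * x a * pd a ψ x) * hm
      simp only [h3]
      rw [← Finset.mul_sum, Finset.sum_sub_distrib, h2, h1, sub_zero, mul_zero]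
    · have h1 : ∀ a, A a x = 0 := fun a => indicator_of_notMem hxD _
      simp [h1]
  · by_cases h1 : δ * ‖spatial x‖ < |x 0|
    · have h2 := hZ0 a x h1
      rw [eul, h2.fderiv_eq, h2.eq_of_nhds]
      simp
    · have hxD : x ∈ D := mem_potentialRegion hδ' (not_lt.1 h1) (by linarith)
      obtain ⟨φ, hφ, he, hAe⟩ := hloc x hxD hx
      have h2 : (eul 0 φ) =ᶠ[𝓝 x] fun _ => 0 := by
        filter_upwards [he.fderiv (𝕜 := ℝ), hDo.mem_nhds hxD] with y y1 y2
        rw [eul, y1, hψe y y2]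
        simp
      have h3 : eul 1 (pd a φ) x = 0 := by
        have h4 := congrFun (pd_eul hφ 0 a) x
        rw [zero_add] at h4
        rw [← h4, (pd_eventuallyEq h2 a).eq_of_nhds]
        simp [pd]
      have h5 := hv.eul_conePot_eq_zero hδ hδ' (by simp)
        (mem_farRegion_imp (σ := 1) (by simp) (potentialRegion_subset hxD)) a
      have h6 := congrFun (eul_sub (hPs a) (contDiff_const.mul (contDiff_pd hφ a)) 1
        (g := fun x => metricSign a * pd a φ x)) x
      rw [eul_const_mul (contDiff_pd hφ a), h3, mul_zero, sub_zero] at h6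
      rw [eul, (hAe a).fderiv_eq, (hAe a).eq_of_nhds]
      exact h6.trans h5
  · by_cases h1 : δ * ‖spatial x‖ < |x 0|
    · rw [(maxwell_eq_zero (fun a => hZ0 a x h1) a).eq_of_nhds,
        hv.supp a x (norm_pos_iff.1 (hr0.trans hx)) h1, mul_zero]
    · have hxD : x ∈ D := mem_potentialRegion hδ' (not_lt.1 h1) (by linarith)
      obtain ⟨φ, hφ, he, hAe⟩ := hloc x hxD hx
      have h2 : ∀ b, ContDiff ℝ ∞ fun x => metricSign b * pd b φ x := fun b =>
        contDiff_const.mul (contDiff_pd hφ b)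
      rw [(maxwell_congr hAe a).eq_of_nhds, maxwell_sub hPs h2, maxwell_gradient hφ, sub_zero]
      have h3 : dvg P =ᶠ[𝓝 x] fun _ => 0 := by
        filter_upwards [hDo.mem_nhds hxD] with y hy
        have h4 := hv.sum_pd_conePot hδ hδ' (by simp)
          (mem_farRegion_imp (σ := 1) (by simp) (potentialRegion_subset hy)) _ coneWeight_inv
        rw [dvg, ← h4]
        exact Finset.sum_congr rfl fun b _ =>
          congrFun ((hv.regionSmooth hδ hδ' b).pd_conePot (by simp) b) y
      rw [maxwell, (pd_eventuallyEq h3 a).eq_of_nhds, hv.box_conePot hδ hδ' (by simp),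
        farCut_eq_one (by linarith)]
      simp [pd]

/-! ### The modified current -/

theorem IsTestField.add_of_hasCompactSupport {κ : ℝ} {φ ψ : M → M} (h : IsTestField κ φ)
    (hψ : ContDiff ℝ ∞ ψ) (hc : HasCompactSupport ψ) : IsTestField κ fun x => φ x + ψ x := by
  refine ⟨h.1.add hψ, fun n => ?_⟩
  obtain ⟨C, hC⟩ := h.2 n
  have hcont : Continuous fun x : M => (1 + ‖x‖) ^ (κ + n) * ‖iteratedFDeriv ℝ n ψ x‖ :=
    ((continuous_const.add continuous_norm).rpow_const fun x =>
      Or.inl (by linarith [norm_nonneg x] : (0 : ℝ) < 1 + ‖x‖).ne').mul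
      ((hψ.continuous_iteratedFDeriv (by exact_mod_cast le_top)).norm)
  obtain ⟨C', hC'⟩ := ((hc.iteratedFDeriv (𝕜 := ℝ) n).norm.mul_left
    (f := fun x : M => (1 + ‖x‖) ^ (κ + n))).exists_bound_of_continuous hcont
  refine ⟨C + C', fun x => ?_⟩
  have e1 : iteratedFDeriv ℝ n (fun x => φ x + ψ x) x
      = iteratedFDeriv ℝ n φ x + iteratedFDeriv ℝ n ψ x :=
    iteratedFDeriv_add_apply (h.1.of_le (by exact_mod_cast le_top)).contDiffAt
      (hψ.of_le (by exact_mod_cast le_top)).contDiffAt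
  have h0 : 0 ≤ (1 + ‖x‖) ^ (κ + n) := Real.rpow_nonneg (by linarith [norm_nonneg x]) _
  calc _ ≤ (1 + ‖x‖) ^ (κ + n) * (‖iteratedFDeriv ℝ n φ x‖ + ‖iteratedFDeriv ℝ n ψ x‖) := by
        rw [e1]
        exact mul_le_mul_of_nonneg_left (norm_add_le _ _) h0
    _ ≤ C + C' := by
        rw [mul_add]
        exact add_le_add (hC x) ((le_abs_self _).trans (hC' x))

/-- The current `J` with its tangential asymptote compensated by the potential `A`. -/
def compensate (J : M → M) (A : Fin 4 → M → ℝ) (x : M) : M :=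
  WithLp.toLp 2 fun a => J x a - sphereArea⁻¹ * maxwell A a x

@[simp] theorem compensate_apply (J : M → M) (A : Fin 4 → M → ℝ) (x : M) (a : Fin 4) :
    compensate J A x a = J x a - sphereArea⁻¹ * maxwell A a x := rfl

section

variable {J : M → M} {A : Fin 4 → M → ℝ}

theorem contDiff_compensate (hJ : ContDiff ℝ ∞ J) (hA : ∀ a, ContDiff ℝ ∞ (A a)) :
    ContDiff ℝ ∞ (compensate J A) := contDiff_euclidean.2 fun a =>
  (contDiff_component hJ a).sub (contDiff_const.mul (contDiff_maxwell hA a))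

theorem eulComp_compensate (hJ : ContDiff ℝ ∞ J) (hA : ∀ a, ContDiff ℝ ∞ (A a)) (a : Fin 4)
    (x : M) : eulComp (compensate J A) a x
      = eulComp J a x - sphereArea⁻¹ * maxwell (fun a => eul 1 (A a)) a x := by
  have h := congrFun (eul_sub (contDiff_component hJ a)
    (contDiff_const.mul (contDiff_maxwell hA a)) 3
    (g := fun x => sphereArea⁻¹ * maxwell A a x)) x
  rw [eul_const_mul (contDiff_maxwell hA a), eul_maxwell hA] at h
  exact h

theorem isConserved_compensate (hJ : ContDiff ℝ ∞ J) (hA : ∀ a, ContDiff ℝ ∞ (A a))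
    (hc : IsConserved J) : IsConserved (compensate J A) := by
  intro x
  have hs := contDiff_compensate hJ hA
  have h1 : ∀ a, fderiv ℝ (compensate J A) x (EuclideanSpace.single a 1) a
      = pd a (fun x => J x a) x - sphereArea⁻¹ * pd a (maxwell A a) x := by
    intro a
    have h1 : HasFDerivAt (fun x => compensate J A x a) ((EuclideanSpace.proj a : M →L[ℝ] ℝ).comp
      (fderiv ℝ (compensate J A) x)) x := (EuclideanSpace.proj a : M →L[ℝ] ℝ).hasFDerivAt.comp x
        ((hs.differentiable (by simp)) x).hasFDerivAt
    have h2 := congrFun (pd_sub (contDiff_component hJ a)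
      (contDiff_const.mul (contDiff_maxwell hA a)) a
      (g := fun x => sphereArea⁻¹ * maxwell A a x)) x
    rw [pd_const_mul (contDiff_maxwell hA a)] at h2
    refine Eq.trans ?_ h2
    change _ = fderiv ℝ (fun x => compensate J A x a) x (EuclideanSpace.single a 1)
    rw [h1.fderiv]
    rfl
  simp only [h1, Finset.sum_sub_distrib, ← Finset.mul_sum, hc.sum_pd hJ]
  rw [show ∑ a, pd a (maxwell A a) x = 0 from dvg_maxwell hA x]
  simp

namespace LocalPotential

variable {γ δ r ε : ℝ} {v : Fin 4 → M → ℝ}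

theorem eventually_zero (h : LocalPotential δ r v A) {x : M} (hx : δ * ‖spatial x‖ < |x 0|)
    (a : Fin 4) : A a =ᶠ[𝓝 x] fun _ => 0 := by
  filter_upwards [(isOpen_lt (continuous_const.mul continuous_spatial.norm)
    (by fun_prop : Continuous fun x : M => |x 0|)).mem_nhds hx] with y hy using h.supp a y hy

protected theorem contDiff_eul (h : LocalPotential δ r v A) (a : Fin 4) : ContDiff ℝ ∞ (eul 1 (A a)) :=
  contDiff_eul (h.smooth a) 1

theorem maxwell_eul_eq_zero (h : LocalPotential δ r v A) (a : Fin 4) {x : M} (hx : r < ‖x‖) :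
    maxwell (fun a => eul 1 (A a)) a x = 0 := by
  refine (maxwell_eq_zero (fun b => ?_) a).eq_of_nhds
  filter_upwards [(isOpen_lt continuous_const continuous_norm).mem_nhds hx] with y hy
    using h.euler b y hy

theorem isHomTestField (h : LocalPotential δ r v A) (hγ : 0 < γ)
    (hJ : IsHomTestField 3 ε (region γ δ) J) :
    IsHomTestField 3 ε (region γ δ) (compensate J A) := by
  refine ⟨contDiff_compensate hJ.1 h.smooth, fun x hx => ?_, ?_⟩
  · by_contra hr
    have h1 : γ + δ * ‖spatial x‖ < |x 0| := not_le.1 hr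
    refine hx ?_
    ext a
    have h2 : J x = 0 := by
      by_contra h3
      exact hr (hJ.2.1 h3)
    rw [compensate_apply, h2, (maxwell_eq_zero (h.eventually_zero (by linarith)) a).eq_of_nhds]
    simp
  · let H : M → M := fun x => WithLp.toLp 2 fun a =>
      -sphereArea⁻¹ * maxwell (fun a => eul 1 (A a)) a x
    have hH : ContDiff ℝ ∞ H := contDiff_euclidean.2 fun a =>
      contDiff_const.mul (contDiff_maxwell h.contDiff_eul a)
    have hHc : HasCompactSupport H := by
      refine HasCompactSupport.intro (isCompact_closedBall (0 : M) r) fun x hx => ?_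
      ext a
      change -sphereArea⁻¹ * maxwell (fun a => eul 1 (A a)) a x = 0
      rw [h.maxwell_eul_eq_zero a (by simpa using hx), mul_zero]
    have h1 := hJ.2.2.add_of_hasCompactSupport hH hHc
    refine (congrArg (IsTestField (3 + ε)) (funext fun x => ?_)).mpr h1
    ext a
    rw [dilation_component (contDiff_compensate hJ.1 h.smooth), PiLp.add_apply,
      dilation_component hJ.1]
    have h2 := eulComp_compensate hJ.1 h.smooth a x
    simp only [eulComp] at h2
    rw [h2, sub_eq_add_neg, ← neg_mul]

theorem hasAsymptote (h : LocalPotential δ r v A) (hε : 0 < ε) {u : Fin 4 → M → ℝ}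
    (hJ : ∀ a, AsymHom 3 ε fun x => J x a) (hu : ∀ a, u a = asym 3 fun x => J x a)
    (hv : v = tangentialPart u)
    (hvh : ∀ a (R : ℝ) x, 0 < R → x ≠ 0 → v a (R • x) = R ^ (-3 : ℝ) * v a x) :
    HasAsymptote 3 (compensate J A) fun x => radialPart u x • x := by
  intro x hx
  refine tendsto_M fun a => ?_
  have h1 := ((hJ a).tendsto hε hx).sub_const (v a x)
  have h2 : asym 3 (fun x => J x a) x - v a x = radialPart u x * x a := by
    rw [← hu, hv, tangentialPart]
    ring
  rw [h2] at h1
  refine h1.congr' ?_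
  have hx0 : 0 < ‖x‖ := norm_pos_iff.2 hx
  filter_upwards [eventually_gt_atTop 0, eventually_gt_atTop (r / ‖x‖)] with R hR hR'
  have h3 : r < ‖R • x‖ := by
    rw [norm_smul, Real.norm_eq_abs, abs_of_pos hR]
    exact (div_lt_iff₀ hx0).1 hR'
  have h4 : sphereArea ≠ 0 := sphereArea_pos.ne'
  rw [PiLp.smul_apply, compensate_apply, h.far a _ h3, hvh a R x hR hx, smul_eq_mul,
    inv_mul_cancel_left₀ h4, mul_sub, ← mul_assoc (R ^ (3 : ℝ)), ← Real.rpow_add hR]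
  norm_num

end LocalPotential

end

/-! ### The profile of the modified current -/

theorem nullInt_pd {κ : ℝ} (hκ : 2 < κ) {f : M → ℝ} (hf : Decays κ f) (s : ℝ) (x : E3)
    (a : Fin 4) : nullInt (pd a f) s x = conormal x a * nullInt (pd 0 f) s x := by
  refine Fin.cases ?_ (fun i => ?_) a
  · rw [conormal_zero, one_mul]
  · rw [nullInt_pd_succ hκ hf, conormal_succ, neg_mul]

theorem nullInt_finsetSum {ι : Type*} (t : Finset ι) {κ : ℝ} (hκ : 3 < κ) {f : ι → M → ℝ}
    (hf : ∀ i ∈ t, Decays κ (f i)) (s : ℝ) (x : E3) :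
    nullInt (fun z => ∑ i ∈ t, f i z) s x = ∑ i ∈ t, nullInt (f i) s x := by
  simp only [nullInt]
  rw [integral_finsetSum _ fun i hi => (hf i hi).integrable_planePt hκ s x, Finset.mul_sum]

theorem sum_metricSign_mul_conormal_sq {x : E3} (hx : x ≠ 0) :
    ∑ a, metricSign a * (conormal x a * conormal x a) = 0 := by
  have h1 := EuclideanSpace.real_norm_sq_eq x
  have h0 : ‖x‖ ≠ 0 := norm_ne_zero_iff.2 hx
  rw [Fin.sum_univ_succ]
  simp only [metricSign_zero, metricSign_succ, conormal_zero, conormal_succ]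
  rw [Fin.sum_univ_three] at *
  field_simp
  linear_combination h1

theorem hasCompactSupport_pd {f : M → ℝ} (hc : HasCompactSupport f) (a : Fin 4) :
    HasCompactSupport (pd a f) := hc.fderiv_apply ℝ _

theorem hasCompactSupport_dvg {B : Fin 4 → M → ℝ} (hc : ∀ a, HasCompactSupport (B a)) :
    HasCompactSupport (dvg B) := by
  have h : dvg B = fun x => pd 0 (B 0) x + (pd 1 (B 1) x + (pd 2 (B 2) x + pd 3 (B 3) x)) := by
    funext x
    rw [dvg, Fin.sum_univ_four]
    ring
  have hp := fun a => hasCompactSupport_pd (hc a) a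
  rw [h]
  exact (hp 0).add ((hp 1).add ((hp 2).add (hp 3)))

theorem nullInt_maxwell {B : Fin 4 → M → ℝ} (hB : ∀ a, ContDiff ℝ ∞ (B a))
    (hc : ∀ a, HasCompactSupport (B a)) (a : Fin 4) (s : ℝ) {x : E3} (hx : x ≠ 0) :
    nullInt (maxwell B a) s x
      = -(metricSign a * conormal x a) * nullInt (pd 0 (dvg B)) s x := by
  have hD : ∀ a, Decays 4 (B a) := fun a => Decays.of_hasCompactSupport (hB a) (hc a)
  have hdv : Decays 4 (dvg B) :=
    Decays.of_hasCompactSupport (contDiff_dvg hB) (hasCompactSupport_dvg hc)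
  have h2 : ∀ b, Decays 6 (pd b (pd b (B a))) := fun b => by
    have := ((hD a).pd b).pd b
    norm_num at this
    exact this
  have hbox : box (B a) = fun x => ∑ b, metricSign b * pd b (pd b (B a)) x :=
    funext (box_eq_sum (B a))
  have h3 : Decays 6 (fun x => ∑ b, metricSign b * pd b (pd b (B a)) x) := by
    rw [← hbox]
    refine Decays.of_hasCompactSupport (contDiff_box (hB a)) ?_
    have h4 := hasCompactSupport_dvg
      (B := fun b x => metricSign b * pd b (B a) x) fun b => (hasCompactSupport_pd (hc a) b).mul_left
    have h5 : dvg (fun b x => metricSign b * pd b (B a) x) = box (B a) := by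
      funext y
      rw [box_eq_sum]
      exact Finset.sum_congr rfl fun b _ => by rw [pd_const_mul (contDiff_pd (hB a) b)]
    rwa [h5] at h4
  have h4 : Decays 6 fun x => metricSign a * pd a (dvg B) x :=
    Decays.of_hasCompactSupport (contDiff_const.mul (contDiff_pd (contDiff_dvg hB) a))
      (hasCompactSupport_pd (hasCompactSupport_dvg hc) a).mul_left
  have e1 : nullInt (maxwell B a) s x = nullInt (fun x => ∑ b, metricSign b * pd b (pd b (B a)) x) s x
      - nullInt (fun x => metricSign a * pd a (dvg B) x) s x := by
    rw [← nullInt_sub (by norm_num) h3 h4]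
    simp only [← box_eq_sum]
    rfl
  have e2 : ∀ b, nullInt (fun x => metricSign b * pd b (pd b (B a)) x) s x
      = metricSign b * (conormal x b * conormal x b) * nullInt (pd 0 (pd 0 (B a))) s x := by
    intro b
    rw [nullInt_const_mul, nullInt_pd (by norm_num) ((hD a).pd b), pd_comm (hB a) 0 b,
      nullInt_pd (by norm_num) ((hD a).pd 0)]
    ring
  rw [e1, nullInt_finsetSum _ (by norm_num : (3 : ℝ) < 6) fun b _ => (h2 b).const_mul _,
    nullInt_const_mul, nullInt_pd (by norm_num) hdv]
  simp only [e2]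
  rw [← Finset.sum_mul, sum_metricSign_mul_conormal_sq hx]
  ring

theorem profInt_eq_of_nullInt {ε : ℝ} (hε : 0 < ε) {f g h : M → ℝ} (hf : NullVanishing ε f)
    (hg : NullVanishing ε g) (hh : NullVanishing ε h) {x : E3} (hx : x ≠ 0) {c : ℝ}
    (he : ∀ s, nullInt f s x = nullInt g s x + c * nullInt h s x) (s : ℝ) :
    profInt f s x = profInt g s x + c * profInt h s x := by
  have e1 : (fun τ => nullQuot f τ x) =ᵐ[volume] fun τ => nullQuot g τ x + c * nullQuot h τ x := by
    filter_upwards [ae_ne 0] with τ hτ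
    rw [hf.nullQuot_eq hε hτ hx, hg.nullQuot_eq hε hτ hx, hh.nullQuot_eq hε hτ hx, he]
    ring
  have e2 := tailInt_eq_of_nullInt hε hf hg hh hx (b := 1) (c := c) fun s => by rw [he, one_mul]
  have e3 : ∫ τ in Iic s, nullQuot f τ x = ∫ τ in Iic s, (nullQuot g τ x + c * nullQuot h τ x) :=
    integral_congr_ae (ae_restrict_of_ae e1)
  rw [integral_add (hg.integrable_nullQuot hε hx).integrableOn
    ((hh.integrable_nullQuot hε hx).const_mul c).integrableOn, integral_const_mul] at e3
  rw [profInt, profInt, profInt, e2, e3]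
  ring

/-! ### Tails proportional to the direction -/

/-- The function `l ↦ l g(l) / l⁰`. -/
def directional (g : E3 → ℝ) (k : Cone) : M :=
  WithLp.toLp 2 fun a => metricSign a * conormal (spatial k) a * g (spatial k)

theorem metricSign_mul_self (a : Fin 4) : metricSign a * metricSign a = 1 :=
  Fin.cases (by simp) (fun i => by simp) a

theorem coneSmooth_directional {g : E3 → ℝ} (hg : ContDiffOn ℝ ∞ g {x | x ≠ 0}) :
    ConeSmooth (directional g) := by
  refine contDiffOn_euclidean.2 fun a => ?_
  have h1 : ContDiffOn ℝ ∞ (fun x : M => g (spatial x)) coneDomain :=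
    hg.comp (s := coneDomain) (f := spatial) contDiff_spatial.contDiffOn fun p hp => hp
  have h2 : ContDiffOn ℝ ∞ (fun x : M => conormal (spatial x) a) coneDomain := by
    refine Fin.cases ?_ (fun i => ?_) a
    · exact contDiffOn_const
    · simp only [conormal_succ, spatial_apply]
      exact ((contDiff_coord i.succ).contDiffOn.div contDiffOn_norm_spatial
        fun x hx => norm_ne_zero_iff.2 hx).neg
  refine (((contDiffOn_const (c := metricSign a)).mul h2).mul h1).congr fun x hx => ?_
  rw [coneExtend_of_mem _ hx]
  simp [directional, Cone.ofSpace]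

theorem inner_spatial_single (l : Cone) (b : Fin 4) :
    inner ℝ (spatial l) (spatial (EuclideanSpace.single b 1))
      = -lower l b + (l : M) 0 * if b = 0 then 1 else 0 := by
  rw [PiLp.inner_apply]
  refine Fin.cases ?_ (fun i => ?_) b
  · simp
  · simp

theorem isCurlFree_directional {g : E3 → ℝ} (hg : ContDiffOn ℝ ∞ g {x | x ≠ 0}) :
    IsCurlFree (directional g) := by
  intro a b c l
  have hx := l.spatial_ne_zero
  have h0 : ‖spatial l‖ ≠ 0 := norm_ne_zero_iff.2 hx
  let q : Fin 4 → E3 → ℝ := Fin.cons (fun z => ‖z‖) fun i z => -z i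
  let Q : Fin 4 → E3 →L[ℝ] ℝ := Fin.cons (‖spatial l‖⁻¹ • innerSL ℝ (spatial l))
    fun i => -(EuclideanSpace.proj i : E3 →L[ℝ] ℝ)
  have hq : ∀ c, HasFDerivAt (q c) (Q c) (spatial l) := by
    intro c
    refine Fin.cases ?_ (fun i => ?_) c
    · exact hasFDerivAt_norm_E3 hx
    · exact (EuclideanSpace.proj i : E3 →L[ℝ] ℝ).hasFDerivAt.neg
  have hql : ∀ c, q c (spatial l) = lower l c := by
    intro c
    refine Fin.cases ?_ (fun i => ?_) c
    · change ‖spatial l‖ = _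
      rw [l.norm_spatial, lower_zero]
    · change -(spatial l i) = _
      rw [spatial_apply, lower_succ]
  let ψ : E3 → ℝ := fun z => g z / ‖z‖
  have hψ : HasFDerivAt ψ (fderiv ℝ ψ (spatial l)) (spatial l) := by
    have h1 : ContDiffAt ℝ ∞ g (spatial l) := hg.contDiffAt (isOpen_ne.mem_nhds hx)
    exact ((h1.div (contDiffAt_norm ℝ hx) h0).differentiableAt (by simp)).hasFDerivAt
  have hlow : ∀ c, (fun k : Cone => lower (directional g k) c)
      = fun k : Cone => (fun z => q c z * ψ z) (spatial k) := by
    intro c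
    funext k
    have h1 : ‖spatial k‖ ≠ 0 := norm_ne_zero_iff.2 k.spatial_ne_zero
    have h2 : q c (spatial k) = ‖spatial k‖ * conormal (spatial k) c := by
      refine Fin.cases ?_ (fun i => ?_) c
      · exact (mul_one _).symm
      · change -(spatial k i) = _
        rw [conormal_succ]
        field_simp
    have h3 := metricSign_mul_self c
    rw [lower_eq_metricSign]
    change metricSign c * (metricSign c * conormal (spatial k) c * g (spatial k)) = q c _ * ψ _
    simp only [ψ, h2]
    field_simp
    linear_combination conormal (spatial k) c * g (spatial k) * h3
  set η : Fin 4 → Fin 4 → ℝ := fun a b => if a = b then metricSign a else 0 with hη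
  have hηs : ∀ a b, η a b = η b a := by
    intro a b
    simp only [hη]
    by_cases h : a = b
    · rw [h]
    · rw [if_neg h, if_neg (Ne.symm h)]
  set w : Fin 4 → E3 := fun b => spatial (EuclideanSpace.single b 1) with hw
  have hwab : ∀ a b, spatial (lower l a • EuclideanSpace.single b 1
      - lower l b • EuclideanSpace.single a 1) = lower l a • w b - lower l b • w a := by
    intro a b
    rw [spatial_sub, spatial_smul, spatial_smul]
  have hQ : ∀ a b c, Q c (lower l a • w b - lower l b • w a)
      = lower l a * η b c - lower l b * η a c := by
    intro a b c
    refine Fin.cases ?_ (fun i => ?_) c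
    · change ‖spatial l‖⁻¹ * inner ℝ (spatial l) (lower l a • w b - lower l b • w a) = _
      rw [inner_sub_right, inner_smul_right, inner_smul_right, inner_spatial_single,
        inner_spatial_single, ← l.norm_spatial]
      have e : ∀ b : Fin 4, η b 0 = if b = 0 then 1 else 0 := fun b => by
        by_cases h : b = 0 <;> simp [hη, h]
      rw [e, e]
      field_simp
      ring
    · change -(lower l a * w b i - lower l b * w a i) = _
      have e : ∀ b : Fin 4, η b i.succ = -w b i := fun b => by
        by_cases h : b = i.succ
        · simp [hη, hw, h]
        · simp [hη, hw, h, Ne.symm h]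
      rw [e, e]
      ring
  have key : ∀ a b c, coneDeriv a b (fun k => lower (directional g k) c) l
      = lower l c * (lower l a * fderiv ℝ ψ (spatial l) (w b)
        - lower l b * fderiv ℝ ψ (spatial l) (w a))
        + ψ (spatial l) * (lower l a * η b c - lower l b * η a c) := by
    intro a b c
    have h1 : HasFDerivAt (fun z => q c z * ψ z) _ (spatial l) := (hq c).mul hψ
    rw [hlow, coneDeriv_comp_spatial h1, hwab, _root_.add_apply, _root_.smul_apply,
      _root_.smul_apply, hQ, hql, map_sub, map_smul, map_smul]
    simp only [smul_eq_mul]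
  rw [key, key, key, hηs b c, hηs a c, hηs b a]
  ring

/-! ### The mean value of the tail of a localized source -/

section

variable {δ : ℝ} {φ : M → ℝ}

theorem integrable_weight_mul {W : ℝ × E3 → ℝ} (hW : Measurable W) {k : ℝ × E3 → M}
    (hk : Continuous k) {ρ C : ℝ} (hφ : ContDiff ℝ ∞ φ)
    (hρ : ∀ p, φ (k p) ≠ 0 → ‖p‖ ≤ ρ) (hC : ∀ p, φ (k p) ≠ 0 → |W p| ≤ C) :
    Integrable (fun p => W p * φ (k p)) ((volume : Measure ℝ).prod (volume : Measure E3)) := by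
  have hc : Continuous fun p => φ (k p) := hφ.continuous.comp hk
  have hcs : HasCompactSupport fun p => φ (k p) := by
    refine HasCompactSupport.intro (isCompact_closedBall (0 : ℝ × E3) ρ) fun p hp => ?_
    by_contra h
    exact hp (mem_closedBall_zero_iff.2 (hρ p h))
  refine ((hc.integrable_of_hasCompactSupport hcs).norm.const_mul C).mono'
    (hW.aestronglyMeasurable.mul hc.aestronglyMeasurable) (Eventually.of_forall fun p => ?_)
  rw [norm_mul]
  by_cases h : φ (k p) = 0
  · rw [h]
    simp
  · exact mul_le_mul_of_nonneg_right (hC p h) (norm_nonneg _)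

theorem lower_bounds_of_support (hδ' : δ < 1) (hs : ∀ x, δ * ‖spatial x‖ < |x 0| → φ x = 0)
    (hn : ∀ x, ‖x‖ < 1 → φ x = 0) {σ : ℝ} (hσ : |σ| = 1) {t : ℝ} {y : E3}
    (h : φ (mkVec t y) ≠ 0) : 1 / 2 ≤ ‖y‖ ∧ (1 - δ) / 2 ≤ |t + σ * ‖y‖| := by
  have h1 : |t| ≤ δ * ‖y‖ := by
    by_contra hc
    exact h (hs _ (by rw [spatial_mkVec, mkVec_zero]; exact not_le.1 hc))
  have h2 : 1 ≤ ‖mkVec t y‖ := by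
    by_contra hc
    exact h (hn _ (not_le.1 hc))
  have h3 := norm_le_abs_add (mkVec t y)
  rw [spatial_mkVec, mkVec_zero] at h3
  have h4 := norm_nonneg y
  have h5 : 1 / 2 ≤ ‖y‖ := by nlinarith
  refine ⟨h5, ?_⟩
  have h6 : |σ * ‖y‖| - |t| ≤ |t + σ * ‖y‖| := by
    have := abs_sub_abs_le_abs_sub (σ * ‖y‖) (-t)
    rw [abs_neg, sub_neg_eq_add, add_comm] at this
    exact this
  rw [abs_mul, hσ, one_mul, abs_of_nonneg h4] at h6
  nlinarith

theorem integral_inv_mul_conePot (hδ' : δ < 1) (hφ : ContDiff ℝ ∞ φ) (hc : HasCompactSupport φ)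
    (hs : ∀ x, δ * ‖spatial x‖ < |x 0| → φ x = 0) (hn : ∀ x, ‖x‖ < 1 → φ x = 0) {σ : ℝ}
    (hσ : |σ| = 1) :
    Integrable (fun s : ℝ => s⁻¹ * conePot σ φ (mkVec s 0)) ∧
    Integrable (fun p : ℝ × E3 => (p.1 + σ * ‖p.2‖)⁻¹ * ‖p.2‖⁻¹ * φ (mkVec p.1 p.2)) ∧
    ∫ s : ℝ, s⁻¹ * conePot σ φ (mkVec s 0)
      = ∫ p : ℝ × E3, (p.1 + σ * ‖p.2‖)⁻¹ * ‖p.2‖⁻¹ * φ (mkVec p.1 p.2) := by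
  obtain ⟨ρ, hρ⟩ := hc.isCompact.isBounded.subset_closedBall (0 : M)
  have hsup : ∀ t y, φ (mkVec t y) ≠ 0 → |t| ≤ ρ ∧ ‖y‖ ≤ ρ := by
    intro t y h
    have h1 := hρ (subset_tsupport φ h)
    rw [mem_closedBall_zero_iff] at h1
    exact ⟨(abs_le_norm_mkVec t y).trans h1, (norm_le_norm_mkVec t y).trans h1⟩
  have hb : ∀ t y, φ (mkVec t y) ≠ 0 → |(t + σ * ‖y‖)⁻¹ * ‖y‖⁻¹| ≤ ((1 - δ) / 2)⁻¹ * 2 := by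
    intro t y h
    obtain ⟨h1, h2⟩ := lower_bounds_of_support hδ' hs hn hσ h
    rw [abs_mul, abs_inv, abs_inv, abs_norm]
    refine mul_le_mul (inv_anti₀ (by linarith) h2) ?_ (by positivity)
      (inv_nonneg.2 (by linarith))
    have := inv_anti₀ (by norm_num) h1
    norm_num at this
    exact this
  have hG := integrable_weight_mul (φ := φ) (W := fun p : ℝ × E3 => (p.1 + σ * ‖p.2‖)⁻¹ * ‖p.2‖⁻¹)
    (k := fun p => mkVec p.1 p.2) (by fun_prop) continuous_mkVec (ρ := ρ) hφ
    (fun p h => norm_prod_le_iff.2 (hsup _ _ h)) (fun p h => hb _ _ h)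
  have hH := integrable_weight_mul (φ := φ) (W := fun p : ℝ × E3 => p.1⁻¹ * ‖p.2‖⁻¹)
    (k := fun p => mkVec (p.1 - σ * ‖p.2‖) p.2) (by fun_prop)
    (continuous_mkVec.comp (f := fun p : ℝ × E3 => (p.1 - σ * ‖p.2‖, p.2)) (by fun_prop))
    (ρ := 2 * ρ) hφ (fun p h => by
      obtain ⟨h1, h2⟩ := hsup _ _ h
      have h3 := abs_add_le (p.1 - σ * ‖p.2‖) (σ * ‖p.2‖)
      rw [sub_add_cancel, abs_mul, hσ, one_mul, abs_norm] at h3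
      refine norm_prod_le_iff.2 ⟨?_, ?_⟩
      · rw [Real.norm_eq_abs]
        linarith
      · linarith [norm_nonneg p.2]) (fun p h => by
      have := hb _ _ h
      rwa [sub_add_cancel] at this)
  have hcone : ∀ s : ℝ, s⁻¹ * conePot σ φ (mkVec s 0)
      = ∫ y : E3, s⁻¹ * ‖y‖⁻¹ * φ (mkVec (s - σ * ‖y‖) y) := by
    intro s
    rw [conePot, coneInt, ← integral_neg_eq_self, ← integral_const_mul]
    congr 1
    funext y
    have h1 : mkVec s 0 - coneVec σ (-y) = mkVec (s - σ * ‖y‖) y := by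
      ext a
      refine Fin.cases ?_ (fun i => ?_) a
      · rw [PiLp.sub_apply, coneVec_zero_apply]
        simp
      · rw [PiLp.sub_apply, coneVec_succ]
        simp
    rw [h1, norm_neg, mul_assoc]
  simp only [hcone]
  refine ⟨hH.integral_prod_left, by rwa [Measure.volume_eq_prod], ?_⟩
  rw [Measure.volume_eq_prod, integral_prod_symm _ hG, integral_integral_swap hH]
  congr 1
  funext y
  rw [← integral_add_right_eq_self _ (σ * ‖y‖)]
  simp only [add_sub_cancel_right]

/-- The mean value over the sphere of the tail of `∂₀φ`. -/
theorem integral_sphere_tailInt {ε : ℝ} (hε : 0 < ε) (hδ : 0 < δ) (hδ' : δ < 1)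
    (hφ : ContDiff ℝ ∞ φ) (hc : HasCompactSupport φ)
    (hs : ∀ x, δ * ‖spatial x‖ < |x 0| → φ x = 0) (hn : ∀ x, ‖x‖ < 1 → φ x = 0)
    (hv : NullVanishing ε (pd 0 φ)) :
    ∫ n : S2, tailInt (pd 0 φ) n ∂sphereMeasure
      = sphereArea * ∫ p : ℝ × E3, φ (mkVec p.1 p.2) / mdot (mkVec p.1 p.2) (mkVec p.1 p.2) := by
  have hr : RegionSmooth 0 δ φ := ⟨hδ.le, hδ', hφ, fun x hx => by
    by_contra h
    exact hx (hs x (by linarith))⟩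
  obtain ⟨C, h0, hC⟩ := hv.nullQuot_bound hε
  have hcont : Continuous fun p : S2 × ℝ => nullQuot (pd 0 φ) p.2 p.1 :=
    (contDiffOn_nullQuot hε hv.decays).continuousOn.comp_continuous
      (f := fun p : S2 × ℝ => (p.2, (p.1 : E3))) (by fun_prop) fun p => p.1.ne_zero
  have hint : Integrable (Function.uncurry fun (n : S2) (s : ℝ) => nullQuot (pd 0 φ) s n)
      (sphereMeasure.prod volume) := by
    have h1 : Integrable (fun s : ℝ => C * (1 + ‖s‖) ^ (-(1 + ε))) :=
      (integrable_one_add_norm (E := ℝ) (μ := volume) (r := 1 + ε) (by simpa using hε)).const_mul C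
    refine (h1.comp_snd sphereMeasure).mono' hcont.aestronglyMeasurable
      (Eventually.of_forall fun p => ?_)
    have h2 := hC p.2 p.1 p.1.ne_zero
    rw [p.1.norm, one_pow, one_mul, div_one] at h2
    refine h2.trans (le_of_eq ?_)
    rw [Real.rpow_neg (by positivity), div_eq_mul_inv, Real.norm_eq_abs]
  obtain ⟨i1, g1, e1⟩ := integral_inv_mul_conePot hδ' hφ hc hs hn (σ := 1) (by simp)
  obtain ⟨i2, g2, e2⟩ := integral_inv_mul_conePot hδ' hφ hc hs hn (σ := -1) (by simp)
  have h3 : (fun s : ℝ => ∫ n : S2, nullQuot (pd 0 φ) s n ∂sphereMeasure) =ᵐ[volume]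
      fun s => -(sphereArea / 2) * (s⁻¹ * conePot 1 φ (mkVec s 0)
        - s⁻¹ * conePot (-1) φ (mkVec s 0)) := by
    filter_upwards [ae_ne 0] with s hs0
    have h4 := integral_sphere_nullInt hr (Decays.of_hasCompactSupport hφ hc) (mkVec s 0)
    simp only [mkVec_zero, spatial_mkVec, inner_zero_right, sub_zero] at h4
    have h5 : ∀ n : S2, nullQuot (pd 0 φ) s n = s⁻¹ * nullInt (pd 0 φ) s n := fun n => by
      rw [hv.nullQuot_eq hε hs0 n.ne_zero]
    simp only [h5]
    rw [integral_const_mul, h4, radField]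
    ring
  simp only [tailInt]
  rw [integral_integral_swap hint, integral_congr_ae h3, integral_const_mul, integral_sub i1 i2,
    e1, e2, ← integral_sub g1 g2, ← integral_const_mul, ← integral_const_mul]
  congr 1
  funext p
  by_cases h : φ (mkVec p.1 p.2) = 0
  · rw [h]
    simp
  · obtain ⟨a1, a2⟩ := lower_bounds_of_support hδ' hs hn (σ := 1) (by simp) h
    obtain ⟨-, a3⟩ := lower_bounds_of_support hδ' hs hn (σ := -1) (by simp) h
    have b1 : ‖p.2‖ ≠ 0 := by linarith
    have b2 : p.1 + 1 * ‖p.2‖ ≠ 0 := abs_pos.1 (by linarith)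
    have b3 : p.1 + -1 * ‖p.2‖ ≠ 0 := abs_pos.1 (by linarith)
    have b4 : mdot (mkVec p.1 p.2) (mkVec p.1 p.2)
        = (p.1 + 1 * ‖p.2‖) * (p.1 + -1 * ‖p.2‖) := by
      rw [mdot_self, mkVec_zero, spatial_mkVec]
      ring
    have b5 : (p.1 + 1 * ‖p.2‖) - (p.1 + -1 * ‖p.2‖) = 2 * ‖p.2‖ := by ring
    rw [b4]
    generalize p.1 + 1 * ‖p.2‖ = u at *
    generalize p.1 + -1 * ‖p.2‖ = w at *
    field_simp
    linear_combination sphereArea * b5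

end

/-- A localized divergence of a field orthogonal to the radius has no monopole. -/
theorem integral_dvg_div_mdot {δ : ℝ} (hδ' : δ < 1) {B : Fin 4 → M → ℝ}
    (hB : ∀ a, ContDiff ℝ ∞ (B a)) (hc : ∀ a, HasCompactSupport (B a))
    (hs : ∀ a x, δ * ‖spatial x‖ < |x 0| → B a x = 0) (hn : ∀ a x, ‖x‖ < 1 → B a x = 0)
    (ho : ∀ x, ∑ a, lower x a * B a x = 0) :
    ∫ p : ℝ × E3, dvg B (mkVec p.1 p.2) / mdot (mkVec p.1 p.2) (mkVec p.1 p.2) = 0 := by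
  set Z : Set M := {x | δ * ‖spatial x‖ < |x 0|} ∪ {x | ‖x‖ < 1} with hZ
  have hZo : IsOpen Z := (isOpen_lt (continuous_const.mul continuous_spatial.norm)
    (by fun_prop : Continuous fun x : M => |x 0|)).union (isOpen_lt continuous_norm continuous_const)
  have hDo : IsOpen {x : M | mdot x x ≠ 0} := isOpen_ne.preimage contDiff_mdot_self.continuous
  have hBZ : ∀ a, ∀ x ∈ Z, B a x = 0 := fun a x hx => hx.elim (hs a x) (hn a x)
  have hcov : ∀ x : M, x ∈ {x : M | mdot x x ≠ 0} ∨ x ∈ Z := by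
    intro x
    by_cases hm : mdot x x = 0
    · refine Or.inr ?_
      rw [mdot_self, sub_eq_zero, sq_eq_sq_iff_abs_eq_abs, abs_norm] at hm
      rcases (norm_nonneg (spatial x)).eq_or_lt with h | h
      · refine Or.inr ?_
        have h1 := norm_le_abs_add x
        change ‖x‖ < 1
        linarith
      · refine Or.inl ?_
        change δ * ‖spatial x‖ < |x 0|
        nlinarith
    · exact Or.inl hm
  let G : Fin 4 → M → ℝ := fun a x => B a x * (mdot x x)⁻¹
  have hG : ∀ a, ContDiff ℝ ∞ (G a) := fun a =>
    contDiff_of_union hDo hZo hcov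
      ((hB a).contDiffOn.mul (contDiff_mdot_self.contDiffOn.inv fun x hx => hx))
      fun x hx => by simp only [G, hBZ a x hx, zero_mul]
  have hGc : ∀ a, HasCompactSupport (G a) := fun a => (hc a).mul_right
  have key : ∀ x, dvg B x / mdot x x = ∑ a, pd a (G a) x := by
    intro x
    by_cases hm : mdot x x = 0
    · rw [hm, div_zero]
      refine (Finset.sum_eq_zero fun a _ => ?_).symm
      have hx : x ∈ Z := (hcov x).resolve_left fun h => h hm
      have h1 : G a =ᶠ[𝓝 x] fun _ => 0 := by
        filter_upwards [hZo.mem_nhds hx] with y hy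
        simp only [G, hBZ a y hy, zero_mul]
      rw [(pd_eventuallyEq h1 a).eq_of_nhds]
      simp [pd]
    · have h1 : ∀ a, pd a (G a) x = pd a (B a) x * (mdot x x)⁻¹
          - 2 * (mdot x x ^ 2)⁻¹ * (lower x a * B a x) := by
        intro a
        have h2 := (smooth_diffAt contDiff_mdot_self x).hasFDerivAt
        have h3 : HasFDerivAt (fun y : M => (mdot y y)⁻¹) _ x :=
          HasDerivAt.comp_hasFDerivAt (f := fun y : M => mdot y y) x (hasDerivAt_inv hm) h2
        have h4 : HasFDerivAt (G a) _ x := (smooth_diffAt (hB a) x).hasFDerivAt.mul h3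
        have h5 := pd_mdot_self a x
        rw [pd] at h5
        rw [pd, h4.fderiv, _root_.add_apply, _root_.smul_apply, _root_.smul_apply,
          _root_.smul_apply, h5, pd]
        simp only [smul_eq_mul]
        ring
      simp only [h1]
      rw [Finset.sum_sub_distrib, ← Finset.sum_mul, ← Finset.mul_sum, ho, mul_zero, sub_zero,
        div_eq_mul_inv]
      rfl
  simp only [key]
  rw [integral_finsetSum]
  · exact Finset.sum_eq_zero fun a _ => integral_pd_eq_zero (hG a) (hGc a) a
  · exact fun a _ => ((contDiff_pd (hG a) a).continuous.comp continuous_mkVec)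
      |>.integrable_of_hasCompactSupport (hasCompactSupport_comp_mkVec (hasCompactSupport_pd (hGc a) a))

/-! ### Comparison of the two profiles -/

theorem mdot_directional_div (g : E3 → ℝ) (l : Cone) :
    (fun n : S2 => mdot l (directional g (Cone.ofSphere n)) / mdot l (Cone.ofSphere n : M))
      =ᵐ[sphereMeasure] fun n => g n := by
  filter_upwards [sphere_inner_ne l.spatial_ne_zero ((l : M) 0)] with n hn0
  have hk : ((Cone.ofSphere n : Cone) : M) = mkVec ‖(n : E3)‖ n := rfl
  have h1 : directional g (Cone.ofSphere n) = g n • ((Cone.ofSphere n : Cone) : M) := by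
    ext a
    change metricSign a * conormal (spatial ((Cone.ofSphere n : Cone) : M)) a
      * g (spatial ((Cone.ofSphere n : Cone) : M)) = g n * ((Cone.ofSphere n : Cone) : M) a
    rw [hk, spatial_mkVec, n.norm]
    refine Fin.cases ?_ (fun i => ?_) a
    · simp
    · simp
      ring
  have h2 : mdot l (Cone.ofSphere n : M) ≠ 0 := by
    rw [hk, mdot_eq, mkVec_zero, spatial_mkVec, n.norm, mul_one, real_inner_comm]
    exact sub_ne_zero.2 (Ne.symm hn0)
  rw [h1, mdot_smul, mul_div_cancel_right₀ _ h2]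

namespace LocalPotential

variable {δ r : ℝ} {v A : Fin 4 → M → ℝ}

theorem hasCompactSupport_eul (h : LocalPotential δ r v A) (a : Fin 4) :
    HasCompactSupport (eul 1 (A a)) :=
  HasCompactSupport.intro (isCompact_closedBall (0 : M) r) fun x hx =>
    h.euler a x (by simpa using hx)

theorem eul_supp (h : LocalPotential δ r v A) (a : Fin 4) (x : M)
    (hx : δ * ‖spatial x‖ < |x 0|) : eul 1 (A a) x = 0 := by
  have h1 := h.eventually_zero hx a
  rw [eul, h1.fderiv_eq, h1.eq_of_nhds]
  simp

theorem eul_near (h : LocalPotential δ r v A) (a : Fin 4) (x : M) (hx : ‖x‖ < 1) :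
    eul 1 (A a) x = 0 := by
  have h1 : A a =ᶠ[𝓝 x] fun _ => 0 := by
    filter_upwards [(isOpen_lt continuous_norm continuous_const).mem_nhds hx] with y hy
      using h.near a y hy
  rw [eul, h1.fderiv_eq, h1.eq_of_nhds]
  simp

theorem eul_orth (h : LocalPotential δ r v A) (x : M) :
    ∑ a, lower x a * eul 1 (A a) x = 0 := by
  have h1 : HasFDerivAt (fun y : M => ∑ a, lower y a * A a y) (0 : M →L[ℝ] ℝ) x := by
    simp only [h.orth]
    exact hasFDerivAt_const _ _
  have h2 : ∀ a, HasFDerivAt (fun y : M => lower y a)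
      (metricSign a • (EuclideanSpace.proj a : M →L[ℝ] ℝ)) x := by
    intro a
    simp only [lower_eq_metricSign]
    exact (EuclideanSpace.proj a : M →L[ℝ] ℝ).hasFDerivAt.const_mul (metricSign a)
  have h3 : HasFDerivAt (fun y : M => ∑ a, lower y a * A a y) _ x :=
    HasFDerivAt.fun_sum fun a _ => (h2 a).mul (smooth_diffAt (h.smooth a) x).hasFDerivAt
  have h4 := congrArg (fun L => L x) (h3.unique h1)
  rw [_root_.sum_apply] at h4
  refine Eq.trans (Finset.sum_congr rfl fun a _ => ?_) h4
  rw [_root_.add_apply, _root_.smul_apply, _root_.smul_apply, _root_.smul_apply, eul,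
    lower_eq_metricSign]
  change _ = metricSign a * x a * fderiv ℝ (A a) x x + A a x * (metricSign a * x a)
  ring

end LocalPotential

section

variable {ε δ r : ℝ} {v A : Fin 4 → M → ℝ} {J : M → M}

/-- The source of the change of the profile. -/
def gaugeSource (A : Fin 4 → M → ℝ) : M → ℝ := pd 0 (dvg fun a => eul 1 (A a))

theorem nullInt_compensate (hε : 0 < ε) (hJ : ContDiff ℝ ∞ J)
    (hd : ∀ a, Decays (3 + ε) (eulComp J a)) (h : LocalPotential δ r v A) (a : Fin 4) (s : ℝ)
    {x : E3} (hx : x ≠ 0) : nullInt (eulComp (compensate J A) a) s x = nullInt (eulComp J a) s x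
      + sphereArea⁻¹ * (metricSign a * conormal x a) * nullInt (gaugeSource A) s x := by
  have h1 : eulComp (compensate J A) a
      = fun x => eulComp J a x - sphereArea⁻¹ * maxwell (fun a => eul 1 (A a)) a x :=
    funext (eulComp_compensate hJ h.smooth a)
  have h2 : Decays (3 + ε) fun x => sphereArea⁻¹ * maxwell (fun a => eul 1 (A a)) a x := by
    refine Decays.of_hasCompactSupport
      (contDiff_const.mul (contDiff_maxwell h.contDiff_eul a)) ?_
    refine HasCompactSupport.intro (isCompact_closedBall (0 : M) r) fun x hx => ?_
    rw [h.maxwell_eul_eq_zero a (by simpa using hx), mul_zero]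
  rw [h1, nullInt_sub (by linarith) (hd a) h2, nullInt_const_mul,
    nullInt_maxwell h.contDiff_eul h.hasCompactSupport_eul a s hx, gaugeSource]
  ring

theorem nullVanishing_gaugeSource (hε : 0 < ε) (hJ : ContDiff ℝ ∞ J) (hA : LocalPotential δ r v A)
    (hn : ∀ a, NullVanishing ε (eulComp J a))
    (hn' : ∀ a, NullVanishing ε (eulComp (compensate J A) a)) :
    NullVanishing ε (gaugeSource A) := by
  have hd := hasCompactSupport_dvg hA.hasCompactSupport_eul
  refine ⟨Decays.of_hasCompactSupport (contDiff_pd (contDiff_dvg hA.contDiff_eul) 0)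
    (hasCompactSupport_pd hd 0), fun x hx => ?_⟩
  have h1 := nullInt_compensate hε hJ (fun a => (hn a).decays) hA 0 0 hx
  rw [(hn' 0).zero x hx, (hn 0).zero x hx, metricSign_zero, conormal_zero] at h1
  have h2 := sphereArea_pos.ne'
  field_simp at h1
  linarith

theorem wedgeZero_compensate (hε : 0 < ε) (hJ : ContDiff ℝ ∞ J) (hA : LocalPotential δ r v A)
    (hn : ∀ a, NullVanishing ε (eulComp J a))
    (hn' : ∀ a, NullVanishing ε (eulComp (compensate J A) a)) :
    WedgeZero (currentProfile (compensate J A) - currentProfile J) := by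
  have hJ' := contDiff_compensate hJ hA.smooth
  intro s l a b
  have hx := l.spatial_ne_zero
  have h1 : ∀ c, (currentProfile (compensate J A) - currentProfile J) s l c
      = sphereArea⁻¹ * (metricSign c * conormal (spatial l) c)
        * profInt (gaugeSource A) s (spatial l) := by
    intro c
    rw [Pi.sub_apply, Pi.sub_apply, PiLp.sub_apply, currentProfile_apply hε hJ' hn',
      currentProfile_apply hε hJ hn, profInt_eq_of_nullInt hε (hn' c) (hn c)
        (nullVanishing_gaugeSource hε hJ hA hn hn') hx
        (fun s => nullInt_compensate hε hJ (fun a => (hn a).decays) hA c s hx) s]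
    ring
  have h2 : ∀ c, (l : M) c = ‖spatial l‖ * (metricSign c * conormal (spatial l) c) := by
    intro c
    have h3 := l.lower_eq c
    rw [lower_eq_metricSign] at h3
    linear_combination metricSign c * h3 - (l : M) c * metricSign_mul_self c
  rw [h1, h1, h2, h2]
  ring

theorem tail_compensate (hε : 0 < ε) (hJ : ContDiff ℝ ∞ J) (hA : LocalPotential δ r v A)
    (hn : ∀ a, NullVanishing ε (eulComp J a))
    (hn' : ∀ a, NullVanishing ε (eulComp (compensate J A) a)) :
    tail (currentProfile (compensate J A)) = tail (currentProfile J)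
    + directional fun z => sphereArea⁻¹ * tailInt (gaugeSource A) z := by
  have hJ' := contDiff_compensate hJ hA.smooth
  funext l
  ext a
  have hx := l.spatial_ne_zero
  rw [Pi.add_apply, PiLp.add_apply, tail_currentProfile hε hJ' hn', tail_currentProfile hε hJ hn,
    tailInt_eq_of_nullInt hε (hn' a) (hn a) (nullVanishing_gaugeSource hε hJ hA hn hn') hx
      (b := 1) (c := sphereArea⁻¹ * (metricSign a * conormal (spatial l) a)) fun s => by
        rw [one_mul]
        exact nullInt_compensate hε hJ (fun a => (hn a).decays) hA a s hx]
  change _ = _ + metricSign a * conormal (spatial l) a * (sphereArea⁻¹ * _)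
  ring

theorem contDiffOn_tailInt_gaugeSource (hε : 0 < ε) (hJ : ContDiff ℝ ∞ J) (hA : LocalPotential δ r v A)
    (hn : ∀ a, NullVanishing ε (eulComp J a))
    (hn' : ∀ a, NullVanishing ε (eulComp (compensate J A) a)) :
    ContDiffOn ℝ ∞ (fun z => sphereArea⁻¹ * tailInt (gaugeSource A) z) {x | x ≠ 0} :=
  contDiffOn_const.mul ((nullVanishing_gaugeSource hε hJ hA hn hn').contDiffOn_tailInt hε)

theorem isCurlFree_tail_compensate (hε : 0 < ε) (hJ : ContDiff ℝ ∞ J) (hA : LocalPotential δ r v A)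
    (hn : ∀ a, NullVanishing ε (eulComp J a))
    (hn' : ∀ a, NullVanishing ε (eulComp (compensate J A) a))
    (hV : IsProfile ε (currentProfile J)) :
    IsCurlFree (tail (currentProfile (compensate J A))) := by
  have hg := contDiffOn_tailInt_gaugeSource hε hJ hA hn hn'
  rw [tail_compensate hε hJ hA hn hn']
  exact hV.closed.add hV.smooth_tail (coneSmooth_directional hg) (isCurlFree_directional hg)

theorem integral_sphere_tailInt_gaugeSource (hε : 0 < ε) (hJ : ContDiff ℝ ∞ J) (hA : LocalPotential δ r v A)
    (hn : ∀ a, NullVanishing ε (eulComp J a))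
    (hn' : ∀ a, NullVanishing ε (eulComp (compensate J A) a))
    (hδ : 0 < δ) (hδ' : δ < 1) :
    ∫ n : S2, sphereArea⁻¹ * tailInt (gaugeSource A) n ∂sphereMeasure = 0 := by
  have hB := hA.contDiff_eul
  have hz : ∀ x, (∀ a, (fun y => eul 1 (A a) y) =ᶠ[𝓝 x] fun _ => 0) →
      dvg (fun a => eul 1 (A a)) x = 0 := fun x hx =>
    Finset.sum_eq_zero fun a _ => by
      rw [(pd_eventuallyEq (hx a) a).eq_of_nhds]
      simp [pd]
  rw [integral_const_mul, gaugeSource, integral_sphere_tailInt hε hδ hδ'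
    (contDiff_dvg hB) (hasCompactSupport_dvg hA.hasCompactSupport_eul)
    (fun x hx => hz x fun a => ?_) (fun x hx => hz x fun a => ?_)
    (nullVanishing_gaugeSource hε hJ hA hn hn'),
    integral_dvg_div_mdot hδ' hB hA.hasCompactSupport_eul hA.eul_supp hA.eul_near hA.eul_orth,
    mul_zero, mul_zero]
  · filter_upwards [(isOpen_lt (continuous_const.mul continuous_spatial.norm)
      (by fun_prop : Continuous fun x : M => |x 0|)).mem_nhds hx] with y hy
      using hA.eul_supp a y hy
  · filter_upwards [(isOpen_lt continuous_norm continuous_const).mem_nhds hx] with y hy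
      using hA.eul_near a y hy

theorem phi_compensate (hε : 0 < ε) (hJ : ContDiff ℝ ∞ J) (hA : LocalPotential δ r v A)
    (hn : ∀ a, NullVanishing ε (eulComp J a))
    (hn' : ∀ a, NullVanishing ε (eulComp (compensate J A) a))
    (hδ : 0 < δ) (hδ' : δ < 1) (l : Cone) :
    phi (currentProfile (compensate J A)) l = phi (currentProfile J) l := by
  have hg := contDiffOn_tailInt_gaugeSource hε hJ hA hn hn'
  have hg0 := integral_sphere_tailInt_gaugeSource hε hJ hA hn hn' hδ hδ'
  set g : E3 → ℝ := fun z => sphereArea⁻¹ * tailInt (gaugeSource A) z with hgdef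
  have hgi : Integrable (fun n : S2 => g n) sphereMeasure :=
    integrable_sphere_of_continuous
      (hg.continuousOn.comp_continuous continuous_subtype_val fun n => n.ne_zero)
  have hae : (fun n : S2 => mdot l (tail (currentProfile (compensate J A)) (Cone.ofSphere n))
      / mdot l (Cone.ofSphere n : M)) =ᵐ[sphereMeasure]
      fun n => mdot l (tail (currentProfile J) (Cone.ofSphere n)) / mdot l (Cone.ofSphere n : M)
        + g n := by
    filter_upwards [mdot_directional_div g l] with n h1
    rw [tail_compensate hε hJ hA hn hn', Pi.add_apply, mdot_add, add_div, h1]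
  simp only [phi, coneIntegral]
  rw [integral_congr_ae hae]
  congr 1
  by_cases hi : Integrable (fun n : S2 => mdot l (tail (currentProfile J) (Cone.ofSphere n))
      / mdot l (Cone.ofSphere n : M)) sphereMeasure
  · rw [integral_add hi hgi, hg0, add_zero]
  · rw [integral_undef hi, integral_undef fun h => hi ?_]
    refine (h.sub hgi).congr (Eventually.of_forall fun n => ?_)
    simp

theorem phi_compensate_sub (hε : 0 < ε) (hJ : ContDiff ℝ ∞ J) (hA : LocalPotential δ r v A)
    (hn : ∀ a, NullVanishing ε (eulComp J a))
    (hn' : ∀ a, NullVanishing ε (eulComp (compensate J A) a))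
    (hδ : 0 < δ) (hδ' : δ < 1) (hV : IsProfile ε (currentProfile J))
    (hV' : IsProfile ε (currentProfile (compensate J A))) (l : Cone) :
    phi (currentProfile (compensate J A) - currentProfile J) l = 0 := by
  have h1 : tail (currentProfile (compensate J A) - currentProfile J)
      = directional fun z => sphereArea⁻¹ * tailInt (gaugeSource A) z := by
    rw [sub_eq_add_neg, ← neg_one_smul ℝ (currentProfile J), hV'.tail_add (hV.const_smul (-1)),
      hV.tail_smul, tail_compensate hε hJ hA hn hn', neg_one_smul, add_neg_cancel_comm]
  rw [phi, h1, coneIntegral, integral_congr_ae (mdot_directional_div _ l),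
    integral_sphere_tailInt_gaugeSource hε hJ hA hn hn' hδ hδ', mul_zero]

end

end AsymptoticQED

end

theorem mainTheorem4 (e ε γ δ : ℝ) (he : e ≠ 0) (hε : 0 < ε) (hγ : 0 < γ) (hδ : 0 < δ)
    (hδ' : δ < 1) (J Jas : AsymptoticQED.M → AsymptoticQED.M)
    (hJ : AsymptoticQED.IsHomTestField 3 ε (AsymptoticQED.region γ δ) J)
    (hcons : AsymptoticQED.IsConserved J)
    (hJas : AsymptoticQED.HasAsymptote 3 J Jas)
    (hodd : ∀ x, x ≠ 0 → Jas (-x) = -Jas x)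
    (hcurl : AsymptoticQED.IsCurlFree
      (AsymptoticQED.tail (AsymptoticQED.currentProfile J))) :
    ∃ hV : AsymptoticQED.currentProfile J ∈ AsymptoticQED.profileSpace ε,
    ∃ J' : AsymptoticQED.M → AsymptoticQED.M,
      AsymptoticQED.IsHomTestField 3 ε (AsymptoticQED.region γ δ) J' ∧
      AsymptoticQED.IsConserved J' ∧
      (∃ g : AsymptoticQED.M → ℝ,
        ContDiffOn ℝ ∞ g {0}ᶜ ∧
        (∀ (r : ℝ) (x : AsymptoticQED.M), 0 < r → x ≠ 0 → g (r • x) = r ^ (-4 : ℝ) * g x) ∧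
        (∀ x, x ≠ 0 → g (-x) = g x) ∧
        AsymptoticQED.hyperboloidIntegral g = 0 ∧
        AsymptoticQED.HasAsymptote 3 J' (fun x => g x • x)) ∧
      ∃ hV' : AsymptoticQED.currentProfile J' ∈ AsymptoticQED.profileSpace ε,
        AsymptoticQED.WedgeZero
          (AsymptoticQED.currentProfile J' - AsymptoticQED.currentProfile J) ∧
        (∀ l, AsymptoticQED.phi (AsymptoticQED.currentProfile J') l
          = AsymptoticQED.phi (AsymptoticQED.currentProfile J) l) ∧
        (⟨AsymptoticQED.currentProfile J', AsymptoticQED.profileSpace_le hε hV'⟩ -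
            ⟨AsymptoticQED.currentProfile J, AsymptoticQED.profileSpace_le hε hV⟩ :
            AsymptoticQED.profiles) ∈ AsymptoticQED.gaugeGroup e ∧
        AsymptoticQED.profileClass e
            ⟨AsymptoticQED.currentProfile J', AsymptoticQED.profileSpace_le hε hV'⟩ =
          AsymptoticQED.profileClass e
            ⟨AsymptoticQED.currentProfile J, AsymptoticQED.profileSpace_le hε hV⟩ := by
  have ho := hJ.oddHom hJas hodd
  have hn := hJ.nullVanishing hε hJas hodd
  have hV : AsymptoticQED.IsProfile ε (AsymptoticQED.currentProfile J) :=
    AsymptoticQED.isProfile_currentProfile hε hJ.1 hn hcons hcurl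
  have hu := hJ.homCurrent hε hcons hJas hodd
  have hv := hu.tangentialPart hδ'
  obtain ⟨r, A, hA⟩ := hv.exists_localPotential hδ hδ' (fun x hx => hu.mdot_tangentialPart hδ' hx)
    fun i j x hx =>
      AsymptoticQED.boostCurl_radField_eq_zero hε hγ hδ hδ' hJ.1 hJ.2.1 ho hu hcurl i j hx
  have hJ' := hA.isHomTestField hγ hJ
  have hcons' := AsymptoticQED.isConserved_compensate hJ.1 hA.smooth hcons
  have has' := hA.hasAsymptote hε (fun a => (ho a).asymHom) (fun _ => rfl) rfl hv.homog
  have hn' := hJ'.nullVanishing hε has' fun x hx => by rw [hu.radialPart_neg hx, smul_neg]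
  have hV' : AsymptoticQED.IsProfile ε
      (AsymptoticQED.currentProfile (AsymptoticQED.compensate J A)) :=
    AsymptoticQED.isProfile_currentProfile hε hJ'.1 hn' hcons'
      (AsymptoticQED.isCurlFree_tail_compensate hε hJ.1 hA hn hn' hV)
  have hw := AsymptoticQED.wedgeZero_compensate hε hJ.1 hA hn hn'
  have hphi := AsymptoticQED.phi_compensate hε hJ.1 hA hn hn' hδ hδ'
  have hgauge : (⟨AsymptoticQED.currentProfile (AsymptoticQED.compensate J A),
        AsymptoticQED.profileSpace_le hε hV'⟩ -
      ⟨AsymptoticQED.currentProfile J, AsymptoticQED.profileSpace_le hε hV⟩ :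
      AsymptoticQED.profiles) ∈ AsymptoticQED.gaugeGroup e := by
    refine ⟨hw, 0, fun l => ?_⟩
    rw [Int.cast_zero, zero_mul]
    exact AsymptoticQED.phi_compensate_sub hε hJ.1 hA hn hn' hδ hδ' hV hV' l
  refine ⟨hV, AsymptoticQED.compensate J A, hJ', hcons', ⟨_, hu.contDiffOn_radialPart hδ',
    fun r x hr hx => hu.radialPart_smul hr hx, fun x hx => hu.radialPart_neg hx,
    hu.hyperboloidIntegral_radialPart hδ hδ' (AsymptoticQED.integral_cutoff_asym_flux hε hγ hδ hδ'
      ho (fun a x hx => hJ.2.1 fun h => hx (by simp [h])) fun x => hcons.sum_pd hJ.1 x), has'⟩,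
    hV', hw, hphi, hgauge, ?_⟩
  refine (QuotientAddGroup.eq.2 ?_).symm
  rwa [neg_add_eq_sub]
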